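/- Conventions. For an undirected graph $H=(V,E)$ the degeneracy is $\delta(H)=\max_{\emptyset\ne U\subseteq V}\min_{u\in U}\deg_{H[U]}(u)$; for a directed graph $G$, $\delta(G)$ is the degeneracy of its underlying undirected graph. The Induced Subgraph (ISG) problem is: preprocess a directed graph $G=(V,E)$ so that, for each query, that is, a sequence of vertices $v_1,v_2,\dots$ given online, all edges $(v_j,v_i)\in E$ with $j<i$ are reported upon arrival of $v_i$ (before $v_{i+1}$ arrives). The model of computation is the randomized word RAM with words of $O(\log N)$ bits, $N$ the size of the input; algorithms make no errors, and running times are expected. An ISG data structure has on $G$ amortized expected preprocessing time $P(G)$, query time $q(G)$ per vertex, and reporting time $r(G)$ per edge, if every series of queries (nonempty vertex sequences) with $L$ vertices and $\mathit{op}$ reported edges in total takes, with the preprocessing, expected time at most $P(G)+q(G)\,L+r(G)\,\mathit{op}$. 3SUM conjecture: for no $\varepsilon>0$ is there an algorithm that decides in $O(n^{2-\varepsilon})$ expected time whether three of $n\ge 1$ given integers of $O(\log n)$ bits (at three different positions) sum to zero. Theorem 2. Assume the 3SUM conjecture. Let $0<a<b\le 1/2$, and let $\mathcal G_{a,b}$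 be the class of all directed graphs with $m\ge 1$ edges, at most $m$ vertices, and $m^a\le\delta(G)\le m^b$. Consider any data structure that solves the ISG problem and has amortized expected costs $P(G),q(G),r(G)$ on the graphs of $\mathcal G_{a,b}$. If, on $\mathcal G_{a,b}$, the preprocessing time is $P(G)=O(m\cdot\delta(G)^{1-\varepsilon})$ for some constant $\varepsilon>0$, and the reporting time is sub-polynomial, $r(G)=O(m^{\eta})$ for every constant $\eta>0$, then the time per query vertex is $\Omega(\delta(G)^{1-o(1)})$, in the following sense: for every $\varepsilon'>0$, $q(G)$ is not $O(\delta(G)^{1-\varepsilon'})$ on $\mathcal G_{a,b}$, i.e. for every constant $C$ there is a graph $G\in\mathcal G_{a,b}$ with $q(G)>C\,\delta(G)^{1-\varepsilon'}$. -/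

import Mathlib

open scoped ENNReal NNReal

namespace ISGLowerBound

/-! ## Randomized random access machine with logarithmic word size -/

/-- Unit-cost operations on words. A comparison returns `1` or `0`. -/
inductive Op where
  | add | sub | mul | div | mod | land | lor | xor | shl | shr | lt | eq

/-- The value of a word operation. -/
def Op.eval : Op → ℤ → ℤ → ℤ
  | .add, x, y => x + y
  | .sub, x, y => x - y
  | .mul, x, y => x * y
  | .div, x, y => x / y
  | .mod, x, y => x % y
  | .land, x, y => Int.land x y
  | .lor, x, y => Int.lor x y
  | .xor, x, y => Int.xor x y
  | .shl, x, y => x * 2 ^ y.toNat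
  | .shr, x, y => x / 2 ^ y.toNat
  | .lt, x, y => if x < y then 1 else 0
  | .eq, x, y => if x = y then 1 else 0

/-- Programs of the machine. Registers and arrays are named by natural numbers, and a program
names finitely many of them; an array is a part of the memory, addressed by words. -/
inductive Cmd where
  /-- `r := z` -/
  | const (r : ℕ) (z : ℤ)
  /-- `r := x o y` -/
  | op (r : ℕ) (o : Op) (x y : ℕ)
  /-- `r := arr[i]` -/
  | load (r arr i : ℕ)
  /-- `arr[i] := x` -/
  | store (arr i x : ℕ)
  /-- `r :=` a fresh uniformly random element of `{0, …, x - 1}` (and `0` if `x ≤ 0`) -/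
  | rand (r x : ℕ)
  /-- report the pair `(x, y)` -/
  | emit (x y : ℕ)
  /-- first `c`, then `d` -/
  | seq (c d : Cmd)
  /-- `c` if `x ≠ 0`, otherwise `d` -/
  | ite (x : ℕ) (c d : Cmd)
  /-- repeat `c` while `x ≠ 0` -/
  | loop (x : ℕ) (c : Cmd)

/-- Contents of registers and arrays, and the list of the pairs reported so far. -/
@[ext]
structure State where
  reg : ℕ → ℤ
  arr : ℕ → ℤ → ℤ
  out : List (ℤ × ℤ)

/-- Assignment to a register. -/
def State.setReg (s : State) (r : ℕ) (z : ℤ) : State :=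
  { s with reg := Function.update s.reg r z }

/-- Assignment to an array cell. -/
def State.setArr (s : State) (a : ℕ) (i z : ℤ) : State :=
  { s with arr := Function.update s.arr a (Function.update (s.arr a) i z) }

/-- Report a pair. -/
def State.report (s : State) (p : ℤ × ℤ) : State :=
  { s with out := s.out ++ [p] }

/-- All the words in registers and arrays have absolute value at most `B`. -/
def State.Bounded (s : State) (B : ℕ) : Prop :=
  (∀ r, |s.reg r| ≤ (B : ℤ)) ∧ ∀ a i, |s.arr a i| ≤ (B : ℤ)

/-- A configuration: the commands still to be executed, and the state. The machine has halted
when no command is left. -/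
abbrev Config := List Cmd × State

/-- One step of the machine: the distribution of the next configuration. -/
noncomputable def step : Config → PMF Config
  | ([], s) => PMF.pure ([], s)
  | (.const r z :: k, s) => PMF.pure (k, s.setReg r z)
  | (.op r o x y :: k, s) => PMF.pure (k, s.setReg r (o.eval (s.reg x) (s.reg y)))
  | (.load r a i :: k, s) => PMF.pure (k, s.setReg r (s.arr a (s.reg i)))
  | (.store a i x :: k, s) => PMF.pure (k, s.setArr a (s.reg i) (s.reg x))
  | (.rand r x :: k, s) =>
      (PMF.uniformOfFintype (Fin ((s.reg x).toNat - 1 + 1))).map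
        fun j => (k, s.setReg r ((j : ℕ) : ℤ))
  | (.emit x y :: k, s) => PMF.pure (k, s.report (s.reg x, s.reg y))
  | (.seq c d :: k, s) => PMF.pure (c :: d :: k, s)
  | (.ite x c d :: k, s) => PMF.pure (if s.reg x ≠ 0 then c :: k else d :: k, s)
  | (.loop x c :: k, s) => PMF.pure (if s.reg x ≠ 0 then c :: .loop x c :: k else k, s)

/-- The distribution of the configuration after `t` steps. -/
noncomputable def distAt (z : Config) : ℕ → PMF Config
  | 0 => PMF.pure z
  | t + 1 => (distAt z t).bind step

/-- The configuration `z'` occurs with positive probability in the computation from `z`. -/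
def Reachable (z z' : Config) : Prop := ∃ t, z' ∈ (distAt z t).support

/-- The expected number `𝔼[T] = ∑ₜ ℙ(T > t)` of steps before halting. -/
noncomputable def expectedTime (z : Config) : ℝ≥0∞ :=
  ∑' t, (distAt z t).toOuterMeasure {z' | z'.1 ≠ []}

/-- An array that holds the entries of a list in the cells `0, 1, …`, and `0` elsewhere. -/
def cells (l : List ℤ) (i : ℤ) : ℤ := if 0 ≤ i then l.getD i.toNat 0 else 0

/-! ## The 3SUM conjecture -/

/-- Three of the integers in the list, at different positions, sum to zero. -/
def HasThreeSum (l : List ℤ) : Prop :=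
  ∃ i j k : Fin l.length, i ≠ j ∧ i ≠ k ∧ j ≠ k ∧ l.get i + l.get j + l.get k = 0

/-- Input of 3SUM: the number of integers in register `0`, the integers in array `0`. -/
def threeSumInput (l : List ℤ) : State where
  reg r := if r = 0 then l.length else 0
  arr a := if a = 0 then cells l else cells []
  out := []

/-- `p` is a (zero-error, randomized) algorithm for 3SUM on `n` integers of `O(log n)` bits, with
expected time `O(n ^ e)`, on words of `O(log n)` bits. The answer, `1` or `0`, is left in
register `0`. The magnitude `n ^ k` of the input is any polynomial; the word size and the constant
in the time bound may depend on `k`. -/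
def SolvesThreeSumInTime (p : Cmd) (e : ℝ) : Prop :=
  ∀ k : ℕ, ∃ (c : ℕ) (C : ℝ), ∀ l : List ℤ, l ≠ [] → (∀ x ∈ l, |x| ≤ (l.length : ℤ) ^ k) →
    (∀ z, Reachable ([p], threeSumInput l) z → z.2.Bounded ((l.length + 2) ^ c)) ∧
    (∀ s, Reachable ([p], threeSumInput l) ([], s) →
      (HasThreeSum l → s.reg 0 = 1) ∧ (¬ HasThreeSum l → s.reg 0 = 0)) ∧
    expectedTime ([p], threeSumInput l) ≤ ENNReal.ofReal (C * (l.length : ℝ) ^ e)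

/-- 3SUM requires `Ω(n ^ (2 - o(1)))` expected time: no algorithm is truly subquadratic. -/
def ThreeSumConjecture : Prop :=
  ∀ ε : ℝ, 0 < ε → ¬ ∃ p : Cmd, SolvesThreeSumInTime p (2 - ε)

/-! ## Graphs and degeneracy -/

open Classical in
/-- The degeneracy: the largest minimum degree of an induced subgraph on a nonempty vertex set
(`0` for the graph without vertices). -/
noncomputable def degeneracy {V : Type*} [Fintype V] (G : SimpleGraph V) : ℕ :=
  (Finset.univ : Finset (Finset V)).sup fun U =>
    if h : U.Nonempty then U.inf' h fun u => (U.filter fun v => G.Adj u v).card else 0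

/-- A finite directed graph with vertices `0, …, n - 1`, given by a list of its edges. -/
structure DirGraph where
  n : ℕ
  edges : List (Fin n × Fin n)
  nodup : edges.Nodup

/-- The number of edges. -/
def DirGraph.m (G : DirGraph) : ℕ := G.edges.length

/-- The underlying undirected graph. -/
def DirGraph.underlying (G : DirGraph) : SimpleGraph (Fin G.n) :=
  SimpleGraph.fromRel fun u v => (u, v) ∈ G.edges

/-- The degeneracy of (the underlying undirected graph of) a directed graph. -/
noncomputable def DirGraph.δ (G : DirGraph) : ℕ := degeneracy G.underlying

/-- Graphs with `m ≥ 1` edges, at most `m` vertices, and degeneracy between `m ^ a` and `m ^ b`. -/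
def DirGraph.InRange (G : DirGraph) (a b : ℝ) : Prop :=
  1 ≤ G.m ∧ G.n ≤ G.m ∧ (G.m : ℝ) ^ a ≤ G.δ ∧ (G.δ : ℝ) ≤ (G.m : ℝ) ^ b

/-! ## The Induced Subgraph problem -/

/-- The edges to be reported at the arrival of `v`, when the vertices in `prev` have arrived
before: all edges from a vertex of `prev` to `v`, each once. -/
def DirGraph.edgesAt (G : DirGraph) (prev : List (Fin G.n)) (v : Fin G.n) : List (ℤ × ℤ) :=
  (G.edges.filter fun e => e.2 = v ∧ e.1 ∈ prev).map fun e => (((e.1 : ℕ) : ℤ), ((e.2 : ℕ) : ℤ))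

/-- The edges to be reported while a sequence of vertices arrives, after those in `prev`. -/
def DirGraph.edgesFrom (G : DirGraph) : List (Fin G.n) → List (Fin G.n) → List (ℤ × ℤ)
  | _, [] => []
  | prev, v :: Q => G.edgesAt prev v ++ G.edgesFrom (v :: prev) Q

/-- The edges to be reported in a series of queries. Each query is a sequence of vertices, and
vertices of earlier queries do not count as arrived. -/
def DirGraph.answer (G : DirGraph) (Qs : List (List (Fin G.n))) : List (ℤ × ℤ) :=
  Qs.flatMap (G.edgesFrom [])

/-- The total number of vertices that arrive in a series of queries. -/
def totalLength {α : Type*} (Qs : List (List α)) : ℕ := (Qs.map List.length).sum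

/-- Input of the preprocessing: numbers of vertices and edges in the registers `0` and `1`, the
tails and the heads of the edges in the arrays `0` and `1`. -/
def DirGraph.input (G : DirGraph) : State where
  reg r := if r = 0 then G.n else if r = 1 then G.m else 0
  arr a :=
    if a = 0 then cells (G.edges.map fun e => ((e.1 : ℕ) : ℤ))
    else if a = 1 then cells (G.edges.map fun e => ((e.2 : ℕ) : ℤ))
    else cells []
  out := []

/-- A data structure for the ISG problem: procedures that share their registers and arrays, for
preprocessing, for the start of a query, and for the arrival of one vertex. -/
structure ISGStructure where
  preprocess : Cmd
  start : Cmd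
  arrive : Cmd

/-- The whole interaction: preprocessing, then the queries one after the other, whose vertices are
put into register `2` one at a time. What the procedures report cannot depend on vertices that
have not yet arrived. -/
def ISGStructure.interaction (D : ISGStructure) (G : DirGraph) (Qs : List (List (Fin G.n))) :
    Config :=
  (D.preprocess :: Qs.flatMap fun Q =>
    D.start :: Q.flatMap fun v => [Cmd.const 2 ((v : ℕ) : ℤ), D.arrive], G.input)

/-- `D` solves the online ISG problem, with zero error, in finite expected time, and on words of
`O(log N)` bits for total input size `N`. The condition on the reported edges is imposed on every
series of queries, hence after every initial part of it: the edges due to the arrival of a vertex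
are reported before the next vertex arrives. -/
def ISGStructure.SolvesISG (D : ISGStructure) : Prop :=
  ∃ c : ℕ, ∀ (G : DirGraph) (Qs : List (List (Fin G.n))), (∀ Q ∈ Qs, Q ≠ []) →
    (∀ z, Reachable (D.interaction G Qs) z →
      z.2.Bounded ((G.n + G.m + totalLength Qs + 2) ^ c)) ∧
    (∀ s, Reachable (D.interaction G Qs) ([], s) → s.out.Perm (G.answer Qs)) ∧
    expectedTime (D.interaction G Qs) ≠ ∞

/-- On the graph `G`, the data structure has amortized expected preprocessing time `P`, time `q`
per vertex that arrives during a query, and time `r` per reported edge: every series of operations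
takes at most the sum of these charges, in expectation. -/
def ISGStructure.HasAmortizedCosts (D : ISGStructure) (G : DirGraph) (P q r : ℝ≥0) : Prop :=
  ∀ Qs : List (List (Fin G.n)), (∀ Q ∈ Qs, Q ≠ []) →
    expectedTime (D.interaction G Qs) ≤
      ((P + q * totalLength Qs + r * (G.answer Qs).length : ℝ≥0) : ℝ≥0∞)

end ISGLowerBound

/-! The contrapositive is proved: a data structure that beats the bound on the query time yields a
3SUM algorithm with expected time O(n^(2-1/t)) for some fixed t.

Residues modulo q₁, q₂, q₃, drawn independently from R, …, 2R-1, serve as linear hash functions. A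
nonzero number of polynomial size has only n^o(1) divisors (`exists_card_divisors_le`), so a triple
with nonzero sum vanishes for all three moduli with probability at most n^o(1)/R³
(`sum_falseTriples_le`). The graph stores numbers z: for each i < q₁ there is an edge from the left
vertex (i, z mod q₂) to the right vertex (-z-i mod q₁, -z mod q₃). The query (u₁, u₂) first sends
the left vertices (x mod q₁, u₁-x mod q₂) for all x ≡ u₂ mod q₃, and then the right vertices (y mod
q₁, u₂+y mod q₃) for all y ≡ -u₁ mod q₂. An edge between two such vertices means that some stored z
satisfies x+y+z ≡ 0 for all three moduli. Each pair (x, y) belongs to exactly one query. Every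
reported edge is decoded into the pairs (x, y) behind it, and for each it is tested whether -x-y is
in the list. Up to the first success all tested pairs come from false triples or from the O(n)
degenerate pairs with two equal members (`Inst.sum_tests_le`), and no solution is missed
(`Inst.exists_good_iff`). Solutions with repeated numbers are found separately by counting
(`hasThreeSum_iff`).

A left vertex (i, p) has one edge for every stored z ≡ p mod q₂. A number is not stored if τ stored
numbers already share its residue modulo q₂; by Markov's inequality there are few such numbers
(`sum_heavy_le`), and each is combined with all x directly. Hence every edge of the hashed part has
an endpoint of degree at most τ, and a disjoint complete bipartite graph K(τ, M) makes the
degeneracy exactly τ (`Inst.delta_eq`) and fixes the order of magnitude of m.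

The sizes are powers of one integer g with g^t ≤ n < (g+1)^t: R = g^s, τ = g^w, τM = g^(t+s). Then
the numbers of edges and of arriving vertices are O(g^(t+s)), and s + w = t + 2. Once w is large
enough, a factor δ^(1-ε) is at most g^(w-3), so preprocessing and queries take O(g^(t+s+w-3)) =
O(g^(2t-1)). The false triples and the exhaustive search obey the same bound. The quotient w/(t+s)
can be placed strictly between a and b (`exists_exponents`), which puts the graphs into the class
(`redInst_inRange`).

The remaining work shows that all this is a program of the machine. Programs are analysed by
expected costs with a continuation. The quantity `cost` is infinite as soon as a word is too large
with positive probability, and the final cost `wrong` is infinite on a wrong answer, so a single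
finite bound (`cost_reduction_le`) gives word size, correctness and time together. The data
structure runs inside the program with a slowdown of at most five (`bnd_sim`); what it still has to
do is charged as the expected time of all its outstanding commands, so that only amortized bounds
are needed. The program stops at the first solution. As the data structure never errs, the position
of that arrival depends on the moduli and the numbers but not on the random choices of the data
structure; the shortened series is therefore a legitimate fixed series, and the amortized bound
applies to it. -/

namespace ISGLowerBound

/-! ## Expectations -/

/-- The expectation of `h` under `p`. -/
noncomputable def ex {α : Type*} (p : PMF α) (h : α → ℝ≥0∞) : ℝ≥0∞ := ∑' a, p a * h a

section ex
variable {α β : Type*}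

theorem ex_pure (a : α) (h : α → ℝ≥0∞) : ex (PMF.pure a) h = h a := by
  classical
  unfold ex
  rw [tsum_eq_single a]
  · simp
  · intro b hb; simp [hb]

theorem ex_bind (p : PMF α) (f : α → PMF β) (h : β → ℝ≥0∞) :
    ex (p.bind f) h = ex p fun a => ex (f a) h := by
  unfold ex
  simp only [PMF.bind_apply, ← ENNReal.tsum_mul_right, ← ENNReal.tsum_mul_left]
  rw [ENNReal.tsum_comm]
  simp only [mul_assoc]

theorem ex_map (p : PMF α) (f : α → β) (h : β → ℝ≥0∞) : ex (p.map f) h = ex p fun a => h (f a) := by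
  rw [PMF.map, ex_bind]
  simp [ex_pure]

theorem ex_mono {p : PMF α} {h h' : α → ℝ≥0∞} (H : ∀ a ∈ p.support, h a ≤ h' a) :
    ex p h ≤ ex p h' := by
  unfold ex
  refine ENNReal.tsum_le_tsum fun a => ?_
  by_cases ha : p a = 0
  · simp [ha]
  · exact mul_le_mul_right (H a ((PMF.mem_support_iff _ _).2 ha)) _

theorem ex_const (p : PMF α) (c : ℝ≥0∞) : ex p (fun _ => c) = c := by
  unfold ex
  rw [ENNReal.tsum_mul_right, p.tsum_coe, one_mul]

theorem ex_add (p : PMF α) (h h' : α → ℝ≥0∞) : ex p (fun a => h a + h' a) = ex p h + ex p h' := by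
  unfold ex
  simp only [mul_add, ENNReal.tsum_add]

theorem ex_mul_left (p : PMF α) (c : ℝ≥0∞) (h : α → ℝ≥0∞) :
    ex p (fun a => c * h a) = c * ex p h := by
  unfold ex
  simp only [← ENNReal.tsum_mul_left]
  exact tsum_congr fun a => by ring

theorem mul_le_ex (p : PMF α) (h : α → ℝ≥0∞) (a : α) : p a * h a ≤ ex p h :=
  ENNReal.le_tsum (f := fun a => p a * h a) a

theorem ex_uniform [Fintype α] [Nonempty α] (h : α → ℝ≥0∞) :
    ex (PMF.uniformOfFintype α) h = (Fintype.card α : ℝ≥0∞)⁻¹ * ∑ a, h a := by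
  unfold ex
  rw [tsum_fintype, Finset.mul_sum]
  simp

end ex

/-! ## Reachability -/

/-- One step with positive probability. -/
def StepTo (z z' : Config) : Prop := z' ∈ (step z).support

/-- `distAt` adds steps at the end; inductions along a computation need the first step split off
instead. -/
theorem distAt_succ' (z : Config) (t : ℕ) :
    distAt z (t + 1) = (step z).bind fun z' => distAt z' t := by
  induction t with
  | zero => simp [distAt]
  | succ t ih =>
    rw [distAt, ih, PMF.bind_bind]
    rfl

theorem reachable_iff {z z' : Config} : Reachable z z' ↔ Relation.ReflTransGen StepTo z z' := by
  constructor
  · rintro ⟨t, ht⟩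
    induction t generalizing z' with
    | zero => simp only [distAt, PMF.mem_support_pure_iff] at ht; subst ht; exact .refl
    | succ t ih =>
      rw [distAt, PMF.mem_support_bind_iff] at ht
      obtain ⟨y, hy, hz⟩ := ht
      exact (ih hy).tail hz
  · intro h
    induction h with
    | refl => exact ⟨0, by simp [distAt]⟩
    | tail _ h ih =>
      obtain ⟨t, ht⟩ := ih
      exact ⟨t + 1, by rw [distAt, PMF.mem_support_bind_iff]; exact ⟨_, ht, h⟩⟩

theorem Reachable.refl (z : Config) : Reachable z z := reachable_iff.2 .refl

theorem Reachable.trans {x y z : Config} (h : Reachable x y) (h' : Reachable y z) :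
    Reachable x z :=
  reachable_iff.2 ((reachable_iff.1 h).trans (reachable_iff.1 h'))

theorem Reachable.step {x y : Config} (h : y ∈ (step x).support) : Reachable x y :=
  reachable_iff.2 (.single h)

/-- A step looks only at the first command, so commands that wait behind `k` are carried along
unchanged. -/
theorem step_append (c : Cmd) (k k' : List Cmd) (s : State) :
    step (c :: (k ++ k'), s) = (step (c :: k, s)).map fun z => (z.1 ++ k', z.2) := by
  cases c
  case ite => simp only [step, PMF.pure_map]; split_ifs <;> rfl
  case loop => simp only [step, PMF.pure_map]; split_ifs <;> rfl
  all_goals simp [step, PMF.pure_map, PMF.map_comp, Function.comp_def]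

theorem Reachable.append {k₁ k₂ : List Cmd} {s₁ s₂ : State} (h : Reachable (k₁, s₁) (k₂, s₂))
    (k : List Cmd) : Reachable (k₁ ++ k, s₁) (k₂ ++ k, s₂) := by
  rw [reachable_iff] at h
  generalize hz : (k₂, s₂) = z at h
  induction h generalizing k₂ s₂ with
  | refl => cases hz; exact Reachable.refl _
  | @tail y z _ h ih =>
    subst hz
    obtain ⟨ky, sy⟩ := y
    refine (ih rfl).trans ?_
    cases ky with
    | nil =>
      simp only [StepTo, ISGLowerBound.step, PMF.mem_support_pure_iff, Prod.mk.injEq] at h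
      obtain ⟨rfl, rfl⟩ := h
      exact Reachable.refl _
    | cons c ky =>
      refine Reachable.step ?_
      rw [List.cons_append, step_append, PMF.mem_support_map_iff]
      exact ⟨_, h, rfl⟩

theorem Reachable.comp {k₁ k₂ k₃ : List Cmd} {s₁ s₂ s₃ : State} (h : Reachable (k₁, s₁) ([], s₂))
    (hk : Reachable (k₂, s₂) (k₃, s₃)) : Reachable (k₁ ++ k₂, s₁) (k₃, s₃) :=
  (h.append k₂).trans hk

/-- What has been reported stays reported. -/
theorem Reachable.out_prefix {z z' : Config} (h : Reachable z z') : z.2.out <+: z'.2.out := by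
  rw [reachable_iff] at h
  induction h with
  | refl => exact List.prefix_refl _
  | @tail y z _ h ih =>
    refine ih.trans ?_
    obtain ⟨k, s⟩ := y
    unfold StepTo at h
    rcases k with _ | ⟨c, k⟩
    · simp only [ISGLowerBound.step, PMF.mem_support_pure_iff] at h; subst h; exact List.prefix_refl _
    · cases c <;> simp only [ISGLowerBound.step, PMF.mem_support_pure_iff,
        PMF.mem_support_map_iff] at h
      case rand => obtain ⟨_, _, rfl⟩ := h; exact List.prefix_refl _
      case ite => subst h; exact List.prefix_refl _
      case loop => subst h; exact List.prefix_refl _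
      all_goals subst h
      all_goals first | exact List.prefix_refl _ | exact List.prefix_append _ _

/-! ## Expected time -/

theorem expectedTime_nil (s : State) : expectedTime ([], s) = 0 := by
  have : ∀ t, distAt ([], s) t = PMF.pure ([], s) := by
    intro t
    induction t with
    | zero => rfl
    | succ t ih => rw [distAt, ih]; simp [step]
  simp [expectedTime, this]

/-- In ∑ₜ ℙ(T > t) the term t = 0 equals one, because a command is left; the other terms form the
same sum seen from the next configuration. -/
theorem expectedTime_cons (c : Cmd) (k : List Cmd) (s : State) :
    expectedTime (c :: k, s) = 1 + ex (step (c :: k, s)) expectedTime := by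
  unfold expectedTime
  rw [tsum_eq_zero_add' ENNReal.summable]
  congr 1
  · simp [distAt]
  · unfold ex
    simp only [distAt_succ', PMF.toOuterMeasure_bind_apply]
    rw [ENNReal.tsum_comm]
    simp only [ENNReal.tsum_mul_left]

/-- An infinite value at a successor of positive probability would make the expectation before the
step infinite. -/
theorem expectedTime_ne_top_of_reachable {z z' : Config} (h : Reachable z z')
    (hz : expectedTime z ≠ ∞) : expectedTime z' ≠ ∞ := by
  rw [reachable_iff] at h
  induction h with
  | refl => exact hz
  | @tail y z _ h ih =>
    obtain ⟨k, s⟩ := y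
    unfold StepTo at h
    rcases k with _ | ⟨c, k⟩
    · simp only [ISGLowerBound.step, PMF.mem_support_pure_iff] at h; subst h; exact ih
    · rw [expectedTime_cons] at ih
      intro hz
      apply ih
      have := mul_le_ex (step (c :: k, s)) expectedTime z
      rw [hz, ENNReal.mul_top ((PMF.mem_support_iff _ _).1 h), top_le_iff] at this
      rw [this]; simp

/-- A computation of finite expected time can halt. -/
theorem exists_halt {z : Config} (hz : expectedTime z ≠ ∞) : ∃ s, Reachable z ([], s) := by
  by_contra! H
  -- If no halted configuration is reachable, every reachable one has a further step, so all of them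
  -- have expected time at least t for every t.
  have key : ∀ t : ℕ, ∀ z', Reachable z z' → (t : ℝ≥0∞) ≤ expectedTime z' := by
    intro t
    induction t with
    | zero => simp
    | succ t ih =>
      rintro ⟨k, s⟩ hr
      rcases k with _ | ⟨c, k⟩
      · exact absurd hr (H s)
      · rw [expectedTime_cons, Nat.cast_succ, add_comm]
        gcongr
        rw [← ex_const (step (c :: k, s)) (t : ℝ≥0∞)]
        exact ex_mono fun a ha => ih a (hr.trans (.step ha))
  refine hz (ENNReal.eq_top_of_forall_nnreal_le fun r => ?_)
  obtain ⟨n, hn⟩ := exists_nat_ge r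
  refine le_trans ?_ (key n z (Reachable.refl z))
  exact_mod_cast hn

/-! ## Guarded expected cost -/

open Classical in
/-- Expected cost of the first `t` steps: one per step, `∞` when a word is too large, and
`f` on halting. -/
noncomputable def costUpTo (B : ℕ) (f : State → ℝ≥0∞) : ℕ → Config → ℝ≥0∞
  | 0, _ => 0
  | _ + 1, ([], s) => if s.Bounded B then f s else ∞
  | t + 1, (c :: k, s) => if s.Bounded B then 1 + ex (step (c :: k, s)) (costUpTo B f t) else ∞

/-- Expected cost of a computation: its length, `∞` when a word is too large, and `f` on
halting. -/
noncomputable def cost (B : ℕ) (f : State → ℝ≥0∞) (z : Config) : ℝ≥0∞ := ⨆ t, costUpTo B f t z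

variable {B : ℕ} {f : State → ℝ≥0∞}

theorem costUpTo_le_cost (t : ℕ) (z : Config) : costUpTo B f t z ≤ cost B f z :=
  le_iSup (fun t => costUpTo B f t z) t

theorem cost_nil_le {s : State} (hs : s.Bounded B) : cost B f ([], s) ≤ f s :=
  iSup_le fun t => by cases t <;> simp [costUpTo, hs]

theorem cost_cons_le {c : Cmd} {k : List Cmd} {s : State} (hs : s.Bounded B) :
    cost B f (c :: k, s) ≤ 1 + ex (step (c :: k, s)) (cost B f) := by
  refine iSup_le fun t => ?_
  cases t with
  | zero => simp [costUpTo]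
  | succ t =>
    simp only [costUpTo, hs, if_true]
    gcongr
    exact ex_mono fun a _ => costUpTo_le_cost t a

/-- Sequential composition: the cost of what follows becomes the final cost of what comes first. On
both sides the step budget can be compared stepwise; when `k` is exhausted, the remaining budget is
replaced by the supremum. -/
theorem cost_append_le (k k' : List Cmd) (s : State) :
    cost B f (k ++ k', s) ≤ cost B (fun s' => cost B f (k', s')) (k, s) := by
  refine iSup_le fun t => le_trans ?_ (costUpTo_le_cost t _)
  induction t generalizing k s with
  | zero => simp [costUpTo]
  | succ t ih =>
    cases k with
    | nil =>
      by_cases hs : s.Bounded B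
      · simpa [costUpTo, hs] using costUpTo_le_cost _ _
      · simp [costUpTo, hs]
    | cons c k =>
      by_cases hs : s.Bounded B
      · simp only [List.cons_append, costUpTo, hs, if_true]
        gcongr
        rw [step_append, ex_map]
        exact ex_mono fun a _ => ih _ _
      · simp [costUpTo, hs]

/-- Finiteness propagates along steps of positive probability. With the two lemmas that follow, one
finite cost at the start excludes every reachable overflow and every reachable halting state with
infinite final cost. -/
theorem cost_ne_top_of_reachable {z z' : Config} (h : Reachable z z') (hz : cost B f z ≠ ∞) :
    cost B f z' ≠ ∞ := by
  rw [reachable_iff] at h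
  induction h with
  | refl => exact hz
  | @tail y z _ h ih =>
    obtain ⟨k, s⟩ := y
    unfold StepTo at h
    rcases k with _ | ⟨c, k⟩
    · simp only [ISGLowerBound.step, PMF.mem_support_pure_iff] at h; subst h; exact ih
    · have hp : (step (c :: k, s)) z ≠ 0 := (PMF.mem_support_iff _ _).1 h
      intro hz
      apply ih
      rw [eq_top_iff, ← ENNReal.mul_top hp, ← hz, cost, ENNReal.mul_iSup]
      refine iSup_le fun t => le_trans ?_ (costUpTo_le_cost (t + 1) _)
      by_cases hs : s.Bounded B
      · simp only [costUpTo, hs, if_true]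
        exact (mul_le_ex _ _ z).trans le_add_self
      · simp [costUpTo, hs]

theorem bounded_of_cost_ne_top {z : Config} (hz : cost B f z ≠ ∞) : z.2.Bounded B := by
  by_contra hs
  apply hz
  rw [eq_top_iff]
  refine le_trans ?_ (costUpTo_le_cost 1 z)
  obtain ⟨k, s⟩ := z
  cases k <;> simp_all [costUpTo]

theorem final_ne_top_of_cost_ne_top {s : State} (hz : cost B f ([], s) ≠ ∞) : f s ≠ ∞ := by
  intro h
  apply hz
  rw [eq_top_iff]
  refine le_trans ?_ (costUpTo_le_cost 1 _)
  simp [costUpTo, h]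

theorem expectedTime_le_cost (z : Config) : expectedTime z ≤ cost B f z := by
  unfold expectedTime
  rw [ENNReal.tsum_eq_iSup_nat]
  refine iSup_le fun t => le_trans ?_ (costUpTo_le_cost t z)
  induction t generalizing z with
  | zero => simp
  | succ t ih =>
    obtain ⟨k, s⟩ := z
    cases k with
    | nil =>
      have := expectedTime_nil s
      unfold expectedTime at this
      rw [ENNReal.tsum_eq_zero] at this
      simp [this]
    | cons c k =>
      by_cases hs : s.Bounded B
      · rw [Finset.sum_range_succ', add_comm]
        simp only [costUpTo, hs, if_true]
        gcongr
        · simp [distAt]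
        · simp only [distAt_succ', PMF.toOuterMeasure_bind_apply]
          refine le_trans (le_of_eq ?_) (ex_mono fun a _ => ih a)
          unfold ex
          rw [← Summable.tsum_finsetSum fun _ _ => ENNReal.summable]
          simp only [Finset.mul_sum]
      · simp [costUpTo, hs]

/-! ## Weakest preexpectations of commands -/

/-- Expected cost of a command followed by `F`. -/
noncomputable def wp (B : ℕ) (c : Cmd) (F : State → ℝ≥0∞) (s : State) : ℝ≥0∞ := cost B F ([c], s)

variable {F G : State → ℝ≥0∞} {s : State}

theorem cost_cons_le_wp (c : Cmd) (k : List Cmd) (s : State) :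
    cost B F (c :: k, s) ≤ wp B c (fun s' => cost B F (k, s')) s :=
  cost_append_le [c] k s

theorem wp_pure_le {c : Cmd} {s' : State} (hs : s.Bounded B)
    (hstep : step ([c], s) = PMF.pure ([], s')) (hs' : s'.Bounded B) :
    wp B c F s ≤ 1 + F s' := by
  refine (cost_cons_le hs).trans ?_
  rw [hstep, ex_pure]
  gcongr
  exact cost_nil_le hs'

theorem State.Bounded.setReg (hs : s.Bounded B) {z : ℤ} (hz : |z| ≤ B) (r : ℕ) :
    (s.setReg r z).Bounded B := by
  refine ⟨fun r' => ?_, hs.2⟩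
  by_cases h : r' = r
  · subst h; simpa [State.setReg] using hz
  · simpa [State.setReg, h] using hs.1 r'

theorem State.Bounded.setArr (hs : s.Bounded B) {z : ℤ} (hz : |z| ≤ B) (a : ℕ) (i : ℤ) :
    (s.setArr a i z).Bounded B := by
  refine ⟨hs.1, fun a' i' => ?_⟩
  by_cases h : a' = a
  · subst h
    by_cases h' : i' = i
    · subst h'; simpa [State.setArr] using hz
    · simpa [State.setArr, h'] using hs.2 a' i'
  · simpa [State.setArr, h] using hs.2 a' i'

theorem wp_const_le {r : ℕ} {z : ℤ} (hs : s.Bounded B) (hz : |z| ≤ B) :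
    wp B (.const r z) F s ≤ 1 + F (s.setReg r z) :=
  wp_pure_le hs rfl (hs.setReg hz r)

theorem wp_op_le {r x y : ℕ} {o : Op} (hs : s.Bounded B)
    (hz : |o.eval (s.reg x) (s.reg y)| ≤ B) :
    wp B (.op r o x y) F s ≤ 1 + F (s.setReg r (o.eval (s.reg x) (s.reg y))) :=
  wp_pure_le hs rfl (hs.setReg hz r)

theorem wp_load_le {r a i : ℕ} (hs : s.Bounded B) :
    wp B (.load r a i) F s ≤ 1 + F (s.setReg r (s.arr a (s.reg i))) :=
  wp_pure_le hs rfl (hs.setReg (hs.2 _ _) r)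

theorem wp_store_le {a i x : ℕ} (hs : s.Bounded B) :
    wp B (.store a i x) F s ≤ 1 + F (s.setArr a (s.reg i) (s.reg x)) :=
  wp_pure_le hs rfl (hs.setArr (hs.1 _) _ _)

theorem wp_seq_le {c d : Cmd} (hs : s.Bounded B) :
    wp B (.seq c d) F s ≤ 1 + wp B c (wp B d F) s := by
  refine (cost_cons_le hs).trans ?_
  simp only [step, ex_pure]
  gcongr
  exact cost_cons_le_wp c [d] s

theorem wp_ite_le {x : ℕ} {c d : Cmd} (hs : s.Bounded B) :
    wp B (.ite x c d) F s ≤ 1 + if s.reg x ≠ 0 then wp B c F s else wp B d F s := by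
  refine (cost_cons_le hs).trans ?_
  simp only [step, ex_pure]
  split_ifs <;> exact le_rfl

theorem wp_loop_le {x : ℕ} {c : Cmd} (hs : s.Bounded B) :
    wp B (.loop x c) F s ≤ 1 + if s.reg x ≠ 0 then wp B c (wp B (.loop x c) F) s else F s := by
  refine (cost_cons_le hs).trans ?_
  simp only [step, ex_pure]
  gcongr
  split_ifs
  · exact cost_cons_le_wp c [_] s
  · exact cost_nil_le hs

theorem wp_rand_le {r x : ℕ} {N : ℕ} (hN : 0 < N) (hs : s.Bounded B) (hx : s.reg x = N) :
    wp B (.rand r x) F s ≤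
      1 + (N : ℝ≥0∞)⁻¹ * ∑ j ∈ Finset.range N, F (s.setReg r (j : ℕ)) := by
  refine (cost_cons_le hs).trans ?_
  -- The machine draws from `x - 1 + 1` values to keep the range nonempty; for positive `x` this is
  -- `x` itself.
  have hN' : (s.reg x).toNat - 1 + 1 = N := by rw [hx, Int.toNat_natCast]; omega
  have hxB : (N : ℤ) ≤ B := by rw [← hx]; exact (le_abs_self _).trans (hs.1 x)
  simp only [step]
  rw [ex_map]
  change 1 + ex ((PMF.uniformOfFintype (Fin ((s.reg x).toNat - 1 + 1))).bind
    fun a => PMF.pure (a : ℕ)) (fun j => cost B F ([], s.setReg r (j : ℤ))) ≤ _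
  rw [ex_bind, ex_uniform, Fintype.card_fin, hN']
  simp only [ex_pure]
  rw [← Finset.sum_range fun j => cost B F ([], s.setReg r (j : ℤ))]
  gcongr with j hj
  refine cost_nil_le (hs.setReg ?_ r)
  rw [abs_of_nonneg (by positivity)]
  have := Finset.mem_range.1 hj
  omega

end ISGLowerBound

namespace ISGLowerBound

/-! ## A small structured language

Programs are written over variables and arrays of their own, next to the registers and arrays of
a simulated machine. Register `4 j` holds variable `j`, register `4 r + 2` the register `r` of the
simulated machine, and the odd registers hold temporaries and loop counters. Array `2 a` is the
array `a` of the program, and array `2 a + 1` the array `a` of the simulated machine. -/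

/-- Variables and arrays of a program, and the state of the simulated machine. -/
structure Store where
  var : ℕ → ℤ
  arr : ℕ → ℤ → ℤ
  ds : State

namespace Store

def setVar (σ : Store) (j : ℕ) (z : ℤ) : Store := { σ with var := Function.update σ.var j z }

def setArr (σ : Store) (a : ℕ) (i z : ℤ) : Store :=
  { σ with arr := Function.update σ.arr a (Function.update (σ.arr a) i z) }

def setDs (σ : Store) (s : State) : Store := { σ with ds := s }

/-- All variables and array entries of the program are at most `X`. -/
def Small (X : ℕ) (σ : Store) : Prop := (∀ j, |σ.var j| ≤ (X : ℤ)) ∧ ∀ a i, |σ.arr a i| ≤ (X : ℤ)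

variable (σ : Store) (j k a b : ℕ) (i i' z : ℤ) (s : State)

@[simp] theorem setVar_var : (σ.setVar j z).var k = if k = j then z else σ.var k := by
  simp [setVar, Function.update_apply]
@[simp] theorem setVar_arr : (σ.setVar j z).arr = σ.arr := rfl
@[simp] theorem setVar_ds : (σ.setVar j z).ds = σ.ds := rfl
@[simp] theorem setArr_var : (σ.setArr a i z).var = σ.var := rfl
@[simp] theorem setArr_arr : (σ.setArr a i z).arr b =
    if b = a then Function.update (σ.arr a) i z else σ.arr b := by
  simp [setArr, Function.update_apply]
@[simp] theorem setDs_var : (σ.setDs s).var = σ.var := rfl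
@[simp] theorem setDs_arr : (σ.setDs s).arr = σ.arr := rfl
@[simp] theorem setDs_ds : (σ.setDs s).ds = s := rfl

variable {σ z}

theorem Small.setVar {X : ℕ} (h : σ.Small X) (hz : |z| ≤ X) : (σ.setVar j z).Small X := by
  refine ⟨fun k => ?_, h.2⟩
  rw [setVar_var]
  split_ifs
  exacts [hz, h.1 k]

theorem Small.setArr {X : ℕ} (h : σ.Small X) (hz : |z| ≤ X) : (σ.setArr a i z).Small X := by
  refine ⟨h.1, fun b i' => ?_⟩
  rw [setArr_arr]
  split_ifs
  · rw [Function.update_apply]; split_ifs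
    exacts [hz, h.2 _ _]
  · exact h.2 _ _

end Store

/-- The variables are bounded by `X`, and all words by `X ^ e`. -/
structure Bds where
  X : ℕ
  e : ℕ
  five_le : 5 ≤ X
  deg_le : 20 ≤ e

/-- The bound on all words. -/
def Bds.B (β : Bds) : ℕ := β.X ^ β.e

theorem Bds.X_le_B (β : Bds) : β.X ≤ β.B :=
  Nat.le_self_pow (by have := β.deg_le; omega) _

/-- Expressions over the variables and arrays of a program. -/
inductive Term where
  | lit (z : ℤ)
  | var (j : ℕ)
  | bin (o : Op) (e e' : Term)
  | get (a : ℕ) (e : Term)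

namespace Term

/-- Value of an expression. -/
def eval (σ : Store) : Term → ℤ
  | lit z => z
  | var j => σ.var j
  | bin o e e' => o.eval (e.eval σ) (e'.eval σ)
  | get a e => σ.arr a (e.eval σ)

/-- The values of subexpressions are at most `X ^ deg`. -/
def deg : Term → ℕ
  | lit _ => 1
  | var _ => 1
  | bin .mul e e' => e.deg + e'.deg
  | bin .add e e' => max e.deg e'.deg + 1
  | bin .sub e e' => max e.deg e'.deg + 1
  | bin _ e e' => max e.deg e'.deg
  | get _ e => e.deg

/-- Only arithmetic operations and small literals occur. -/
def Plain : Term → Prop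
  | lit z => |z| ≤ 5
  | var _ => True
  | bin o e e' => (o = .add ∨ o = .sub ∨ o = .mul ∨ o = .div ∨ o = .mod ∨ o = .lt ∨ o = .eq) ∧
      e.Plain ∧ e'.Plain
  | get _ e => e.Plain

/-- Number of steps for the evaluation. -/
def size : Term → ℕ
  | lit _ => 1
  | var _ => 3
  | bin _ e e' => e.size + e'.size + 3
  | get _ e => e.size + 2

end Term

/-- Registers for temporary values. -/
def tmp (j : ℕ) : ℕ := 6 * j + 1
/-- Loop counters. -/
def ctr (d : ℕ) : ℕ := 6 * d + 3
/-- Numbers of repetitions. -/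
def lim (d : ℕ) : ℕ := 6 * d + 5

/-- Code that evaluates an expression into the temporary register `j`. -/
def Term.code : ℕ → Term → Cmd
  | j, lit z => .const (tmp j) z
  | j, var k => .seq (.const (tmp j) 0) (.op (tmp j) .add (4 * k) (tmp j))
  | j, bin o e e' =>
      .seq (e.code j) (.seq (e'.code (j + 1)) (.op (tmp j) o (tmp j) (tmp (j + 1))))
  | j, get a e => .seq (e.code j) (.load (tmp j) (2 * a) (tmp j))

/-- Assignment of an expression to a register. -/
def setRegC (r : ℕ) (e : Term) : Cmd :=
  .seq (e.code 0) (.seq (.const (tmp 1) 0) (.op r .add (tmp 0) (tmp 1)))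
/-- `x_j := e` -/
def asg (j : ℕ) (e : Term) : Cmd := setRegC (4 * j) e
/-- `r := e` for a register of the simulated machine. -/
def asgD (r : ℕ) (e : Term) : Cmd := setRegC (4 * r + 2) e
/-- Assignment to an array cell. -/
def setArrC (a : ℕ) (i e : Term) : Cmd :=
  .seq (i.code 0) (.seq (e.code 1) (.store a (tmp 0) (tmp 1)))
/-- `a[i] := e` -/
def sto (a : ℕ) (i e : Term) : Cmd := setArrC (2 * a) i e
/-- `a[i] := e` for an array of the simulated machine. -/
def stoD (a : ℕ) (i e : Term) : Cmd := setArrC (2 * a + 1) i e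
/-- Conditional. -/
def iteC (e : Term) (c d : Cmd) : Cmd := .seq (e.code 0) (.ite (tmp 0) c d)
/-- A command without effect. -/
def skipC : Cmd := .const (tmp 0) 0
/-- One repetition in a counting loop. -/
def forBody (d j : ℕ) (c : Cmd) : Cmd :=
  .seq (.const (tmp 0) 0) <| .seq (.op (4 * j) .add (ctr d) (tmp 0)) <| .seq c <|
    .seq (.const (tmp 1) 1) <| .seq (.op (ctr d) .add (ctr d) (tmp 1)) <|
    .op (tmp 0) .lt (ctr d) (lim d)
/-- `for x_j := 0, …, e - 1 do c`, where `d` is the nesting depth. -/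
def forC (d j : ℕ) (e : Term) (c : Cmd) : Cmd :=
  .seq (e.code 0) <| .seq (.const (tmp 1) 0) <| .seq (.op (lim d) .add (tmp 0) (tmp 1)) <|
    .seq (.const (ctr d) 0) <| .seq (.op (tmp 0) .lt (ctr d) (lim d)) <|
    .loop (tmp 0) (forBody d j c)

/-- A machine state represents a store. -/
structure Rep (β : Bds) (s : State) (σ : Store) : Prop where
  var : ∀ j, s.reg (4 * j) = σ.var j
  arr : ∀ a, s.arr (2 * a) = σ.arr a
  dreg : ∀ r, s.reg (4 * r + 2) = σ.ds.reg r
  darr : ∀ a, s.arr (2 * a + 1) = σ.ds.arr a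
  bdd : s.Bounded β.B
  small : σ.Small β.X

namespace Rep
variable {β : Bds} {s : State} {σ : Store}

@[simp] theorem _root_.ISGLowerBound.State.setReg_reg (s : State) (r r' : ℕ) (z : ℤ) :
    (s.setReg r z).reg r' = if r' = r then z else s.reg r' := by
  simp [State.setReg, Function.update_apply]

@[simp] theorem _root_.ISGLowerBound.State.setArr_arr (s : State) (a b : ℕ) (i z : ℤ) :
    (s.setArr a i z).arr b = if b = a then Function.update (s.arr a) i z else s.arr b := by
  simp [State.setArr, Function.update_apply]

theorem setHidden (h : Rep β s σ) {r : ℕ} (hr : r % 2 = 1) {z : ℤ} (hz : |z| ≤ β.B) :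
    Rep β (s.setReg r z) σ where
  var j := by rw [State.setReg_reg, if_neg (by omega), h.var]
  arr := h.arr
  dreg j := by rw [State.setReg_reg, if_neg (by omega), h.dreg]
  darr := h.darr
  bdd := h.bdd.setReg hz r
  small := h.small

theorem setVar (h : Rep β s σ) (j : ℕ) {z : ℤ} (hz : |z| ≤ β.X) :
    Rep β (s.setReg (4 * j) z) (σ.setVar j z) where
  var k := by simp [h.var]
  arr := h.arr
  dreg j := by rw [State.setReg_reg, if_neg (by omega), h.dreg]; rfl
  darr := h.darr
  bdd := h.bdd.setReg (hz.trans (by exact_mod_cast β.X_le_B)) _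
  small := h.small.setVar _ hz

theorem setD (h : Rep β s σ) (r : ℕ) {z : ℤ} (hz : |z| ≤ β.B) :
    Rep β (s.setReg (4 * r + 2) z) (σ.setDs (σ.ds.setReg r z)) where
  var k := by rw [State.setReg_reg, if_neg (by omega), h.var]; rfl
  arr := h.arr
  dreg j := by simp [h.dreg]
  darr := h.darr
  bdd := h.bdd.setReg hz _
  small := h.small

theorem setArr (h : Rep β s σ) (a : ℕ) (i : ℤ) {z : ℤ} (hz : |z| ≤ β.X) :
    Rep β (s.setArr (2 * a) i z) (σ.setArr a i z) where
  var k := h.var k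
  arr b := by simp [h.arr]
  dreg j := h.dreg j
  darr b := by rw [State.setArr_arr, if_neg (by omega), h.darr]; rfl
  bdd := h.bdd.setArr (hz.trans (by exact_mod_cast β.X_le_B)) _ _
  small := h.small.setArr _ _ hz

theorem setDArr (h : Rep β s σ) (a : ℕ) (i : ℤ) {z : ℤ} (hz : |z| ≤ β.B) :
    Rep β (s.setArr (2 * a + 1) i z) (σ.setDs (σ.ds.setArr a i z)) where
  var k := h.var k
  arr b := by rw [State.setArr_arr, if_neg (by omega), h.arr]; rfl
  dreg j := h.dreg j
  darr b := by simp [h.darr]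
  bdd := h.bdd.setArr hz _ _
  small := h.small

end Rep

/-! ### Evaluation of expressions -/

theorem Term.one_le_deg (e : Term) : 1 ≤ e.deg := by
  induction e with
  | lit | var => simp [deg]
  | get => simpa [deg]
  | bin o e e' h h' => cases o <;> simp only [deg] <;> omega

/-- A sum or difference at most doubles the bound, which one more factor X ≥ 5 absorbs; a product
adds the degrees; quotients, remainders and comparisons do not increase the degree. An array entry
is at most X whatever the index, and the degree of the index is kept only because the index is
itself an intermediate value. -/
theorem Term.abs_eval_le {β : Bds} {σ : Store} (hσ : σ.Small β.X) {e : Term} (he : e.Plain) :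
    |e.eval σ| ≤ (β.X : ℤ) ^ e.deg := by
  have h5 : (5 : ℤ) ≤ β.X := by exact_mod_cast β.five_le
  have h1 : (1 : ℤ) ≤ β.X := by linarith
  induction e with
  | lit z => simp only [Plain] at he; simp only [deg, eval, pow_one]; linarith
  | var j => simpa [deg, eval] using hσ.1 j
  | get a e ih =>
    simp only [deg, eval]
    exact (hσ.2 _ _).trans (le_self_pow₀ h1 (by have := e.one_le_deg; omega))
  | bin o e e' h h' =>
    obtain ⟨ho, he, he'⟩ := he
    have h := h he
    have h' := h' he'
    have hm : |e.eval σ| ≤ (β.X : ℤ) ^ max e.deg e'.deg :=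
      h.trans (pow_le_pow_right₀ h1 (le_max_left _ _))
    have hm' : |e'.eval σ| ≤ (β.X : ℤ) ^ max e.deg e'.deg :=
      h'.trans (pow_le_pow_right₀ h1 (le_max_right _ _))
    have hp : (1 : ℤ) ≤ (β.X : ℤ) ^ max e.deg e'.deg := one_le_pow₀ h1
    rcases ho with rfl | rfl | rfl | rfl | rfl | rfl | rfl <;> simp only [deg, eval, Op.eval]
    · rw [pow_succ]; refine (abs_add_le _ _).trans ?_; nlinarith
    · rw [pow_succ]; refine (abs_sub _ _).trans ?_; nlinarith
    · rw [abs_mul, pow_add]; gcongr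
    · exact (Int.abs_ediv_le_abs _ _).trans hm
    -- The remainder modulo zero is the dividend, so this case needs the bound for the other
    -- operand.
    · rcases eq_or_ne (e'.eval σ) 0 with h0 | h0
      · simpa [h0] using hm
      · rw [abs_of_nonneg (Int.emod_nonneg _ h0)]
        exact (Int.emod_lt_abs _ h0).le.trans hm'
    · split_ifs <;> first | (simp; done) | (simp; linarith)
    · split_ifs <;> first | (simp; done) | (simp; linarith)

variable {β : Bds} {s : State} {σ : Store} {F : State → ℝ≥0∞} {T : ℝ≥0∞}

theorem wp_seq_le_of {B : ℕ} {c d : Cmd} {t : ℝ≥0∞} (hs : s.Bounded B)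
    (h : wp B c (wp B d F) s ≤ t) : wp B (.seq c d) F s ≤ 1 + t :=
  (wp_seq_le hs).trans (by gcongr)

theorem wp_const_le_of {B r : ℕ} {z : ℤ} (hs : s.Bounded B) (hz : |z| ≤ B)
    (h : F (s.setReg r z) ≤ T) : wp B (.const r z) F s ≤ 1 + T :=
  (wp_const_le hs hz).trans (by gcongr)

theorem wp_op_le_of {B r x y : ℕ} {o : Op} {z : ℤ} (hs : s.Bounded B)
    (he : o.eval (s.reg x) (s.reg y) = z) (hz : |z| ≤ B) (h : F (s.setReg r z) ≤ T) :
    wp B (.op r o x y) F s ≤ 1 + T := by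
  subst he
  exact (wp_op_le hs hz).trans (by gcongr)

/-- The temporaries work as a stack: evaluation into temporary `j` may destroy those from `j` on,
but not the lower ones. Thus the second operand, evaluated at `j + 1`, leaves the first one alone.
-/
theorem wp_term_le {e : Term} {j : ℕ} (hs : Rep β s σ) (he : e.Plain) (hd : e.deg ≤ β.e)
    (hF : ∀ s', Rep β s' σ → (∀ r, (∀ i ≥ j, r ≠ tmp i) → s'.reg r = s.reg r) →
      s'.reg (tmp j) = e.eval σ → F s' ≤ T) :
    wp β.B (e.code j) F s ≤ (e.size : ℕ) + T := by
  have hX : (1 : ℤ) ≤ β.X := by have := β.five_le; omega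
  have bd : ∀ e : Term, e.Plain → e.deg ≤ β.e → |e.eval σ| ≤ β.B := fun e he hd =>
    (Term.abs_eval_le hs.small he).trans (by
      rw [Bds.B]; push_cast; exact pow_le_pow_right₀ hX hd)
  induction e generalizing j s F T with
  | lit z =>
    have hz := bd _ he hd
    refine (wp_const_le hs.bdd hz).trans ?_
    simp only [Term.size, Nat.cast_one]
    gcongr
    refine hF _ (hs.setHidden (by simp only [tmp]; omega) hz) (fun r hr => ?_) (by simp [Term.eval])
    simp [hr j le_rfl]
  | var k =>
    have hz := bd _ he hd
    have h0 : |(0 : ℤ)| ≤ β.B := by simp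
    have hs1 := hs.setHidden (r := tmp j) (by simp only [tmp]; omega) h0
    have e1 : (s.setReg (tmp j) 0).reg (4 * k) = σ.var k := hs1.var k
    have e2 : Op.add.eval ((s.setReg (tmp j) 0).reg (4 * k)) ((s.setReg (tmp j) 0).reg (tmp j))
        = σ.var k := by rw [e1]; simp [Op.eval]
    refine (wp_seq_le_of hs.bdd ((wp_const_le hs.bdd h0).trans
      (add_le_add_right ((wp_op_le hs1.bdd ?_).trans
        (add_le_add_right (hF _ (hs1.setHidden ?_ ?_) ?_ ?_) _)) _))).trans ?_
    · rw [e2]; exact hz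
    · simp [tmp]; omega
    · rw [e2]; exact hz
    · intro r hr; simp [hr j le_rfl]
    · rw [e2]; simp [Term.eval]
    · simp only [Term.size]; apply le_of_eq; push_cast; ring
  | get a e ih =>
    simp only [Term.Plain, Term.deg] at he hd
    refine (wp_seq_le_of hs.bdd (ih (T := 1 + T) hs he hd fun s1 hs1 hr he1 => ?_)).trans ?_
    · have e1 : s1.arr (2 * a) (s1.reg (tmp j)) = σ.arr a (e.eval σ) := by rw [he1, hs1.arr]
      refine (wp_load_le hs1.bdd).trans (add_le_add_right (hF _ (hs1.setHidden ?_ ?_) ?_ ?_) _)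
      · simp [tmp]; omega
      · exact hs1.bdd.2 _ _
      · intro r hr'; simp [hr' j le_rfl, hr r hr']
      · simp [e1, Term.eval]
    · simp only [Term.size]; apply le_of_eq; push_cast; ring
  | bin o e e' ih ih' =>
    have hz := bd _ he hd
    have hdd : max e.deg e'.deg ≤ β.e := by
      refine le_trans ?_ hd
      have := e.one_le_deg
      have := e'.one_le_deg
      cases o <;> simp only [Term.deg] <;> omega
    refine (wp_seq_le_of hs.bdd (ih (T := 1 + ((e'.size : ℕ) + (1 + T))) hs he.2.1
      ((le_max_left _ _).trans hdd) fun s1 hs1 hr he1 => ?_)).trans ?_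
    · refine wp_seq_le_of hs1.bdd (ih' hs1 he.2.2
        ((le_max_right _ _).trans hdd) fun s2 hs2 hr2 he2 => ?_)
      have e1 : s2.reg (tmp j) = e.eval σ := by
        rw [hr2, he1]; intro i hi; simp only [tmp]; omega
      have e2 : o.eval (s2.reg (tmp j)) (s2.reg (tmp (j + 1))) = (Term.bin o e e').eval σ := by
        rw [e1, he2]; rfl
      refine (wp_op_le hs2.bdd ?_).trans (add_le_add_right (hF _ (hs2.setHidden ?_ ?_) ?_ ?_) _)
      · rw [e2]; exact hz
      · simp [tmp]; omega
      · rw [e2]; exact hz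
      · intro r hr'
        simp only [State.setReg_reg, hr' j le_rfl, if_false]
        rw [hr2 r fun i hi => hr' i (by omega), hr r hr']
      · simp only [State.setReg_reg, if_true]; exact e2
    · simp only [Term.size]; apply le_of_eq; push_cast; ring

/-! ### Triples -/

/-- The counters and limits of loops of depth less than `d` agree with `ρ`. -/
def SameLoops (d : ℕ) (ρ : ℕ → ℤ) (s : State) : Prop :=
  ∀ k < d, s.reg (ctr k) = ρ (ctr k) ∧ s.reg (lim k) = ρ (lim k)

/-- `F` is at most `T` on all states that represent `σ`. -/
def Bnd (β : Bds) (d : ℕ) (ρ : ℕ → ℤ) (F : State → ℝ≥0∞) (σ : Store) (T : ℝ≥0∞) : Prop :=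
  ∀ s, Rep β s σ → SameLoops d ρ s → F s ≤ T

/-- From `σ`, the command `c` takes at most `t` steps and establishes `Q`; it leaves the counters
of loops of depth less than `d` alone. -/
def Ok (β : Bds) (d : ℕ) (c : Cmd) (σ : Store) (t : ℕ) (Q : Store → Prop) : Prop :=
  ∀ ρ F T, (∀ σ', Q σ' → Bnd β d ρ F σ' T) → Bnd β d ρ (wp β.B c F) σ (t + T)

variable {d : ℕ} {ρ : ℕ → ℤ} {c c' : Cmd} {t t' : ℕ} {Q Q' : Store → Prop} {e i : Term}

theorem SameLoops.setReg (h : SameLoops d ρ s) {r : ℕ} (hr : ∀ k < d, r ≠ ctr k ∧ r ≠ lim k)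
    (z : ℤ) : SameLoops d ρ (s.setReg r z) := fun k hk => by
  simp [(hr k hk).1.symm, (hr k hk).2.symm, h k hk]

theorem SameLoops.congr (h : SameLoops d ρ s) {s' : State}
    (hs : ∀ r, (∀ i ≥ 0, r ≠ tmp i) → s'.reg r = s.reg r) : SameLoops d ρ s' := fun k hk => by
  rw [hs, hs]
  · exact h k hk
  all_goals intro i _; simp only [ctr, lim, tmp]; omega

theorem Bnd.mono {T' : ℝ≥0∞} (h : Bnd β d ρ F σ T) (hT : T ≤ T') : Bnd β d ρ F σ T' :=
  fun s hs hl => (h s hs hl).trans hT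

theorem Ok.mono (h : Ok β d c σ t Q) (ht : t ≤ t') (hQ : ∀ σ', Q σ' → Q' σ') :
    Ok β d c σ t' Q' := fun ρ F T hF =>
  (h ρ F T fun σ' hσ => hF σ' (hQ σ' hσ)).mono (by gcongr)

/-- A store with a variable out of bounds is represented by no state, so smallness is available for
free in the proof of a triple. -/
theorem Ok.of_small (h : σ.Small β.X → Ok β d c σ t Q) : Ok β d c σ t Q :=
  fun ρ F T hF s hs hl => h hs.small ρ F T hF s hs hl

theorem bnd_term (he : e.Plain) (hd : e.deg ≤ β.e)
    (hF : ∀ s, Rep β s σ → SameLoops d ρ s → s.reg (tmp 0) = e.eval σ → F s ≤ T) :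
    Bnd β d ρ (wp β.B (e.code 0) F) σ ((e.size : ℕ) + T) := fun _ hs hl =>
  wp_term_le hs he hd fun s' hs' hr hv => hF s' hs' (hl.congr hr) hv

theorem Ok.small (h : Ok β d c σ t Q) : Ok β d c σ t fun σ' => Q σ' ∧ σ'.Small β.X :=
  fun ρ F T hF => h ρ F T fun σ' hσ s hs hl => hF σ' ⟨hσ, hs.small⟩ s hs hl

/-- Because a triple is quantified over all continuations, the second command together with its
continuation serves as the continuation of the first. -/
theorem ok_seq (h : Ok β d c σ t Q) (h' : ∀ σ', Q σ' → Ok β d c' σ' t' Q') :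
    Ok β d (.seq c c') σ (1 + t + t') Q' := fun ρ F T hF s hs hl => by
  refine (wp_seq_le_of hs.bdd (h ρ _ (t' + T) (fun σ' hσ => h' σ' hσ ρ F T hF) s hs hl)).trans
    (le_of_eq ?_)
  push_cast; ring

/-- The machine has no move instruction; the value is transferred by adding a register that holds
zero. The target is left general here, since the same code writes variables of the program and
registers of the simulated machine. -/
theorem bnd_setReg {r : ℕ} (he : e.Plain) (hd : e.deg ≤ β.e)
    (hF : ∀ s, Rep β s σ → SameLoops d ρ s →  F (s.setReg r (e.eval σ)) ≤ T) :
    Bnd β d ρ (wp β.B (setRegC r e) F) σ ((e.size + 4 : ℕ) + T) := fun s hs hl => by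
  have hz : |e.eval σ| ≤ β.B := (Term.abs_eval_le hs.small he).trans (by
      rw [Bds.B]; push_cast
      exact pow_le_pow_right₀ (by have := β.five_le; omega) hd)
  refine (wp_seq_le_of hs.bdd (bnd_term (T := 3 + T) he hd (fun s hs hl he => ?_) s hs hl)).trans
    (le_of_eq ?_)
  · have hs1 := hs.setHidden (r := tmp 1) (z := 0) (by simp [tmp]) (by simp)
    have e2 : Op.add.eval ((s.setReg (tmp 1) 0).reg (tmp 0)) ((s.setReg (tmp 1) 0).reg (tmp 1))
        = e.eval σ := by simp [Op.eval, tmp, ← he]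
    refine (wp_seq_le_of hs.bdd (wp_const_le_of hs.bdd (by simp)
      (wp_op_le_of hs1.bdd e2 hz (hF _ hs1 (hl.setReg (fun k _ => ?_) _))))).trans (le_of_eq ?_)
    · simp only [tmp, ctr, lim]; omega
    · ring
  · push_cast; ring

theorem ok_asg {j : ℕ} (he : e.Plain) (hd : e.deg ≤ β.e) (hz : |e.eval σ| ≤ β.X)
    (hQ : Q (σ.setVar j (e.eval σ))) : Ok β d (asg j e) σ (e.size + 4) Q := fun _ _ _ hF =>
  bnd_setReg he hd fun _ hs hl =>
    hF _ hQ _ (hs.setVar j hz) (hl.setReg (fun k _ => by simp only [ctr, lim]; omega) _)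

theorem ok_asgD {r : ℕ} (he : e.Plain) (hd : e.deg ≤ β.e) (hz : |e.eval σ| ≤ β.X)
    (hQ : Q (σ.setDs (σ.ds.setReg r (e.eval σ)))) : Ok β d (asgD r e) σ (e.size + 4) Q :=
  fun _ _ _ hF => bnd_setReg he hd fun _ hs hl =>
    hF _ hQ _ (hs.setD r (hz.trans (by exact_mod_cast β.X_le_B)))
      (hl.setReg (fun k _ => by simp only [ctr, lim]; omega) _)

theorem bnd_setArr {a : ℕ} (hi : i.Plain) (hdi : i.deg ≤ β.e) (he : e.Plain) (hd : e.deg ≤ β.e)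
    (hF : ∀ s, Rep β s σ → SameLoops d ρ s → F (s.setArr a (i.eval σ) (e.eval σ)) ≤ T) :
    Bnd β d ρ (wp β.B (setArrC a i e) F) σ ((i.size + e.size + 3 : ℕ) + T) := fun s hs hl => by
  refine (wp_seq_le_of hs.bdd (bnd_term (T := (e.size + 2 : ℕ) + T) hi hdi
    (fun s hs hl hi => ?_) s hs hl)).trans (le_of_eq ?_)
  · refine (wp_seq_le_of hs.bdd (wp_term_le (T := 1 + T) hs he hd fun s' hs' hr hv => ?_)).trans
      (le_of_eq ?_)
    · have h0 : s'.reg (tmp 0) = i.eval σ := by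
        rw [← hi]; apply hr; intro i hi; simp only [tmp]; omega
      refine (wp_store_le hs'.bdd).trans (add_le_add_right ?_ _)
      rw [h0, hv]
      refine hF s' hs' (hl.congr fun r h => hr r fun i _ => h i (by omega))
    · push_cast; ring
  · push_cast; ring

theorem SameLoops.setArr (h : SameLoops d ρ s) (a : ℕ) (i z : ℤ) :
    SameLoops d ρ (s.setArr a i z) := h

theorem ok_sto {a : ℕ} (hi : i.Plain) (hdi : i.deg ≤ β.e) (he : e.Plain) (hd : e.deg ≤ β.e)
    (hz : |e.eval σ| ≤ β.X) (hQ : Q (σ.setArr a (i.eval σ) (e.eval σ))) :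
    Ok β d (sto a i e) σ (i.size + e.size + 3) Q := fun _ _ _ hF =>
  bnd_setArr hi hdi he hd fun _ hs hl => hF _ hQ _ (hs.setArr a _ hz) (hl.setArr _ _ _)

theorem ok_stoD {a : ℕ} (hi : i.Plain) (hdi : i.deg ≤ β.e) (he : e.Plain) (hd : e.deg ≤ β.e)
    (hz : |e.eval σ| ≤ β.X) (hQ : Q (σ.setDs (σ.ds.setArr a (i.eval σ) (e.eval σ)))) :
    Ok β d (stoD a i e) σ (i.size + e.size + 3) Q := fun _ _ _ hF =>
  bnd_setArr hi hdi he hd fun _ hs hl => hF _ hQ _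
    (hs.setDArr a _ (hz.trans (by exact_mod_cast β.X_le_B))) (hl.setArr _ _ _)

theorem bnd_ite (he : e.Plain) (hd : e.deg ≤ β.e)
    (h1 : e.eval σ ≠ 0 → Bnd β d ρ (wp β.B c F) σ T)
    (h2 : e.eval σ = 0 → Bnd β d ρ (wp β.B c' F) σ T) :
    Bnd β d ρ (wp β.B (iteC e c c') F) σ ((e.size + 2 : ℕ) + T) := fun s hs hl => by
  refine (wp_seq_le_of hs.bdd (bnd_term (T := 1 + T) he hd
    (fun s hs hl hi => ?_) s hs hl)).trans (le_of_eq ?_)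
  · refine (wp_ite_le hs.bdd).trans (add_le_add_right ?_ _)
    rw [hi]
    split_ifs with h
    exacts [h1 h s hs hl, h2 (not_not.1 h) s hs hl]
  · push_cast; ring

theorem ok_ite (he : e.Plain) (hd : e.deg ≤ β.e) (h1 : e.eval σ ≠ 0 → Ok β d c σ t Q)
    (h2 : e.eval σ = 0 → Ok β d c' σ t Q) : Ok β d (iteC e c c') σ (e.size + 2 + t) Q :=
  fun ρ F T hF => (bnd_ite he hd (fun h => h1 h ρ F T hF) (fun h => h2 h ρ F T hF)).mono
    (le_of_eq (by push_cast; ring))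

theorem ok_skip (hQ : Q σ) : Ok β d skipC σ 1 Q := fun ρ F T hF s hs hl => by
  refine (wp_const_le hs.bdd (by simp)).trans ?_
  rw [Nat.cast_one]
  gcongr
  refine hF σ hQ _ (hs.setHidden (by simp [tmp]) (by simp)) (hl.setReg (fun k _ => ?_) _)
  simp only [tmp, ctr, lim]; omega

/-- Overhead of one repetition of a loop. -/
def loopCost : ℕ := 11

/-- A loop rule with a potential: `Φ i σ` is what remains to be paid before repetition `i`. It
covers the loop over the arrivals, where the outstanding amount contains the expected time of the
data structure from its present, random state and is not a number fixed in advance. The body has to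
be treated for every `A`, as `A` also takes up the overhead of the later repetitions. -/
theorem bnd_for {j : ℕ} {N : ℕ} {Inv : ℕ → Store → Prop} {Φ : ℕ → Store → ℝ≥0∞} {A : ℝ≥0∞}
    (he : e.Plain) (hd : e.deg ≤ β.e) (hN : e.eval σ = N) (hNX : N ≤ β.X) (h0 : Inv 0 σ)
    (hbody : ∀ i < N, ∀ σ, Inv i σ → ∀ ρ F A,
      (∀ σ', Inv (i + 1) σ' → Bnd β (d + 1) ρ F σ' (A + Φ (i + 1) σ')) →
      Bnd β (d + 1) ρ (wp β.B c F) (σ.setVar j i) (A + Φ i σ))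
    (hF : ∀ σ', Inv N σ' → Bnd β d ρ F σ' (A + Φ N σ')) :
    Bnd β d ρ (wp β.B (forC d j e c) F) σ
      (A + Φ 0 σ + (e.size + 10 + N * loopCost : ℕ)) := by
  have hXB : (β.X : ℤ) ≤ β.B := by exact_mod_cast β.X_le_B
  have hX5 := β.five_le
  -- Induction on the number `m` of repetitions still to come; the hidden registers hold the
  -- counter, the limit and the result of their comparison.
  have key : ∀ m i : ℕ, i + m = N → ∀ σ, Inv i σ → ∀ s, Rep β s σ → SameLoops d ρ s →
      s.reg (ctr d) = i → s.reg (lim d) = N → s.reg (tmp 0) = (if i < N then 1 else 0) →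
      wp β.B (.loop (tmp 0) (forBody d j c)) F s ≤ A + Φ i σ + (m * loopCost + 1 : ℕ) := by
    intro m
    induction m with
    | zero =>
      intro i hi σ hinv s hs hl _ _ h3
      simp only [add_zero] at hi
      subst hi
      refine (wp_loop_le hs.bdd).trans ?_
      rw [h3]
      simp only [lt_irrefl, if_false, ne_eq, not_true_eq_false]
      rw [add_comm]
      push_cast
      gcongr
      · exact hF σ hinv s hs hl
      · simp
    | succ m ih =>
      intro i hi σ hinv s hs hl h1 h2 h3
      have hiN : i < N := by omega
      refine (wp_loop_le hs.bdd).trans ?_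
      rw [h3]
      simp only [hiN, if_true, ne_eq, one_ne_zero, not_false_eq_true]
      have hiX : |(i : ℤ)| ≤ β.X := by rw [abs_of_nonneg (by positivity)]; omega
      have hs1 := hs.setHidden (r := tmp 0) (z := 0) (by simp [tmp]) (by simp)
      have e1 : Op.add.eval ((s.setReg (tmp 0) 0).reg (ctr d)) ((s.setReg (tmp 0) 0).reg (tmp 0))
        = (i : ℤ) := by
        simp only [Op.eval, State.setReg_reg, if_true, add_zero]
        rw [if_neg (by simp only [tmp, ctr]; omega), h1]
      set s2 := (s.setReg (tmp 0) 0).setReg (4 * j) (i : ℤ) with hs2d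
      have hs2 : Rep β s2 (σ.setVar j i) := hs1.setVar j hiX
      -- The reference values for the body are the present register contents. At depth `d + 1` the
      -- counter of this loop is thereby protected as well.
      have hl2 : SameLoops (d + 1) (s2.reg) s2 := fun k _ => ⟨rfl, rfl⟩
      have hwp : wp β.B c (wp β.B (.seq (.const (tmp 1) 1) <|
          .seq (.op (ctr d) .add (ctr d) (tmp 1)) <| .op (tmp 0) .lt (ctr d) (lim d))
          (wp β.B (.loop (tmp 0) (forBody d j c)) F)) s2 ≤
          (A + (5 + (m * loopCost + 1 : ℕ))) + Φ i σ := by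
        refine hbody i hiN σ hinv s2.reg _ (A + (5 + (m * loopCost + 1 : ℕ)))
          (fun σ' hσ' s3 hs3 hl3 => ?_) s2 hs2 hl2
        have r3 : s3.reg (ctr d) = i ∧ s3.reg (lim d) = N := by
          obtain ⟨p, q⟩ := hl3 d (Nat.lt_succ_self d)
          rw [p, q, hs2d]
          simp only [State.setReg_reg, tmp, ctr, lim] at h1 h2 ⊢
          rw [if_neg (by omega), if_neg (by omega), if_neg (by omega), if_neg (by omega)]
          exact ⟨h1, h2⟩
        have hl3' : SameLoops d ρ s3 := fun k hk => by
          obtain ⟨p, q⟩ := hl3 k (by omega)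
          rw [p, q, hs2d]
          simp only [State.setReg_reg, tmp, ctr, lim]
          rw [if_neg (by omega), if_neg (by omega), if_neg (by omega), if_neg (by omega)]
          exact hl k hk
        have hs4 := hs3.setHidden (r := tmp 1) (z := 1) (by simp [tmp]) (by simp; omega)
        have e4 : Op.add.eval ((s3.setReg (tmp 1) 1).reg (ctr d))
            ((s3.setReg (tmp 1) 1).reg (tmp 1)) = ((i + 1 : ℕ) : ℤ) := by
          simp only [Op.eval, State.setReg_reg, if_true]
          rw [if_neg (by simp only [tmp, ctr]; omega), r3.1]; simp
        have hi1 : |((i + 1 : ℕ) : ℤ)| ≤ β.B := by rw [abs_of_nonneg (by positivity)]; omega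
        have hs5 := hs4.setHidden (r := ctr d) (by simp [ctr]; omega) hi1
        set s5 := (s3.setReg (tmp 1) 1).setReg (ctr d) ((i + 1 : ℕ) : ℤ) with hs5d
        have r5 : s5.reg (ctr d) = (i + 1 : ℕ) ∧ s5.reg (lim d) = N := by
          rw [hs5d]
          simp only [State.setReg_reg, if_true, true_and]
          rw [if_neg (by simp only [lim, ctr]; omega), if_neg (by simp only [lim, tmp]; omega)]
          exact r3.2
        have e5 : Op.lt.eval (s5.reg (ctr d)) (s5.reg (lim d)) =
            (if i + 1 < N then 1 else 0) := by
          rw [r5.1, r5.2]; simp only [Op.eval, Nat.cast_lt]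
        have hb5 : |(if i + 1 < N then (1 : ℤ) else 0)| ≤ β.B := by
          split_ifs <;> simp; omega
        have hs6 := hs5.setHidden (r := tmp 0) (by simp [tmp]) hb5
        have hl6 : SameLoops d ρ (s5.setReg (tmp 0) (if i + 1 < N then (1 : ℤ) else 0)) := by
          refine ((hl3'.setReg (fun k _ => ?_) _).setReg (fun k _ => ?_) _).setReg
            (fun k _ => ?_) _ <;> simp only [tmp, ctr, lim] <;> omega
        have h6 : wp β.B (.loop (tmp 0) (forBody d j c)) F
            (s5.setReg (tmp 0) (if i + 1 < N then (1 : ℤ) else 0)) ≤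
            A + Φ (i + 1) σ' + (m * loopCost + 1 : ℕ) := by
          refine ih (i + 1) (by omega) σ' hσ' _ hs6 hl6 ?_ ?_ ?_
          · rw [State.setReg_reg, if_neg (by simp only [tmp, ctr]; omega)]; exact r5.1
          · rw [State.setReg_reg, if_neg (by simp only [tmp, lim]; omega)]; exact r5.2
          · simp
        refine (wp_seq_le_of hs3.bdd (wp_const_le_of hs3.bdd (by simp; omega)
          (wp_seq_le_of hs4.bdd (wp_op_le_of hs4.bdd e4 hi1
            (wp_op_le_of hs5.bdd e5 hb5 h6))))).trans (le_of_eq ?_)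
        push_cast; ring
      refine (add_le_add_right (wp_seq_le_of hs.bdd (wp_const_le_of hs.bdd (by simp)
        (wp_seq_le_of hs1.bdd (wp_op_le_of hs1.bdd e1 (hiX.trans hXB)
          (wp_seq_le_of hs2.bdd hwp))))) _).trans (le_of_eq ?_)
      simp only [loopCost]; push_cast; ring
  intro s hs hl
  have hNB : |(N : ℤ)| ≤ β.B := by rw [abs_of_nonneg (by positivity)]; omega
  refine (wp_seq_le_of hs.bdd (bnd_term (T := A + Φ 0 σ + (9 + N * loopCost : ℕ)) he hd
    (fun s hs hl hv => ?_) s hs hl)).trans (le_of_eq ?_)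
  · have hs1 := hs.setHidden (r := tmp 1) (z := 0) (by simp [tmp]) (by simp)
    have e1 : Op.add.eval ((s.setReg (tmp 1) 0).reg (tmp 0)) ((s.setReg (tmp 1) 0).reg (tmp 1))
        = (N : ℤ) := by simp [Op.eval, tmp, ← hN, ← hv]
    have hs2 := hs1.setHidden (r := lim d) (by simp [lim]; omega) hNB
    have hs3 := hs2.setHidden (r := ctr d) (z := 0) (by simp [ctr]; omega) (by simp)
    set s3 := ((s.setReg (tmp 1) 0).setReg (lim d) N).setReg (ctr d) 0 with hs3d
    have r3 : s3.reg (ctr d) = (0 : ℕ) ∧ s3.reg (lim d) = N := by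
      rw [hs3d]; simp [ctr, lim]
    have e3 : Op.lt.eval (s3.reg (ctr d)) (s3.reg (lim d)) = (if 0 < N then 1 else 0) := by
      rw [r3.1, r3.2]; simp [Op.eval]
    have hb3 : |(if 0 < N then (1 : ℤ) else 0)| ≤ β.B := by
      split_ifs <;> simp; omega
    have hs4 := hs3.setHidden (r := tmp 0) (by simp [tmp]) hb3
    have hl4 : SameLoops d ρ (s3.setReg (tmp 0) (if 0 < N then (1 : ℤ) else 0)) := by
      refine (((hl.setReg (fun k _ => ?_) _).setReg (fun k _ => ?_) _).setReg
        (fun k _ => ?_) _).setReg (fun k _ => ?_) _ <;> simp only [tmp, ctr, lim] <;> omega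
    have h5 : wp β.B (.loop (tmp 0) (forBody d j c)) F
        (s3.setReg (tmp 0) (if 0 < N then (1 : ℤ) else 0)) ≤
        A + Φ 0 σ + (N * loopCost + 1 : ℕ) := by
      refine key N 0 (by omega) σ h0 _ hs4 hl4 ?_ ?_ ?_
      · rw [State.setReg_reg, if_neg (by simp only [tmp, ctr]; omega)]; exact r3.1
      · rw [State.setReg_reg, if_neg (by simp only [tmp, lim]; omega)]; exact r3.2
      · simp
    refine (wp_seq_le_of hs.bdd (wp_const_le_of hs.bdd (by simp)
      (wp_seq_le_of hs1.bdd (wp_op_le_of hs1.bdd e1 hNB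
        (wp_seq_le_of hs2.bdd (wp_const_le_of hs2.bdd (by simp)
          (wp_seq_le_of hs3.bdd (wp_op_le_of hs3.bdd e3 hb3 h5)))))))).trans (le_of_eq ?_)
    push_cast; ring
  · push_cast; ring

/-- The potential is the sum of the time bounds of the repetitions that are left. -/
theorem ok_for {j : ℕ} {N : ℕ} {Inv : ℕ → Store → Prop} {w : ℕ → ℕ}
    (he : e.Plain) (hd : e.deg ≤ β.e) (hN : e.eval σ = N) (hNX : N ≤ β.X) (h0 : Inv 0 σ)
    (hbody : ∀ i < N, ∀ σ, Inv i σ → Ok β (d + 1) c (σ.setVar j i) (w i) (Inv (i + 1))) :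
    Ok β d (forC d j e c) σ (e.size + 10 + ∑ i ∈ Finset.range N, (w i + loopCost)) (Inv N) := by
  intro ρ F T hF
  refine (bnd_for (Inv := Inv) (A := T) (Φ := fun i _ => ((∑ k ∈ Finset.Ico i N, w k : ℕ) : ℝ≥0∞))
    he hd hN hNX h0 (fun i hi σ hσ ρ F A hF => ?_) fun σ' hσ' => by simpa using hF σ' hσ').mono
    (le_of_eq ?_)
  · refine (hbody i hi σ hσ ρ F _ hF).mono (le_of_eq ?_)
    rw [Finset.sum_eq_sum_Ico_succ_bot hi]
    push_cast; ring
  · rw [Finset.sum_add_distrib, Finset.sum_const, Finset.card_range, ← Finset.range_eq_Ico]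
    push_cast; simp only [smul_eq_mul]; push_cast; ring

end ISGLowerBound

namespace ISGLowerBound

/-! ## Simulation of a machine

Reported pairs are appended to a buffer, which consists of two arrays of the program. -/

/-- The variable that holds `1`. -/
abbrev vOne : ℕ := 1
/-- The variable that holds the length of the buffer. -/
abbrev vCnt : ℕ := 2
/-- The array of the first components of the reported pairs. -/
abbrev aFst : ℕ := 1
/-- The array of the second components of the reported pairs. -/
abbrev aSnd : ℕ := 2

/-- The simulating program. -/
def simC : Cmd → Cmd
  | .const r z => .const (4 * r + 2) z
  | .op r o x y => .op (4 * r + 2) o (4 * x + 2) (4 * y + 2)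
  | .load r a i => .load (4 * r + 2) (2 * a + 1) (4 * i + 2)
  | .store a i x => .store (2 * a + 1) (4 * i + 2) (4 * x + 2)
  | .rand r x => .rand (4 * r + 2) (4 * x + 2)
  | .emit x y => .seq (.store (2 * aFst) (4 * vCnt) (4 * x + 2)) <|
      .seq (.store (2 * aSnd) (4 * vCnt) (4 * y + 2)) <|
      .op (4 * vCnt) .add (4 * vCnt) (4 * vOne)
  | .seq c d => .seq (simC c) (simC d)
  | .ite x c d => .ite (4 * x + 2) (simC c) (simC d)
  | .loop x c => .loop (4 * x + 2) (simC c)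

/-- The buffer holds the pairs reported by the simulated machine. -/
structure BufOK (σ : Store) : Prop where
  one : σ.var vOne = 1
  cnt : σ.var vCnt = σ.ds.out.length
  fst : ∀ i (h : i < σ.ds.out.length), σ.arr aFst i = σ.ds.out[i].1
  snd : ∀ i (h : i < σ.ds.out.length), σ.arr aSnd i = σ.ds.out[i].2

/-- Only the simulated machine and the buffer have changed. -/
structure SimFrame (σ σ' : Store) : Prop where
  var : ∀ j, j ≠ vCnt → σ'.var j = σ.var j
  arr : ∀ a, a ≠ aFst → a ≠ aSnd → σ'.arr a = σ.arr a

/-- The random element drawn by the machine. -/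
noncomputable def randDist (z : ℤ) : PMF ℕ :=
  (PMF.uniformOfFintype (Fin (z.toNat - 1 + 1))).bind fun a => PMF.pure (a : ℕ)

theorem step_rand (r x : ℕ) (k : List Cmd) (s : State) :
    step (.rand r x :: k, s) = (randDist (s.reg x)).map fun j : ℕ => (k, s.setReg r (j : ℤ)) := rfl

theorem costUpTo_pure_le {B : ℕ} {f : State → ℝ≥0∞} {c : Cmd} {k : List Cmd} {s : State}
    {z : Config} (hs : s.Bounded B) (h : step (c :: k, s) = PMF.pure z) (t : ℕ) :
    costUpTo B f t (c :: k, s) ≤ 1 + costUpTo B f (t - 1) z := by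
  cases t with
  | zero => simp [costUpTo]
  | succ t => simp [costUpTo, hs, h, ex_pure]

theorem expectedTime_pure {c : Cmd} {k : List Cmd} {s : State} {z : Config}
    (h : step (c :: k, s) = PMF.pure z) : expectedTime (c :: k, s) = 1 + expectedTime z := by
  rw [expectedTime_cons, h, ex_pure]

theorem abs_le_of_bounded_setReg {s : State} {B r : ℕ} {z : ℤ} (h : (s.setReg r z).Bounded B) :
    |z| ≤ B := by simpa using h.1 r

variable {β : Bds} {d : ℕ} {ρ : ℕ → ℤ} {F : State → ℝ≥0∞} {A : ℝ≥0∞}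

/-- The output list of the simulated machine is a ghost: it occupies no memory, so it can be
replaced without touching the representing state. -/
theorem Rep.setDs {s : State} {σ : Store} (h : Rep β s σ) {s' : State} (h1 : s'.reg = σ.ds.reg)
    (h2 : s'.arr = σ.ds.arr) : Rep β s (σ.setDs s') where
  var := h.var
  arr := h.arr
  dreg r := by rw [h.dreg, Store.setDs_ds, h1]
  darr r := by rw [h.darr, Store.setDs_ds, h2]
  bdd := h.bdd
  small := h.small

/-- A report is replaced by five steps that write into the buffer, any other command step by one
step; hence the factor five. The commands `kr` are those that the simulated machine will execute
later, after the program has done work of its own. Keeping their expected time inside the potential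
lets the time be charged to the whole computation of the data structure instead of to single
procedures, for which nothing is known. -/
theorem bnd_sim {c : Cmd} {kr : List Cmd} {σ : Store} {B L : ℕ} (hB : B ≤ β.X) (hL : L ≤ β.X)
    (hbuf : BufOK σ)
    (hreach : ∀ z, Reachable ([c], σ.ds) z → z.2.Bounded B ∧ z.2.out.length ≤ L)
    (hF : ∀ σ', Reachable ([c], σ.ds) ([], σ'.ds) → BufOK σ' → SimFrame σ σ' →
      Bnd β d ρ F σ' (A + 5 * expectedTime (kr, σ'.ds))) :
    Bnd β d ρ (wp β.B (simC c) F) σ (A + 5 * expectedTime (c :: kr, σ.ds)) := by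
  have hXB := β.X_le_B
  have key : ∀ (t : ℕ) (k : List Cmd) (τ : Store) (s : State), BufOK τ → SimFrame σ τ →
      Reachable ([c], σ.ds) (k, τ.ds) → Rep β s τ → SameLoops d ρ s →
      costUpTo β.B F t (k.map simC, s) ≤ A + 5 * expectedTime (k ++ kr, τ.ds) := by
    intro t
    -- Strong induction, because one reporting step of the simulated machine uses up five steps of
    -- the simulation.
    induction t using Nat.strong_induction_on with
    | _ t IH =>
    intro k τ s hb hf hr hs hl
    rcases Nat.eq_zero_or_pos t with rfl | ht
    · simp [costUpTo]
    rcases k with _ | ⟨c', k⟩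
    · refine le_trans ?_ (hF τ hr hb hf s hs hl)
      obtain ⟨t, rfl⟩ : ∃ u, t = u + 1 := ⟨t - 1, by omega⟩
      simp [costUpTo, hs.bdd]
    -- one step of the machine, one step of the simulation
    have one : ∀ (k' : List Cmd) (τ' : Store) (s' : State) ,
        step (c' :: k, τ.ds) = PMF.pure (k', τ'.ds) →
        step (simC c' :: k.map simC, s) = PMF.pure (k'.map simC, s') →
        (τ'.ds.Bounded B → Rep β s' τ') → BufOK τ' → SimFrame τ τ' → SameLoops d ρ s' →
        costUpTo β.B F t ((c' :: k).map simC, s) ≤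
          A + 5 * expectedTime ((c' :: k) ++ kr, τ.ds) := by
      intro k' τ' s' h1 h2 hs' hb' hf' hl'
      have hr' : Reachable ([c], σ.ds) (k', τ'.ds) := hr.trans (.step (by rw [h1]; simp))
      have h1' : step (c' :: (k ++ kr), τ.ds) = PMF.pure (k' ++ kr, τ'.ds) := by
        rw [step_append, h1, PMF.pure_map]
      rw [List.cons_append, expectedTime_pure h1']
      refine (costUpTo_pure_le hs.bdd h2 t).trans ((add_le_add_right (IH (t - 1) (by omega) k' τ' s'
        hb' ⟨fun j hj => (hf'.var j hj).trans (hf.var j hj), fun a ha ha' =>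
          (hf'.arr a ha ha').trans (hf.arr a ha ha')⟩ hr' (hs' (hreach _ hr').1) hl') _).trans ?_)
      rw [mul_add, mul_one, ← add_assoc, ← add_assoc, add_comm A 5]
      gcongr
      norm_num
    have setRegCase : ∀ r z, step (c' :: k, τ.ds) = PMF.pure (k, τ.ds.setReg r z) →
        step (simC c' :: k.map simC, s) = PMF.pure (k.map simC, s.setReg (4 * r + 2) z) →
        costUpTo β.B F t ((c' :: k).map simC, s) ≤
          A + 5 * expectedTime ((c' :: k) ++ kr, τ.ds) := fun r z h1 h2 =>
      one k (τ.setDs (τ.ds.setReg r z)) _ h1 h2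
        (fun h => hs.setD r ((abs_le_of_bounded_setReg h).trans (by exact_mod_cast hB.trans hXB)))
        ⟨hb.one, hb.cnt, hb.fst, hb.snd⟩ ⟨fun _ _ => rfl, fun _ _ _ => rfl⟩
        (hl.setReg (fun k _ => by simp only [ctr, lim]; omega) _)
    cases c' with
    | const r z => exact setRegCase r z rfl rfl
    | op r o x y =>
      refine setRegCase r _ rfl ?_
      rw [← hs.dreg, ← hs.dreg]; rfl
    | load r a i =>
      refine setRegCase r _ rfl ?_
      rw [← hs.dreg, ← hs.darr]; rfl
    | store a i x =>
      refine one k (τ.setDs (τ.ds.setArr a (τ.ds.reg i) (τ.ds.reg x)))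
        (s.setArr (2 * a + 1) (τ.ds.reg i) (τ.ds.reg x)) rfl ?_ (fun _ => hs.setDArr a _ ?_)
        ⟨hb.one, hb.cnt, hb.fst, hb.snd⟩ ⟨fun _ _ => rfl, fun _ _ _ => rfl⟩ (hl.setArr _ _ _)
      · rw [← hs.dreg, ← hs.dreg]; rfl
      · rw [← hs.dreg]; exact hs.bdd.1 _
    | seq c₁ c₂ =>
      exact one (c₁ :: c₂ :: k) τ s rfl rfl (fun _ => hs) hb ⟨fun _ _ => rfl, fun _ _ _ => rfl⟩ hl
    | ite x c₁ c₂ =>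
      refine one (if τ.ds.reg x ≠ 0 then c₁ :: k else c₂ :: k) τ s ?_ ?_ (fun _ => hs) hb
        ⟨fun _ _ => rfl, fun _ _ _ => rfl⟩ hl
      · rfl
      · simp only [simC, step, hs.dreg]; split_ifs <;> rfl
    | loop x c₁ =>
      refine one (if τ.ds.reg x ≠ 0 then c₁ :: .loop x c₁ :: k else k) τ s ?_ ?_ (fun _ => hs) hb
        ⟨fun _ _ => rfl, fun _ _ _ => rfl⟩ hl
      · rfl
      · simp only [simC, step, hs.dreg]; split_ifs <;> rfl
    | emit x y =>
      have hstep : step (.emit x y :: k, τ.ds) =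
        PMF.pure (k, τ.ds.report (τ.ds.reg x, τ.ds.reg y)) := rfl
      have hstep' : step (.emit x y :: (k ++ kr), τ.ds) =
        PMF.pure (k ++ kr, τ.ds.report (τ.ds.reg x, τ.ds.reg y)) := rfl
      have hr' : Reachable ([c], σ.ds) (k, τ.ds.report (τ.ds.reg x, τ.ds.reg y)) :=
        hr.trans (.step (by rw [hstep]; simp))
      have hlen : τ.ds.out.length + 1 ≤ L := by simpa [State.report] using (hreach _ hr').2
      have hD := (hreach _ hr').1.1
      have hXx : |τ.ds.reg x| ≤ β.X := (hD x).trans (by exact_mod_cast hB)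
      have hXy : |τ.ds.reg y| ≤ β.X := (hD y).trans (by exact_mod_cast hB)
      have hs1 := hs.setArr aFst (τ.var vCnt) hXx
      have hs2 := hs1.setArr aSnd (τ.var vCnt) hXy
      -- Here the bound `L` on the number of reported pairs is used: it keeps the length of the
      -- buffer within the bound on variables.
      have hs3 := hs2.setVar vCnt (z := τ.var vCnt + 1) (by
        rw [hb.cnt, abs_of_nonneg (by positivity)]; exact_mod_cast hlen.trans hL)
      have hs4 := hs3.setDs (s' := τ.ds.report (τ.ds.reg x, τ.ds.reg y)) rfl rfl
      have st1 : ∀ K, step (simC (.emit x y) :: K, s) =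
          PMF.pure (.store (2 * aFst) (4 * vCnt) (4 * x + 2) ::
            .seq (.store (2 * aSnd) (4 * vCnt) (4 * y + 2))
            (.op (4 * vCnt) .add (4 * vCnt) (4 * vOne)) :: K, s) := fun K => rfl
      have st2 : ∀ K, step (.store (2 * aFst) (4 * vCnt) (4 * x + 2) :: K, s) =
          PMF.pure (K, s.setArr (2 * aFst) (τ.var vCnt) (τ.ds.reg x)) := fun K => by
        rw [← hs.var, ← hs.dreg]; rfl
      have st3 : ∀ K c₁ c₂ s, step (.seq c₁ c₂ :: K, s) = PMF.pure (c₁ :: c₂ :: K, s) :=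
        fun _ _ _ _ => rfl
      have st4 : ∀ K, step (.store (2 * aSnd) (4 * vCnt) (4 * y + 2) :: K,
          s.setArr (2 * aFst) (τ.var vCnt) (τ.ds.reg x)) = PMF.pure (K,
          (s.setArr (2 * aFst) (τ.var vCnt) (τ.ds.reg x)).setArr (2 * aSnd) (τ.var vCnt)
            (τ.ds.reg y)) := fun K => by
        rw [← hs.var vCnt, ← hs.dreg, ← hs.dreg]; rfl
      have st5 : ∀ K, step (.op (4 * vCnt) .add (4 * vCnt) (4 * vOne) :: K,
          (s.setArr (2 * aFst) (τ.var vCnt) (τ.ds.reg x)).setArr (2 * aSnd) (τ.var vCnt)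
            (τ.ds.reg y)) = PMF.pure (K,
          ((s.setArr (2 * aFst) (τ.var vCnt) (τ.ds.reg x)).setArr (2 * aSnd) (τ.var vCnt)
            (τ.ds.reg y)).setReg (4 * vCnt) (τ.var vCnt + 1)) := fun K => by
        rw [← hs.var vCnt, ← hs.dreg, ← hs.dreg, ← hb.one, ← hs.var vOne]; rfl
      rw [List.cons_append, expectedTime_pure hstep', List.map_cons]
      refine (costUpTo_pure_le hs.bdd (st1 _) t).trans ((add_le_add_right
        ((costUpTo_pure_le hs.bdd (st2 _) _).trans (add_le_add_right
        ((costUpTo_pure_le hs1.bdd (st3 _ _ _ _) _).trans (add_le_add_right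
        ((costUpTo_pure_le hs1.bdd (st4 _) _).trans (add_le_add_right
        ((costUpTo_pure_le hs2.bdd (st5 _) _).trans (add_le_add_right
        (IH _ (by omega) k _ _ ?_ ?_ hr' hs4 ?_) _)) _)) _)) _)) _).trans (le_of_eq ?_))
      · refine ⟨hb.one, ?_, fun i hi => ?_, fun i hi => ?_⟩
        · simp [State.report, hb.cnt]
        · simp only [State.report, Store.setDs_ds, List.length_append, List.length_cons,
            List.length_nil, zero_add] at hi
          simp only [Store.setDs_arr, Store.setVar_arr, Store.setArr_arr, Store.setDs_ds,
            State.report, List.getElem_append, hb.cnt, if_true]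
          rcases Nat.lt_succ_iff_lt_or_eq.1 hi with hi | rfl
          · simp [hi, hi.ne, hb.fst i hi]
          · simp
        · simp only [State.report, Store.setDs_ds, List.length_append, List.length_cons,
            List.length_nil, zero_add] at hi
          simp only [Store.setDs_arr, Store.setVar_arr, Store.setArr_arr, Store.setDs_ds,
            State.report, List.getElem_append, hb.cnt, Function.update_apply, if_true]
          rcases Nat.lt_succ_iff_lt_or_eq.1 hi with hi | rfl
          · simp [hi, hi.ne, hb.snd i hi]
          · simp
      · refine ⟨fun j hj => ?_, fun a ha ha' => ?_⟩
        · simp [hj, hf.var j hj]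
        · simp [ha, ha', hf.arr a ha ha']
      · exact ((hl.setArr _ _ _).setArr _ _ _).setReg (fun k _ => by simp only [ctr, lim]; omega) _
      · rw [Store.setDs_ds]; ring
    | rand r x =>
      have e1 : s.reg (4 * x + 2) = τ.ds.reg x := hs.dreg x
      have h1 : step (.rand r x :: (k ++ kr), τ.ds) = (randDist (τ.ds.reg x)).map
        fun j : ℕ => (k ++ kr, τ.ds.setReg r (j : ℤ)) := rfl
      have h2 : step (simC (.rand r x) :: k.map simC, s) = (randDist (τ.ds.reg x)).map
          fun j : ℕ => (k.map simC, s.setReg (4 * r + 2) (j : ℤ)) := by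
        rw [← e1]; rfl
      obtain ⟨t, rfl⟩ : ∃ u, t = u + 1 := ⟨t - 1, by omega⟩
      simp only [List.map_cons, costUpTo, hs.bdd, if_true, List.cons_append]
      rw [expectedTime_cons, h1, h2, ex_map, ex_map, mul_add, mul_one, ← ex_mul_left]
      have : ex (randDist (τ.ds.reg x)) (fun j : ℕ => costUpTo β.B F t
          (k.map simC, s.setReg (4 * r + 2) (j : ℤ))) ≤
          A + ex (randDist (τ.ds.reg x)) (fun j : ℕ =>
            5 * expectedTime (k ++ kr, τ.ds.setReg r (j : ℤ))) := by
        -- The same random element drives both machines; `A` is written as its own expectation so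
        -- that the two sides are compared outcome by outcome.
        rw [← ex_const (randDist (τ.ds.reg x)) A, ← ex_add]
        refine ex_mono fun j hj => ?_
        have hr' : Reachable ([c], σ.ds) (k, τ.ds.setReg r (j : ℤ)) := hr.trans (.step (by
          rw [step_rand, PMF.mem_support_map_iff]; exact ⟨j, hj, rfl⟩))
        have hz := (abs_le_of_bounded_setReg (hreach _ hr').1).trans
          (show (B : ℤ) ≤ β.B by exact_mod_cast hB.trans hXB)
        exact IH t (by omega) k (τ.setDs (τ.ds.setReg r (j : ℤ))) (s.setReg (4 * r + 2) (j : ℤ))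
          ⟨hb.one, hb.cnt, hb.fst, hb.snd⟩ ⟨hf.var, hf.arr⟩ hr'
          (hs.setD r hz) (hl.setReg (fun k _ => by simp only [ctr, lim]; omega) _)
      refine (add_le_add_right this 1).trans ?_
      rw [← add_assoc, ← add_assoc, add_comm A 5]
      gcongr
      norm_num
  intro s hs hl
  exact iSup_le fun t => key t [c] σ s hbuf ⟨fun _ _ => rfl, fun _ _ _ => rfl⟩
    (Reachable.refl _) hs hl

end ISGLowerBound

namespace ISGLowerBound

/-! ## Divisors in an interval -/

/-- The number of divisors is the product of e + 1 over the prime powers p^e in n. For p ≥ 2^(1/η)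
one has e + 1 ≤ 2^e ≤ p^(eη). For each smaller prime the inequality holds up to a constant factor K,
and there are boundedly many of these primes. -/
theorem exists_card_divisors_le {η : ℝ} (hη : 0 < η) :
    ∃ C : ℝ, 1 ≤ C ∧ ∀ n : ℕ, n ≠ 0 → (n.divisors.card : ℝ) ≤ C * (n : ℝ) ^ η := by
  have hl2 : 0 < Real.log 2 := Real.log_pos (by norm_num)
  -- Chosen such that e + 1 ≤ K (1 + η e log 2), where the bracket is at most 2^(η e).
  set K : ℝ := 1 / (η * Real.log 2) + 1 with hK
  have hK1 : 1 ≤ K := by rw [hK]; have : 0 < 1 / (η * Real.log 2) := by positivity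
                         linarith
  obtain ⟨T, hT⟩ := exists_nat_ge ((2 : ℝ) ^ (1 / η))
  have small : ∀ (p e : ℕ), 2 ≤ p → (e : ℝ) + 1 ≤ K * ((p : ℝ) ^ e) ^ η := by
    intro p e hp
    have h1 : (2 : ℝ) ^ (η * e) ≤ ((p : ℝ) ^ e) ^ η := by
      rw [← Real.rpow_natCast (p : ℝ), ← Real.rpow_mul (by positivity), mul_comm]
      exact Real.rpow_le_rpow (by norm_num) (by exact_mod_cast hp) (by positivity)
    have h2 : 1 + η * e * Real.log 2 ≤ (2 : ℝ) ^ (η * e) := by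
      rw [Real.rpow_def_of_pos (by norm_num)]
      have := Real.add_one_le_exp (Real.log 2 * (η * e))
      linarith
    have h3 : (e : ℝ) + 1 ≤ K * (1 + η * e * Real.log 2) := by
      have : K * (1 + η * e * Real.log 2) = 1 / (η * Real.log 2) + 1 + e + η * e * Real.log 2 := by
        rw [hK]; field_simp; ring
      rw [this]
      have : 0 ≤ 1 / (η * Real.log 2) := by positivity
      have : 0 ≤ η * e * Real.log 2 := by positivity
      linarith
    exact h3.trans (by gcongr; exact h2.trans h1)
  have large : ∀ (p e : ℕ), T ≤ p → (e : ℝ) + 1 ≤ ((p : ℝ) ^ e) ^ η := by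
    intro p e hp
    have h1 : (2 : ℝ) ≤ (p : ℝ) ^ η := by
      have h : (2 : ℝ) ^ (1 / η) ≤ p := hT.trans (by exact_mod_cast hp)
      calc (2 : ℝ) = ((2 : ℝ) ^ (1 / η)) ^ η := by
            rw [← Real.rpow_mul (by norm_num), one_div_mul_cancel hη.ne', Real.rpow_one]
        _ ≤ _ := Real.rpow_le_rpow (by positivity) h hη.le
    have h2 : ((p : ℝ) ^ e) ^ η = ((p : ℝ) ^ η) ^ e := by
      rw [← Real.rpow_natCast, ← Real.rpow_natCast, ← Real.rpow_mul (by positivity),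
        ← Real.rpow_mul (by positivity), mul_comm]
    rw [h2]
    calc (e : ℝ) + 1 ≤ 2 ^ e := by exact_mod_cast Nat.lt_two_pow_self
      _ ≤ _ := by gcongr
  -- One factor `K` for each possible prime below `T`.
  refine ⟨K ^ T, one_le_pow₀ hK1, fun n hn => ?_⟩
  have hn' : (n : ℝ) ^ η = ∏ p ∈ n.primeFactors, (((p : ℝ) ^ n.factorization p) ^ η) := by
    rw [Real.finsetProd_rpow _ _ (fun _ _ => by positivity)]
    congr 1
    conv_lhs => rw [← Nat.prod_factorization_pow_eq_self hn]
    rw [Finsupp.prod, Nat.cast_prod]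
    simp
  rw [Nat.card_divisors hn, hn', Nat.cast_prod]
  have hprod : ∏ p ∈ n.primeFactors, (if p < T then K else 1) ≤ K ^ T := by
    rw [Finset.prod_ite, Finset.prod_const, Finset.prod_const_one, mul_one]
    refine pow_le_pow_right₀ hK1 ?_
    calc _ ≤ (Finset.range T).card := Finset.card_le_card fun p hp => by
          simp only [Finset.mem_filter] at hp; simp [hp.2]
      _ = T := Finset.card_range T
  calc _ ≤ ∏ p ∈ n.primeFactors, ((if p < T then K else 1) *
        ((p : ℝ) ^ n.factorization p) ^ η) := by
        refine Finset.prod_le_prod (fun _ _ => by positivity) fun p hp => ?_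
        have hp2 := (Nat.prime_of_mem_primeFactors hp).two_le
        push_cast
        split_ifs with h
        · exact small p _ hp2
        · rw [one_mul]; exact large p _ (not_lt.1 h)
    _ ≤ _ := by
        rw [Finset.prod_mul_distrib]
        gcongr

/-- Number of the moduli `R, …, 2 R - 1` that divide `v`. -/
def modCount (R : ℕ) (v : ℤ) : ℕ := ((Finset.range R).filter fun j => ((R + j : ℕ) : ℤ) ∣ v).card

theorem modCount_le (R : ℕ) {v : ℤ} (hv : v ≠ 0) : modCount R v ≤ v.natAbs.divisors.card := by
  refine Finset.card_le_card_of_injOn (fun j => R + j) (fun j hj => ?_) (fun i _ j _ h => by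
    simpa using h)
  simp only [Finset.coe_filter, Finset.mem_range, Set.mem_ofPred_eq] at hj
  simp only [Finset.mem_coe, Nat.mem_divisors]
  exact ⟨Int.natCast_dvd.1 hj.2, by simpa using hv⟩

/-- Triples that do not sum to zero, but do so modulo the three moduli. -/
def falseTriples (S : Finset ℤ) (q₁ q₂ q₃ : ℕ) : Finset (ℤ × ℤ × ℤ) :=
  (S ×ˢ S ×ˢ S).filter fun t => t.1 + t.2.1 + t.2.2 ≠ 0 ∧ (q₁ : ℤ) ∣ t.1 + t.2.1 + t.2.2 ∧
    (q₂ : ℤ) ∣ t.1 + t.2.1 + t.2.2 ∧ (q₃ : ℤ) ∣ t.1 + t.2.1 + t.2.2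

/-- Numbers that are congruent to at least `τ` numbers. -/
def heavy (S : Finset ℤ) (τ q : ℕ) : Finset ℤ :=
  S.filter fun z => τ ≤ (S.filter fun w => (q : ℤ) ∣ w - z).card

/-- Double counting: for a fixed triple with nonzero sum v the three moduli are independent, so the
number of bad choices is the cube of the number of moduli that divide v. -/
theorem sum_falseTriples_le {S : Finset ℤ} {R D : ℕ}
    (hD : ∀ x ∈ S, ∀ y ∈ S, ∀ z ∈ S, x + y + z ≠ 0 → modCount R (x + y + z) ≤ D) :
    ∑ i ∈ Finset.range R, ∑ j ∈ Finset.range R, ∑ k ∈ Finset.range R,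
      (falseTriples S (R + i) (R + j) (R + k)).card ≤ S.card ^ 3 * D ^ 3 := by
  have h : ∀ i j k, (falseTriples S (R + i) (R + j) (R + k)).card =
      ∑ t ∈ (S ×ˢ S ×ˢ S).filter (fun t => t.1 + t.2.1 + t.2.2 ≠ 0),
        (if ((R + i : ℕ) : ℤ) ∣ t.1 + t.2.1 + t.2.2 then 1 else 0) *
        ((if ((R + j : ℕ) : ℤ) ∣ t.1 + t.2.1 + t.2.2 then 1 else 0) *
        (if ((R + k : ℕ) : ℤ) ∣ t.1 + t.2.1 + t.2.2 then 1 else 0)) := by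
    intro i j k
    rw [falseTriples, ← Finset.filter_filter, Finset.card_filter]
    refine Finset.sum_congr rfl fun t _ => ?_
    by_cases h1 : ((R + i : ℕ) : ℤ) ∣ t.1 + t.2.1 + t.2.2 <;>
    by_cases h2 : ((R + j : ℕ) : ℤ) ∣ t.1 + t.2.1 + t.2.2 <;>
    by_cases h3 : ((R + k : ℕ) : ℤ) ∣ t.1 + t.2.1 + t.2.2 <;> simp only [h1, h2, h3] <;> simp
  simp only [h]
  have h2 : ∀ i, ∑ j ∈ Finset.range R, ∑ k ∈ Finset.range R,
      ∑ t ∈ (S ×ˢ S ×ˢ S).filter (fun t => t.1 + t.2.1 + t.2.2 ≠ 0),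
        (if ((R + i : ℕ) : ℤ) ∣ t.1 + t.2.1 + t.2.2 then 1 else 0) *
        ((if ((R + j : ℕ) : ℤ) ∣ t.1 + t.2.1 + t.2.2 then 1 else 0) *
        (if ((R + k : ℕ) : ℤ) ∣ t.1 + t.2.1 + t.2.2 then 1 else 0)) =
      ∑ t ∈ (S ×ˢ S ×ˢ S).filter (fun t => t.1 + t.2.1 + t.2.2 ≠ 0),
        (if ((R + i : ℕ) : ℤ) ∣ t.1 + t.2.1 + t.2.2 then 1 else 0) *
        (modCount R (t.1 + t.2.1 + t.2.2) * modCount R (t.1 + t.2.1 + t.2.2)) := by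
    intro i
    simp only [Finset.sum_comm (s := Finset.range R) (t := Finset.filter _ _)]
    refine Finset.sum_congr rfl fun t _ => ?_
    simp only [← Finset.mul_sum, ← Finset.sum_mul, modCount, Finset.card_filter]
  simp only [h2]
  rw [Finset.sum_comm]
  simp only [← Finset.sum_mul]
  calc _ ≤ ∑ t ∈ (S ×ˢ S ×ˢ S).filter (fun t => t.1 + t.2.1 + t.2.2 ≠ 0), D ^ 3 := by
        refine Finset.sum_le_sum fun t ht => ?_
        simp only [Finset.mem_filter, Finset.mem_product] at ht
        have := hD _ ht.1.1 _ ht.1.2.1 _ ht.1.2.2 ht.2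
        rw [show D ^ 3 = D * (D * D) by ring, ← Finset.card_filter]
        exact Nat.mul_le_mul this (Nat.mul_le_mul this this)
    _ ≤ _ := by
        rw [Finset.sum_const, smul_eq_mul]
        refine Nat.mul_le_mul_right _ ((Finset.card_filter_le _ _).trans (le_of_eq ?_))
        rw [Finset.card_product, Finset.card_product]; ring

/-- Markov's inequality: every heavy number belongs to at least τ congruent pairs, and the congruent
pairs are counted over all moduli. -/
theorem sum_heavy_le {S : Finset ℤ} {R D τ : ℕ}
    (hD : ∀ z ∈ S, ∀ w ∈ S, w - z ≠ 0 → modCount R (w - z) ≤ D) :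
    τ * ∑ j ∈ Finset.range R, (heavy S τ (R + j)).card ≤ S.card * R + S.card ^ 2 * D := by
  have h1 : ∀ j, τ * (heavy S τ (R + j)).card ≤
      ∑ z ∈ S, ∑ w ∈ S, if ((R + j : ℕ) : ℤ) ∣ w - z then 1 else 0 := by
    intro j
    calc τ * (heavy S τ (R + j)).card = ∑ z ∈ heavy S τ (R + j), τ := by
          rw [Finset.sum_const, smul_eq_mul, mul_comm]
      _ ≤ ∑ z ∈ heavy S τ (R + j), (S.filter fun w => ((R + j : ℕ) : ℤ) ∣ w - z).card :=
          Finset.sum_le_sum fun z hz => (Finset.mem_filter.1 hz).2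
      _ ≤ ∑ z ∈ S, (S.filter fun w => ((R + j : ℕ) : ℤ) ∣ w - z).card :=
          Finset.sum_le_sum_of_subset (Finset.filter_subset _ _)
      _ = _ := by simp only [Finset.card_filter]
  rw [Finset.mul_sum]
  refine (Finset.sum_le_sum fun j _ => h1 j).trans ?_
  rw [Finset.sum_comm]
  have h2 : ∀ z ∈ S, ∑ j ∈ Finset.range R, ∑ w ∈ S,
      (if ((R + j : ℕ) : ℤ) ∣ w - z then 1 else 0) ≤ R + S.card * D := by
    intro z hz
    -- The pair of `z` with itself is congruent for all `R` moduli; every other pair is congruent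
    -- for at most `D` of them.
    rw [Finset.sum_comm, ← Finset.add_sum_erase _ _ hz]
    refine Nat.add_le_add ?_ ?_
    · simp
    · refine (Finset.sum_le_card_nsmul _ _ D fun w hw => ?_).trans ?_
      · rw [← Finset.card_filter]
        exact hD z hz w (Finset.mem_of_mem_erase hw)
          (sub_ne_zero.2 (Finset.ne_of_mem_erase hw))
      · rw [smul_eq_mul]
        exact Nat.mul_le_mul_right _ (Finset.card_erase_le)
  refine (Finset.sum_le_card_nsmul _ _ _ h2).trans (le_of_eq ?_)
  rw [smul_eq_mul]; ring

end ISGLowerBound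

namespace ISGLowerBound

/-! ## Series of queries as one list of arrivals -/

section arrivals

variable {ι α : Type*} (fl : ι → Bool) (vt : ι → α)

/-- The queries of a list of arrivals, where `fl` marks the beginnings of queries, after the
vertices `cur` of the current query. -/
def groupFrom (cur : List α) : List ι → List (List α)
  | [] => [cur]
  | i :: l => if fl i then cur :: groupFrom [vt i] l else groupFrom (cur ++ [vt i]) l

/-- The queries of a list of arrivals that begins with a mark. -/
def group : List ι → List (List α)
  | [] => []
  | i :: l => groupFrom fl vt [vt i] l

/-- Every arrival with the vertices that have arrived before in the same query. -/
def withPrev (prev : List α) : List ι → List (List α × ι)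
  | [] => []
  | i :: l => (if fl i then [] else prev, i) ::
      withPrev (vt i :: if fl i then [] else prev) l

/-- The vertices that have arrived in the current query. -/
def prevAfter (prev : List α) : List ι → List α
  | [] => prev
  | i :: l => prevAfter (vt i :: if fl i then [] else prev) l

variable {fl vt}

theorem withPrev_append (prev : List α) (l l' : List ι) :
    withPrev fl vt prev (l ++ l') =
      withPrev fl vt prev l ++ withPrev fl vt (prevAfter fl vt prev l) l' := by
  induction l generalizing prev with
  | nil => rfl
  | cons i l ih => simp [withPrev, prevAfter, ih]

theorem map_snd_withPrev (prev : List α) (l : List ι) :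
    (withPrev fl vt prev l).map Prod.snd = l := by
  induction l generalizing prev with
  | nil => rfl
  | cons i l ih => simp [withPrev, ih]

theorem length_withPrev (prev : List α) (l : List ι) :
    (withPrev fl vt prev l).length = l.length := by
  rw [← List.length_map (f := Prod.snd), map_snd_withPrev]

theorem withPrev_take (prev : List α) (l : List ι) (k : ℕ) :
    withPrev fl vt prev (l.take k) = (withPrev fl vt prev l).take k := by
  induction l generalizing prev k with
  | nil => simp [withPrev]
  | cons i l ih => cases k <;> simp [withPrev, ih]

theorem groupFrom_ne_nil {cur : List α} (hc : cur ≠ []) (l : List ι) :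
    ∀ Q ∈ groupFrom fl vt cur l, Q ≠ [] := by
  induction l generalizing cur with
  | nil => simp [groupFrom, hc]
  | cons i l ih =>
    intro Q hQ
    rw [groupFrom] at hQ
    split_ifs at hQ
    · rcases List.mem_cons.1 hQ with rfl | hQ
      exacts [hc, ih (by simp) Q hQ]
    · exact ih (by simp) Q hQ

theorem group_ne_nil (l : List ι) : ∀ Q ∈ group fl vt l, Q ≠ [] := by
  cases l with
  | nil => simp [group]
  | cons i l => exact groupFrom_ne_nil (by simp) l

theorem totalLength_groupFrom (cur : List α) (l : List ι) :
    totalLength (groupFrom fl vt cur l) = cur.length + l.length := by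
  induction l generalizing cur with
  | nil => simp [groupFrom, totalLength]
  | cons i l ih =>
    rw [groupFrom]
    split_ifs
    · have := ih [vt i]
      simp only [totalLength] at this
      simp [totalLength, this]; omega
    · rw [ih]; simp; omega

theorem totalLength_group (l : List ι) : totalLength (group fl vt l) = l.length := by
  cases l with
  | nil => rfl
  | cons i l => rw [group, totalLength_groupFrom]; simp; omega

theorem flatMap_groupFrom {γ : Type*} (a : γ) (g : α → List γ) (cur : List α) (l : List ι) :
    ((groupFrom fl vt cur l).flatMap fun Q => a :: Q.flatMap g) =
      a :: cur.flatMap g ++ l.flatMap fun i => (if fl i then [a] else []) ++ g (vt i) := by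
  induction l generalizing cur with
  | nil => simp [groupFrom]
  | cons i l ih =>
    rw [groupFrom]
    split_ifs with h
    · simp [ih, h]
    · simp [ih, h]

theorem flatMap_group {γ : Type*} (a : γ) (g : α → List γ) (l : List ι)
    (hl : ∀ i ∈ l.head?, fl i = true) :
    ((group fl vt l).flatMap fun Q => a :: Q.flatMap g) =
      l.flatMap fun i => (if fl i then [a] else []) ++ g (vt i) := by
  cases l with
  | nil => rfl
  | cons i l => rw [group, flatMap_groupFrom]; simp [hl i (by simp)]

end arrivals

/-! ### The computation of a data structure on a list of arrivals -/

section run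

variable {ι : Type*} {fl : ι → Bool} {G : DirGraph} {vt : ι → Fin G.n}

theorem DirGraph.edgesFrom_append (G : DirGraph) (prev Q : List (Fin G.n)) (v : Fin G.n) :
    G.edgesFrom prev (Q ++ [v]) = G.edgesFrom prev Q ++ G.edgesAt (Q.reverse ++ prev) v := by
  induction Q generalizing prev with
  | nil => simp [edgesFrom]
  | cons u Q ih => simp [edgesFrom, ih]

/-- The edges to be reported for a list of arrivals. -/
def flatAnswer (fl : ι → Bool) (vt : ι → Fin G.n) (l : List ι) : List (ℤ × ℤ) :=
  (withPrev fl vt [] l).flatMap fun a => G.edgesAt a.1 (vt a.2)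

theorem answer_groupFrom (cur : List (Fin G.n)) (l : List ι) :
    G.answer (groupFrom fl vt cur l) = G.edgesFrom [] cur ++
      (withPrev fl vt cur.reverse l).flatMap fun a => G.edgesAt a.1 (vt a.2) := by
  induction l generalizing cur with
  | nil => simp [groupFrom, DirGraph.answer, withPrev]
  | cons i l ih =>
    rw [groupFrom]
    split_ifs with h
    · have := ih [vt i]
      simp only [DirGraph.answer] at this ⊢
      simp [this, withPrev, h, DirGraph.edgesFrom]
    · rw [ih, DirGraph.edgesFrom_append]
      simp [withPrev, h]

theorem answer_group (l : List ι) (hl : ∀ i ∈ l.head?, fl i = true) :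
    G.answer (group fl vt l) = flatAnswer fl vt l := by
  cases l with
  | nil => rfl
  | cons i l =>
    rw [group, answer_groupFrom]
    simp [flatAnswer, withPrev, hl i (by simp), DirGraph.edgesFrom]

/-- The commands for one arrival. -/
def ISGStructure.arrivalCmds (D : ISGStructure) (fl : ι → Bool) (vt : ι → Fin G.n) (i : ι) :
    List Cmd :=
  (if fl i then [D.start] else []) ++ [Cmd.const 2 ((vt i : ℕ) : ℤ), D.arrive]

theorem interaction_group (D : ISGStructure) (l : List ι) (hl : ∀ i ∈ l.head?, fl i = true) :
    D.interaction G (group fl vt l) =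
      (D.preprocess :: l.flatMap (D.arrivalCmds fl vt), G.input) := by
  unfold ISGStructure.interaction ISGStructure.arrivalCmds
  -- In the elaborated interaction the vertices of a query are first coerced to a list of natural
  -- numbers through the list monad; this identity removes that detour.
  have key : ∀ Q : List (Fin G.n), List.flatMap (fun v : ℕ => [Cmd.const 2 (v : ℤ), D.arrive])
      (Q >>= fun a => pure (a : ℕ)) = Q.flatMap fun v : Fin G.n => [Cmd.const 2 ((v : ℕ) : ℤ), D.arrive] :=
    fun Q => by induction Q <;> simp_all
  have key' : (fun Q : List (Fin G.n) => D.start :: List.flatMap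
      (fun v : ℕ => [Cmd.const 2 (v : ℤ), D.arrive]) (Q >>= fun a => pure (a : ℕ))) =
      fun Q => D.start :: Q.flatMap fun v : Fin G.n => [Cmd.const 2 ((v : ℕ) : ℤ), D.arrive] :=
    funext fun Q => by rw [key]
  erw [key']
  rw [flatMap_group D.start (fun v : Fin G.n => [Cmd.const 2 ((v : ℕ) : ℤ), D.arrive]) l hl]

/-- What is known about the computation of an ISG structure on a list of arrivals. -/
structure RunSpec (D : ISGStructure) (c : ℕ) (fl : ι → Bool) (vt : ι → Fin G.n) (l : List ι) :
    Prop where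
  bdd : ∀ z, Reachable (D.preprocess :: l.flatMap (D.arrivalCmds fl vt), G.input) z →
    z.2.Bounded ((G.n + G.m + l.length + 2) ^ c) ∧ z.2.out.length ≤ (flatAnswer fl vt l).length
  out : ∀ s, Reachable (D.preprocess :: l.flatMap (D.arrivalCmds fl vt), G.input) ([], s) →
    s.out.Perm (flatAnswer fl vt l)
  time : expectedTime (D.preprocess :: l.flatMap (D.arrivalCmds fl vt), G.input) ≠ ∞
  amortized : ∀ P q r, D.HasAmortizedCosts G P q r →
    expectedTime (D.preprocess :: l.flatMap (D.arrivalCmds fl vt), G.input) ≤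
      ((P + q * l.length + r * (flatAnswer fl vt l).length : ℝ≥0) : ℝ≥0∞)

/-- The exponent `c` is one constant for all graphs and all lists of arrivals, which the word size
of the reduction depends on. -/
theorem ISGStructure.SolvesISG.runSpec {D : ISGStructure} (hD : D.SolvesISG) :
    ∃ c, ∀ (ι : Type) (G : DirGraph) (fl : ι → Bool) (vt : ι → Fin G.n) (l : List ι),
      (∀ i ∈ l.head?, fl i = true) → RunSpec D c fl vt l := by
  obtain ⟨c, hc⟩ := hD
  refine ⟨c, fun ι G fl vt l hl => ?_⟩
  obtain ⟨h1, h2, h3⟩ := hc G (group fl vt l) (group_ne_nil l)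
  rw [interaction_group D l hl] at h1 h2 h3
  rw [answer_group l hl] at h2
  rw [totalLength_group] at h1
  refine ⟨fun z hz => ⟨h1 z hz, ?_⟩, h2, h3, fun P q r h => ?_⟩
  -- Every configuration on the way can still halt, output is never retracted, and the final output
  -- has the right length; so no intermediate output is too long.
  · obtain ⟨s, hs⟩ := exists_halt (expectedTime_ne_top_of_reachable hz h3)
    rw [← (h2 s (hz.trans hs)).length_eq]
    exact hs.out_prefix.length_le
  · have := h (group fl vt l) (group_ne_nil l)
    rwa [interaction_group D l hl, answer_group l hl, totalLength_group] at this

end run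

/-! ## Degeneracy -/

/-- A vertex set that meets `A` contains a vertex with at most τ neighbours; one that avoids `A` is
independent. -/
theorem degeneracy_le {V : Type*} [Fintype V] (G : SimpleGraph V) (A : Set V) (τ : ℕ)
    (hA : ∀ u v, G.Adj u v → u ∈ A ∨ v ∈ A)
    (hdeg : ∀ u ∈ A, ∃ N : Finset V, N.card ≤ τ ∧ ∀ v, G.Adj u v → v ∈ N) :
    degeneracy G ≤ τ := by
  classical
  refine Finset.sup_le fun U _ => ?_
  split_ifs with hU
  · by_cases h : ∃ u ∈ U, u ∈ A
    · obtain ⟨u, hu, huA⟩ := h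
      obtain ⟨N, hN, hN'⟩ := hdeg u huA
      refine (Finset.inf'_le _ hu).trans ((Finset.card_le_card fun v hv => ?_).trans hN)
      exact hN' v (Finset.mem_filter.1 hv).2
    · push Not at h
      obtain ⟨u, hu⟩ := hU
      refine (Finset.inf'_le _ hu).trans ?_
      rw [Finset.card_eq_zero.2]
      · exact Nat.zero_le _
      · refine Finset.filter_eq_empty_iff.2 fun v hv hadj => ?_
        rcases hA u v hadj with h' | h'
        exacts [h u hu h', h v hv h']
  · exact Nat.zero_le _

theorem le_degeneracy {V : Type*} [Fintype V] (G : SimpleGraph V) (U : Finset V) (hU : U.Nonempty)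
    (τ : ℕ) (h : ∀ u ∈ U, ∃ N ⊆ U, τ ≤ N.card ∧ ∀ v ∈ N, G.Adj u v) : τ ≤ degeneracy G := by
  classical
  refine le_trans ?_ (Finset.le_sup (Finset.mem_univ U))
  rw [dif_pos hU]
  refine Finset.le_inf' _ _ fun u hu => ?_
  obtain ⟨N, hNU, hN, hadj⟩ := h u hu
  refine hN.trans (Finset.card_le_card fun v hv => ?_)
  exact Finset.mem_filter.2 ⟨hNU hv, hadj v hv⟩

end ISGLowerBound

namespace ISGLowerBound

/-! ## The graph and the queries of the reduction -/

/-- Sizes, moduli, and the numbers of the instance. -/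
structure Inst where
  R : ℕ
  τ : ℕ
  M : ℕ
  q₁ : ℕ
  q₂ : ℕ
  q₃ : ℕ
  S : List ℤ
  R_pos : 0 < R
  τ_pos : 0 < τ
  τ_le : τ ≤ M
  q₁_pos : 0 < q₁
  q₂_pos : 0 < q₂
  q₃_pos : 0 < q₃
  q₁_le : q₁ ≤ 2 * R
  q₂_le : q₂ ≤ 2 * R
  q₃_le : q₃ ≤ 2 * R
  nodup : S.Nodup

namespace Inst

variable (I : Inst)

/-- Bound on the moduli. -/
def w : ℕ := 2 * I.R

/-- Two numbers are congruent for all three moduli. -/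
def Same (x y : ℤ) : Prop := x % I.q₁ = y % I.q₁ ∧ x % I.q₂ = y % I.q₂ ∧ x % I.q₃ = y % I.q₃

instance : DecidableRel I.Same := fun _ _ => by unfold Same; infer_instance

/-- Numbers that get edges, and numbers that are treated by exhaustive search. -/
def selStep (p : List ℤ × List ℤ) (z : ℤ) : List ℤ × List ℤ :=
  if ∃ x ∈ p.1, I.Same x z then p
  else if I.τ ≤ (p.1.filter fun x => x % I.q₂ = z % I.q₂).length then (p.1, p.2 ++ [z])
  else (p.1 ++ [z], p.2)

def sel (l : List ℤ) : List ℤ × List ℤ := l.foldl I.selStep ([], [])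

/-- The numbers that get edges. -/
def ins : List ℤ := (I.sel I.S).1
/-- The numbers that are treated by exhaustive search. -/
def rest : List ℤ := (I.sel I.S).2

theorem sel_append (l : List ℤ) (z : ℤ) : I.sel (l ++ [z]) = I.selStep (I.sel l) z := by
  simp [sel]

/-- The parts have different purposes. Pairwise different residues keep the edges distinct. At most
τ stored numbers per residue modulo q₂ bounds the degrees. Every number is represented by a stored
one or treated separately, so no solution is lost. Those treated separately share their residue with
τ numbers, so they are heavy and therefore few. -/
theorem sel_spec (l : List ℤ) : (∀ z ∈ (I.sel l).1, z ∈ l) ∧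
    (I.sel l).1.Pairwise (fun x y => ¬ I.Same x y) ∧
    (∀ p : ℤ, ((I.sel l).1.filter fun x => x % I.q₂ = p).length ≤ I.τ) ∧
    (∀ z ∈ l, (∃ x ∈ (I.sel l).1, I.Same x z) ∨ z ∈ (I.sel l).2) ∧
    (I.sel l).2.Sublist l ∧ (I.sel l).1.Sublist l ∧
    (∀ z ∈ (I.sel l).2, I.τ ≤ (l.filter fun x => x % I.q₂ = z % I.q₂).length) := by
  induction l using List.reverseRecOn with
  | nil => simp [sel]
  | append_singleton l z ih =>
    rw [sel_append]
    generalize I.sel l = p at ih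
    obtain ⟨h1, h2, h3, h4, h5, h6, h7⟩ := ih
    unfold selStep
    have h7' : ∀ y ∈ p.2, I.τ ≤ ((l ++ [z]).filter fun x => x % I.q₂ = y % I.q₂).length :=
      fun y hy => (h7 y hy).trans (by rw [List.filter_append, List.length_append]; omega)
    split_ifs with hz hτ
    · refine ⟨fun y hy => by simp [h1 y hy], h2, h3, fun y hy => ?_,
        h5.trans (List.sublist_append_left _ _), h6.trans (List.sublist_append_left _ _), h7'⟩
      rcases List.mem_append.1 hy with hy | hy
      · exact h4 y hy
      · rw [List.mem_singleton.1 hy]; exact .inl hz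
    · refine ⟨fun y hy => by simp [h1 y hy], h2, h3, fun y hy => ?_,
        h5.append_right _, h6.trans (List.sublist_append_left _ _), fun y hy => ?_⟩
      · rcases List.mem_append.1 hy with hy | hy
        · rcases h4 y hy with h | h
          · exact .inl h
          · exact .inr (by simp [h])
        · exact .inr (List.mem_append_right _ hy)
      · rcases List.mem_append.1 hy with hy | hy
        · exact h7' y hy
        · rw [List.mem_singleton.1 hy]
          refine hτ.trans ?_
          exact ((h6.trans (List.sublist_append_left _ _)).filter _).length_le
    · refine ⟨fun y hy => ?_, ?_, fun q => ?_, fun y hy => ?_,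
        h5.trans (List.sublist_append_left _ _), h6.append_right _, h7'⟩
      · rcases List.mem_append.1 hy with hy | hy
        · simp [h1 y hy]
        · exact List.mem_append_right _ hy
      · rw [List.pairwise_append]
        refine ⟨h2, List.pairwise_singleton _ _, fun x hx y hy => ?_⟩
        rw [List.mem_singleton.1 hy]
        exact fun h => hz ⟨x, hx, h⟩
      · rw [List.filter_append, List.length_append]
        by_cases hq : z % I.q₂ = q
        · subst hq; simp; omega
        · simpa [hq] using h3 q
      · rcases List.mem_append.1 hy with hy | hy
        · rcases h4 y hy with ⟨x, hx, h⟩ | h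
          · exact .inl ⟨x, by simp [hx], h⟩
          · exact .inr h
        · rw [List.mem_singleton.1 hy]
          exact .inl ⟨z, by simp, rfl, rfl, rfl⟩

theorem mem_of_mem_ins {z : ℤ} (h : z ∈ I.ins) : z ∈ I.S := (I.sel_spec I.S).1 z h

theorem ins_length_le : I.ins.length ≤ I.S.length := (I.sel_spec I.S).2.2.2.2.2.1.length_le

theorem rest_length_le : I.rest.length ≤ (heavy I.S.toFinset I.τ I.q₂).card := by
  obtain ⟨-, -, -, -, h5, -, h7⟩ := I.sel_spec I.S
  rw [rest, ← List.toFinset_card_of_nodup (h5.nodup I.nodup)]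
  refine Finset.card_le_card fun z hz => ?_
  rw [List.mem_toFinset] at hz
  refine Finset.mem_filter.2 ⟨List.mem_toFinset.2 (h5.subset hz), (h7 z hz).trans ?_⟩
  rw [← List.toFinset_card_of_nodup (I.nodup.filter _)]
  refine Finset.card_le_card fun x hx => ?_
  simp only [List.mem_toFinset, List.mem_filter, decide_eq_true_eq, Finset.mem_filter] at hx ⊢
  exact ⟨hx.1, Int.ModEq.dvd hx.2.symm⟩

/-! ### The graph -/

/-- Number of vertices. -/
def nv : ℕ := 2 * (I.w * I.w) + I.τ + I.M

theorem nv_pos : 0 < I.nv := by have := I.τ_pos; unfold nv; omega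

/-- The vertex with a given number. -/
def toV (v : ℤ) : Fin I.nv := ⟨v.toNat % I.nv, Nat.mod_lt _ I.nv_pos⟩

theorem toV_val {v : ℤ} (h0 : 0 ≤ v) (h : v < I.nv) : ((I.toV v : ℕ) : ℤ) = v := by
  have : v.toNat < I.nv := by omega
  simp only [toV, Nat.mod_eq_of_lt this]
  omega

theorem toV_inj {v v' : ℤ} (h0 : 0 ≤ v) (h : v < I.nv) (h0' : 0 ≤ v') (h' : v' < I.nv)
    (he : I.toV v = I.toV v') : v = v' := by
  rw [← I.toV_val h0 h, ← I.toV_val h0' h', he]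

/-- Edges of a complete bipartite graph. -/
def padEdges : List (ℤ × ℤ) := (List.range I.τ).flatMap fun a : ℕ =>
  (List.range I.M).map fun b : ℕ =>
  (2 * (I.w * I.w) + a, 2 * (I.w * I.w) + I.τ + b)

/-- Edges for the number `z`. -/
def numEdges (z : ℤ) : List (ℤ × ℤ) := (List.range I.q₁).map fun i : ℕ =>
  (i * I.w + z % I.q₂, I.w * I.w + ((-z - i) % I.q₁ * I.w + (-z) % I.q₃))

/-- All edges. -/
def allEdges : List (ℤ × ℤ) := I.padEdges ++ I.ins.flatMap I.numEdges

theorem mod_bound (x : ℤ) {q : ℕ} (hq : 0 < q) : 0 ≤ x % q ∧ x % q < q :=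
  ⟨Int.emod_nonneg _ (by omega), Int.emod_lt_of_pos _ (by omega)⟩

theorem pair_bound {a b w : ℤ} (ha : 0 ≤ a) (ha' : a < w) (hb : 0 ≤ b) (hb' : b < w) :
    0 ≤ a * w + b ∧ a * w + b < w * w := by constructor <;> nlinarith

theorem pair_inj {a b a' b' w : ℤ} (hb : 0 ≤ b) (hb' : b < w) (hc : 0 ≤ b') (hc' : b' < w)
    (h : a * w + b = a' * w + b') : a = a' ∧ b = b' := by
  have h1 : (a * w + b) / w = a := by
    rw [add_comm, Int.add_mul_ediv_right _ _ (by omega), Int.ediv_eq_zero_of_lt hb hb', zero_add]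
  have h2 : (a' * w + b') / w = a' := by
    rw [add_comm, Int.add_mul_ediv_right _ _ (by omega), Int.ediv_eq_zero_of_lt hc hc', zero_add]
  have : a = a' := by rw [← h1, ← h2, h]
  subst this
  exact ⟨rfl, by omega⟩

theorem mod_lt_w₁ (x : ℤ) : 0 ≤ x % I.q₁ ∧ x % I.q₁ < I.w := by
  have := mod_bound x I.q₁_pos; have := I.q₁_le; unfold w; omega
theorem mod_lt_w₂ (x : ℤ) : 0 ≤ x % I.q₂ ∧ x % I.q₂ < I.w := by
  have := mod_bound x I.q₂_pos; have := I.q₂_le; unfold w; omega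
theorem mod_lt_w₃ (x : ℤ) : 0 ≤ x % I.q₃ ∧ x % I.q₃ < I.w := by
  have := mod_bound x I.q₃_pos; have := I.q₃_le; unfold w; omega

/-- Where edges can be. -/
theorem numEdges_bound {z : ℤ} {e : ℤ × ℤ} (he : e ∈ I.numEdges z) :
    (0 ≤ e.1 ∧ e.1 < I.w * I.w) ∧ ((I.w * I.w : ℤ) ≤ e.2 ∧ e.2 < 2 * (I.w * I.w)) := by
  simp only [numEdges, List.mem_map, List.mem_range] at he
  obtain ⟨i, hi, rfl⟩ := he
  have hi' : (i : ℤ) < I.w := by have := I.q₁_le; unfold w; omega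
  have h1 := pair_bound (by positivity) hi' (I.mod_lt_w₂ z).1 (I.mod_lt_w₂ z).2
  have h2 := pair_bound (I.mod_lt_w₁ (-z - i)).1 (I.mod_lt_w₁ (-z - i)).2 (I.mod_lt_w₃ (-z)).1
    (I.mod_lt_w₃ (-z)).2
  refine ⟨h1, ?_, ?_⟩ <;> simp only <;> linarith [h2.1, h2.2]

theorem padEdges_bound {e : ℤ × ℤ} (he : e ∈ I.padEdges) :
    ((2 * (I.w * I.w) : ℤ) ≤ e.1 ∧ e.1 < 2 * (I.w * I.w) + I.τ) ∧
    ((2 * (I.w * I.w) + I.τ : ℤ) ≤ e.2 ∧ e.2 < I.nv) := by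
  simp only [padEdges, List.mem_flatMap, List.mem_map, List.mem_range] at he
  obtain ⟨a, ha, b, hb, rfl⟩ := he
  unfold nv
  push_cast
  refine ⟨⟨?_, ?_⟩, ?_, ?_⟩ <;> omega

theorem allEdges_bound {e : ℤ × ℤ} (he : e ∈ I.allEdges) :
    (0 ≤ e.1 ∧ e.1 < I.nv) ∧ (0 ≤ e.2 ∧ e.2 < I.nv) := by
  have hw : (0 : ℤ) ≤ I.w * I.w := by positivity
  have hτ : (0 : ℤ) ≤ I.τ := by positivity
  have hM : (0 : ℤ) ≤ I.M := by positivity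
  have hn : (I.nv : ℤ) = 2 * (I.w * I.w) + I.τ + I.M := by unfold nv; push_cast; ring
  rcases List.mem_append.1 he with he | he
  · have := I.padEdges_bound he
    refine ⟨⟨?_, ?_⟩, ?_, ?_⟩ <;> linarith [this.1.1, this.1.2, this.2.1, this.2.2]
  · obtain ⟨z, -, he⟩ := List.mem_flatMap.1 he
    have := I.numEdges_bound he
    refine ⟨⟨?_, ?_⟩, ?_, ?_⟩ <;> linarith [this.1.1, this.1.2, this.2.1, this.2.2]

theorem same_of_emod {x y q : ℤ} (h : (-x) % q = (-y) % q) : x % q = y % q := by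
  have h' : -x ≡ -y [ZMOD q] := h
  exact Int.neg_modEq_neg.1 h'

theorem same_of_emod_sub {x y i q : ℤ} (h : (-x - i) % q = (-y - i) % q) : x % q = y % q := by
  have h' : -x - i ≡ -y - i [ZMOD q] := h
  have := h'.add_right i
  simp only [sub_add_cancel] at this
  exact Int.neg_modEq_neg.1 this

/-- The index i and the residues of z for all three moduli can be read off an edge as digits in base
w. Equal edges thus come from numbers with the same residues, of which at most one is stored. The
padding lies on other vertices. -/
theorem nodup_allEdges : I.allEdges.Nodup := by
  unfold allEdges
  rw [List.nodup_append]
  refine ⟨?_, ?_, ?_⟩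
  · unfold padEdges
    rw [List.nodup_flatMap]
    refine ⟨fun a _ => List.Nodup.map (fun b b' h => ?_) List.nodup_range, ?_⟩
    · simpa using h
    · refine List.nodup_range.imp fun {a b} hab e he he' => hab ?_
      simp only [List.mem_map] at he he'
      obtain ⟨_, _, rfl⟩ := he
      obtain ⟨_, _, h⟩ := he'
      have := congrArg Prod.fst h
      simp at this
      exact this.symm
  · rw [List.nodup_flatMap]
    refine ⟨fun z _ => List.Nodup.map (fun i j h => ?_) List.nodup_range, ?_⟩
    · have := congrArg Prod.fst h
      have := (pair_inj (I.mod_lt_w₂ z).1 (I.mod_lt_w₂ z).2 (I.mod_lt_w₂ z).1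
        (I.mod_lt_w₂ z).2 this).1
      exact_mod_cast this
    · refine (I.sel_spec I.S).2.1.imp fun {x y} hxy e he he' => hxy ?_
      simp only [numEdges, List.mem_map, List.mem_range] at he he'
      obtain ⟨i, _, rfl⟩ := he
      obtain ⟨j, _, h⟩ := he'
      have h1 := pair_inj (I.mod_lt_w₂ y).1 (I.mod_lt_w₂ y).2 (I.mod_lt_w₂ x).1
        (I.mod_lt_w₂ x).2 (congrArg Prod.fst h)
      have h2 := pair_inj (I.mod_lt_w₃ (-y)).1 (I.mod_lt_w₃ (-y)).2 (I.mod_lt_w₃ (-x)).1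
        (I.mod_lt_w₃ (-x)).2 (add_left_cancel (congrArg Prod.snd h))
      have hij := h1.1
      rw [hij] at h2
      exact ⟨(same_of_emod_sub h2.1).symm, h1.2.symm, (same_of_emod h2.2).symm⟩
  · intro e he e' he' hee
    subst hee
    obtain ⟨z, -, he'⟩ := List.mem_flatMap.1 he'
    have := I.padEdges_bound he
    have := I.numEdges_bound he'
    have hw : (0 : ℤ) ≤ I.w * I.w := by positivity
    linarith [this.1.2]

/-- The graph. -/
@[reducible]
def graph : DirGraph where
  n := I.nv
  edges := I.allEdges.map fun e => (I.toV e.1, I.toV e.2)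
  nodup := by
    refine List.Nodup.map_on (fun e he e' he' h => ?_) I.nodup_allEdges
    have b := I.allEdges_bound he
    have b' := I.allEdges_bound he'
    simp only [Prod.mk.injEq] at h
    exact Prod.ext (I.toV_inj b.1.1 b.1.2 b'.1.1 b'.1.2 h.1)
      (I.toV_inj b.2.1 b.2.2 b'.2.1 b'.2.2 h.2)

theorem graph_n : I.graph.n = I.nv := rfl

theorem length_numEdges (z : ℤ) : (I.numEdges z).length = I.q₁ := by simp [numEdges]

theorem length_padEdges : I.padEdges.length = I.τ * I.M := by
  simp [padEdges, List.length_flatMap]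

theorem graph_m : I.graph.m = I.τ * I.M + I.ins.length * I.q₁ := by
  simp [DirGraph.m, graph, allEdges, length_padEdges, List.length_flatMap, length_numEdges]

theorem graph_m_eq : I.graph.m = I.allEdges.length := by simp [DirGraph.m, graph]

theorem map_fst_edges :
    (I.graph.edges.map fun e => ((e.1 : ℕ) : ℤ)) = I.allEdges.map Prod.fst := by
  simp only [graph, List.map_map]
  refine List.map_congr_left fun e he => ?_
  exact I.toV_val (I.allEdges_bound he).1.1 (I.allEdges_bound he).1.2

theorem map_snd_edges :
    (I.graph.edges.map fun e => ((e.2 : ℕ) : ℤ)) = I.allEdges.map Prod.snd := by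
  simp only [graph, List.map_map]
  refine List.map_congr_left fun e he => ?_
  exact I.toV_val (I.allEdges_bound he).2.1 (I.allEdges_bound he).2.2

theorem mem_edges {u v : Fin I.nv} : (u, v) ∈ I.graph.edges ↔
    (((u : ℕ) : ℤ), ((v : ℕ) : ℤ)) ∈ I.allEdges := by
  simp only [graph, List.mem_map, Prod.mk.injEq]
  constructor
  · rintro ⟨e, he, rfl, rfl⟩
    have b := I.allEdges_bound he
    rwa [I.toV_val b.1.1 b.1.2, I.toV_val b.2.1 b.2.2]
  · intro h
    refine ⟨_, h, ?_, ?_⟩ <;> ext <;> simp [toV, Nat.mod_eq_of_lt u.2, Nat.mod_eq_of_lt v.2]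

theorem mem_edgesAt {pv : List (Fin I.nv)} {v : ℤ} (h0 : 0 ≤ v) (hv : v < I.nv) {e : ℤ × ℤ} :
    e ∈ I.graph.edgesAt pv (I.toV v) ↔ e ∈ I.allEdges ∧ e.2 = v ∧ I.toV e.1 ∈ pv := by
  simp only [DirGraph.edgesAt, graph, List.mem_map, List.mem_filter, decide_eq_true_eq]
  constructor
  · rintro ⟨_, ⟨⟨e', he, rfl⟩, h1, h2⟩, rfl⟩
    have b := I.allEdges_bound he
    simp only at h1 h2
    rw [I.toV_val b.1.1 b.1.2, I.toV_val b.2.1 b.2.2]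
    exact ⟨he, I.toV_inj b.2.1 b.2.2 h0 hv h1, h2⟩
  · rintro ⟨he, rfl, h2⟩
    have b := I.allEdges_bound he
    exact ⟨_, ⟨⟨e, he, rfl⟩, rfl, h2⟩, Prod.ext (I.toV_val b.1.1 b.1.2) (I.toV_val b.2.1 b.2.2)⟩

theorem _root_.ISGLowerBound.DirGraph.nodup_edgesAt (G : DirGraph) (pv : List (Fin G.n))
    (v : Fin G.n) : (G.edgesAt pv v).Nodup := by
  refine List.Nodup.map (fun e e' h => ?_) (G.nodup.filter _)
  simp only [Prod.mk.injEq, Nat.cast_inj] at h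
  exact Prod.ext (Fin.ext h.1) (Fin.ext h.2)

/-- The threshold for storing a number is the degree bound for left vertices, and the padding
attains the same value. The degeneracy is therefore known exactly, whatever the moduli and the
numbers are. -/
theorem delta_eq : I.graph.δ = I.τ := by
  have hw : (0 : ℤ) ≤ I.w * I.w := by positivity
  have hn : (I.nv : ℤ) = 2 * (I.w * I.w) + I.τ + I.M := by unfold nv; push_cast; ring
  refine le_antisymm ?_ ?_
  -- The vertices of small degree are the left vertices of the hashed part and the heads of the
  -- padding; every edge has one of them as an endpoint.
  · refine degeneracy_le _ {u : Fin I.nv | ((u : ℕ) : ℤ) < I.w * I.w ∨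
      (2 * (I.w * I.w) + I.τ : ℤ) ≤ ((u : ℕ) : ℤ)} I.τ ?_ ?_
    · intro u v h
      rw [DirGraph.underlying, SimpleGraph.fromRel_adj] at h
      have key : ∀ u v : Fin I.nv, (u, v) ∈ I.graph.edges → ((u : ℕ) : ℤ) < I.w * I.w ∨
          (2 * (I.w * I.w) + I.τ : ℤ) ≤ ((v : ℕ) : ℤ) := by
        intro u v h
        rw [mem_edges] at h
        rcases List.mem_append.1 h with he | he
        · exact .inr (I.padEdges_bound he).2.1
        · obtain ⟨z, -, he⟩ := List.mem_flatMap.1 he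
          exact .inl (I.numEdges_bound he).1.2
      rcases h.2 with h | h
      · rcases key _ _ h with h | h
        exacts [.inl (.inl h), .inr (.inr h)]
      · rcases key _ _ h with h | h
        exacts [.inr (.inl h), .inl (.inr h)]
    · intro u hu
      rcases hu with hu | hu
      -- A left vertex (i, p) has at most one neighbour for each stored number with residue p modulo
      -- q₂, namely the head of the edge with index i.
      · refine ⟨((I.ins.filter fun z => z % I.q₂ = ((u : ℕ) : ℤ) % I.w).toFinset).image fun z =>
          I.toV (I.w * I.w + ((-z - ((u : ℕ) : ℤ) / I.w) % I.q₁ * I.w + (-z) % I.q₃)), ?_, ?_⟩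
        · refine Finset.card_image_le.trans ((List.toFinset_card_le _).trans ?_)
          exact (I.sel_spec I.S).2.2.1 _
        · intro v h
          rw [DirGraph.underlying, SimpleGraph.fromRel_adj] at h
          rcases h.2 with h | h <;> rw [mem_edges] at h <;>
            rcases List.mem_append.1 h with he | he
          · have := (I.padEdges_bound he).1.1
            simp only at this; linarith
          · obtain ⟨z, hz, he⟩ := List.mem_flatMap.1 he
            simp only [numEdges, List.mem_map, List.mem_range, Prod.mk.injEq] at he
            obtain ⟨i, hi, h1, h2⟩ := he
            have hb := I.mod_lt_w₂ z
            have e1 : ((u : ℕ) : ℤ) / I.w = i := by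
              rw [← h1, add_comm, Int.add_mul_ediv_right _ _ (by omega),
                Int.ediv_eq_zero_of_lt hb.1 hb.2, zero_add]
            have e2 : ((u : ℕ) : ℤ) % I.w = z % I.q₂ := by
              rw [← h1, add_comm, Int.add_mul_emod_self_right, Int.emod_eq_of_lt hb.1 hb.2]
            simp only [Finset.mem_image, List.mem_toFinset, List.mem_filter, decide_eq_true_eq]
            refine ⟨z, ⟨hz, e2.symm⟩, ?_⟩
            rw [e1, h2]
            ext; simp [toV, Nat.mod_eq_of_lt v.2]
          · have := (I.padEdges_bound he).2.1
            simp only at this; linarith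
          · obtain ⟨z, -, he⟩ := List.mem_flatMap.1 he
            have := (I.numEdges_bound he).2.1
            simp only at this; linarith
      · refine ⟨(Finset.range I.τ).image fun a => I.toV (2 * (I.w * I.w) + (a : ℕ)), ?_, ?_⟩
        · exact Finset.card_image_le.trans (by simp)
        · intro v h
          rw [DirGraph.underlying, SimpleGraph.fromRel_adj] at h
          rcases h.2 with h | h <;> rw [mem_edges] at h <;>
            rcases List.mem_append.1 h with he | he
          · have := (I.padEdges_bound he).1.2
            simp only at this; linarith
          · obtain ⟨z, -, he⟩ := List.mem_flatMap.1 he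
            have := (I.numEdges_bound he).1.2
            simp only at this; linarith
          · simp only [padEdges, List.mem_flatMap, List.mem_map, List.mem_range,
              Prod.mk.injEq] at he
            obtain ⟨a, ha, b, hb, h1, h2⟩ := he
            simp only [Finset.mem_image, Finset.mem_range]
            refine ⟨a, ha, ?_⟩
            rw [h1]
            ext; simp [toV, Nat.mod_eq_of_lt v.2]
          · obtain ⟨z, -, he⟩ := List.mem_flatMap.1 he
            have := (I.numEdges_bound he).2.2
            simp only at this; linarith
  -- In the padding, tails have M ≥ τ neighbours and heads have τ.
  · set T := (Finset.range I.τ).image fun a => I.toV (2 * (I.w * I.w) + (a : ℕ)) with hT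
    set H := (Finset.range I.M).image fun b => I.toV (2 * (I.w * I.w) + I.τ + (b : ℕ)) with hH
    have vt : ∀ a < I.τ, ((I.toV (2 * (I.w * I.w) + (a : ℕ)) : ℕ) : ℤ) =
        2 * (I.w * I.w) + (a : ℕ) := fun a ha => I.toV_val (by positivity) (by
      rw [hn]; omega)
    have vh : ∀ b < I.M, ((I.toV (2 * (I.w * I.w) + I.τ + (b : ℕ)) : ℕ) : ℤ) =
        2 * (I.w * I.w) + I.τ + (b : ℕ) := fun a ha => I.toV_val (by positivity) (by
      rw [hn]; omega)
    have hTc : T.card = I.τ := by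
      rw [hT, Finset.card_image_of_injOn, Finset.card_range]
      intro a ha b hb h
      simp only [Finset.coe_range, Set.mem_Iio] at ha hb
      have h' : ((I.toV (2 * (I.w * I.w) + (a : ℕ)) : ℕ) : ℤ) =
        ((I.toV (2 * (I.w * I.w) + (b : ℕ)) : ℕ) : ℤ) := by simp only at h; rw [h]
      rw [vt a ha, vt b hb] at h'
      omega
    have hHc : H.card = I.M := by
      rw [hH, Finset.card_image_of_injOn, Finset.card_range]
      intro a ha b hb h
      simp only [Finset.coe_range, Set.mem_Iio] at ha hb
      have h' : ((I.toV (2 * (I.w * I.w) + I.τ + (a : ℕ)) : ℕ) : ℤ) =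
        ((I.toV (2 * (I.w * I.w) + I.τ + (b : ℕ)) : ℕ) : ℤ) := by simp only at h; rw [h]
      rw [vh a ha, vh b hb] at h'
      omega
    have adj : ∀ a < I.τ, ∀ b < I.M, I.graph.underlying.Adj (I.toV (2 * (I.w * I.w) + (a : ℕ)))
        (I.toV (2 * (I.w * I.w) + I.τ + (b : ℕ))) := by
      intro a ha b hb
      rw [DirGraph.underlying, SimpleGraph.fromRel_adj]
      refine ⟨fun h => ?_, .inl (I.mem_edges.2 ?_)⟩
      · have := vt a ha
        rw [h, vh b hb] at this
        omega
      · rw [vt a ha, vh b hb]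
        refine List.mem_append_left _ ?_
        simp only [padEdges, List.mem_flatMap, List.mem_map, List.mem_range]
        exact ⟨a, ha, b, hb, rfl⟩
    refine le_degeneracy _ (T ∪ H) ?_ I.τ ?_
    · have : T.Nonempty := by rw [← Finset.card_pos, hTc]; exact I.τ_pos
      exact this.mono Finset.subset_union_left
    · intro u hu
      rcases Finset.mem_union.1 hu with hu | hu
      · refine ⟨H, Finset.subset_union_right, by rw [hHc]; exact I.τ_le, fun v hv => ?_⟩
        obtain ⟨a, ha, rfl⟩ := Finset.mem_image.1 hu
        obtain ⟨b, hb, rfl⟩ := Finset.mem_image.1 hv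
        exact adj a (Finset.mem_range.1 ha) b (Finset.mem_range.1 hb)
      · refine ⟨T, Finset.subset_union_left, hTc.ge, fun v hv => ?_⟩
        obtain ⟨a, ha, rfl⟩ := Finset.mem_image.1 hv
        obtain ⟨b, hb, rfl⟩ := Finset.mem_image.1 hu
        exact (adj a (Finset.mem_range.1 ha) b (Finset.mem_range.1 hb)).symm

end Inst
end ISGLowerBound

/-! ### The queries, and the pairs tested upon a reported edge -/

namespace ISGLowerBound

/-- Three different numbers of the list that sum to zero: `x`, `y` and `-x - y`. -/
def Good (S : List ℤ) (x y : ℤ) : Prop := x ≠ y ∧ -x - y ∈ S ∧ -x - y ≠ x ∧ -x - y ≠ y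

instance (S : List ℤ) (x y : ℤ) : Decidable (Good S x y) := by unfold Good; infer_instance

/-- The arrival of vertex `v`, at the beginning of a query if `fl`. If `isB`, then the vertex
belongs to the number `y`. The query has the number `(u₁, u₂)`. -/
structure Arrival where
  fl : Bool
  isB : Bool
  v : ℤ
  y : ℤ
  u₁ : ℤ
  u₂ : ℤ

/-- The part of a list up to and including the first element with property `p`. -/
def upTo {α : Type*} (p : α → Prop) [DecidablePred p] : List α → List α
  | [] => []
  | a :: l => if p a then [a] else a :: upTo p l

/-- Only the last element can have the property, and it is paid for by `K`; all the others are
covered by `g`. -/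
theorem sum_upTo_le {α : Type*} (p : α → Prop) [DecidablePred p] (f g : α → ℕ) (K : ℕ)
    (l : List α) (h : ∀ a ∈ l, ¬ p a → f a ≤ g a) (hK : ∀ a ∈ l, f a ≤ K) :
    ((upTo p l).map f).sum ≤ (l.map g).sum + K := by
  induction l with
  | nil => simp [upTo]
  | cons a l ih =>
    rw [upTo]
    split_ifs with hp
    · have := hK a (by simp)
      simp; omega
    · have h1 := h a (by simp) hp
      have h2 := ih (fun b hb => h b (by simp [hb])) (fun b hb => hK b (by simp [hb]))
      simp only [List.map_cons, List.sum_cons]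
      omega

theorem upTo_prefix {α : Type*} (p : α → Prop) [DecidablePred p] (l : List α) :
    upTo p l <+: l := by
  induction l with
  | nil => exact List.prefix_refl _
  | cons a l ih =>
    rw [upTo]
    split_ifs
    · exact ⟨l, rfl⟩
    · exact (List.prefix_cons_inj a).2 ih

/-- The conditions under which a pair of numbers is tested. -/
def pairWeight (S : Finset ℤ) (q₁ q₂ q₃ : ℕ) (x y : ℤ) : ℕ :=
  (S.filter fun z => x + y + z ≠ 0 ∧ (q₁ : ℤ) ∣ x + y + z ∧ (q₂ : ℤ) ∣ x + y + z ∧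
    (q₃ : ℤ) ∣ x + y + z).card + ((if x = y then 1 else 0) + (if y = -x - x then 1 else 0) +
    (if x = -y - y then 1 else 0))

/-- A pair with a completing z is a false triple. In each of the three degenerate cases one member
of the pair determines the other, so each case occurs at most once per number. -/
theorem sum_pairWeight_le (S : Finset ℤ) (q₁ q₂ q₃ : ℕ) :
    ∑ y ∈ S, ∑ x ∈ S, pairWeight S q₁ q₂ q₃ x y ≤ (falseTriples S q₁ q₂ q₃).card + 3 * S.card := by
  simp only [pairWeight, Finset.sum_add_distrib]
  have h1 : ∑ y ∈ S, ∑ x ∈ S, (S.filter fun z => x + y + z ≠ 0 ∧ (q₁ : ℤ) ∣ x + y + z ∧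
      (q₂ : ℤ) ∣ x + y + z ∧ (q₃ : ℤ) ∣ x + y + z).card = (falseTriples S q₁ q₂ q₃).card := by
    rw [Finset.sum_comm, falseTriples, Finset.card_filter, Finset.sum_product]
    simp only [Finset.sum_product, Finset.card_filter]
  have h2 : ∑ y ∈ S, ∑ x ∈ S, (if x = y then 1 else 0) ≤ S.card := by
    refine (Finset.sum_le_card_nsmul _ _ 1 fun y _ => ?_).trans (by simp)
    rw [Finset.sum_ite_eq']
    split_ifs; simp
  have h3 : ∑ y ∈ S, ∑ x ∈ S, (if y = -x - x then 1 else 0) ≤ S.card := by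
    rw [Finset.sum_comm]
    refine (Finset.sum_le_card_nsmul _ _ 1 fun y _ => ?_).trans (by simp)
    rw [Finset.sum_ite_eq']; split_ifs <;> simp
  have h4 : ∑ y ∈ S, ∑ x ∈ S, (if x = -y - y then 1 else 0) ≤ S.card := by
    refine (Finset.sum_le_card_nsmul _ _ 1 fun y _ => ?_).trans (by simp)
    rw [Finset.sum_ite_eq']; split_ifs <;> simp
  omega

namespace Inst

variable (I : Inst)

/-- The vertex for the number `x` in the queries with first number `u₁`. -/
def vertA (u₁ x : ℤ) : ℤ := x % I.q₁ * I.w + (u₁ - x) % I.q₂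
/-- The vertex for the number `y` in the queries with second number `u₂`. -/
def vertB (u₂ y : ℤ) : ℤ := I.w * I.w + (y % I.q₁ * I.w + (u₂ + y) % I.q₃)
/-- A vertex that has no edges to vertices of numbers. -/
def dummy : ℤ := 2 * (I.w * I.w)

/-- The zero is a placeholder: only arrivals of right vertices carry a number y. The initial arrival
`itemD` makes every query nonempty and carries the mark that starts it. -/
def itemA (u₁ u₂ x : ℤ) : Arrival := ⟨false, false, I.vertA u₁ x, 0, u₁, u₂⟩
def itemB (u₁ u₂ y : ℤ) : Arrival := ⟨false, true, I.vertB u₂ y, y, u₁, u₂⟩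
def itemD (u₁ u₂ : ℤ) : Arrival := ⟨true, false, I.dummy, 0, u₁, u₂⟩

def listA (u₁ u₂ : ℤ) : List Arrival :=
  (I.S.filter fun x => x % I.q₃ = u₂).map (I.itemA u₁ u₂)
def listB (u₁ u₂ : ℤ) : List Arrival :=
  (I.S.filter fun y => y % I.q₂ = (-u₁) % I.q₂).map (I.itemB u₁ u₂)

/-- A query. -/
def query (u₁ u₂ : ℤ) : List Arrival := I.itemD u₁ u₂ :: (I.listA u₁ u₂ ++ I.listB u₁ u₂)

/-- All queries, as one list of arrivals. -/
def arrivals : List Arrival :=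
  (List.range I.q₂).flatMap fun i : ℕ => (List.range I.q₃).flatMap fun j : ℕ => I.query i j

/-- The vertex of an arrival. -/
def vt (a : Arrival) : Fin I.graph.n := I.toV a.v

/-- Arrivals with the vertices that arrived before in the same query. -/
abbrev annotated : List (List (Fin I.graph.n) × Arrival) :=
  withPrev Arrival.fl I.vt [] I.arrivals

/-- The edges reported upon an arrival. -/
def reported (a : List (Fin I.graph.n) × Arrival) : List (ℤ × ℤ) :=
  I.graph.edgesAt a.1 (I.vt a.2)

/-- The numbers that explain a reported edge. -/
def cands (a : Arrival) (e : ℤ × ℤ) : List ℤ := I.S.filter fun x =>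
  x % I.q₁ = e.1 / I.w ∧ x % I.q₂ = (a.u₁ - e.1 % I.w) % I.q₂ ∧ x % I.q₃ = a.u₂

/-- A solution is found upon an arrival. -/
def Hit (a : List (Fin I.graph.n) × Arrival) : Prop :=
  ∃ e ∈ I.reported a, ∃ x ∈ I.cands a.2 e, Good I.S x a.2.y

instance : DecidablePred I.Hit := fun _ => by unfold Hit; infer_instance

/-- Number of pairs tested upon an arrival. -/
def tests (a : List (Fin I.graph.n) × Arrival) : ℕ :=
  ((I.reported a).map fun e => (I.cands a.2 e).length).sum

variable {I}

theorem withPrev_block {prev : List (Fin I.graph.n)} {l : List Arrival}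
    (hl : ∃ a ∈ l.head?, a.fl = true) :
    withPrev Arrival.fl I.vt prev l = withPrev Arrival.fl I.vt [] l := by
  cases l with
  | nil => simp at hl
  | cons a l => simp only [List.head?_cons, Option.mem_def, Option.some.injEq,
      exists_eq_left'] at hl; simp [withPrev, hl]

theorem mem_withPrev_flatMap {β : Type*} (f : β → List Arrival)
    (hf : ∀ b, ∃ a ∈ (f b).head?, a.fl = true) (L : List β) (prev : List (Fin I.graph.n))
    {a : List (Fin I.graph.n) × Arrival}
    (h : a ∈ withPrev Arrival.fl I.vt prev (L.flatMap f)) :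
    ∃ b ∈ L, a ∈ withPrev Arrival.fl I.vt [] (f b) := by
  induction L generalizing prev with
  | nil => simp [withPrev] at h
  | cons b L ih =>
    rw [List.flatMap_cons, withPrev_append, List.mem_append] at h
    rcases h with h | h
    · rw [withPrev_block (hf b)] at h
      exact ⟨b, by simp, h⟩
    · obtain ⟨b', hb', h⟩ := ih _ h
      exact ⟨b', by simp [hb'], h⟩

theorem mem_withPrev_unflagged {l : List Arrival} (hl : ∀ a ∈ l, a.fl = false)
    {prev : List (Fin I.graph.n)} {a : List (Fin I.graph.n) × Arrival}
    (h : a ∈ withPrev Arrival.fl I.vt prev l) :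
    a.2 ∈ l ∧ (∀ v ∈ prev, v ∈ a.1) ∧ ∀ v ∈ a.1, v ∈ prev ∨ ∃ b ∈ l, v = I.vt b := by
  induction l generalizing prev with
  | nil => simp [withPrev] at h
  | cons b l ih =>
    have hb := hl b (by simp)
    simp only [withPrev, hb, Bool.false_eq_true, if_false, List.mem_cons] at h
    rcases h with rfl | h
    · exact ⟨by simp, fun v hv => hv, fun v hv => .inl hv⟩
    · obtain ⟨h1, h2, h3⟩ := ih (fun a ha => hl a (by simp [ha])) h
      refine ⟨by simp [h1], fun v hv => h2 v (by simp [hv]), fun v hv => ?_⟩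
      rcases h3 v hv with h | ⟨c, hc, h⟩
      · rcases List.mem_cons.1 h with h | h
        · exact .inr ⟨b, by simp, h⟩
        · exact .inl h
      · exact .inr ⟨c, by simp [hc], h⟩

theorem prevAfter_unflagged {l : List Arrival} (hl : ∀ a ∈ l, a.fl = false)
    (prev : List (Fin I.graph.n)) :
    prevAfter Arrival.fl I.vt prev l = (l.map I.vt).reverse ++ prev := by
  induction l generalizing prev with
  | nil => simp [prevAfter]
  | cons b l ih =>
    have hb := hl b (by simp)
    simp [prevAfter, hb, ih fun a ha => hl a (by simp [ha])]

theorem w_pos : 0 < I.w := by have := I.R_pos; unfold w; omega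

theorem nv_eq : (I.nv : ℤ) = 2 * (I.w * I.w) + I.τ + I.M := by unfold nv; push_cast; ring

theorem vertA_bound (u₁ x : ℤ) : 0 ≤ I.vertA u₁ x ∧ I.vertA u₁ x < I.w * I.w :=
  pair_bound (I.mod_lt_w₁ x).1 (I.mod_lt_w₁ x).2 (I.mod_lt_w₂ _).1 (I.mod_lt_w₂ _).2

theorem vertB_bound (u₂ y : ℤ) :
    (I.w * I.w : ℤ) ≤ I.vertB u₂ y ∧ I.vertB u₂ y < 2 * (I.w * I.w) := by
  have := pair_bound (I.mod_lt_w₁ y).1 (I.mod_lt_w₁ y).2 (I.mod_lt_w₃ (u₂ + y)).1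
    (I.mod_lt_w₃ (u₂ + y)).2
  unfold vertB
  constructor <;> linarith [this.1, this.2]

theorem lt_nv {v : ℤ} (h : v < 2 * (I.w * I.w)) : v < I.nv := by
  rw [nv_eq]
  have : (0 : ℤ) ≤ I.τ := by positivity
  have : (0 : ℤ) ≤ I.M := by positivity
  linarith

theorem dummy_bound : 0 ≤ I.dummy ∧ I.dummy < I.nv := by
  have : (0 : ℤ) < I.τ := by exact_mod_cast I.τ_pos
  have : (0 : ℤ) ≤ I.M := by positivity
  have hw : (0 : ℤ) ≤ I.w * I.w := by positivity
  rw [nv_eq]; unfold dummy; constructor <;> linarith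

/-- The arrivals at which edges can be reported. -/
structure IsTest (I : Inst) (a : List (Fin I.graph.n) × Arrival) : Prop where
  y_mem : a.2.y ∈ I.S
  isB : a.2.isB = true
  v_eq : a.2.v = I.vertB a.2.u₂ a.2.y
  hy : a.2.y % I.q₂ = (-a.2.u₁) % I.q₂
  prev : ∀ x ∈ I.S, x % I.q₃ = a.2.u₂ → I.toV (I.vertA a.2.u₁ x) ∈ a.1
  of_prev : ∀ v ∈ a.1, ((v : ℕ) : ℤ) < I.w * I.w →
    ∃ x ∈ I.S, x % I.q₃ = a.2.u₂ ∧ v = I.toV (I.vertA a.2.u₁ x)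

theorem reported_eq_nil {a : List (Fin I.graph.n) × Arrival} (h0 : 0 ≤ a.2.v) (hv : a.2.v < I.nv)
    (h : ∀ e ∈ I.allEdges, e.2 ≠ a.2.v) : I.reported a = [] := by
  rw [List.eq_nil_iff_forall_not_mem]
  intro e he
  obtain ⟨h1, h2, -⟩ := (I.mem_edgesAt h0 hv).1 he
  exact h e h1 h2

theorem allEdges_snd {e : ℤ × ℤ} (he : e ∈ I.allEdges) :
    (I.w * I.w : ℤ) ≤ e.2 ∧ e.2 ≠ I.dummy := by
  have hw : (0 : ℤ) ≤ I.w * I.w := by positivity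
  have hτ : (0 : ℤ) < I.τ := by exact_mod_cast I.τ_pos
  unfold dummy
  rcases List.mem_append.1 he with he | he
  · have := (I.padEdges_bound he).2.1
    constructor <;> linarith
  · obtain ⟨z, -, he⟩ := List.mem_flatMap.1 he
    have := (I.numEdges_bound he).2
    exact ⟨this.1, this.2.ne⟩

/-- No edge ends in a left vertex or in the dummy, so reports can occur only when a right vertex
arrives. By then all left vertices of the query have arrived, and apart from them only the dummy and
earlier right vertices, which have numbers at least w². -/
theorem mem_query {u₁ u₂ : ℤ} {a : List (Fin I.graph.n) × Arrival}
    (ha : a ∈ withPrev Arrival.fl I.vt [] (I.query u₁ u₂)) :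
    (I.reported a = [] ∧ a.2.isB = false) ∨ I.IsTest a := by
  have hlA : ∀ a ∈ I.listA u₁ u₂, a.fl = false := fun a ha => by
    simp only [listA, List.mem_map] at ha; obtain ⟨_, _, rfl⟩ := ha; rfl
  have hlB : ∀ a ∈ I.listB u₁ u₂, a.fl = false := fun a ha => by
    simp only [listB, List.mem_map] at ha; obtain ⟨_, _, rfl⟩ := ha; rfl
  simp only [query, withPrev, List.mem_cons] at ha
  rcases ha with rfl | ha
  · left
    exact ⟨reported_eq_nil dummy_bound.1 dummy_bound.2 fun e he => (allEdges_snd he).2, rfl⟩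
  rw [withPrev_append, List.mem_append] at ha
  rcases ha with ha | ha
  · left
    obtain ⟨h1, -, -⟩ := mem_withPrev_unflagged hlA ha
    simp only [listA, List.mem_map] at h1
    obtain ⟨x, _, hx⟩ := h1
    have hb := I.vertA_bound u₁ x
    have hw : (0 : ℤ) ≤ I.w * I.w := by positivity
    have hav : a.2.v = I.vertA u₁ x := by rw [← hx]; rfl
    refine ⟨reported_eq_nil (hav ▸ hb.1) (hav ▸ lt_nv (by linarith [hb.2])) fun e he h => ?_,
      by rw [← hx]; rfl⟩
    have := (allEdges_snd he).1
    rw [h, hav] at this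
    linarith [hb.2]
  · right
    rw [prevAfter_unflagged hlA, if_pos (show (I.itemD u₁ u₂).fl = true from rfl)] at ha
    obtain ⟨h1, h2, h3⟩ := mem_withPrev_unflagged hlB ha
    simp only [listB, List.mem_map, List.mem_filter, decide_eq_true_eq] at h1
    obtain ⟨y, hy, hy'⟩ := h1
    have e1 : a.2.u₁ = u₁ := by rw [← hy']; rfl
    have e2 : a.2.u₂ = u₂ := by rw [← hy']; rfl
    have e3 : a.2.y = y := by rw [← hy']; rfl
    refine ⟨by rw [e3]; exact hy.1, by rw [← hy']; rfl, by rw [e2, e3, ← hy']; rfl,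
      by rw [e1, e3]; exact hy.2, fun x hx hx' => h2 _ ?_, fun v hv hlt => ?_⟩
    · rw [e1]
      simp only [List.mem_append, List.mem_reverse, List.mem_map, listA, List.mem_filter,
        decide_eq_true_eq]
      left
      exact ⟨_, ⟨x, ⟨hx, by rw [hx', e2]⟩, rfl⟩, rfl⟩
    · have hw : (0 : ℤ) ≤ I.w * I.w := by positivity
      rcases h3 v hv with h | ⟨b, hb, rfl⟩
      · simp only [List.mem_append, List.mem_reverse, List.mem_map, listA, List.mem_filter,
          decide_eq_true_eq, List.mem_singleton] at h
        rcases h with ⟨_, ⟨x, ⟨hx, hx'⟩, rfl⟩, rfl⟩ | rfl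
        · exact ⟨x, hx, by rw [hx', e2], by rw [e1]; rfl⟩
        · exfalso
          have hd := dummy_bound (I := I)
          have h := I.toV_val hd.1 hd.2
          change ((I.toV I.dummy : ℕ) : ℤ) < _ at hlt
          rw [h] at hlt
          unfold dummy at hlt
          linarith
      · exfalso
        simp only [listB, List.mem_map] at hb
        obtain ⟨z, _, rfl⟩ := hb
        have hd := I.vertB_bound u₂ z
        change ((I.toV (I.vertB u₂ z) : ℕ) : ℤ) < _ at hlt
        rw [I.toV_val (by linarith [hd.1]) (lt_nv hd.2)] at hlt
        linarith [hd.1]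

theorem mem_annotated {a : List (Fin I.graph.n) × Arrival} (ha : a ∈ I.annotated) :
    (I.reported a = [] ∧ a.2.isB = false) ∨ I.IsTest a := by
  have hq : ∀ u₁ u₂, ∃ a ∈ (I.query u₁ u₂).head?, a.fl = true := fun u₁ u₂ =>
    ⟨_, rfl, rfl⟩
  have h3 := I.q₃_pos
  obtain ⟨i, -, h⟩ := mem_withPrev_flatMap
    (fun i : ℕ => (List.range I.q₃).flatMap fun j : ℕ => I.query i j) (fun i => by
      obtain ⟨k, hk⟩ : ∃ k, I.q₃ = k + 1 := ⟨I.q₃ - 1, by omega⟩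
      rw [hk, List.range_succ_eq_map]
      exact ⟨_, rfl, rfl⟩) _ _ ha
  obtain ⟨j, -, h⟩ := mem_withPrev_flatMap (fun j : ℕ => I.query i j) (fun j => hq _ _) _ _ h
  exact mem_query h

theorem IsTest.bound {a : List (Fin I.graph.n) × Arrival} (ha : I.IsTest a) :
    0 ≤ a.2.v ∧ a.2.v < I.nv := by
  rw [ha.v_eq]
  have := I.vertB_bound a.2.u₂ a.2.y
  have hw : (0 : ℤ) ≤ I.w * I.w := by positivity
  exact ⟨by linarith [this.1], lt_nv this.2⟩

theorem vertA_div (u₁ x : ℤ) : I.vertA u₁ x / I.w = x % I.q₁ := by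
  have := I.mod_lt_w₂ (u₁ - x)
  have hw := I.w_pos
  rw [vertA, add_comm, Int.add_mul_ediv_right _ _ (by omega),
    Int.ediv_eq_zero_of_lt this.1 this.2, zero_add]

theorem vertA_mod (u₁ x : ℤ) : I.vertA u₁ x % I.w = (u₁ - x) % I.q₂ := by
  have := I.mod_lt_w₂ (u₁ - x)
  rw [vertA, add_comm, Int.add_mul_emod_self_right, Int.emod_eq_of_lt this.1 this.2]

/-- Reported edges come from numbers that complete the sum modulo the moduli. -/
theorem IsTest.reported_spec {a : List (Fin I.graph.n) × Arrival} (ha : I.IsTest a)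
    {e : ℤ × ℤ} (he : e ∈ I.reported a) :
    e.2 = a.2.v ∧ (∃ x ∈ I.cands a.2 e, True) ∧ ∀ x ∈ I.cands a.2 e,
      e.1 = I.vertA a.2.u₁ x ∧ ∃ z ∈ I.S, (I.q₁ : ℤ) ∣ x + a.2.y + z ∧ (I.q₂ : ℤ) ∣ x + a.2.y + z ∧
        (I.q₃ : ℤ) ∣ x + a.2.y + z := by
  obtain ⟨h1, h2, h3⟩ := (I.mem_edgesAt ha.bound.1 ha.bound.2).1 he
  have hB := I.vertB_bound a.2.u₂ a.2.y
  have hw : (0 : ℤ) ≤ I.w * I.w := by positivity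
  have hτ : (0 : ℤ) < I.τ := by exact_mod_cast I.τ_pos
  rw [← ha.v_eq, ← h2] at hB
  rcases List.mem_append.1 h1 with h1' | h1'
  · have := (I.padEdges_bound h1').2.1
    linarith [hB.2]
  obtain ⟨z, hz, h1'⟩ := List.mem_flatMap.1 h1'
  have hb1 := (I.numEdges_bound h1').1
  refine ⟨h2, ?_, fun x hx => ?_⟩
  -- The tail of a reported edge has arrived, so it is the vertex of some number x of the query, and
  -- that x is a candidate.
  · obtain ⟨x, hx, hx3, hxe⟩ := ha.of_prev _ h3 (by
      rw [I.toV_val hb1.1 (lt_nv (by linarith [hb1.2]))]; exact hb1.2)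
    have hbx := I.vertA_bound a.2.u₁ x
    have := I.toV_inj hb1.1 (lt_nv (by linarith [hb1.2])) hbx.1 (lt_nv (by linarith [hbx.2])) hxe
    refine ⟨x, ?_, trivial⟩
    simp only [cands, List.mem_filter, decide_eq_true_eq]
    refine ⟨hx, ?_, ?_, hx3⟩
    · rw [this, vertA_div]
    · rw [this, vertA_mod]
      simp
  · simp only [cands, List.mem_filter, decide_eq_true_eq] at hx
    obtain ⟨hxS, hx1, hx2, hx3⟩ := hx
    simp only [numEdges, List.mem_map, List.mem_range] at h1'
    obtain ⟨i, hi, rfl⟩ := h1'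
    have hmz := I.mod_lt_w₂ z
    have hwp := I.w_pos
    simp only at hx1 hx2 h2
    rw [add_comm, Int.add_mul_ediv_right _ _ (by omega),
      Int.ediv_eq_zero_of_lt hmz.1 hmz.2, zero_add] at hx1
    rw [add_comm, Int.add_mul_emod_self_right, Int.emod_eq_of_lt hmz.1 hmz.2] at hx2
    rw [ha.v_eq, vertB] at h2
    have h4 := pair_inj (I.mod_lt_w₃ _).1 (I.mod_lt_w₃ _).2 (I.mod_lt_w₃ _).1 (I.mod_lt_w₃ _).2
      (add_left_cancel h2)
    refine ⟨?_, z, I.mem_of_mem_ins hz, ?_, ?_, ?_⟩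
    · simp only [vertA, hx1]
      congr 1
      have h5 : x ≡ a.2.u₁ - z % I.q₂ [ZMOD I.q₂] := hx2
      have h6 : z ≡ a.2.u₁ - x [ZMOD I.q₂] := by
        have := (Int.ModEq.refl a.2.u₁).sub h5
        rw [sub_sub_cancel] at this
        exact (Int.mod_modEq z _).symm.trans this.symm
      exact h6
    -- The head of the edge says -z-i ≡ y modulo q₁ and -z ≡ u₂+y modulo q₃, where i and u₂ are
    -- residues of x. Modulo q₂ the tail gives z ≡ u₁-x, and the query contains y because y ≡ -u₁.
    · have h5 : -z - x ≡ a.2.y [ZMOD I.q₁] := by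
        have h5 : -z - (i : ℤ) ≡ a.2.y [ZMOD I.q₁] := h4.1
        rw [← hx1] at h5
        exact ((Int.ModEq.refl (-z)).sub (Int.mod_modEq x _).symm).trans h5
      have := h5.dvd
      rwa [show a.2.y - (-z - x) = x + a.2.y + z by ring] at this
    · have h5 : x ≡ a.2.u₁ - z [ZMOD I.q₂] :=
        (show x ≡ a.2.u₁ - z % I.q₂ [ZMOD I.q₂] from hx2).trans
          ((Int.ModEq.refl _).sub (Int.mod_modEq z _))
      have h6 : a.2.y ≡ -a.2.u₁ [ZMOD I.q₂] := ha.hy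
      have := (h5.add h6).dvd
      rw [show a.2.u₁ - z + -a.2.u₁ - (x + a.2.y) = -(x + a.2.y + z) by ring] at this
      exact (dvd_neg).1 this
    · have h5 : -z ≡ a.2.u₂ + a.2.y [ZMOD I.q₃] := h4.2
      rw [← hx3] at h5
      have h6 : -z ≡ x + a.2.y [ZMOD I.q₃] := h5.trans ((Int.mod_modEq x _).add_right _)
      have := h6.dvd
      rwa [show x + a.2.y - -z = x + a.2.y + z by ring] at this

/-- A candidate determines its edge: the tail is its own vertex and the head is the vertex that
arrives. Hence no number is tested twice upon one arrival. -/
theorem IsTest.nodup {a : List (Fin I.graph.n) × Arrival} (ha : I.IsTest a) :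
    ((I.reported a).flatMap (I.cands a.2)).Nodup := by
  rw [List.nodup_flatMap]
  refine ⟨fun e _ => I.nodup.filter _, ?_⟩
  have h : (I.reported a).Nodup := I.graph.nodup_edgesAt _ _
  refine List.Pairwise.imp_of_mem (fun {e e'} he he' hne x hx hx' => hne ?_) h
  have h1 := ha.reported_spec he
  have h2 := ha.reported_spec he'
  exact Prod.ext ((h1.2.2 x hx).1.trans (h2.2.2 x hx').1.symm) (h1.1.trans h2.1.symm)

theorem IsTest.tests_eq {a : List (Fin I.graph.n) × Arrival} (ha : I.IsTest a) :
    I.tests a = ((I.reported a).flatMap (I.cands a.2)).toFinset.card := by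
  rw [List.toFinset_card_of_nodup ha.nodup, List.length_flatMap, tests]

theorem tests_le {a : List (Fin I.graph.n) × Arrival} (ha : a ∈ I.annotated) :
    I.tests a ≤ I.S.length := by
  rcases mem_annotated ha with ⟨h, -⟩ | h
  · simp [tests, h]
  · rw [h.tests_eq, ← List.toFinset_card_of_nodup I.nodup]
    refine Finset.card_le_card fun x hx => ?_
    simp only [List.mem_toFinset, List.mem_flatMap, cands, List.mem_filter] at hx ⊢
    obtain ⟨_, _, h, _⟩ := hx
    exact h

/-- Every reported edge has a candidate, so bounding the tests also bounds the output that the data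
structure is paid for. -/
theorem length_reported_le {a : List (Fin I.graph.n) × Arrival} (ha : a ∈ I.annotated) :
    (I.reported a).length ≤ I.tests a := by
  rcases mem_annotated ha with ⟨h, -⟩ | h
  · simp [h]
  · rw [tests]
    calc (I.reported a).length = ((I.reported a).map fun _ => 1).sum := by simp
      _ ≤ _ := by
        refine List.sum_le_sum fun e he => ?_
        obtain ⟨x, hx, -⟩ := (h.reported_spec he).2.1
        exact List.length_pos_of_mem hx

/-! ### Counting the tests up to the first solution -/

/-- Bound on the tests upon an arrival that does not find a solution. -/
def itemWeight (a : Arrival) : ℕ := if a.isB then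
  ∑ x ∈ I.S.toFinset.filter (fun x => x % I.q₃ = a.u₂),
    pairWeight I.S.toFinset I.q₁ I.q₂ I.q₃ x a.y else 0

/-- Let z be the stored number behind the edge of a candidate x. If x+y+z ≠ 0, the triple is false.
Otherwise -x-y = z is in the list, and as x and y are no solution, two of the three numbers
coincide. -/
theorem tests_le_itemWeight {a : List (Fin I.graph.n) × Arrival} (ha : a ∈ I.annotated)
    (hh : ¬ I.Hit a) : I.tests a ≤ I.itemWeight a.2 := by
  rcases mem_annotated ha with ⟨h, -⟩ | h
  · simp [tests, h]
  · rw [h.tests_eq, itemWeight, if_pos h.isB, Finset.card_eq_sum_ones]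
    refine (Finset.sum_le_sum (fun x hx => ?_)).trans (Finset.sum_le_sum_of_subset
      (fun x hx => ?_))
    · simp only [List.mem_toFinset, List.mem_flatMap] at hx
      obtain ⟨e, he, hx⟩ := hx
      obtain ⟨z, hz, h1, h2, h3⟩ := ((h.reported_spec he).2.2 x hx).2
      have hng : ¬ Good I.S x a.2.y := fun hg => hh ⟨e, he, x, hx, hg⟩
      unfold pairWeight
      by_cases hs : x + a.2.y + z = 0
      · have hz' : z = -x - a.2.y := by linarith
        subst hz'
        unfold Good at hng
        have : x = a.2.y ∨ a.2.y = -x - x ∨ x = -a.2.y - a.2.y := by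
          by_contra hc
          push Not at hc
          exact hng ⟨hc.1, hz, fun h => hc.2.1 (by linarith), fun h => hc.2.2 (by linarith)⟩
        rcases this with h | h | h
        · rw [if_pos h]; omega
        · rw [if_pos h]; omega
        · rw [if_pos h]; omega
      · have : 0 < (I.S.toFinset.filter fun z => x + a.2.y + z ≠ 0 ∧ (I.q₁ : ℤ) ∣ x + a.2.y + z ∧
            (I.q₂ : ℤ) ∣ x + a.2.y + z ∧ (I.q₃ : ℤ) ∣ x + a.2.y + z).card :=
          Finset.card_pos.2 ⟨z, Finset.mem_filter.2 ⟨List.mem_toFinset.2 hz, hs, h1, h2, h3⟩⟩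
        omega
    · simp only [List.mem_toFinset, List.mem_flatMap, cands, List.mem_filter,
        decide_eq_true_eq, Finset.mem_filter] at hx ⊢
      obtain ⟨_, _, h, _, _, h'⟩ := hx
      exact ⟨h, h'⟩

theorem sum_map_filter_eq (f : ℤ → ℕ) (p : ℤ → Prop) [DecidablePred p] :
    ((I.S.filter fun x => p x).map f).sum = ∑ x ∈ I.S.toFinset.filter p, f x := by
  rw [← List.sum_toFinset _ (I.nodup.filter _), List.toFinset_filter]
  simp

/-- By `hg` each number belongs to at most one of the q classes. -/
theorem sum_filter_unique {q : ℕ} (S : Finset ℤ) (g : ℕ → ℤ → ℤ) (f : ℤ → ℕ)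
    (hg : ∀ y, ∀ i < q, ∀ j < q, y % q = g i y → y % q = g j y → i = j) :
    ∑ i ∈ Finset.range q, ∑ y ∈ S.filter (fun y => y % q = g i y), f y ≤ ∑ y ∈ S, f y := by
  simp only [Finset.sum_filter]
  rw [Finset.sum_comm]
  refine Finset.sum_le_sum fun y _ => ?_
  rw [← Finset.sum_filter, Finset.sum_const, smul_eq_mul]
  calc _ ≤ 1 * f y := Nat.mul_le_mul_right _ (Finset.card_le_one.2 fun i hi j hj => by
        simp only [Finset.mem_filter, Finset.mem_range] at hi hj
        exact hg y i hi.1 j hj.1 hi.2 hj.2)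
    _ = f y := one_mul _

theorem neg_emod_inj {q i j : ℕ} (hi : i < q) (hj : j < q)
    (h : (-(i : ℤ)) % q = (-(j : ℤ)) % q) : i = j := by
  have := same_of_emod h
  rw [Int.emod_eq_of_lt (by positivity) (by omega),
    Int.emod_eq_of_lt (by positivity) (by omega)] at this
  omega

theorem sum_map_flatMap_range {α : Type*} (g : α → ℕ) (f : ℕ → List α) (n : ℕ) :
    (((List.range n).flatMap f).map g).sum = ∑ i ∈ Finset.range n, ((f i).map g).sum := by
  induction n with
  | zero => simp
  | succ n ih => rw [List.range_succ, Finset.sum_range_succ, ← ih]; simp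

/-- No pair (x, y) is met in two queries: u₂ is the residue of x modulo q₃, and u₁ is that of -y
modulo q₂. -/
theorem sum_itemWeight_le : (I.arrivals.map I.itemWeight).sum ≤
    (falseTriples I.S.toFinset I.q₁ I.q₂ I.q₃).card + 3 * I.S.length := by
  have hq : ∀ u₁ u₂ : ℤ, ((I.query u₁ u₂).map I.itemWeight).sum =
      ∑ y ∈ I.S.toFinset.filter (fun y => y % I.q₂ = (-u₁) % I.q₂),
        ∑ x ∈ I.S.toFinset.filter (fun x => x % I.q₃ = u₂),
          pairWeight I.S.toFinset I.q₁ I.q₂ I.q₃ x y := by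
    intro u₁ u₂
    simp only [query, List.map_cons, List.map_append, List.sum_cons, List.sum_append, listA, listB,
      List.map_map]
    have h1 : I.itemWeight (I.itemD u₁ u₂) = 0 := rfl
    have h2 : I.itemWeight ∘ I.itemA u₁ u₂ = fun _ => 0 := rfl
    have h3 : I.itemWeight ∘ I.itemB u₁ u₂ = fun y =>
        ∑ x ∈ I.S.toFinset.filter (fun x => x % I.q₃ = u₂),
          pairWeight I.S.toFinset I.q₁ I.q₂ I.q₃ x y := rfl
    rw [h1, h2, h3]
    simpa using sum_map_filter_eq _ _
  have hsum : (I.arrivals.map I.itemWeight).sum = ∑ i ∈ Finset.range I.q₂,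
      ∑ j ∈ Finset.range I.q₃, ((I.query (i : ℕ) (j : ℕ)).map I.itemWeight).sum := by
    unfold arrivals
    rw [sum_map_flatMap_range]
    exact Finset.sum_congr rfl fun i _ => sum_map_flatMap_range _ _ _
  rw [hsum]
  simp only [hq]
  have h1 : ∀ i ∈ Finset.range I.q₂, ∑ j ∈ Finset.range I.q₃,
      ∑ y ∈ I.S.toFinset.filter (fun y => y % I.q₂ = (-((i : ℕ) : ℤ)) % I.q₂),
        ∑ x ∈ I.S.toFinset.filter (fun x => x % I.q₃ = ((j : ℕ) : ℤ)),
          pairWeight I.S.toFinset I.q₁ I.q₂ I.q₃ x y ≤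
      ∑ y ∈ I.S.toFinset.filter (fun y => y % I.q₂ = (-((i : ℕ) : ℤ)) % I.q₂),
        ∑ x ∈ I.S.toFinset, pairWeight I.S.toFinset I.q₁ I.q₂ I.q₃ x y := by
    intro i _
    rw [Finset.sum_comm]
    refine Finset.sum_le_sum fun y _ => ?_
    exact sum_filter_unique _ (fun (j : ℕ) (_ : ℤ) => (j : ℤ)) _ fun y i _ j _ h h' => by omega
  refine (Finset.sum_le_sum h1).trans ?_
  refine (sum_filter_unique _ (fun (j : ℕ) (_ : ℤ) => (-(j : ℤ)) % I.q₂) _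
    fun y i hi j hj h h' => neg_emod_inj hi hj (h.symm.trans h')).trans ?_
  refine (sum_pairWeight_le _ _ _ _).trans ?_
  rw [List.toFinset_card_of_nodup I.nodup]

/-- Total number of tests until a solution is found. -/
theorem sum_tests_le : ((upTo I.Hit I.annotated).map I.tests).sum ≤
    (falseTriples I.S.toFinset I.q₁ I.q₂ I.q₃).card + 4 * I.S.length := by
  have := sum_upTo_le I.Hit I.tests (fun a => I.itemWeight a.2) I.S.length I.annotated
    (fun a ha h => tests_le_itemWeight ha h) (fun a ha => tests_le ha)
  have h2 : (I.annotated.map fun a => I.itemWeight a.2) = I.arrivals.map I.itemWeight := by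
    have := congrArg (List.map I.itemWeight)
      (map_snd_withPrev (fl := Arrival.fl) (vt := I.vt) [] I.arrivals)
    rwa [List.map_map] at this
  rw [h2] at this
  have := I.sum_itemWeight_le
  omega

/-- Solutions are found. -/
theorem exists_good_iff : (∃ x ∈ I.S, ∃ y ∈ I.S, Good I.S x y) ↔
    (∃ z ∈ I.rest, ∃ x ∈ I.S, Good I.S x z) ∨ ∃ a ∈ I.annotated, I.Hit a := by
  constructor
  · rintro ⟨x, hx, y, hy, hne, hz, hzx, hzy⟩
    -- The stored representative z may differ from -x-y. This does no harm: the edges depend on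
    -- residues only, and the test looks up -x-y itself.
    rcases (I.sel_spec I.S).2.2.2.1 _ hz with ⟨z, hzi, hs⟩ | h
    · right
      have hmy := mod_bound (-y) I.q₂_pos
      have hmx := mod_bound x I.q₃_pos
      -- The only query in which x and y meet.
      set u₁ := (-y) % I.q₂ with hu₁
      set u₂ := x % I.q₃ with hu₂
      have hu : y % I.q₂ = (-u₁) % I.q₂ := by
        have : -y ≡ u₁ [ZMOD I.q₂] := (Int.mod_modEq _ _).symm
        have := this.neg
        rw [neg_neg] at this
        exact this
      have hmem : I.itemB u₁ u₂ y ∈ I.arrivals := by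
        simp only [arrivals, List.mem_flatMap, List.mem_range]
        refine ⟨u₁.toNat, by omega, u₂.toNat, by omega, ?_⟩
        rw [Int.toNat_of_nonneg hmy.1, Int.toNat_of_nonneg hmx.1, query]
        refine List.mem_cons_of_mem _ (List.mem_append_right _ ?_)
        simp only [listB, List.mem_map, List.mem_filter, decide_eq_true_eq]
        exact ⟨y, ⟨hy, hu⟩, rfl⟩
      rw [← map_snd_withPrev (fl := Arrival.fl) (vt := I.vt) [] I.arrivals, List.mem_map] at hmem
      obtain ⟨a, ha, hae⟩ := hmem
      have hB : I.IsTest a := by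
        rcases mem_annotated ha with ⟨-, h⟩ | h
        · rw [hae] at h; simp [itemB] at h
        · exact h
      have e1 : a.2.u₁ = u₁ := by rw [hae]; rfl
      have e2 : a.2.u₂ = u₂ := by rw [hae]; rfl
      have e3 : a.2.y = y := by rw [hae]; rfl
      have hmod1 := mod_bound x I.q₁_pos
      have hz1 : z ≡ -x - y [ZMOD I.q₁] := hs.1
      have hz2 : z ≡ -x - y [ZMOD I.q₂] := hs.2.1
      have hz3 : z ≡ -x - y [ZMOD I.q₃] := hs.2.2
      have hm2 : (u₁ - x) % I.q₂ = z % I.q₂ := by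
        have : u₁ ≡ -y [ZMOD I.q₂] := Int.mod_modEq _ _
        have := this.sub_right x
        rw [show -y - x = -x - y by ring] at this
        exact this.trans hz2.symm
      have hedge : (I.vertA u₁ x, I.vertB u₂ y) ∈ I.allEdges := by
        refine List.mem_append_right _ (List.mem_flatMap.2 ⟨z, hzi, ?_⟩)
        simp only [numEdges, List.mem_map, List.mem_range]
        refine ⟨(x % I.q₁).toNat, by omega, ?_⟩
        rw [Int.toNat_of_nonneg hmod1.1]
        refine Prod.ext ?_ ?_
        · simp only [vertA, hm2]
        · simp only [vertB]
          have h1 : (-z - x % I.q₁) % I.q₁ = y % I.q₁ := by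
            have : -z - x % I.q₁ ≡ -(-x - y) - x [ZMOD I.q₁] := hz1.neg.sub (Int.mod_modEq _ _)
            rw [show -(-x - y) - x = y by ring] at this
            exact this
          have h2 : (-z) % I.q₃ = (u₂ + y) % I.q₃ := by
            have h : u₂ + y ≡ x + y [ZMOD I.q₃] := (Int.mod_modEq _ _).add_right _
            have := hz3.neg
            rw [show -(-x - y) = x + y by ring] at this
            exact this.trans h.symm
          rw [h1, h2]
      refine ⟨a, ha, (I.vertA u₁ x, I.vertB u₂ y), ?_, x, ?_, ?_⟩
      · refine (I.mem_edgesAt hB.bound.1 hB.bound.2).2 ⟨hedge, ?_, ?_⟩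
        · rw [hB.v_eq, e2, e3]
        · have := hB.prev x hx e2.symm
          rwa [e1] at this
      · simp only [cands, List.mem_filter, decide_eq_true_eq]
        refine ⟨hx, (vertA_div _ _).symm, ?_, e2.symm⟩
        rw [e1, vertA_mod, Int.sub_emod_emod, sub_sub_cancel]
      · rw [e3]; exact ⟨hne, hz, hzx, hzy⟩
    · left
      -- The exhaustive search finds the same solution with -x-y in the role of y, so that y is now
      -- the completing number.
      refine ⟨_, h, x, hx, fun h => hzx h.symm, ?_, ?_, ?_⟩
      · rw [show -x - (-x - y) = y by ring]; exact hy
      · rw [show -x - (-x - y) = y by ring]; exact hne.symm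
      · rw [show -x - (-x - y) = y by ring]; exact fun h => hzy h.symm
  · rintro (⟨z, hz, x, hx, hg⟩ | ⟨a, ha, e, he, x, hx, hg⟩)
    · exact ⟨x, hx, z, (I.sel_spec I.S).2.2.2.2.1.subset hz, hg⟩
    · rcases mem_annotated ha with ⟨h, -⟩ | h
      · rw [h] at he; simp at he
      · simp only [cands, List.mem_filter] at hx
        exact ⟨x, hx.1, a.2.y, h.y_mem, hg⟩

end Inst
end ISGLowerBound

namespace ISGLowerBound

/-! ## Rules for programs -/

namespace Term

/-- A check that an expression is admissible. -/
def chk : Term → Bool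
  | lit z => decide (z.natAbs ≤ 5)
  | var _ => true
  | bin o e e' => (match o with
      | .add | .sub | .mul | .div | .mod | .lt | .eq => true
      | _ => false) && e.chk && e'.chk
  | get _ e => e.chk

theorem plain_of_chk {e : Term} (h : e.chk = true) : e.Plain := by
  induction e with
  | lit z =>
    simp only [chk, decide_eq_true_eq] at h
    simp only [Plain, Int.abs_eq_natAbs]; omega
  | var => trivial
  | get a e ih => exact ih h
  | bin o e e' ih ih' =>
    simp only [chk, Bool.and_eq_true] at h
    refine ⟨?_, ih h.1.2, ih' h.2⟩
    cases o <;> simp_all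

end Term

instance : Add Term := ⟨Term.bin .add⟩
instance : Sub Term := ⟨Term.bin .sub⟩
instance : Mul Term := ⟨Term.bin .mul⟩
instance : Div Term := ⟨Term.bin .div⟩
instance : Mod Term := ⟨Term.bin .mod⟩

/-- Comparison of expressions. -/
def ltT (e₁ e₂ : Term) : Term := .bin .lt e₁ e₂
/-- Equality test of expressions. -/
def eqT (e₁ e₂ : Term) : Term := .bin .eq e₁ e₂

section eval
variable (σ : Store) (e e' : Term)
@[simp] theorem eval_lit (z : ℤ) : (Term.lit z).eval σ = z := rfl
@[simp] theorem eval_var (j : ℕ) : (Term.var j).eval σ = σ.var j := rfl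
@[simp] theorem eval_get (a : ℕ) : (Term.get a e).eval σ = σ.arr a (e.eval σ) := rfl
@[simp] theorem eval_add : (e + e').eval σ = e.eval σ + e'.eval σ := rfl
@[simp] theorem eval_sub : (e - e').eval σ = e.eval σ - e'.eval σ := rfl
@[simp] theorem eval_mul : (e * e').eval σ = e.eval σ * e'.eval σ := rfl
@[simp] theorem eval_div : (e / e').eval σ = e.eval σ / e'.eval σ := rfl
@[simp] theorem eval_mod : (e % e').eval σ = e.eval σ % e'.eval σ := rfl
@[simp] theorem eval_ltT : (ltT e e').eval σ = if e.eval σ < e'.eval σ then 1 else 0 := rfl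
@[simp] theorem eval_eqT : (eqT e e').eval σ = if e.eval σ = e'.eval σ then 1 else 0 := rfl
end eval

/-- Powers of an expression. -/
def powT (e : Term) : ℕ → Term
  | 0 => .lit 1
  | t + 1 => powT e t * e

@[simp] theorem eval_powT (σ : Store) (e : Term) (t : ℕ) : (powT e t).eval σ = e.eval σ ^ t := by
  induction t with
  | zero => rw [pow_zero]; rfl
  | succ t ih => rw [powT, eval_mul, ih, pow_succ]

theorem chk_powT {e : Term} (h : e.chk = true) (t : ℕ) : (powT e t).chk = true := by
  induction t with
  | zero => rfl
  | succ t ih =>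
    change (true && (powT e t).chk && e.chk) = true
    simp [ih, h]

theorem deg_powT (e : Term) (t : ℕ) : (powT e t).deg = 1 + t * e.deg := by
  induction t with
  | zero => simp [powT, Term.deg]
  | succ t ih =>
    change (powT e t).deg + e.deg = _
    rw [ih]; ring

theorem size_powT (e : Term) (t : ℕ) : (powT e t).size = 1 + t * (e.size + 3) := by
  induction t with
  | zero => simp [powT, Term.size]
  | succ t ih =>
    change (powT e t).size + e.size + 3 = _
    rw [ih]; ring

section rules
variable {β : Bds} {d : ℕ} {c c' : Cmd} {σ : Store} {t t' : ℕ} {Q Q' : Store → Prop} {e i : Term}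

/-- In this and the following rules the conditions on the shape of an expression are closed
computations and are discharged by default. Degree 20 suffices for every expression without
parameters; expressions with powers supply their own bounds. -/
theorem run_asg {j : ℕ} (hz : σ.Small β.X → |e.eval σ| ≤ β.X)
    (h : Ok β d c (σ.setVar j (e.eval σ)) t Q) (he : e.chk = true := by rfl)
    (hβ : e.deg ≤ β.e := by exact le_trans (by decide) (Bds.deg_le _)) :
    Ok β d (.seq (asg j e) c) σ (e.size + 5 + t) Q := Ok.of_small fun hσ =>
  (ok_seq (ok_asg (Q := (· = _)) (Term.plain_of_chk he) hβ (hz hσ) rfl)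
    (fun σ' hσ' => by subst hσ'; exact h)).mono (by omega) fun _ => id

theorem run_sto {a : ℕ}
    (hz : σ.Small β.X → |e.eval σ| ≤ β.X)
    (h : Ok β d c (σ.setArr a (i.eval σ) (e.eval σ)) t Q) (hi : i.chk = true := by rfl)
    (he : e.chk = true := by rfl)
    (hβ : e.deg ≤ β.e := by exact le_trans (by decide) (Bds.deg_le _))
    (hi' : i.deg ≤ β.e := by exact le_trans (by decide) (Bds.deg_le _)) :
    Ok β d (.seq (sto a i e) c) σ (i.size + e.size + 4 + t) Q := Ok.of_small fun hσ =>
  (ok_seq (ok_sto (Q := (· = _)) (Term.plain_of_chk hi) hi' (Term.plain_of_chk he) hβ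
    (hz hσ) rfl) (fun σ' hσ' => by subst hσ'; exact h)).mono (by omega) fun _ => id

theorem run_asgD {r : ℕ} (hz : σ.Small β.X → |e.eval σ| ≤ β.X)
    (h : Ok β d c (σ.setDs (σ.ds.setReg r (e.eval σ))) t Q) (he : e.chk = true := by rfl)
    (hβ : e.deg ≤ β.e := by exact le_trans (by decide) (Bds.deg_le _)) :
    Ok β d (.seq (asgD r e) c) σ (e.size + 5 + t) Q := Ok.of_small fun hσ =>
  (ok_seq (ok_asgD (Q := (· = _)) (Term.plain_of_chk he) hβ (hz hσ) rfl)
    (fun σ' hσ' => by subst hσ'; exact h)).mono (by omega) fun _ => id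

theorem run_stoD {a : ℕ}
    (hz : σ.Small β.X → |e.eval σ| ≤ β.X)
    (h : Ok β d c (σ.setDs (σ.ds.setArr a (i.eval σ) (e.eval σ))) t Q)
    (hi : i.chk = true := by rfl) (he : e.chk = true := by rfl)
    (hβ : e.deg ≤ β.e := by exact le_trans (by decide) (Bds.deg_le _))
    (hi' : i.deg ≤ β.e := by exact le_trans (by decide) (Bds.deg_le _)) :
    Ok β d (.seq (stoD a i e) c) σ (i.size + e.size + 4 + t) Q := Ok.of_small fun hσ =>
  (ok_seq (ok_stoD (Q := (· = _)) (Term.plain_of_chk hi) hi' (Term.plain_of_chk he) hβ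
    (hz hσ) rfl) (fun σ' hσ' => by subst hσ'; exact h)).mono (by omega) fun _ => id

theorem run_ite (h1 : e.eval σ ≠ 0 → Ok β d c σ t Q)
    (h2 : e.eval σ = 0 → Ok β d c' σ t' Q) (he : e.chk = true := by rfl)
    (hβ : e.deg ≤ β.e := by exact le_trans (by decide) (Bds.deg_le _)) :
    Ok β d (iteC e c c') σ (e.size + 2 + max t t') Q :=
  ok_ite (Term.plain_of_chk he) hβ
    (fun h => (h1 h).mono (le_max_left _ _) fun _ => id)
    (fun h => (h2 h).mono (le_max_right _ _) fun _ => id)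

end rules

/-! ### Which variables and arrays change -/

/-- Whether a register may be written. -/
def okReg (V : List ℕ) (D : Bool) (r : ℕ) : Bool :=
  decide (r % 2 = 1) || (decide (r % 4 = 0) && V.contains (r / 4)) || (D && decide (r % 4 = 2))

/-- Whether an array may be written. -/
def okArr (A : List ℕ) (D : Bool) (a : ℕ) : Bool :=
  (decide (a % 2 = 0) && A.contains (a / 2)) || (D && decide (a % 2 = 1))

/-- Only the given variables and arrays, and if `D` the simulated machine, may be written. -/
def Cmd.touches (V A : List ℕ) (D : Bool) : Cmd → Bool
  | .const r _ => okReg V D r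
  | .op r _ _ _ => okReg V D r
  | .load r _ _ => okReg V D r
  | .store a _ _ => okArr A D a
  | .rand r _ => okReg V D r
  | .emit _ _ => true
  | .seq c d => c.touches V A D && d.touches V A D
  | .ite _ c d => c.touches V A D && d.touches V A D
  | .loop _ c => c.touches V A D

theorem touches_code (V A : List ℕ) (D : Bool) (e : Term) (j : ℕ) :
    (e.code j).touches V A D = true := by
  have : ∀ j, okReg V D (tmp j) = true := fun j => by
    have : tmp j % 2 = 1 := by simp only [tmp]; omega
    simp [okReg, this]
  induction e generalizing j <;> simp_all [Term.code, Cmd.touches]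

/-- Only the given variables and arrays, and if `D` the simulated machine, have changed. -/
structure Frame (V A : List ℕ) (D : Bool) (σ σ' : Store) : Prop where
  var : ∀ j, V.contains j = false → σ'.var j = σ.var j
  arr : ∀ a, A.contains a = false → σ'.arr a = σ.arr a
  reg : D = false → σ'.ds.reg = σ.ds.reg
  darr : D = false → σ'.ds.arr = σ.ds.arr

theorem Frame.refl (V A : List ℕ) (D : Bool) (σ : Store) : Frame V A D σ σ :=
  ⟨fun _ _ => rfl, fun _ _ => rfl, fun _ => rfl, fun _ => rfl⟩

theorem Frame.trans {V A : List ℕ} {D : Bool} {σ σ' σ'' : Store} (h : Frame V A D σ σ')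
    (h' : Frame V A D σ' σ'') : Frame V A D σ σ'' :=
  ⟨fun j hj => (h'.var j hj).trans (h.var j hj), fun a ha => (h'.arr a ha).trans (h.arr a ha),
    fun hD => (h'.reg hD).trans (h.reg hD), fun hD => (h'.darr hD).trans (h.darr hD)⟩

theorem step_touches {V A : List ℕ} {D : Bool} {k : List Cmd} {s : State} {z : Config}
    (h : ∀ c ∈ k, c.touches V A D = true) (hz : z ∈ (step (k, s)).support) :
    (∀ c ∈ z.1, c.touches V A D = true) ∧
      (∀ r, okReg V D r = false → z.2.reg r = s.reg r) ∧
      ∀ a, okArr A D a = false → z.2.arr a = s.arr a := by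
  have hreg : ∀ r x, okReg V D r = true →
      ∀ r', okReg V D r' = false → (s.setReg r x).reg r' = s.reg r' := fun r x hr r' hr' => by
    rw [State.setReg_reg, if_neg]; rintro rfl; rw [hr] at hr'; cases hr'
  rcases k with _ | ⟨c, k⟩
  · simp only [step, PMF.mem_support_pure_iff] at hz
    subst hz
    exact ⟨h, fun _ _ => rfl, fun _ _ => rfl⟩
  have hc := h c (by simp)
  have hk : ∀ c ∈ k, c.touches V A D = true := fun c hc => h c (by simp [hc])
  cases c with
  | const r x =>
    simp only [step, PMF.mem_support_pure_iff] at hz; subst hz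
    exact ⟨hk, hreg r _ hc, fun _ _ => rfl⟩
  | op r o x y =>
    simp only [step, PMF.mem_support_pure_iff] at hz; subst hz
    exact ⟨hk, hreg r _ hc, fun _ _ => rfl⟩
  | load r a i =>
    simp only [step, PMF.mem_support_pure_iff] at hz; subst hz
    exact ⟨hk, hreg r _ hc, fun _ _ => rfl⟩
  | store a i x =>
    simp only [step, PMF.mem_support_pure_iff] at hz; subst hz
    refine ⟨hk, fun _ _ => rfl, fun a' ha' => ?_⟩
    rw [State.setArr_arr, if_neg]; rintro rfl
    have : okArr A D a' = true := hc
    rw [this] at ha'; cases ha'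
  | rand r x =>
    simp only [step, PMF.mem_support_map_iff] at hz
    obtain ⟨j, -, rfl⟩ := hz
    exact ⟨hk, hreg r _ hc, fun _ _ => rfl⟩
  | emit x y =>
    simp only [step, PMF.mem_support_pure_iff] at hz; subst hz
    exact ⟨hk, fun _ _ => rfl, fun _ _ => rfl⟩
  | seq c d =>
    simp only [step, PMF.mem_support_pure_iff] at hz; subst hz
    simp only [Cmd.touches, Bool.and_eq_true] at hc
    refine ⟨?_, fun _ _ => rfl, fun _ _ => rfl⟩
    intro c' hc'
    simp only [List.mem_cons] at hc'
    rcases hc' with rfl | rfl | h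
    exacts [hc.1, hc.2, hk _ h]
  | ite x c d =>
    simp only [step, PMF.mem_support_pure_iff] at hz; subst hz
    simp only [Cmd.touches, Bool.and_eq_true] at hc
    refine ⟨?_, fun _ _ => rfl, fun _ _ => rfl⟩
    intro c' hc'
    dsimp only at hc'
    split_ifs at hc' <;> simp only [List.mem_cons] at hc' <;> rcases hc' with rfl | h
    exacts [hc.1, hk _ h, hc.2, hk _ h]
  | loop x c =>
    simp only [step, PMF.mem_support_pure_iff] at hz; subst hz
    refine ⟨?_, fun _ _ => rfl, fun _ _ => rfl⟩
    intro c' hc'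
    dsimp only at hc'
    split_ifs at hc' with h0
    · simp only [List.mem_cons] at hc'
      rcases hc' with rfl | rfl | h
      exacts [hc, hc, hk _ h]
    · exact hk _ hc'

/-- Two final costs need to be compared only on states whose protected memory is that of `s₀`, since
no other state is reached by commands that leave this memory alone. -/
theorem costUpTo_congr_final {B : ℕ} {F G : State → ℝ≥0∞} {V A : List ℕ} {D : Bool} (s₀ : State)
    (hFG : ∀ s, (∀ r, okReg V D r = false → s.reg r = s₀.reg r) →
      (∀ a, okArr A D a = false → s.arr a = s₀.arr a) → F s ≤ G s) (t : ℕ) (z : Config)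
    (h : ∀ c ∈ z.1, c.touches V A D = true)
    (h1 : ∀ r, okReg V D r = false → z.2.reg r = s₀.reg r)
    (h2 : ∀ a, okArr A D a = false → z.2.arr a = s₀.arr a) :
    costUpTo B F t z ≤ costUpTo B G t z := by
  induction t generalizing z with
  | zero => simp [costUpTo]
  | succ t ih =>
    obtain ⟨k, s⟩ := z
    rcases k with _ | ⟨c, k⟩
    · simp only [costUpTo]
      split_ifs
      exacts [hFG s h1 h2, le_rfl]
    · simp only [costUpTo]
      split_ifs
      · gcongr
        refine ex_mono fun z hz => ?_
        obtain ⟨a, b, c⟩ := step_touches h hz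
        exact ih z a (fun r hr => (b r hr).trans (h1 r hr)) fun a ha => (c a ha).trans (h2 a ha)
      · exact le_rfl

section frame
variable {β : Bds} {d : ℕ} {c : Cmd} {σ : Store} {t : ℕ} {Q : Store → Prop} {V A : List ℕ} {D : Bool}

/-- Everything that is not written remains as it is. -/
theorem Ok.frame (h : Ok β d c σ t Q) (hc : c.touches V A D = true) :
    Ok β d c σ t fun σ' => Q σ' ∧ Frame V A D σ σ' := by
  classical
  intro ρ F T hF s hs hl
  let P : State → Prop := fun s' => (∀ r, okReg V D r = false → s'.reg r = s.reg r) ∧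
      (∀ a, okArr A D a = false → s'.arr a = s.arr a)
  -- The continuation is replaced by zero on states whose protected memory has changed. Such states
  -- do not occur, and afterwards the triple has to be used only where the frame property holds.
  refine le_trans (iSup_mono fun t => costUpTo_congr_final (V := V) (A := A) (D := D)
    (G := fun s' => if P s' then F s' else 0) s (fun s' h1 h2 => ?_) t _ ?_ ?_ ?_)
    (h ρ (fun s' => if P s' then F s' else 0) T (fun σ' hσ' s' hs' hl' => ?_) s hs hl)
  · have : P s' := ⟨h1, h2⟩
    simp [this]
  · simpa using hc
  · exact fun _ _ => rfl
  · exact fun _ _ => rfl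
  · dsimp only
    split_ifs with hP
    · refine hF σ' ⟨hσ', fun j hj => ?_, fun a ha => ?_, fun hD => ?_, fun hD => ?_⟩ s' hs' hl'
      · rw [← hs'.var, ← hs.var, hP.1]
        have e1 : 4 * j % 2 = 0 := by omega
        have e3 : 4 * j % 4 = 0 := by omega
        simp [okReg, e1, e3] at hj ⊢
        exact hj
      · rw [← hs'.arr, ← hs.arr, hP.2]
        have e1 : 2 * a % 2 = 0 := by omega
        simp [okArr] at ha ⊢
        exact ha
      · funext r
        rw [← hs'.dreg, ← hs.dreg, hP.1]
        have e1 : (4 * r + 2) % 2 = 0 := by omega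
        have e2 : (4 * r + 2) % 4 = 2 := by omega
        simp [okReg, e1, e2, hD]
      · funext a
        rw [← hs'.darr, ← hs.darr, hP.2]
        have e2 : (2 * a + 1) % 2 = 1 := by omega
        simp [okArr, e2, hD]
    · exact zero_le

/-- A loop with constant time bound for the body. -/
theorem run_for {j : ℕ} {N : ℕ} {e : Term} (Inv : ℕ → Store → Prop) {w : ℕ}
    (V A : List ℕ) (D : Bool)
    (hN : e.eval σ = N) (hNX : σ.Small β.X → N ≤ β.X)
    (h0 : Inv 0 σ)
    (hbody : ∀ i < N, ∀ σ', Inv i σ' → Frame V A D σ σ' →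
      Ok β (d + 1) c (σ'.setVar j i) w (Inv (i + 1)))
    (hc : c.touches V A D = true := by rfl) (hj : V.contains j = true := by rfl)
    (he : e.chk = true := by rfl)
    (hd : e.deg ≤ β.e := by exact le_trans (by decide) (Bds.deg_le _)) :
    Ok β d (forC d j e c) σ (e.size + 10 + N * (w + loopCost))
      (fun σ' => Inv N σ' ∧ Frame V A D σ σ') := Ok.of_small fun hσ => by
  refine (ok_for (Inv := fun i σ' => Inv i σ' ∧ Frame V A D σ σ') (w := fun _ => w)
    (Term.plain_of_chk he) hd hN (hNX hσ) ⟨h0, Frame.refl _ _ _ _⟩ fun i hi σ' hσ' => ?_).mono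
    (by simp) fun _ => id
  refine ((hbody i hi σ' hσ'.1 hσ'.2).frame hc).mono le_rfl fun σ'' h => ⟨h.1, hσ'.2.trans ?_⟩
  refine ⟨fun k hk => ?_, h.2.arr, h.2.reg, h.2.darr⟩
  rw [h.2.var k hk, Store.setVar_var, if_neg]
  rintro rfl
  rw [hj] at hk; cases hk

/-- A loop with varying time bounds for the body. -/
theorem run_for' {j : ℕ} {N : ℕ} {e : Term} (Inv : ℕ → Store → Prop) (w : ℕ → ℕ)
    (V A : List ℕ) (D : Bool)
    (hN : e.eval σ = N) (hNX : σ.Small β.X → N ≤ β.X)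
    (h0 : Inv 0 σ)
    (hbody : ∀ i < N, ∀ σ', Inv i σ' → Frame V A D σ σ' →
      Ok β (d + 1) c (σ'.setVar j i) (w i) (Inv (i + 1)))
    (hc : c.touches V A D = true := by rfl) (hj : V.contains j = true := by rfl)
    (he : e.chk = true := by rfl)
    (hd : e.deg ≤ β.e := by exact le_trans (by decide) (Bds.deg_le _)) :
    Ok β d (forC d j e c) σ (e.size + 10 + ∑ i ∈ Finset.range N, (w i + loopCost))
      (fun σ' => Inv N σ' ∧ Frame V A D σ σ') := Ok.of_small fun hσ => by
  refine (ok_for (Inv := fun i σ' => Inv i σ' ∧ Frame V A D σ σ') (w := w)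
    (Term.plain_of_chk he) hd hN (hNX hσ) ⟨h0, Frame.refl _ _ _ _⟩ fun i hi σ' hσ' => ?_).mono
    le_rfl fun _ => id
  refine ((hbody i hi σ' hσ'.1 hσ'.2).frame hc).mono le_rfl fun σ'' h => ⟨h.1, hσ'.2.trans ?_⟩
  refine ⟨fun k hk => ?_, h.2.arr, h.2.reg, h.2.darr⟩
  rw [h.2.var k hk, Store.setVar_var, if_neg]
  rintro rfl
  rw [hj] at hk; cases hk

theorem ok_done (hQ : Q σ) : Ok β d skipC σ 1 Q := ok_skip hQ

end frame

/-- What the simulated machine has reported is not part of the memory. -/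
theorem Bnd.setOut {β : Bds} {d : ℕ} {ρ : ℕ → ℤ} {F : State → ℝ≥0∞} {σ : Store} {T : ℝ≥0∞}
    (o : List (ℤ × ℤ)) (h : Bnd β d ρ F (σ.setDs { σ.ds with out := o }) T) : Bnd β d ρ F σ T :=
  fun s hs hl => h s (hs.setDs rfl rfl) hl

/-- A random choice. -/
theorem bnd_rand {β : Bds} {d : ℕ} {ρ : ℕ → ℤ} {F : State → ℝ≥0∞} {σ : Store} {j x N : ℕ}
    {T : ℕ → ℝ≥0∞} (hN : 0 < N) (hx : σ.var x = N)
    (h : ∀ i < N, Bnd β d ρ F (σ.setVar j i) (T i)) :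
    Bnd β d ρ (wp β.B (.rand (4 * j) (4 * x)) F) σ
      (1 + (N : ℝ≥0∞)⁻¹ * ∑ i ∈ Finset.range N, T i) := fun s hs hl => by
  refine (wp_rand_le hN hs.bdd (by rw [hs.var, hx])).trans ?_
  gcongr with i hi
  have hi := Finset.mem_range.1 hi
  have hNX : (N : ℤ) ≤ β.X := by rw [← hx]; exact (le_abs_self _).trans (hs.small.1 x)
  exact h i hi _ (hs.setVar j (by rw [abs_of_nonneg (by positivity)]; omega))
    (hl.setReg (fun k _ => by simp only [ctr, lim]; omega) _)

theorem bnd_seq {β : Bds} {d : ℕ} {ρ : ℕ → ℤ} {F : State → ℝ≥0∞} {σ : Store} {T : ℝ≥0∞}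
    {c c' : Cmd} (h : Bnd β d ρ (wp β.B c (wp β.B c' F)) σ T) :
    Bnd β d ρ (wp β.B (.seq c c') F) σ (1 + T) := fun s hs hl =>
  wp_seq_le_of hs.bdd (h s hs hl)

/-- Truth values. -/
def Flag (σ : Store) (j : ℕ) (P : Prop) : Prop := (σ.var j = 0 ∧ ¬ P) ∨ (σ.var j = 1 ∧ P)

theorem Flag.congr {σ σ' : Store} {j : ℕ} {P P' : Prop} (h : Flag σ j P)
    (hv : σ'.var j = σ.var j) (hP : P ↔ P') : Flag σ' j P' := by
  unfold Flag at *; rw [hv, ← hP]; exact h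

theorem Flag.of_true {σ : Store} {j : ℕ} {P : Prop} (hv : σ.var j = 1) (hP : P) : Flag σ j P :=
  .inr ⟨hv, hP⟩

theorem cells_append (l : List ℤ) (x : ℤ) :
    Function.update (cells l) (l.length : ℤ) x = cells (l ++ [x]) := by
  funext i
  rw [Function.update_apply]
  unfold cells
  split_ifs with h1 h2 h2
  · subst h1; simp
  · subst h1; simp at h2
  · rcases lt_trichotomy i.toNat l.length with h | h | h
    · rw [List.getD_append _ _ _ _ h]
    · exfalso; omega
    · rw [List.getD_eq_default _ _ h.le, List.getD_eq_default]; simp; omega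
  · rfl

theorem cells_getElem (l : List ℤ) (i : ℕ) (h : i < l.length) : cells l (i : ℤ) = l[i] := by
  simp [cells, h]

end ISGLowerBound

namespace ISGLowerBound

/-! ## The reduction: preparations -/

open Term (lit var get)

/-- The different numbers of the list. -/
def distinct (l : List ℤ) : List ℤ := l.reverse.dedup.reverse

theorem distinct_append_of_mem {l : List ℤ} {x : ℤ} (h : x ∈ l) :
    distinct (l ++ [x]) = distinct l := by
  simp [distinct, List.dedup_cons_of_mem (List.mem_reverse.2 h)]

theorem distinct_append_of_notMem {l : List ℤ} {x : ℤ} (h : x ∉ l) :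
    distinct (l ++ [x]) = distinct l ++ [x] := by
  simp [distinct, List.dedup_cons_of_notMem (mt List.mem_reverse.1 h)]

theorem nodup_distinct (l : List ℤ) : (distinct l).Nodup :=
  List.nodup_reverse.2 (List.nodup_dedup _)

@[simp] theorem mem_distinct {l : List ℤ} {x : ℤ} : x ∈ distinct l ↔ x ∈ l := by
  simp [distinct]

theorem length_distinct_le (l : List ℤ) : (distinct l).length ≤ l.length := by
  rw [distinct, List.length_reverse]
  exact ((List.dedup_sublist _).length_le).trans (by simp)

/-- Count every number in array `3`, and list the different numbers in array `4`. -/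
def distinctC : Cmd :=
  forC 0 17 (var 0) <|
    .seq (asg 20 (get 0 (var 17))) <|
    iteC (get 3 (var 20))
      (.seq (sto 3 (var 20) (get 3 (var 20) + lit 1)) skipC)
      (.seq (sto 3 (var 20) (get 3 (var 20) + lit 1)) <|
       .seq (sto 4 (var 3) (var 20)) <|
       .seq (asg 3 (var 3 + lit 1)) skipC)

variable {β : Bds} {l : List ℤ} {σ : Store}

theorem take_succ_eq (l : List ℤ) {i : ℕ} (hi : i < l.length) :
    l.take (i + 1) = l.take i ++ [l[i]] := by simp

theorem count_append_eq (l : List ℤ) (x : ℤ) :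
    (fun v => ((l ++ [x]).count v : ℤ)) =
      Function.update (fun v => (l.count v : ℤ)) x ((l.count x : ℤ) + 1) := by
  funext v
  rw [Function.update_apply, List.count_append, List.count_singleton]
  split_ifs with h h' h'
  · subst h'; simp
  · simp at h; exact absurd h.symm h'
  · simp at h; exact absurd h'.symm h
  · simp

/-- Arrays are addressed by arbitrary words, negative ones included, so the count of a number is
stored under the number itself; this table later decides membership in one step. -/
theorem ok_distinct (h0 : σ.arr 0 = cells l) (hn : σ.var 0 = l.length)
    (h3 : σ.arr 3 = fun _ => 0) (h4 : σ.arr 4 = cells []) (hns : σ.var 3 = 0) :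
    Ok β 0 distinctC σ (100 * (l.length + 1)) fun σ' =>
      (σ'.arr 3 = (fun v => (l.count v : ℤ)) ∧ σ'.arr 4 = cells (distinct l) ∧
        σ'.var 3 = (distinct l).length) ∧ Frame [17, 20, 3] [3, 4] false σ σ' := by
  have hlX : σ.Small β.X → l.length ≤ β.X := fun h => by
    have := (le_abs_self _).trans (h.1 0); rw [hn] at this; exact_mod_cast this
  refine Ok.of_small fun hσ => ?_
  refine (run_for (σ := σ) (N := l.length) (e := var 0) (fun i σ' => σ'.arr 3 = (fun v => ((l.take i).count v : ℤ)) ∧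
    σ'.arr 4 = cells (distinct (l.take i)) ∧ σ'.var 3 = (distinct (l.take i)).length)
    [17, 20, 3] [3, 4] false hn hlX ⟨by simpa using h3, by simpa [distinct] using h4,
    by simpa [distinct] using hns⟩
    (w := 80) ?_).mono ?_ fun σ' h => ?_
  · intro i hi σ' ⟨a3, a4, v3⟩ hf
    rw [take_succ_eq l hi]
    have hl := hlX hσ
    have hx : σ'.arr 0 i = l[i] := by
      rw [hf.arr 0 rfl, h0, cells_getElem _ _ hi]
    have hc : (l.take i).count l[i] ≤ i := (List.count_le_length).trans (by simp)
    have hd : (distinct (l.take i)).length ≤ i := (length_distinct_le _).trans (by simp)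
    refine (run_asg (fun h => h.2 _ _) (run_ite (fun h => run_sto (fun _ => ?_) (ok_done ?_))
      fun h => run_sto (fun _ => ?_) (run_sto (fun h => ?_)
        (run_asg (fun _ => ?_) (ok_done ?_))))).mono (by decide) fun _ => id
    · simp [hx, a3]; rw [abs_of_nonneg (by positivity)]; omega
    · have hm : l[i] ∈ l.take i := by
        by_contra hm
        apply h; simp [hx, a3, List.count_eq_zero_of_not_mem hm]
      rw [distinct_append_of_mem hm, count_append_eq]
      simp [hx, a3, a4, v3]
    · simp [hx, a3]; rw [abs_of_nonneg (by positivity)]; omega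
    · simpa using h.1 20
    · simp [v3]; rw [abs_of_nonneg (by positivity)]; omega
    · have hm : l[i] ∉ l.take i := by
        intro hm
        simp [hx, a3, List.count_eq_zero] at h
        exact h hm
      rw [distinct_append_of_notMem hm, count_append_eq]
      simp [hx, a3, a4, v3, cells_append]
  · simp [Term.size, loopCost]; omega
  · simpa using h

/-- A number that occurs repeatedly and is part of a solution. -/
def Dup (l : List ℤ) (x : ℤ) : Prop :=
  1 < l.count x ∧ (if x = 0 then 2 else 0) < l.count (-x - x)

/-- Look for solutions with repeated numbers. -/
def dupC : Cmd :=
  forC 0 17 (var 0) <|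
    .seq (asg 20 (get 0 (var 17))) <|
    iteC (ltT (lit 1) (get 3 (var 20)) *
        ltT (lit 2 * eqT (var 20) (lit 0)) (get 3 (lit 0 - var 20 - var 20)))
      (.seq (asg 4 (lit 1)) skipC)
      skipC

theorem exists_mem_take_succ {α : Type*} {l : List α} {i : ℕ} (hi : i < l.length) (P : α → Prop) :
    (∃ x ∈ l.take (i + 1), P x) ↔ (∃ x ∈ l.take i, P x) ∨ P l[i] := by
  rw [List.take_succ_eq_append_getElem hi]
  simp only [List.mem_append, List.mem_singleton, or_and_right, exists_or, exists_eq_left]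

theorem ok_dup (h0 : σ.arr 0 = cells l) (hn : σ.var 0 = l.length)
    (h3 : σ.arr 3 = (fun v => (l.count v : ℤ))) (h4 : σ.var 4 = 0) :
    Ok β 0 dupC σ (100 * (l.length + 1)) fun σ' =>
      Flag σ' 4 (∃ x ∈ l, Dup l x) ∧ Frame [17, 20, 4] [] false σ σ' := by
  have hlX : σ.Small β.X → l.length ≤ β.X := fun h => by
    have := (le_abs_self _).trans (h.1 0); rw [hn] at this; exact_mod_cast this
  refine (run_for (σ := σ) (N := l.length) (e := var 0)
    (fun i σ' => Flag σ' 4 (∃ x ∈ l.take i, Dup l x))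
    [17, 20, 4] [] false hn hlX (.inl ⟨h4, by simp⟩) (w := 80) ?_).mono ?_ fun σ' h => ?_
  · intro i hi σ' h hf
    have hx : σ'.arr 0 i = l[i] := by
      rw [hf.arr 0 rfl, h0, cells_getElem _ _ hi]
    rw [exists_mem_take_succ hi]
    refine (run_asg (fun h => h.2 _ _) (run_ite (fun h => run_asg (fun _ => ?_) (ok_done ?_))
      fun h' => ok_done ?_)).mono (by decide) fun _ => id
    · have := β.five_le; simp; omega
    · refine .of_true (by simp) (.inr ?_)
      simp [hx, hf.arr 3 rfl, h3] at h
      refine ⟨by exact_mod_cast h.2, ?_⟩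
      have := h.1
      split_ifs at this ⊢ <;> simpa using this
    · refine h.congr (by simp) (by
        rw [or_iff_left]
        rintro ⟨h1, h2⟩
        simp [hx, hf.arr 3 rfl, h3] at h'
        split_ifs at h2 h' with h0
        all_goals exact absurd h1 (by have := h' (by simpa using h2); omega))
  · simp [Term.size, loopCost]; omega
  · simpa using h

theorem card_positions (l : List ℤ) (x : ℤ) :
    (Finset.univ.filter fun i : Fin l.length => l.get i = x).card = l.count x :=
  Fin.card_filter_univ_eq_vector_get_eq_count x (⟨l, rfl⟩ : List.Vector ℤ l.length)

/-- Positions can be forgotten. -/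
theorem hasThreeSum_iff (l : List ℤ) : HasThreeSum l ↔ (∃ x ∈ l, Dup l x) ∨
    ∃ x ∈ distinct l, ∃ y ∈ distinct l, Good (distinct l) x y := by
  -- If two members of a solution are equal to x, the third is -2x. This is again x only if x = 0,
  -- and then three occurrences are needed.
  have eq : ∀ {i j k : Fin l.length}, i ≠ j → i ≠ k → j ≠ k → l.get i + l.get j + l.get k = 0 →
      l.get i = l.get j → ∃ x ∈ l, Dup l x := by
    intro i j k hij hik hjk h0 h
    have hk : l.get k = -l.get i - l.get i := by linarith
    refine ⟨l.get i, List.get_mem _ _, ?_, ?_⟩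
    · rw [← card_positions, Finset.one_lt_card]
      exact ⟨i, by simp, j, by simp [-List.get_eq_getElem, h], hij⟩
    · split_ifs with hz
      · have hz' : l.get k = 0 := by rw [hk, hz]; rfl
        have hj' : l.get j = 0 := by rw [← h, hz]
        rw [← hk, hz', ← card_positions, Finset.two_lt_card]
        exact ⟨i, Finset.mem_filter.2 ⟨Finset.mem_univ _, hz⟩, j,
          Finset.mem_filter.2 ⟨Finset.mem_univ _, hj'⟩, k,
          Finset.mem_filter.2 ⟨Finset.mem_univ _, hz'⟩, hij, hik, hjk⟩
      · rw [← hk]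
        exact List.count_pos_iff.2 (List.get_mem _ _)
  constructor
  · rintro ⟨i, j, k, hij, hik, hjk, h0⟩
    by_cases h1 : l.get i = l.get j
    · exact .inl (eq hij hik hjk h0 h1)
    by_cases h2 : l.get i = l.get k
    · exact .inl (eq hik hij hjk.symm (by linarith) h2)
    by_cases h3 : l.get j = l.get k
    · exact .inl (eq hjk hij.symm hik.symm (by linarith) h3)
    have hk : -l.get i - l.get j = l.get k := by linarith
    refine .inr ⟨_, mem_distinct.2 (List.get_mem l i), _, mem_distinct.2 (List.get_mem l j), h1, ?_⟩
    rw [hk]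
    exact ⟨mem_distinct.2 (List.get_mem l k), fun h => h2 h.symm, fun h => h3 h.symm⟩
  · rintro (⟨x, -, h1, h2⟩ | ⟨x, hx, y, hy, hxy, hz, hzx, hzy⟩)
    · rw [← card_positions] at h1
      split_ifs at h2 with h0
      · subst h0
        rw [show (-0 - 0 : ℤ) = 0 from rfl, ← card_positions, Finset.two_lt_card] at h2
        obtain ⟨i, hi, j, hj, k, hk, hij, hik, hjk⟩ := h2
        simp only [Finset.mem_filter, Finset.mem_univ, true_and] at hi hj hk
        exact ⟨i, j, k, hij, hik, hjk, by rw [hi, hj, hk]; rfl⟩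
      · obtain ⟨i, hi, j, hj, hij⟩ := Finset.one_lt_card.1 h1
        simp only [Finset.mem_filter, Finset.mem_univ, true_and] at hi hj
        obtain ⟨k, hk⟩ := List.mem_iff_get.1 (List.count_pos_iff.1 h2)
        refine ⟨i, j, k, hij, ?_, ?_, by rw [hi, hj, hk]; ring⟩
        · rintro rfl; rw [hi] at hk; omega
        · rintro rfl; rw [hj] at hk; omega
    · obtain ⟨i, hi⟩ := List.mem_iff_get.1 (mem_distinct.1 hx)
      obtain ⟨j, hj⟩ := List.mem_iff_get.1 (mem_distinct.1 hy)
      obtain ⟨k, hk⟩ := List.mem_iff_get.1 (mem_distinct.1 hz)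
      refine ⟨i, j, k, ?_, ?_, ?_, by rw [hi, hj, hk]; ring⟩
      · rintro rfl; exact hxy (hi.symm.trans hj)
      · rintro rfl; exact hzx (hk.symm.trans hi)
      · rintro rfl; exact hzy (hk.symm.trans hj)

/-- Find the largest `g` with `g ^ t ≤ n`. -/
def rootC (t : ℕ) : Cmd :=
  forC 0 17 (var 0) <|
    iteC (ltT (powT (var 17 + lit 1) t) (var 0 + lit 1)) (.seq (asg 5 (var 17 + lit 1)) skipC) skipC

/-- For code that depends on the exponents the set of written variables cannot be evaluated by
computation; this lemma and the next two compose it by hand. -/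
theorem touches_asg {V A : List ℕ} {D : Bool} {j : ℕ} (e : Term) (h : V.contains j = true) :
    (asg j e).touches V A D = true := by
  have e1 : ∀ i, tmp i % 2 = 1 := fun i => by simp only [tmp]; omega
  have : 4 * j % 4 = 0 := by omega
  simp only [asg, setRegC, Cmd.touches, touches_code, okReg, e1, this]
  simp at h ⊢
  exact .inr h

theorem touches_iteC {V A : List ℕ} {D : Bool} (e : Term) {c c' : Cmd}
    (h : c.touches V A D = true) (h' : c'.touches V A D = true) :
    (iteC e c c').touches V A D = true := by
  simp [iteC, Cmd.touches, touches_code, h, h']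

theorem touches_seq {V A : List ℕ} {D : Bool} {c c' : Cmd}
    (h : c.touches V A D = true) (h' : c'.touches V A D = true) :
    (Cmd.seq c c').touches V A D = true := by
  simp [Cmd.touches, h, h']

/-- A linear search for the root is affordable, because time O(n) is negligible. -/
theorem ok_root {t n : ℕ} (ht : 0 < t) (hβ : 2 * t + 1 ≤ β.e) (hn : σ.var 0 = n) (hpos : 0 < n)
    (h5 : σ.var 5 = 0) :
    Ok β 0 (rootC t) σ (100 * (t + 1) * (n + 1)) fun σ' =>
      (∃ g : ℕ, σ'.var 5 = g ∧ 0 < g ∧ g ^ t ≤ n ∧ n < (g + 1) ^ t) ∧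
        Frame [17, 5] [] false σ σ' := by
  have hnX : σ.Small β.X → n ≤ β.X := fun h => by
    have := (le_abs_self _).trans (h.1 0); rw [hn] at this; exact_mod_cast this
  have h20 := β.deg_le
  refine Ok.of_small fun hσ => ?_
  refine (run_for (σ := σ) (N := n) (e := var 0)
    (fun i σ' => ∃ g : ℕ, σ'.var 5 = g ∧ g ^ t ≤ n ∧ ∀ j ≤ i, j ^ t ≤ n → j ≤ g)
    [17, 5] [] false hn hnX ⟨0, by simpa using h5, by simp [ht.ne'], fun j hj _ => hj⟩
    (w := 30 + 10 * t) ?_ (touches_iteC _ rfl rfl)).mono ?_ fun σ' h => ?_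
  · rintro i hi σ' ⟨g, h1, h2, h3⟩ hf
    have hlt : (((i : ℤ) + 1) ^ t < (n : ℤ) + 1) ↔ (i + 1) ^ t ≤ n := by
      rw [Int.lt_add_one_iff]; exact_mod_cast Iff.rfl
    refine (run_ite (fun h => run_asg (fun _ => ?_) (ok_done ?_)) (fun h' => ok_done ?_) ?_ ?_).mono
      ?_ fun _ => id
    · have := hnX hσ
      simp; rw [abs_of_nonneg (by positivity)]; omega
    · refine ⟨i + 1, by simp, ?_, fun j hj _ => hj⟩
      simpa [hf.var 0 rfl, hn, hlt] using h
    · refine ⟨g, by simpa using h1, h2, fun j hj hj' => ?_⟩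
      rcases Nat.lt_or_ge i j with hij | hij
      · obtain rfl : j = i + 1 := by omega
        exfalso
        simp [hf.var 0 rfl, hn] at h'
        have := hlt.2 hj'
        omega
      · exact h3 j hij hj'
    · have : (powT (var 17 + lit 1) t).chk = true := chk_powT rfl t
      change (true && (powT (var 17 + lit 1) t).chk && true) = true
      rw [this]; rfl
    · change max (powT (var 17 + lit 1) t).deg 2 ≤ _
      rw [deg_powT]
      change max (1 + t * 2) 2 ≤ _
      omega
    · change (powT (var 17 + lit 1) t).size + 7 + 3 + 2 + _ ≤ _
      rw [size_powT]
      change 1 + t * (7 + 3) + 7 + 3 + 2 + 13 ≤ _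
      omega
  · simp only [Term.size, loopCost]; nlinarith
  · obtain ⟨⟨g, h1, h2, h3⟩, hf⟩ := h
    refine ⟨⟨g, h1, h3 1 hpos (by simpa using Nat.one_le_iff_ne_zero.2 hpos.ne'), h2, ?_⟩, hf⟩
    -- A number with (g+1)^t ≤ n is itself at most n, so the search has examined it.
    by_contra hc
    push Not at hc
    have : g + 1 ≤ (g + 1) ^ t := Nat.le_self_pow ht.ne' _
    have := h3 (g + 1) (by omega) hc
    omega

/-- Compute the sizes of the reduction. -/
def sizesC (t s w : ℕ) : Cmd :=
  .seq (asg 6 (powT (var 5) s)) <| .seq (asg 7 (powT (var 5) w)) <|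
  .seq (asg 8 (powT (var 5) (t + s - w))) <| .seq (asg 12 (var 6 + var 6)) skipC

theorem ok_sizes {t s w g n : ℕ} (hst : s ≤ t) (hw : w ≤ t + s) (hβ : 2 * t + 1 ≤ β.e)
    (h5 : σ.var 5 = g) (hg : 0 < g) (hgn : g ^ t ≤ n) (hn : 2 * n ^ 2 ≤ β.X) :
    Ok β 0 (sizesC t s w) σ (100 * (t + 1)) fun σ' =>
      (σ'.var 6 = (g ^ s : ℕ) ∧ σ'.var 7 = (g ^ w : ℕ) ∧ σ'.var 8 = (g ^ (t + s - w) : ℕ) ∧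
        σ'.var 12 = (2 * g ^ s : ℕ)) ∧ Frame [6, 7, 8, 12] [] false σ σ' := by
  -- All exponents in use are at most 2t, so all sizes are at most n².
  have bd : ∀ e ≤ 2 * t, g ^ e ≤ n ^ 2 := fun e he =>
    (Nat.pow_le_pow_right hg he).trans (by rw [mul_comm, pow_mul]; exact Nat.pow_le_pow_left hgn 2)
  have bd' : ∀ e ≤ 2 * t, |(g : ℤ) ^ e| ≤ β.X := fun e he => by
    rw [abs_of_nonneg (by positivity)]
    have := bd e he
    exact_mod_cast this.trans (by omega)
  have hdeg : ∀ e ≤ 2 * t, (powT (var 5) e).deg ≤ β.e := fun e he => by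
    rw [deg_powT]; simp only [Term.deg]; omega
  have htc : (sizesC t s w).touches [6, 7, 8, 12] [] false = true :=
    touches_seq (touches_asg _ rfl) <| touches_seq (touches_asg _ rfl) <|
    touches_seq (touches_asg _ rfl) rfl
  refine Ok.frame ?_ htc
  refine (run_asg (fun _ => ?_) (run_asg (fun _ => ?_) (run_asg (fun _ => ?_)
    (run_asg (fun _ => ?_) (ok_done ?_)) (chk_powT rfl _) (hdeg _ (by omega))) (chk_powT rfl _)
    (hdeg _ (by omega))) (chk_powT rfl _) (hdeg _ (by omega))).mono ?_ fun _ => id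
  · simp only [eval_powT, eval_var, h5]; exact bd' _ (by omega)
  · simp [h5]; simpa using bd' w (by omega)
  · simp [h5]; simpa using bd' (t + s - w) (by omega)
  · have := bd s (by omega)
    have h : |(g : ℤ) ^ s + (g : ℤ) ^ s| ≤ β.X := by
      rw [abs_of_nonneg (by positivity)]; exact_mod_cast (by omega : g ^ s + g ^ s ≤ β.X)
    simpa [h5] using h
  · simp [h5]; ring
  · simp only [size_powT, Term.size]
    change _ + (_ + (_ + (9 + 5 + 1))) ≤ _
    omega

/-- The store at the beginning. -/
def initStore (l : List ℤ) : Store where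
  var j := if j = 0 then l.length else 0
  arr a := if a = 0 then cells l else cells []
  ds := ⟨fun _ => 0, fun _ => cells [], []⟩

/-- The first part of the program. -/
def prepareC (t s w : ℕ) : Cmd :=
  .seq (asg 1 (lit 1)) <| .seq distinctC <| .seq dupC <| .seq (rootC t) <| sizesC t s w

/-- What is known after the first part. -/
structure Prepared (l : List ℤ) (t s w g : ℕ) (σ : Store) : Prop where
  pos : 0 < g
  pow_le : g ^ t ≤ l.length
  lt_pow : l.length < (g + 1) ^ t
  one : σ.var 1 = 1
  cnt : σ.var 2 = 0
  ns : σ.var 3 = (distinct l).length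
  found : Flag σ 4 (∃ x ∈ l, Dup l x)
  R : σ.var 6 = (g ^ s : ℕ)
  τ : σ.var 7 = (g ^ w : ℕ)
  M : σ.var 8 = (g ^ (t + s - w) : ℕ)
  W : σ.var 12 = (2 * g ^ s : ℕ)
  n : σ.var 0 = l.length
  tab : σ.arr 3 = (fun v => (l.count v : ℤ))
  S : σ.arr 4 = cells (distinct l)
  var_zero : ∀ j, 13 ≤ j → j ≤ 16 → σ.var j = 0
  arr_zero : ∀ a, 5 ≤ a → σ.arr a = cells []
  reg : σ.ds.reg = fun _ => 0
  darr : σ.ds.arr = fun _ => cells []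

theorem ok_prepare {t s w : ℕ} (hl : l ≠ []) (ht : 0 < t) (hst : s ≤ t) (hw : w ≤ t + s)
    (hβ : 2 * t + 1 ≤ β.e) (hn : 2 * l.length ^ 2 ≤ β.X) :
    Ok β 0 (prepareC t s w) (initStore l) (1000 * (t + 1) * (l.length + 1)) fun σ =>
      ∃ g, Prepared l t s w g σ := by
  have hpos : 0 < l.length := List.length_pos_iff.2 hl
  refine (run_asg (fun _ => ?_) (ok_seq (ok_distinct (l := l) ?_ ?_ ?_ ?_ ?_)
    fun σ₁ ⟨⟨a1, a2, a3⟩, f1⟩ => ok_seq (ok_dup (l := l) ?_ ?_ a1 ?_) fun σ₂ ⟨b1, f2⟩ =>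
    ok_seq (ok_root (n := l.length) ht hβ ?_ hpos ?_) fun σ₃ ⟨⟨g, c1, c2, c3, c4⟩, f3⟩ =>
    (ok_sizes hst hw hβ c1 c2 c3 hn).mono le_rfl
      fun σ₄ ⟨⟨d1, d2, d3, d4⟩, f4⟩ => ?_)).mono ?_ fun _ => id
  · have := β.five_le; simp; omega
  · rfl
  · rfl
  · funext v; simp [initStore, cells]
  · rfl
  · rfl
  · simp only [Term.size]
    nlinarith
  · rw [f1.arr 0 rfl]; rfl
  · rw [f1.var 0 rfl]; rfl
  · rw [f1.var 4 rfl]; rfl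
  · rw [f2.var 0 rfl, f1.var 0 rfl]; rfl
  · rw [f2.var 5 rfl, f1.var 5 rfl]; rfl
  · have hv : ∀ j, [17, 20, 3, 4, 5, 6, 7, 8, 12].contains j = false →
        σ₄.var j = ((initStore l).setVar 1 1).var j := by
      intro j hj
      simp at hj
      rw [f4.var j (by simp; omega), f3.var j (by simp; omega), f2.var j (by simp; omega),
        f1.var j (by simp; omega)]
      rfl
    have ha : ∀ a, σ₄.arr a = σ₁.arr a := fun a => by
      rw [f4.arr a rfl, f3.arr a rfl, f2.arr a rfl]
    refine ⟨g, c2, c3, c4, ?_, ?_, ?_, ?_, d1, d2, d3, d4, ?_, ?_, ?_, fun j h1 h2 => ?_,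
      fun a h1 => ?_, ?_, ?_⟩
    · rw [hv _ rfl]; rfl
    · rw [hv _ rfl]; rfl
    · rw [f4.var _ rfl, f3.var _ rfl, f2.var _ rfl, a3]
    · refine b1.congr ?_ Iff.rfl
      rw [f4.var _ rfl, f3.var _ rfl]
    · rw [hv _ rfl]; rfl
    · rw [ha, a1]
    · rw [ha, a2]
    · rw [hv j (by simp; omega), Store.setVar_var, if_neg (by omega)]
      simp [initStore]; omega
    · rw [ha, f1.arr a (by simp; omega)]
      simp [initStore]; omega
    · rw [f4.reg rfl, f3.reg rfl, f2.reg rfl, f1.reg rfl]; rfl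
    · rw [f4.darr rfl, f3.darr rfl, f2.darr rfl, f1.darr rfl]; rfl

end ISGLowerBound

namespace ISGLowerBound

/-! ## The reduction: the graph and the queries -/

open Term (lit var get)

namespace Inst
variable (I : Inst)

/-- The residues of a number, as one number. -/
def code (z : ℤ) : ℤ := (z % I.q₁ * I.w + z % I.q₂) * I.w + z % I.q₃

/-- The residues are digits in base w. The leading digit needs no bound, so a key assembled from an
arbitrary edge can be compared as well. -/
theorem code_eq_iff {x : ℤ} {a b c : ℤ} (hb : 0 ≤ b) (hb' : b < I.w) (hc : 0 ≤ c) (hc' : c < I.w) :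
    I.code x = (a * I.w + b) * I.w + c ↔ x % I.q₁ = a ∧ x % I.q₂ = b ∧ x % I.q₃ = c := by
  constructor
  · intro h
    have h1 := pair_inj (I.mod_lt_w₃ x).1 (I.mod_lt_w₃ x).2 hc hc' h
    have h2 := pair_inj (I.mod_lt_w₂ x).1 (I.mod_lt_w₂ x).2 hb hb' h1.1
    exact ⟨h2.1, h2.2, h1.2⟩
  · rintro ⟨rfl, rfl, rfl⟩; rfl

theorem code_eq_code {x z : ℤ} : I.code x = I.code z ↔ I.Same x z :=
  I.code_eq_iff (I.mod_lt_w₂ z).1 (I.mod_lt_w₂ z).2 (I.mod_lt_w₃ z).1 (I.mod_lt_w₃ z).2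

theorem code_bound (z : ℤ) : 0 ≤ I.code z ∧ I.code z < I.w ^ 3 := by
  have h1 := pair_bound (I.mod_lt_w₁ z).1 (I.mod_lt_w₁ z).2 (I.mod_lt_w₂ z).1 (I.mod_lt_w₂ z).2
  have h2 := I.mod_lt_w₃ z
  unfold code
  constructor <;> nlinarith

end Inst

/-- What the program needs to know about the instance. -/
structure Ctx (I : Inst) (n : ℕ) (σ : Store) : Prop where
  n : σ.var 0 = n
  one : σ.var 1 = 1
  ns : σ.var 3 = I.S.length
  τ : σ.var 7 = I.τ
  M : σ.var 8 = I.M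
  q₁ : σ.var 9 = I.q₁
  q₂ : σ.var 10 = I.q₂
  q₃ : σ.var 11 = I.q₃
  w : σ.var 12 = I.w
  tab : ∀ v, σ.arr 3 v ≠ 0 ↔ v ∈ I.S
  S : σ.arr 4 = cells I.S

theorem Ctx.congr {I : Inst} {n : ℕ} {σ σ' : Store} (h : Ctx I n σ)
    (hv : ∀ j ∈ [0, 1, 3, 7, 8, 9, 10, 11, 12], σ'.var j = σ.var j)
    (ha : ∀ a ∈ [3, 4], σ'.arr a = σ.arr a) : Ctx I n σ' := by
  simp only [List.mem_cons, List.not_mem_nil, or_false, forall_eq_or_imp, forall_eq] at hv ha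
  obtain ⟨h0, h1, h3, h7, h8, h9, h10, h11, h12⟩ := hv
  constructor
  · rw [h0, h.n]
  · rw [h1, h.one]
  · rw [h3, h.ns]
  · rw [h7, h.τ]
  · rw [h8, h.M]
  · rw [h9, h.q₁]
  · rw [h10, h.q₂]
  · rw [h11, h.q₃]
  · rw [h12, h.w]
  · rw [ha.1]; exact h.tab
  · rw [ha.2, h.S]

theorem Ctx.frame {I : Inst} {n : ℕ} {σ σ' : Store} (h : Ctx I n σ) {V A : List ℕ} {D : Bool}
    (hf : Frame V A D σ σ')
    (hV : ([0, 1, 3, 7, 8, 9, 10, 11, 12].all fun j => !V.contains j) = true := by rfl)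
    (hA : ([3, 4].all fun j => !A.contains j) = true := by rfl) : Ctx I n σ' := by
  rw [List.all_eq_true] at hV hA
  exact h.congr (fun j hj => hf.var j (by simpa using hV j hj))
    (fun a ha' => hf.arr a (by simpa using hA a ha'))

/-- Bounds on the sizes that occur. -/
structure Fits (I : Inst) (n : ℕ) (β : Bds) : Prop where
  S_le : I.S.length ≤ n
  n_le : n ≤ β.X
  code_le : I.w ^ 3 ≤ β.X
  nv_le : I.nv ≤ β.X
  m_le : I.τ * I.M + I.S.length * I.q₁ ≤ β.X
  arr_le : I.arrivals.length ≤ β.X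

/-! ### Buckets -/

/-- Numbers with a given key are listed in an array. -/
structure Buck (f g : ℤ → ℤ) (n : ℕ) (key : ℤ → ℤ) (L : List ℤ) : Prop where
  len : f = fun κ => ((L.filter fun x => key x = κ).length : ℤ)
  elem : ∀ (κ : ℤ) (i : ℕ) (h : i < (L.filter fun x => key x = κ).length),
    g (κ * n + i) = (L.filter fun x => key x = κ)[i]

theorem Buck.nil (n : ℕ) (key : ℤ → ℤ) : Buck (cells []) (cells []) n key [] where
  len := by funext; simp [cells]
  elem κ i h := by simp at h

/-- The bucket of κ occupies the cells from κn on. With fewer than n numbers so far, the new entry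
still fits into its row, and different rows do not overlap. -/
theorem Buck.push {f g : ℤ → ℤ} {n : ℕ} {key : ℤ → ℤ} {L : List ℤ} (h : Buck f g n key L)
    (hL : L.length < n) (x : ℤ) :
    Buck (Function.update f (key x) (f (key x) + 1))
      (Function.update g (key x * n + f (key x)) x) n key (L ++ [x]) where
  len := by
    funext κ
    rw [Function.update_apply, h.len, List.filter_append]
    split_ifs with hκ
    · subst hκ; simp
    · simp [Ne.symm hκ]
  elem κ i hi := by
    have hn : (0 : ℤ) < n := by exact_mod_cast (Nat.zero_le _).trans_lt hL
    have hlen : (L.filter fun y => key y = key x).length < n := (List.length_filter_le _ _).trans_lt hL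
    have hlen' : (L.filter fun y => key y = κ).length < n := (List.length_filter_le _ _).trans_lt hL
    rw [Function.update_apply, h.len]
    by_cases hκ : key x = κ
    · subst hκ
      simp only [List.filter_append, List.length_append, List.filter_cons, decide_true, if_true,
        List.filter_nil, List.length_cons, List.length_nil, zero_add] at hi ⊢
      rcases Nat.lt_succ_iff_lt_or_eq.1 hi with hi | rfl
      · rw [if_neg (by omega), h.elem _ _ hi, List.getElem_append_left hi]
      · rw [if_pos rfl]; simp
    · simp only [List.filter_append, List.filter_cons, hκ, decide_false, Bool.false_eq_true,
        if_false, List.filter_nil, List.append_nil] at hi ⊢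
      rw [if_neg, h.elem _ _ hi]
      intro he
      refine hκ (Inst.pair_inj ?_ ?_ ?_ ?_ he).1.symm
      · positivity
      · omega
      · positivity
      · exact_mod_cast hlen

/-- Add variable `20` to a bucket. -/
def pushC (a b : ℕ) (K : Term) (c : Cmd) : Cmd :=
  .seq (sto b (K * var 0 + get a K) (var 20)) <| .seq (sto a K (get a K + lit 1)) c

/-- All residues of a number. -/
def codeT (j : ℕ) : Term :=
  (var j % var 9 * var 12 + var j % var 10) * var 12 + var j % var 11

/-- Sort the numbers into buckets. -/
def bucketC : Cmd :=
  forC 0 17 (var 3) <|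
    .seq (asg 20 (get 4 (var 17))) <|
    pushC 5 6 (codeT 20) <| pushC 7 8 (var 20 % var 10) <| pushC 9 10 (var 20 % var 11) skipC

/-- All buckets. -/
structure Bucks (I : Inst) (n : ℕ) (L : List ℤ) (σ : Store) : Prop where
  code : Buck (σ.arr 5) (σ.arr 6) n I.code L
  q₂ : Buck (σ.arr 7) (σ.arr 8) n (fun x => x % I.q₂) L
  q₃ : Buck (σ.arr 9) (σ.arr 10) n (fun x => x % I.q₃) L

variable {β : Bds} {I : Inst} {n : ℕ} {σ : Store}

theorem eval_codeT (h : Ctx I n σ) (j : ℕ) : (codeT j).eval σ = I.code (σ.var j) := by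
  simp [codeT, Inst.code, h.q₁, h.q₂, h.q₃, h.w]

theorem Ctx.setVar (h : Ctx I n σ) {j : ℕ} (z : ℤ)
    (hj : [0, 1, 3, 7, 8, 9, 10, 11, 12].contains j = false := by rfl) :
    Ctx I n (σ.setVar j z) := h.congr (fun k hk => by
  rw [Store.setVar_var, if_neg]; rintro rfl; simp at hj hk; omega) fun _ _ => rfl

theorem Ctx.setArr (h : Ctx I n σ) {a : ℕ} (i z : ℤ)
    (ha : [3, 4].contains a = false := by rfl) :
    Ctx I n (σ.setArr a i z) := h.congr (fun _ _ => rfl) fun k hk => by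
  rw [Store.setArr_arr, if_neg]; rintro rfl; simp at ha hk; omega

theorem Buck.len_le {f g : ℤ → ℤ} {key : ℤ → ℤ} {L : List ℤ} (h : Buck f g n key L) (κ : ℤ) :
    0 ≤ f κ ∧ f κ ≤ L.length := by
  simp only [h.len]
  exact ⟨by positivity, by exact_mod_cast List.length_filter_le _ _⟩

theorem ok_bucket (hc : Ctx I n σ) (hfit : Fits I n β) (h0 : ∀ a, 5 ≤ a → σ.arr a = cells []) :
    Ok β 0 bucketC σ (500 * (n + 1)) fun σ' =>
      Bucks I n I.S σ' ∧ Frame [17, 20] [5, 6, 7, 8, 9, 10] false σ σ' := by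
  refine (run_for (σ := σ) (N := I.S.length) (e := var 3)
    (fun i σ' => Bucks I n (I.S.take i) σ')
    [17, 20] [5, 6, 7, 8, 9, 10] false hc.ns (fun _ => hfit.S_le.trans hfit.n_le) ?_
    (w := 400) ?_).mono ?_ fun σ' h => ?_
  · rw [List.take_zero]
    refine ⟨?_, ?_, ?_⟩ <;> rw [h0 _ (by norm_num), h0 _ (by norm_num)] <;> exact Buck.nil _ _
  · intro i hi σ₁ h hf
    have hc₁ := hc.frame hf
    have hlt : (I.S.take i).length < n := by
      rw [List.length_take]; have := hfit.S_le; omega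
    rw [take_succ_eq _ hi]
    have hx : σ₁.arr 4 i = I.S[i] := by rw [hc₁.S, cells_getElem _ _ hi]
    have hv : ∀ z : ℤ, 0 ≤ z ∧ z ≤ (I.S.take i).length → |z + 1| ≤ β.X := fun z hz => by
      have := hfit.n_le
      rw [abs_of_nonneg (by omega)]; omega
    have hc₂ : Ctx I n ((σ₁.setVar 17 i).setVar 20 I.S[i]) := (hc₁.setVar _).setVar _
    have e1 := eval_codeT hc₂ 20
    have hn := hc₁.n
    have p1 := h.code.push hlt I.S[i]
    have p2 := h.q₂.push hlt I.S[i]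
    have p3 := h.q₃.push hlt I.S[i]
    refine (run_asg (fun h => h.2 _ _) (run_sto (fun h => ?_) (run_sto (fun _ => ?_)
      (run_sto (fun h => ?_) (run_sto (fun _ => ?_) (run_sto (fun h => ?_)
      (run_sto (fun _ => ?_) (ok_done ?_)))))))).mono (by decide) fun _ => id
    · exact h.1 20
    · exact hv _ (h.code.len_le _)
    · exact h.1 20
    · simpa using hv _ (h.q₂.len_le _)
    · exact h.1 20
    · simpa using hv _ (h.q₃.len_le _)
    · have c1 : (codeT 20).eval ((σ₁.setVar 17 i).setVar 20 I.S[i]) = I.code I.S[i] := by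
        rw [e1]; simp
      have hs : ∀ (σ : Store) a j z, (codeT 20).eval (σ.setArr a j z) = (codeT 20).eval σ :=
        fun _ _ _ _ => rfl
      have hq2 := hc₁.q₂
      have hq3 := hc₁.q₃
      constructor
      · simpa [hs, hx, c1, hn] using p1
      · simpa [hs, hx, c1, hn, hq2] using p2
      · simpa [hs, hx, c1, hn, hq3] using p3
  · have := hfit.S_le
    simp [Term.size, loopCost]; omega
  · simpa using h

/-! ### The edges -/

/-- The edges written so far. -/
structure Edg (L : List (ℤ × ℤ)) (σ : Store) : Prop where
  len : σ.var 13 = L.length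
  arr : σ.ds.arr = fun a => if a = 0 then cells (L.map Prod.fst) else
    if a = 1 then cells (L.map Prod.snd) else cells []
  reg : σ.ds.reg = fun _ => 0

theorem Edg.congr {L : List (ℤ × ℤ)} {σ σ' : Store} (h : Edg L σ) (h1 : σ'.var 13 = σ.var 13)
    (h2 : σ'.ds.arr = σ.ds.arr) (h3 : σ'.ds.reg = σ.ds.reg) : Edg L σ' :=
  ⟨h1.trans h.len, h2.trans h.arr, h3.trans h.reg⟩

/-- Write an edge. -/
def edgeC (x y : Term) : Cmd :=
  .seq (stoD 0 (var 13) x) <| .seq (stoD 1 (var 13) y) <| .seq (asg 13 (var 13 + lit 1)) skipC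

theorem ok_edge {d : ℕ} {x y : Term} {L : List (ℤ × ℤ)} {u v : ℤ} (h : Edg L σ)
    (hx : x.eval σ = u)
    (hy : y.eval (σ.setDs (σ.ds.setArr 0 L.length u)) = v)
    (hu : |u| ≤ β.X) (hv : |v| ≤ β.X) (hL : L.length + 1 ≤ β.X)
    (hxc : x.chk = true := by rfl) (hyc : y.chk = true := by rfl)
    (hxd : x.deg ≤ β.e := by exact le_trans (by decide) (Bds.deg_le _))
    (hyd : y.deg ≤ β.e := by exact le_trans (by decide) (Bds.deg_le _)) :
    Ok β d (edgeC x y) σ (x.size + y.size + 50) fun σ' =>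
      Edg (L ++ [(u, v)]) σ' ∧ (∀ j, j ≠ 13 → σ'.var j = σ.var j) ∧ σ'.arr = σ.arr := by
  have hl : σ.var 13 = L.length := h.len
  refine (run_stoD (fun _ => ?_) (run_stoD (fun _ => ?_) (run_asg (fun _ => ?_) (ok_done ?_))
    (he := hyc) (hβ := hyd)) (he := hxc) (hβ := hxd)).mono ?_ fun _ => id
  · rw [hx]; exact hu
  · rw [eval_var, hl, hx, hy]; exact hv
  · simp [hl]; rw [abs_of_nonneg (by positivity)]; exact_mod_cast hL
  · rw [eval_var, hl, hx, eval_var, Store.setDs_var, hl, hy]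
    refine ⟨⟨by simp [hl], ?_, ?_⟩, fun j hj => by simp [hj], rfl⟩
    · funext a
      have e0 := congrFun h.arr 0
      have e1 := congrFun h.arr 1
      have ea := congrFun h.arr a
      simp only [Store.setVar_ds, Store.setDs_ds, State.setArr_arr]
      rcases eq_or_ne a 0 with rfl | h0
      · simp only [if_true, if_neg (zero_ne_one), e0]
        rw [List.map_append, ← List.length_map (f := Prod.fst), cells_append]; rfl
      rcases eq_or_ne a 1 with rfl | h1
      · simp only [if_true, if_neg (one_ne_zero), e1]
        rw [List.map_append, ← List.length_map (f := Prod.snd), cells_append]; rfl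
      · simp only [h0, h1, if_false] at ea ⊢; exact ea
    · exact h.reg
  · simp only [Term.size]; omega

/-- Write the edges of the complete bipartite graph. -/
def padC : Cmd :=
  forC 0 17 (var 7) <| forC 1 18 (var 8) <|
    edgeC (lit 2 * (var 12 * var 12) + var 17) (lit 2 * (var 12 * var 12) + var 7 + var 18)

theorem padEdges_length_le (hfit : Fits I n β) : I.τ * I.M ≤ β.X :=
  (Nat.le_add_right _ _).trans hfit.m_le

theorem ok_pad (hc : Ctx I n σ) (hfit : Fits I n β) (he : Edg [] σ) :
    Ok β 0 padC σ (300 * (I.τ * I.M + 1)) fun σ' =>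
      Edg I.padEdges σ' ∧ Frame [17, 18, 13] [] true σ σ' := by
  have hnv := hfit.nv_le
  unfold Inst.nv at hnv
  have hMX : I.M ≤ β.X := by omega
  have hMpos : 0 < I.M := I.τ_pos.trans_le I.τ_le
  have hm := padEdges_length_le hfit
  have hwt : (0 : ℤ) ≤ I.w * I.w := by positivity
  have hnv' : (2 * (I.w * I.w) + I.τ + I.M : ℤ) ≤ β.X := by exact_mod_cast hnv
  let f : ℕ → ℕ → ℤ × ℤ := fun a b => (2 * (I.w * I.w) + a, 2 * (I.w * I.w) + I.τ + b)
  let g : ℕ → List (ℤ × ℤ) := fun a => (List.range I.M).map (f a)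
  have hlen : ∀ i, ((List.range i).flatMap g).length = i * I.M := fun i => by
    simp [g, List.length_flatMap]
  refine (run_for (σ := σ) (N := I.τ) (e := var 7)
    (fun i σ' => Edg ((List.range i).flatMap g) σ')
    [17, 18, 13] [] true hc.τ (fun _ => by omega) (by simpa using he)
    (w := 50 + I.M * 150) ?_).mono ?_ fun σ' h => ?_
  · intro i hi σ₁ h₁ hf₁
    have hc₁ : Ctx I n (σ₁.setVar 17 i) := (hc.frame hf₁).setVar _
    refine (run_for (σ := σ₁.setVar 17 i) (N := I.M) (e := var 8)
      (fun j σ' => Edg ((List.range i).flatMap g ++ (List.range j).map (f i)) σ')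
      [18, 13] [] true hc₁.M (fun _ => hMX) (by
        rw [List.range_zero, List.map_nil, List.append_nil]
        exact h₁.congr (by simp) rfl rfl)
      (w := 120) ?_).mono ?_ fun σ' h => ?_
    · intro j hj σ₂ h₂ hf₂
      have hc₂ : Ctx I n (σ₂.setVar 18 j) := (hc₁.frame hf₂).setVar _
      have e1 := hc₂.w
      have e2 := hc₂.τ
      have e3 : (σ₂.setVar 18 j).var 17 = i := by
        rw [Store.setVar_var, if_neg (by norm_num), hf₂.var 17 rfl]; simp
      have e4 : (σ₂.setVar 18 j).var 18 = j := by simp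
      refine (ok_edge (β := β) (σ := σ₂.setVar 18 j) (x := lit 2 * (var 12 * var 12) + var 17)
        (y := lit 2 * (var 12 * var 12) + var 7 + var 18) (u := 2 * (I.w * I.w) + i) (v := 2 * (I.w * I.w) + I.τ + j)
        (h₂.congr (by simp) rfl rfl) ?_ ?_ ?_ ?_ ?_).mono (by decide) fun σ' h => ?_
      · simp only [eval_add, eval_mul, eval_lit, eval_var, e1, e3]
      · simp only [eval_add, eval_mul, eval_lit, eval_var, Store.setDs_var, e1, e2, e4]
      · rw [abs_of_nonneg (by positivity)]; omega
      · rw [abs_of_nonneg (by positivity)]; omega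
      · rw [List.length_append, hlen]
        simp only [List.length_map, List.length_range]
        have : (i + 1) * I.M ≤ I.τ * I.M := Nat.mul_le_mul_right _ hi
        rw [add_mul] at this
        omega
      · have := h.1
        rw [List.range_succ, List.map_append]
        simpa using this
    · simp only [Term.size, loopCost]; omega
    · rw [List.range_succ, List.flatMap_append]
      simpa using h.1
  · simp only [Term.size, loopCost]
    have : I.τ ≤ I.τ * I.M := Nat.le_mul_of_pos_right _ hMpos
    calc _ = 13 + I.τ * 61 + 150 * (I.τ * I.M) := by ring
      _ ≤ _ := by omega
  · exact h

/-- The test whether two numbers are part of a solution. -/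
def goodT (x y : Term) : Term :=
  (lit 1 - eqT x y) * get 3 (lit 0 - x - y) * (lit 1 - eqT (lit 0 - x - y) x) *
    (lit 1 - eqT (lit 0 - x - y) y)

/-- A conjunction is computed as a product, with the count of -x-y as the factor for membership. -/
theorem eval_goodT (hc : Ctx I n σ) (x y : Term) :
    (goodT x y).eval σ ≠ 0 ↔ Good I.S (x.eval σ) (y.eval σ) := by
  unfold Good
  rw [← hc.tab]
  simp only [goodT, eval_mul, eval_sub, eval_lit, eval_eqT, eval_get, zero_sub]
  split_ifs <;> simp_all

/-- Search for a solution with the number in variable `21`. -/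
def bruteC : Cmd :=
  forC 1 18 (var 3) <| .seq (asg 20 (get 4 (var 18))) <|
    iteC (goodT (var 20) (var 21)) (.seq (asg 4 (lit 1)) skipC) skipC

theorem ok_brute (hc : Ctx I n σ) (hfit : Fits I n β) {P : Prop} (hP : Flag σ 4 P) {z : ℤ}
    (hz : σ.var 21 = z) :
    Ok β 1 bruteC σ (200 * (n + 1)) fun σ' =>
      Flag σ' 4 (P ∨ ∃ x ∈ I.S, Good I.S x z) ∧ Frame [18, 20, 4] [] false σ σ' := by
  refine (run_for (σ := σ) (N := I.S.length) (e := var 3)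
    (fun i σ' => Flag σ' 4 (P ∨ ∃ x ∈ I.S.take i, Good I.S x z))
    [18, 20, 4] [] false hc.ns (fun _ => hfit.S_le.trans hfit.n_le) (by simpa using hP)
    (w := 150) ?_).mono ?_ fun σ' h => ?_
  · intro i hi σ₁ h hf
    have hc₁ := hc.frame hf
    have hx : σ₁.arr 4 i = I.S[i] := by rw [hc₁.S, cells_getElem _ _ hi]
    have hc₂ : Ctx I n ((σ₁.setVar 18 i).setVar 20 I.S[i]) := (hc₁.setVar _).setVar _
    have hg := eval_goodT hc₂ (var 20) (var 21)
    have e1 : ((σ₁.setVar 18 i).setVar 20 I.S[i]).var 21 = z := by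
      simp only [Store.setVar_var]
      rw [if_neg (by norm_num), if_neg (by norm_num), hf.var 21 rfl, hz]
    have e2 : ((σ₁.setVar 18 i).setVar 20 I.S[i]).var 20 = I.S[i] := by simp
    have e3 : (Term.get 4 (var 18)).eval (σ₁.setVar 18 i) = I.S[i] := by simp [hx]
    rw [eval_var, eval_var, e1, e2] at hg
    rw [exists_mem_take_succ hi]
    refine (run_asg (fun h => h.2 _ _) (run_ite (fun h' => run_asg (fun _ => ?_) (ok_done ?_))
      fun h' => ok_done ?_)).mono (by decide) fun _ => id
    · have := β.five_le; simp; omega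
    · rw [e3] at h' ⊢
      exact .of_true (by simp) (.inr (.inr (hg.1 h')))
    · rw [e3] at h' ⊢
      refine h.congr (by simp) ?_
      rw [or_iff_left (a := ∃ x ∈ I.S.take i, _)]
      exact fun hh => hg.2 hh h'
  · have := hfit.S_le
    simp [Term.size, loopCost]; omega
  · simpa using h

end ISGLowerBound

/-! ### Selecting the numbers that are stored, and writing their edges -/

namespace ISGLowerBound

open Term (lit var get)

variable {β : Bds} {I : Inst} {n : ℕ} {σ : Store}

/-- Write the edges for the number in variable `21`. -/
def insC : Cmd :=
  .seq (sto 11 (var 23) (lit 1)) <|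
  .seq (sto 12 (var 21 % var 10) (get 12 (var 21 % var 10) + lit 1)) <|
  forC 1 18 (var 9) <|
    edgeC (var 18 * var 12 + var 21 % var 10)
      (var 12 * var 12 + ((lit 0 - var 21 - var 18) % var 9 * var 12 + (lit 0 - var 21) % var 11))

/-- Write the edges of the numbers, or search solutions with them. -/
def selC : Cmd :=
  forC 0 17 (var 3) <|
    .seq (asg 21 (get 4 (var 17))) <| .seq (asg 23 (codeT 21)) <|
    iteC (get 11 (var 23)) skipC <|
    iteC (ltT (get 12 (var 21 % var 10)) (var 7)) insC bruteC

theorem ok_ins (hc : Ctx I n σ) (hfit : Fits I n β) {L : List (ℤ × ℤ)} (hL : Edg L σ)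
    (hlen : L.length + I.q₁ ≤ β.X) {z : ℤ} (hz : σ.var 21 = z) (h23 : σ.var 23 = I.code z)
    (hcnt : 0 ≤ σ.arr 12 (z % I.q₂) ∧ σ.arr 12 (z % I.q₂) + 1 ≤ β.X) :
    Ok β 1 insC σ (100 + 200 * I.q₁) fun σ' =>
      Edg (L ++ I.numEdges z) σ' ∧ σ'.arr 11 = Function.update (σ.arr 11) (I.code z) 1 ∧
      σ'.arr 12 = Function.update (σ.arr 12) (z % I.q₂) (σ.arr 12 (z % I.q₂) + 1) ∧
      σ'.var 4 = σ.var 4 := by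
  have hq2 := hc.q₂
  set σ₁ := (σ.setArr 11 (I.code z) 1).setArr 12 (z % I.q₂) (σ.arr 12 (z % I.q₂) + 1) with hσ₁
  have hc₁ : Ctx I n σ₁ := (hc.setArr _ _).setArr _ _
  have hnv := hfit.nv_le
  have hnv' : (2 * (I.w * I.w) + I.τ + I.M : ℤ) ≤ β.X := by
    unfold Inst.nv at hnv; exact_mod_cast hnv
  have hq1 : I.q₁ ≤ β.X := by omega
  have h1 : |(lit 1).eval σ| ≤ β.X := by have := β.five_le; simp; omega
  have h2 : |(get 12 (var 21 % var 10) + lit 1).eval (σ.setArr 11 (I.code z) 1)| ≤ β.X := by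
    simp [hz, hq2]; rw [abs_of_nonneg (by omega)]; exact hcnt.2
  have e2 : (σ.setArr 11 ((var 23).eval σ) ((lit 1).eval σ)) = σ.setArr 11 (I.code z) 1 := by
    simp [h23]
  have e3 : (σ.setArr 11 (I.code z) 1).setArr 12
      ((var 21 % var 10).eval (σ.setArr 11 (I.code z) 1))
      ((get 12 (var 21 % var 10) + lit 1).eval (σ.setArr 11 (I.code z) 1)) = σ₁ := by
    simp [hz, hq2, hσ₁]
  refine (run_sto (fun _ => h1) (run_sto (fun _ => by rw [e2]; exact h2) (t := 40 + 200 * I.q₁) ?_)).mono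
    ?_ fun _ => id
  · rw [e2, e3]
    refine (run_for (σ := σ₁) (N := I.q₁) (e := var 9)
      (fun i σ' => Edg (L ++ (I.numEdges z).take i) σ')
      [18, 13] [] true hc₁.q₁ (fun _ => hq1) (by simpa using hL.congr (σ' := σ₁) rfl rfl rfl)
      (w := 150) ?_).mono ?_ fun σ' h => ?_
    · intro i hi σ₂ h₂ hf
      have hc₂ : Ctx I n (σ₂.setVar 18 i) := (hc₁.frame hf).setVar _
      have e1 := hc₂.w
      have e2 := hc₂.q₁
      have e3 := hc₂.q₂
      have e4 := hc₂.q₃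
      have e5 : (σ₂.setVar 18 i).var 21 = z := by
        rw [Store.setVar_var, if_neg (by norm_num), hf.var 21 rfl, ← hz]; rfl
      have e6 : (σ₂.setVar 18 i).var 18 = i := by simp
      have hlt : i < (I.numEdges z).length := by rw [I.length_numEdges]; exact hi
      have hmem : (I.numEdges z)[i] ∈ I.numEdges z := List.getElem_mem _
      have hb := I.numEdges_bound hmem
      have hel : (I.numEdges z)[i] = ((i : ℤ) * I.w + z % I.q₂,
        I.w * I.w + ((-z - i) % I.q₁ * I.w + (-z) % I.q₃)) := by simp [Inst.numEdges]
      rw [hel] at hb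
      refine (ok_edge (β := β) (σ := σ₂.setVar 18 i) (x := var 18 * var 12 + var 21 % var 10)
        (y := var 12 * var 12 + ((lit 0 - var 21 - var 18) % var 9 * var 12 +
          (lit 0 - var 21) % var 11)) (u := i * I.w + z % I.q₂)
        (v := I.w * I.w + ((-z - i) % I.q₁ * I.w + (-z) % I.q₃))
        (h₂.congr (by simp) rfl rfl) ?_ ?_ ?_ ?_ ?_).mono (by decide) fun σ' h => ?_
      · simp only [eval_add, eval_mul, eval_mod, eval_var, e1, e3, e5, e6]
      · simp only [eval_add, eval_mul, eval_mod, eval_sub, eval_lit, eval_var, Store.setDs_var,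
          e1, e2, e4, e5, e6, zero_sub]
      · have := hb.1
        rw [abs_of_nonneg this.1]; dsimp only at this; linarith [this.2]
      · have := hb.2
        dsimp only at this
        have hw : (0 : ℤ) ≤ I.w * I.w := by positivity
        rw [abs_of_nonneg (by linarith [this.1])]; linarith [this.2]
      · rw [List.length_append, List.length_take]; omega
      · rw [List.take_succ_eq_append_getElem hlt, ← List.append_assoc, hel]
        exact h.1
    · simp only [Term.size, loopCost]; omega
    · have ht := h.1
      rw [List.take_of_length_le (by rw [I.length_numEdges])] at ht
      refine ⟨ht, ?_, ?_, ?_⟩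
      · rw [h.2.arr 11 rfl, hσ₁]; simp
      · rw [h.2.arr 12 rfl, hσ₁]; simp
      · rw [h.2.var 4 rfl, hσ₁]; simp
  · change 3 + 1 + 4 + ((3 + 3 + 3) + (3 + 3 + 3 + 2 + 1 + 3) + 4 + (40 + 200 * I.q₁)) ≤ _
    omega

/-- The selection of the numbers so far. -/
structure SelOK (I : Inst) (p : List ℤ × List ℤ) (P : Prop) (σ : Store) : Prop where
  mark : ∀ κ, σ.arr 11 κ = if ∃ x ∈ p.1, I.code x = κ then 1 else 0
  cnt : ∀ κ, σ.arr 12 κ = ((p.1.filter fun x => x % I.q₂ = κ).length : ℤ)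
  edg : Edg (I.padEdges ++ p.1.flatMap I.numEdges) σ
  found : Flag σ 4 (P ∨ ∃ z ∈ p.2, ∃ x ∈ I.S, Good I.S x z)

theorem sel_length_le (L : List ℤ) : (I.sel L).1.length ≤ L.length :=
  (I.sel_spec L).2.2.2.2.2.1.length_le

theorem selStep_mono (p : List ℤ × List ℤ) (z : ℤ) :
    p.1.length ≤ (I.selStep p z).1.length ∧ p.2.length ≤ (I.selStep p z).2.length := by
  unfold Inst.selStep
  split_ifs <;> simp

theorem take_length_mono {i j : ℕ} (h : i ≤ j) :
    (I.sel (I.S.take i)).1.length ≤ (I.sel (I.S.take j)).1.length ∧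
    (I.sel (I.S.take i)).2.length ≤ (I.sel (I.S.take j)).2.length := by
  induction j, h using Nat.le_induction with
  | base => exact ⟨le_rfl, le_rfl⟩
  | succ j _ ih =>
    rcases lt_or_ge j I.S.length with hj | hj
    · rw [take_succ_eq _ hj, I.sel_append]
      have := selStep_mono (I := I) (I.sel (I.S.take j)) I.S[j]
      exact ⟨ih.1.trans this.1, ih.2.trans this.2⟩
    · rw [List.take_of_length_le (i := j + 1) (by omega)]
      rwa [List.take_of_length_le (i := j) hj] at ih

/-- A stored number costs q₁ steps up to constants, a number searched exhaustively costs n, and a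
duplicate in residues costs a constant. -/
theorem ok_sel (hc : Ctx I n σ) (hfit : Fits I n β) {P : Prop} (h0 : SelOK I ([], []) P σ) :
    Ok β 0 selC σ (300 * (n + 1) + 300 * (I.ins.length * I.q₁) + 300 * (I.rest.length * (n + 1)))
      fun σ' => SelOK I (I.ins, I.rest) P σ' ∧ Frame [17, 18, 20, 21, 23, 13, 4] [11, 12] true σ σ' := by
  have hSn := hfit.S_le
  -- The time of one repetition is expressed by the increments of the two lengths `a` and `b`, so
  -- that the total telescopes.
  let a : ℕ → ℕ := fun i => (I.sel (I.S.take i)).1.length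
  let b : ℕ → ℕ := fun i => (I.sel (I.S.take i)).2.length
  refine (run_for' (σ := σ) (N := I.S.length) (e := var 3)
    (fun i σ' => SelOK I (I.sel (I.S.take i)) P σ')
    (fun i => 250 + (300 * I.q₁ * (a (i + 1) - a i) + 300 * (n + 1) * (b (i + 1) - b i)))
    [17, 18, 20, 21, 23, 13, 4] [11, 12] true hc.ns (fun _ => hSn.trans hfit.n_le)
    (by rw [List.take_zero]; exact h0) ?_).mono ?_ fun σ' h => ?_
  · intro i hi σ₁ h hf
    have hc₁ := hc.frame hf
    have hx : σ₁.arr 4 i = I.S[i] := by rw [hc₁.S, cells_getElem _ _ hi]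
    obtain ⟨hmark, hcnt, hedg, hfound⟩ := h
    simp only [a, b]
    rw [take_succ_eq _ hi, I.sel_append]
    set z := I.S[i] with hzd
    set L := I.S.take i with hLd
    set p := I.sel L with hpd
    have hplen : p.1.length ≤ i := (sel_length_le L).trans (by rw [hLd]; simp)
    set σ₂ := ((σ₁.setVar 17 i).setVar 21 z).setVar 23 (I.code z) with hσ₂
    have hc₂ : Ctx I n σ₂ := ((hc₁.setVar _).setVar _).setVar _
    have h2z : σ₂.var 21 = z := by simp [hσ₂]
    have h2k : σ₂.var 23 = I.code z := by simp [hσ₂]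
    have e1 : (get 4 (var 17)).eval (σ₁.setVar 17 i) = z := by simp [hx]
    have e2 : (codeT 21).eval ((σ₁.setVar 17 i).setVar 21 z) = I.code z := by
      rw [eval_codeT ((hc₁.setVar _).setVar _)]; simp
    have hcode : |I.code z| ≤ β.X := by
      have := I.code_bound z
      rw [abs_of_nonneg this.1]
      exact this.2.le.trans (by exact_mod_cast hfit.code_le)
    have hM : (get 11 (var 23)).eval σ₂ ≠ 0 ↔ ∃ x ∈ p.1, I.Same x z := by
      have : (get 11 (var 23)).eval σ₂ = σ₁.arr 11 (I.code z) := by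
        rw [eval_get, eval_var, h2k]; rfl
      rw [this, hmark]
      simp only [I.code_eq_code]
      split_ifs <;> simp_all
    have hT : (ltT (get 12 (var 21 % var 10)) (var 7)).eval σ₂ = 0 ↔
        I.τ ≤ (p.1.filter fun x => x % I.q₂ = z % I.q₂).length := by
      have : (get 12 (var 21 % var 10)).eval σ₂ =
          ((p.1.filter fun x => x % I.q₂ = z % I.q₂).length : ℤ) := by
        rw [eval_get, eval_mod, eval_var, eval_var, h2z, hc₂.q₂]
        exact hcnt _
      rw [eval_ltT, this, eval_var, hc₂.τ]
      split_ifs with h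
      · simp; exact_mod_cast h
      · simp; exact_mod_cast not_lt.1 h
    have start : ∀ {t : ℕ} {Q : Store → Prop}, Ok β 1 (iteC (get 11 (var 23)) skipC <|
        iteC (ltT (get 12 (var 21 % var 10)) (var 7)) insC bruteC) σ₂ t Q →
        Ok β 1 (.seq (asg 21 (get 4 (var 17))) <| .seq (asg 23 (codeT 21)) <|
          iteC (get 11 (var 23)) skipC <|
          iteC (ltT (get 12 (var 21 % var 10)) (var 7)) insC bruteC) (σ₁.setVar 17 i) (70 + t) Q := by
      intro t Q h
      refine (run_asg (fun h => h.2 _ _) (run_asg (fun _ => ?_) (t := t) ?_)).mono ?_ fun _ => id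
      · rw [e1, e2]; exact hcode
      · rw [e1, e2]; exact h
      · change 5 + 5 + (45 + 5 + t) ≤ _; omega
    unfold Inst.selStep
    split_ifs with hs hτ
    · refine (start ((run_ite (fun _ => ok_done ?_) (fun h' => absurd h' (hM.2 hs)) (t' := 0)))).mono
        ?_ fun _ => id
      · exact ⟨hmark, hcnt, hedg.congr (by simp [hσ₂]) rfl rfl,
          hfound.congr (by simp [hσ₂]) Iff.rfl⟩
      · change 70 + (5 + 2 + max 1 0) ≤ _; omega
    · refine (start ((run_ite (fun h' => absurd (hM.1 h') hs) (fun _ => run_ite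
        (fun h' => absurd (hT.2 hτ) h') (fun _ => ((ok_brute hc₂ hfit (P := P ∨ ∃ z ∈ p.2, ∃ x ∈ I.S,
        Good I.S x z) (hfound.congr (by simp [hσ₂]) Iff.rfl) h2z).frame (V := [18, 20, 4])
        (A := []) (D := false) rfl)) (t := 0)) (t := 0)))).mono ?_ fun σ' h => ?_
      · change 70 + (5 + 2 + max 0 ((11 + 3 + 3) + 2 + max 0 (200 * (n + 1)))) ≤ _
        simp
        omega
      · obtain ⟨⟨hfl, hfr⟩, -⟩ := h
        have a11 : σ'.arr 11 = σ₁.arr 11 := by rw [hfr.arr _ rfl]; rfl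
        have a12 : σ'.arr 12 = σ₁.arr 12 := by rw [hfr.arr _ rfl]; rfl
        refine ⟨fun κ => by rw [a11]; exact hmark κ, fun κ => by rw [a12]; exact hcnt κ,
          hedg.congr ?_ ?_ ?_, hfl.congr rfl ?_⟩
        · rw [hfr.var _ rfl]; simp [hσ₂]
        · rw [hfr.darr rfl]; rfl
        · rw [hfr.reg rfl]; rfl
        · simp only [List.mem_append, List.mem_singleton, or_and_right, exists_or,
            exists_eq_left, or_assoc]
    · have hX := hfit.n_le
      have hm := hfit.m_le
      have hfl : (p.1.filter fun x => x % I.q₂ = z % I.q₂).length ≤ i :=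
        (List.length_filter_le _ _).trans hplen
      have h12 : σ₂.arr 12 (z % I.q₂) =
          ((p.1.filter fun x => x % I.q₂ = z % I.q₂).length : ℤ) := hcnt _
      have hlen : (I.padEdges ++ p.1.flatMap I.numEdges).length + I.q₁ ≤ β.X := by
        rw [List.length_append, I.length_padEdges, List.length_flatMap]
        simp only [I.length_numEdges, List.map_const', List.sum_replicate, smul_eq_mul]
        have : (p.1.length + 1) * I.q₁ ≤ I.S.length * I.q₁ := Nat.mul_le_mul_right _ (by omega)
        rw [add_mul] at this
        omega
      refine (start ((run_ite (fun h' => absurd (hM.1 h') hs) (fun _ => run_ite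
        (fun _ => ok_ins hc₂ hfit (hedg.congr (by simp [hσ₂]) rfl rfl) hlen h2z h2k
          ⟨by rw [h12]; positivity, by rw [h12]; omega⟩)
        (fun h' => absurd (hT.1 h') hτ) (t' := 0)) (t := 0)))).mono ?_ fun σ' h => ?_
      · change 70 + (5 + 2 + max 0 ((11 + 3 + 3) + 2 + max (100 + 200 * I.q₁) 0)) ≤ _
        simp
        omega
      · obtain ⟨g1, g2, g3, g4⟩ := h
        refine ⟨fun κ => ?_, fun κ => ?_, ?_, ?_⟩
        · rw [g2, Function.update_apply]
          have : σ₂.arr 11 κ = _ := hmark κ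
          rw [this]
          simp only [List.mem_append, List.mem_singleton, or_and_right, exists_or, exists_eq_left]
          by_cases hκ : κ = I.code z
          · subst hκ; simp
          · rw [if_neg hκ]
            have : ¬ I.code z = κ := fun h => hκ h.symm
            simp only [this, or_false]
        · rw [g3, Function.update_apply, h12]
          have : σ₂.arr 12 κ = _ := hcnt κ
          rw [this, List.filter_append]
          split_ifs with hκ
          · subst hκ; simp
          · simp [Ne.symm hκ]
        · simp only [List.flatMap_append, List.flatMap_singleton]
          rw [← List.append_assoc]
          exact g1
        · exact hfound.congr (by rw [g4]; simp [hσ₂]) Iff.rfl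
  · have ha := Finset.sum_range_tsub (f := a) (fun i j h => (take_length_mono h).1) I.S.length
    have hb := Finset.sum_range_tsub (f := b) (fun i j h => (take_length_mono h).2) I.S.length
    have ha' : a I.S.length = I.ins.length := by simp [a, Inst.ins]
    have hb' : b I.S.length = I.rest.length := by simp [b, Inst.rest]
    have ha0 : a 0 = 0 := by simp [a, Inst.sel]
    have hb0 : b 0 = 0 := by simp [b, Inst.sel]
    simp only [Finset.sum_add_distrib, ← Finset.mul_sum, Finset.sum_const, Finset.card_range,
      smul_eq_mul]
    rw [ha, hb, ha', hb', ha0, hb0]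
    simp only [Term.size, loopCost, Nat.sub_zero]
    nlinarith
  · have := h.1
    rw [List.take_length] at this
    exact ⟨this, h.2⟩

end ISGLowerBound

namespace ISGLowerBound

open Term (lit var get)

variable {β : Bds} {I : Inst} {n : ℕ} {σ : Store}

/-! ### The list of arrivals -/

/-- The arrivals written so far. -/
structure Items (L : List Arrival) (σ : Store) : Prop where
  len : σ.var 14 = L.length
  fl : σ.arr 13 = cells (L.map fun a => if a.fl then 1 else 0)
  v : σ.arr 14 = cells (L.map Arrival.v)
  y : σ.arr 15 = cells (L.map Arrival.y)
  u₁ : σ.arr 16 = cells (L.map Arrival.u₁)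
  u₂ : σ.arr 17 = cells (L.map Arrival.u₂)

theorem Items.congr {L : List Arrival} {σ σ' : Store} (h : Items L σ) (h1 : σ'.var 14 = σ.var 14)
    (h2 : ∀ a ∈ [13, 14, 15, 16, 17], σ'.arr a = σ.arr a) : Items L σ' := by
  simp only [List.mem_cons, List.not_mem_nil, or_false, forall_eq_or_imp, forall_eq] at h2
  obtain ⟨a, b, c, d, e⟩ := h2
  exact ⟨h1.trans h.len, a.trans h.fl, b.trans h.v, c.trans h.y, d.trans h.u₁, e.trans h.u₂⟩

/-- Append an arrival of the query `(x₁₇, x₁₈)`. -/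
def itemC (fl v y : Term) : Cmd :=
  .seq (sto 13 (var 14) fl) <| .seq (sto 14 (var 14) v) <| .seq (sto 15 (var 14) y) <|
  .seq (sto 16 (var 14) (var 17)) <| .seq (sto 17 (var 14) (var 18)) <|
  .seq (asg 14 (var 14 + lit 1)) skipC

theorem map_append_cells {L : List Arrival} (f : Arrival → ℤ) (a : Arrival) :
    Function.update (cells (L.map f)) (L.length : ℤ) (f a) = cells ((L ++ [a]).map f) := by
  rw [List.map_append, ← List.length_map (f := f), cells_append]; rfl

theorem ok_item {d : ℕ} {fl v y : Term} {L : List Arrival} {a : Arrival} (h : Items L σ)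
    (hfl : fl.eval σ = if a.fl then 1 else 0)
    (hv : v.eval (σ.setArr 13 L.length (if a.fl then 1 else 0)) = a.v)
    (hy : y.eval ((σ.setArr 13 L.length (if a.fl then 1 else 0)).setArr 14 L.length a.v) = a.y)
    (h1 : σ.var 17 = a.u₁) (h2 : σ.var 18 = a.u₂)
    (hvX : |a.v| ≤ β.X) (hyX : |a.y| ≤ β.X) (hL : L.length + 1 ≤ β.X)
    (cfl : fl.chk = true := by rfl) (cv : v.chk = true := by rfl) (cy : y.chk = true := by rfl)
    (dfl : fl.deg ≤ β.e := by exact le_trans (by decide) (Bds.deg_le _))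
    (dv : v.deg ≤ β.e := by exact le_trans (by decide) (Bds.deg_le _))
    (dy : y.deg ≤ β.e := by exact le_trans (by decide) (Bds.deg_le _)) :
    Ok β d (itemC fl v y) σ (fl.size + v.size + y.size + 80) fun σ' => Items (L ++ [a]) σ' ∧
      ∀ j, j ≠ 14 → σ'.var j = σ.var j := by
  have hl : σ.var 14 = L.length := h.len
  refine (run_sto (fun _ => ?_) (run_sto (fun _ => ?_) (run_sto (fun _ => ?_)
    (run_sto (fun h => ?_) (run_sto (fun h => ?_) (run_asg (fun _ => ?_) (ok_done ?_)))) (he := cy)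
    (hβ := dy)) (he := cv) (hβ := dv)) (he := cfl) (hβ := dfl)).mono ?_ fun _ => id
  · rw [hfl]; have := β.five_le; split_ifs <;> simp; omega
  · rw [eval_var, hl, hfl, hv]; exact hvX
  · rw [eval_var, hl, hfl, hv, eval_var, Store.setArr_var, hl, hy]; exact hyX
  · exact h.1 17
  · exact h.1 18
  · simp [hl]; rw [abs_of_nonneg (by positivity)]; exact_mod_cast hL
  · rw [eval_var, hl, hfl, hv, eval_var, Store.setArr_var, hl, hy]
    refine ⟨⟨by simp [hl], ?_, ?_, ?_, ?_, ?_⟩, fun j hj => by simp [hj]⟩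
    · rw [← map_append_cells]; simp [hl, h.fl]
    · rw [← map_append_cells]; simp [hl, h.v]
    · rw [← map_append_cells]; simp [hl, h.y]
    · rw [← map_append_cells]; simp [hl, h.u₁, h1]
    · rw [← map_append_cells]; simp [hl, h.u₂, h2]
  · simp only [Term.size]; omega

/-- Write all arrivals. -/
def arrivalsC : Cmd :=
  forC 0 17 (var 10) <| forC 1 18 (var 11) <|
    .seq (itemC (lit 1) (lit 2 * (var 12 * var 12)) (lit 0)) <|
    .seq (forC 2 19 (get 9 (var 18)) <|
      .seq (asg 20 (get 10 (var 18 * var 0 + var 19)))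
      (itemC (lit 0) (var 20 % var 9 * var 12 + (var 17 - var 20) % var 10) (lit 0))) <|
    forC 2 19 (get 7 ((lit 0 - var 17) % var 10)) <|
      .seq (asg 20 (get 8 ((lit 0 - var 17) % var 10 * var 0 + var 19)))
      (itemC (lit 0) (var 12 * var 12 + (var 20 % var 9 * var 12 + (var 18 + var 20) % var 11))
        (var 20))

theorem Bucks.frame {σ' : Store} {L : List ℤ} (h : Bucks I n L σ) {V A : List ℕ} {D : Bool}
    (hf : Frame V A D σ σ')
    (hA : ([5, 6, 7, 8, 9, 10].all fun j => !A.contains j) = true := by rfl) :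
    Bucks I n L σ' := by
  rw [List.all_eq_true] at hA
  have ha : ∀ a ∈ [5, 6, 7, 8, 9, 10], σ'.arr a = σ.arr a :=
    fun a ha' => hf.arr a (by simpa using hA a ha')
  simp only [List.mem_cons, List.not_mem_nil, or_false, forall_eq_or_imp, forall_eq] at ha
  obtain ⟨a5, a6, a7, a8, a9, a10⟩ := ha
  exact ⟨by rw [a5, a6]; exact h.code, by rw [a7, a8]; exact h.q₂, by rw [a9, a10]; exact h.q₃⟩

theorem Bucks.setVar {L : List ℤ} (h : Bucks I n L σ) (j : ℕ) (z : ℤ) :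
    Bucks I n L (σ.setVar j z) := ⟨h.code, h.q₂, h.q₃⟩

/-- The arrivals of the first queries. -/
def someArrivals (I : Inst) (i j : ℕ) : List Arrival :=
  ((List.range i).flatMap fun i : ℕ => (List.range I.q₃).flatMap fun j : ℕ => I.query i j) ++
    (List.range j).flatMap fun j : ℕ => I.query i j

theorem someArrivals_prefix {i j : ℕ} (hi : i < I.q₂) (hj : j < I.q₃) :
    someArrivals I i j ++ I.query i j <+: I.arrivals := by
  have h1 : ∀ {α : Type} (f : ℕ → List α) (a b : ℕ), a ≤ b →
      (List.range a).flatMap f <+: (List.range b).flatMap f := by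
    intro α f a b hab
    induction b, hab using Nat.le_induction with
    | base => exact List.prefix_refl _
    | succ b _ ih =>
      rw [List.range_succ, List.flatMap_append]
      exact ih.trans (List.prefix_append _ _)
  have e : someArrivals I i j ++ I.query i j =
      ((List.range i).flatMap fun i : ℕ => (List.range I.q₃).flatMap fun j : ℕ => I.query i j) ++
      (List.range (j + 1)).flatMap fun j : ℕ => I.query i j := by
    unfold someArrivals
    rw [List.range_succ, List.flatMap_append, List.append_assoc]; simp
  rw [e]
  refine List.IsPrefix.trans ?_ (h1 (fun i : ℕ => (List.range I.q₃).flatMap fun j : ℕ => I.query i j)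
    (i + 1) I.q₂ hi)
  have e2 : ∀ f : ℕ → List Arrival, (List.range (i + 1)).flatMap f =
      (List.range i).flatMap f ++ f i := fun f => by
    rw [List.range_succ, List.flatMap_append, List.flatMap_singleton]
  rw [e2, List.prefix_append_right_inj]
  exact h1 (fun j : ℕ => I.query i j) (j + 1) I.q₃ hj

theorem abs_le_of_mem (hS : σ.Small β.X) (hc : Ctx I n σ) {x : ℤ} (hx : x ∈ I.S) : |x| ≤ β.X := by
  obtain ⟨i, hi, rfl⟩ := List.mem_iff_getElem.1 hx
  have := hS.2 4 i
  rwa [hc.S, cells_getElem _ _ hi] at this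

theorem ok_itemsA {i j : ℕ} {L : List Arrival} (hc : Ctx I n σ) (hfit : Fits I n β)
    (hb : Bucks I n I.S σ) (h17 : σ.var 17 = i) (h18 : σ.var 18 = j) (hL : Items L σ)
    (hX : L.length + (I.listA i j).length ≤ β.X) :
    Ok β 2 (forC 2 19 (get 9 (var 18)) <|
      .seq (asg 20 (get 10 (var 18 * var 0 + var 19)))
      (itemC (lit 0) (var 20 % var 9 * var 12 + (var 17 - var 20) % var 10) (lit 0))) σ
      (50 + 300 * (I.listA i j).length) fun σ' =>
      Items (L ++ I.listA i j) σ' ∧ Frame [19, 20, 14] [13, 14, 15, 16, 17] false σ σ' := by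
  set l := I.S.filter fun x => x % I.q₃ = (j : ℤ) with hl
  have hAl : I.listA i j = l.map (I.itemA i j) := rfl
  have hlen : (I.listA i j).length = l.length := by rw [hAl, List.length_map]
  have hN : (get 9 (var 18)).eval σ = l.length := by
    rw [eval_get, eval_var, h18, hb.q₃.len]
  refine Ok.mono (run_for (σ := σ) (N := l.length) (e := get 9 (var 18))
    (fun k σ' => Items (L ++ (l.take k).map (I.itemA i j)) σ')
    [19, 20, 14] [13, 14, 15, 16, 17] false hN (fun _ => by omega) (by simpa using hL)
    (w := 200) ?_) ?_ fun σ' h => ?_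
  · intro k hk σ₁ h hf
    have hc₁ := hc.frame hf
    have hb₁ := hb.frame hf
    have e17 : σ₁.var 17 = i := by rw [hf.var _ rfl, h17]
    have e18 : σ₁.var 18 = j := by rw [hf.var _ rfl, h18]
    have hx : (get 10 (var 18 * var 0 + var 19)).eval (σ₁.setVar 19 k) = l[k] := by
      have := hb₁.q₃.elem j k hk
      simpa [e18, hc₁.n] using this
    have hmem : l[k] ∈ I.S := (List.mem_filter.1 (List.getElem_mem hk)).1
    have hc₂ : Ctx I n ((σ₁.setVar 19 k).setVar 20 l[k]) := (hc₁.setVar _).setVar _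
    have hvb := I.vertA_bound i l[k]
    have hnv := hfit.nv_le
    have hnv' : (I.nv : ℤ) ≤ β.X := by exact_mod_cast hnv
    have hlt : I.vertA i l[k] < I.nv :=
      Inst.lt_nv (by linarith [hvb.1, hvb.2])
    rw [List.take_succ_eq_append_getElem hk, List.map_append, ← List.append_assoc]
    refine Ok.mono (run_asg (fun h => h.2 _ _) ?_ (t := 150) (Q := fun σ' =>
      Items (L ++ (l.take k).map (I.itemA i j) ++ [I.itemA i j l[k]]) σ')) (by decide) fun _ => id
    rw [hx]
    refine Ok.mono (ok_item (β := β) (σ := (σ₁.setVar 19 k).setVar 20 l[k])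
      (fl := lit 0) (v := var 20 % var 9 * var 12 + (var 17 - var 20) % var 10) (y := lit 0)
      (a := I.itemA i j l[k]) (h.congr (by simp) fun _ _ => rfl) rfl ?_ rfl ?_ ?_ ?_ ?_ ?_)
      (by decide) fun σ' h => h.1
    · simp only [eval_add, eval_mul, eval_mod, eval_sub, eval_var, Store.setArr_var, hc₂.q₁,
        hc₂.w, hc₂.q₂]
      simp [e17]; rfl
    · change _ = (i : ℤ)
      simpa using e17
    · change _ = (j : ℤ)
      simpa using e18
    · change |I.vertA i l[k]| ≤ _
      rw [abs_of_nonneg hvb.1]; linarith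
    · change |(0 : ℤ)| ≤ _
      simp
    · simp only [List.length_append, List.length_map, List.length_take]; omega
  · simp only [Term.size, loopCost]; omega
  · rw [List.take_length] at h
    exact h

theorem ok_itemsB {i j : ℕ} {L : List Arrival} (hc : Ctx I n σ) (hfit : Fits I n β)
    (hS : σ.Small β.X)
    (hb : Bucks I n I.S σ) (h17 : σ.var 17 = i) (h18 : σ.var 18 = j) (hL : Items L σ)
    (hX : L.length + (I.listB i j).length ≤ β.X) :
    Ok β 2 (forC 2 19 (get 7 ((lit 0 - var 17) % var 10)) <|
      .seq (asg 20 (get 8 ((lit 0 - var 17) % var 10 * var 0 + var 19)))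
      (itemC (lit 0) (var 12 * var 12 + (var 20 % var 9 * var 12 + (var 18 + var 20) % var 11))
        (var 20))) σ
      (50 + 300 * (I.listB i j).length) fun σ' =>
      Items (L ++ I.listB i j) σ' ∧ Frame [19, 20, 14] [13, 14, 15, 16, 17] false σ σ' := by
  set l := I.S.filter fun x => x % I.q₂ = (-(i : ℤ)) % I.q₂ with hl
  have hAl : I.listB i j = l.map (I.itemB i j) := rfl
  have hlen : (I.listB i j).length = l.length := by rw [hAl, List.length_map]
  have hN : (get 7 ((lit 0 - var 17) % var 10)).eval σ = l.length := by
    simp only [eval_get, eval_mod, eval_sub, eval_lit, eval_var, h17, hc.q₂, hb.q₂.len, zero_sub]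
    rfl
  refine Ok.mono (run_for (σ := σ) (N := l.length) (e := get 7 ((lit 0 - var 17) % var 10))
    (fun k σ' => Items (L ++ (l.take k).map (I.itemB i j)) σ')
    [19, 20, 14] [13, 14, 15, 16, 17] false hN (fun _ => by omega) (by simpa using hL)
    (w := 200) ?_) ?_ fun σ' h => ?_
  · intro k hk σ₁ h hf
    have hc₁ := hc.frame hf
    have hb₁ := hb.frame hf
    have e17 : σ₁.var 17 = i := by rw [hf.var _ rfl, h17]
    have e18 : σ₁.var 18 = j := by rw [hf.var _ rfl, h18]
    have hx : (get 8 ((lit 0 - var 17) % var 10 * var 0 + var 19)).eval (σ₁.setVar 19 k) =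
        l[k] := by
      have := hb₁.q₂.elem ((-(i : ℤ)) % I.q₂) k hk
      simpa [e17, hc₁.n, hc₁.q₂] using this
    have hmem : l[k] ∈ I.S := (List.mem_filter.1 (List.getElem_mem hk)).1
    have hc₂ : Ctx I n ((σ₁.setVar 19 k).setVar 20 l[k]) := (hc₁.setVar _).setVar _
    have hvb := I.vertB_bound j l[k]
    have hnv := hfit.nv_le
    have hnv' : (I.nv : ℤ) ≤ β.X := by exact_mod_cast hnv
    have hlt : I.vertB j l[k] < I.nv := Inst.lt_nv hvb.2
    have hw : (0 : ℤ) ≤ I.w * I.w := by positivity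
    rw [List.take_succ_eq_append_getElem hk, List.map_append, ← List.append_assoc]
    refine Ok.mono (run_asg (fun h => h.2 _ _) ?_ (t := 150) (Q := fun σ' =>
      Items (L ++ (l.take k).map (I.itemB i j) ++ [I.itemB i j l[k]]) σ')) (by decide) fun _ => id
    rw [hx]
    refine Ok.mono (ok_item (β := β) (σ := (σ₁.setVar 19 k).setVar 20 l[k])
      (fl := lit 0) (v := var 12 * var 12 + (var 20 % var 9 * var 12 + (var 18 + var 20) % var 11))
      (y := var 20)
      (a := I.itemB i j l[k]) (h.congr (by simp) fun _ _ => rfl) rfl ?_ ?_ ?_ ?_ ?_ ?_ ?_)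
      (by decide) fun σ' h => h.1
    · simp only [eval_add, eval_mul, eval_mod, eval_var, Store.setArr_var, hc₂.q₁,
        hc₂.w, hc₂.q₃]
      simp [e18]; rfl
    · simp; rfl
    · change _ = (i : ℤ)
      simpa using e17
    · change _ = (j : ℤ)
      simpa using e18
    · change |I.vertB j l[k]| ≤ _
      rw [abs_of_nonneg (by linarith [hvb.1])]; linarith
    · exact abs_le_of_mem hS hc hmem
    · simp only [List.length_append, List.length_map, List.length_take]; omega
  · change ((3 + 1 + 3) + 3 + 3 + 2) + 10 + _ ≤ _
    simp only [loopCost]; omega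
  · rw [List.take_length] at h
    exact h

theorem ok_arrivals (hc : Ctx I n σ) (hfit : Fits I n β) (hb : Bucks I n I.S σ)
    (h0 : Items [] σ) :
    Ok β 0 arrivalsC σ (1000 * (I.arrivals.length + 1)) fun σ' =>
      Items I.arrivals σ' ∧ Frame [17, 18, 19, 20, 14] [13, 14, 15, 16, 17] false σ σ' := by
  have hq2X : σ.Small β.X → I.q₂ ≤ β.X := fun h => by
    have := (le_abs_self _).trans (h.1 10); rw [hc.q₂] at this; exact_mod_cast this
  have hq3X : σ.Small β.X → I.q₃ ≤ β.X := fun h => by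
    have := (le_abs_self _).trans (h.1 11); rw [hc.q₃] at this; exact_mod_cast this
  have hnv := hfit.nv_le
  have hnv' : (I.nv : ℤ) ≤ β.X := by exact_mod_cast hnv
  have hlen : I.arrivals.length = ∑ i ∈ Finset.range I.q₂, ∑ j ∈ Finset.range I.q₃,
      (I.query i j).length := by
    have h : ∀ (f : ℕ → List Arrival) m, ((List.range m).flatMap f).length =
        ∑ i ∈ Finset.range m, (f i).length := fun f m => by
      have := Inst.sum_map_flatMap_range (fun _ => 1) f m
      simpa using this
    unfold Inst.arrivals
    rw [h]
    exact Finset.sum_congr rfl fun i _ => h _ _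
  -- The dummy makes every query contribute to the number of arrivals, which therefore also pays for
  -- the overhead of queries without numbers.
  have hq1 : ∀ i j : ℤ, 1 ≤ (I.query i j).length := fun i j => by simp [Inst.query]
  refine Ok.of_small fun hS => ?_
  refine Ok.mono (run_for' (σ := σ) (N := I.q₂) (e := var 10)
    (fun i σ' => Items (someArrivals I i 0) σ')
    (fun i => ∑ j ∈ Finset.range I.q₃, 700 * (I.query i j).length + 20)
    [17, 18, 19, 20, 14] [13, 14, 15, 16, 17] false hc.q₂ hq2X
    (by simpa [someArrivals] using h0) ?_) ?_ fun σ' h => ?_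
  · intro i hi σ₁ h₁ hf₁
    have hc₁ : Ctx I n (σ₁.setVar 17 i) := (hc.frame hf₁).setVar _
    have hb₁ : Bucks I n I.S (σ₁.setVar 17 i) := (hb.frame hf₁).setVar _ _
    refine Ok.mono (run_for' (σ := σ₁.setVar 17 i) (N := I.q₃) (e := var 11)
      (fun j σ' => Items (someArrivals I i j) σ')
      (fun j => 350 + 300 * (I.query i j).length)
      [18, 19, 20, 14] [13, 14, 15, 16, 17] false hc₁.q₃ (fun _ => hq3X hS)
      (h₁.congr (by simp) fun _ _ => rfl) ?_) ?_ fun σ' h => ?_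
    · intro j hj σ₂ h₂ hf₂
      refine Ok.of_small fun hS₂ => ?_
      have hc₂ : Ctx I n (σ₂.setVar 18 j) := (hc₁.frame hf₂).setVar _
      have hb₂ : Bucks I n I.S (σ₂.setVar 18 j) := (hb₁.frame hf₂).setVar _ _
      have e17 : (σ₂.setVar 18 j).var 17 = i := by
        rw [Store.setVar_var, if_neg (by norm_num), hf₂.var 17 rfl]; simp
      have e18 : (σ₂.setVar 18 j).var 18 = j := by simp
      have hpre := (someArrivals_prefix (I := I) hi hj).length_le
      have hX := hfit.arr_le
      have hql : (I.query i j).length = 1 + (I.listA i j).length + (I.listB i j).length := by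
        simp [Inst.query]; omega
      rw [List.length_append] at hpre
      have hd := I.dummy_bound
      refine Ok.mono (ok_seq (d := 2) (((ok_item (d := 2) (β := β) (σ := σ₂.setVar 18 j) (fl := lit 1)
        (v := lit 2 * (var 12 * var 12)) (y := lit 0) (a := I.itemD i j)
        (h₂.congr (by simp) fun _ _ => rfl) rfl ?_ rfl e17 e18 ?_ ?_ ?_).frame
        (V := [14]) (A := [13, 14, 15, 16, 17]) (D := false) rfl).small) fun σ₃ h₃ =>
        ok_seq (d := 2) (ok_itemsA (hc₂.frame h₃.1.2) hfit (hb₂.frame h₃.1.2)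
          (by rw [h₃.1.2.var _ rfl, e17]) (by rw [h₃.1.2.var _ rfl, e18]) h₃.1.1.1 ?_).small
        fun σ₄ h₄ => Ok.mono (ok_itemsB (β := β) (σ := σ₄) (I := I) (n := n) (i := i) (j := j)
          (L := someArrivals I i j ++ [I.itemD i j] ++ I.listA i j) ((hc₂.frame h₃.1.2).frame h₄.1.2) hfit h₄.2
          ((hb₂.frame h₃.1.2).frame h₄.1.2)
          (by rw [h₄.1.2.var _ rfl, h₃.1.2.var _ rfl, e17])
          (by rw [h₄.1.2.var _ rfl, h₃.1.2.var _ rfl, e18]) h₄.1.1 ?_)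
          (le_refl _) (Q' := Items (someArrivals I i j ++ [I.itemD i j] ++ I.listA i j ++
            I.listB i j)) fun σ' h => h.1) ?_ fun σ' h => ?_
      · simp only [eval_lit, eval_mul, eval_var, Store.setArr_var, hc₂.w]; rfl
      · change |I.dummy| ≤ _
        rw [abs_of_nonneg hd.1]; linarith [hd.2]
      · change |(0 : ℤ)| ≤ _
        simp
      · omega
      · rw [List.length_append, List.length_singleton]; omega
      · rw [List.length_append, List.length_append, List.length_singleton]; omega
      · have : (lit 1).size + (lit 2 * (var 12 * var 12)).size + (lit 0).size ≤ 60 := by decide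
        omega
      · have e : someArrivals I i (j + 1) = someArrivals I i j ++ [I.itemD i j] ++ I.listA i j ++
            I.listB i j := by
          unfold someArrivals
          rw [List.range_succ, List.flatMap_append]
          simp [Inst.query]
        rw [e]; exact h
    · have : ∑ j ∈ Finset.range I.q₃, (350 + 300 * (I.query i j).length + loopCost) ≤
          ∑ j ∈ Finset.range I.q₃, 700 * (I.query i j).length := Finset.sum_le_sum fun j _ => by
        have := hq1 i j; simp only [loopCost]; omega
      simp only [Term.size]; omega
    · have := h.1
      have e : someArrivals I (i + 1) 0 = someArrivals I i I.q₃ := by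
        unfold someArrivals
        rw [List.range_succ, List.flatMap_append]; simp
      rw [e]; exact this
  · rw [hlen]
    have : ∑ i ∈ Finset.range I.q₂, (∑ j ∈ Finset.range I.q₃, 700 * (I.query i j).length + 20 +
        loopCost) ≤ ∑ i ∈ Finset.range I.q₂, 1000 * ∑ j ∈ Finset.range I.q₃,
          (I.query i j).length := Finset.sum_le_sum fun i _ => by
      rw [← Finset.mul_sum]
      have : 1 ≤ ∑ j ∈ Finset.range I.q₃, (I.query i j).length :=
        (hq1 i 0).trans (Finset.single_le_sum (f := fun j : ℕ => (I.query i j).length)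
          (fun _ _ => Nat.zero_le _) (Finset.mem_range.2 I.q₃_pos))
      simp only [loopCost]; omega
    rw [← Finset.mul_sum] at this
    simp only [Term.size]; omega
  · have := h.1
    have e : someArrivals I I.q₂ 0 = I.arrivals := by simp [someArrivals, Inst.arrivals]
    rw [e] at this
    exact ⟨this, h.2⟩

end ISGLowerBound

namespace ISGLowerBound

open Term (lit var get)

variable {β : Bds} {I : Inst} {n : ℕ} {σ : Store}

/-! ### Tests upon an arrival -/

/-- Test the edges reported upon the arrival with index `x₂₄`. -/
def handleC : Cmd :=
  .seq (forC 1 18 (var 2 - var 15) <|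
    .seq (asg 21 (get 1 (var 15 + var 18))) <|
    .seq (asg 23 ((var 21 / var 12 * var 12 + (get 16 (var 24) - var 21 % var 12) % var 10) *
      var 12 + get 17 (var 24))) <|
    forC 2 19 (get 5 (var 23)) <|
      .seq (asg 20 (get 6 (var 23 * var 0 + var 19))) <|
      iteC (goodT (var 20) (get 15 (var 24))) (.seq (asg 16 (lit 1)) skipC) skipC) <|
  .seq (asg 15 (var 2)) skipC

/-- The key under which the candidates for an edge are listed. -/
def edgeKey (I : Inst) (a : Arrival) (u : ℤ) : ℤ :=
  (u / I.w * I.w + (a.u₁ - u % I.w) % I.q₂) * I.w + a.u₂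

/-- The three congruences fix the full code of a candidate, so the candidates are exactly one bucket
and are listed without search. -/
theorem cands_eq {a : Arrival} {e : ℤ × ℤ} (hu : 0 ≤ a.u₂) (hu' : a.u₂ < I.w) :
    I.cands a e = I.S.filter fun x => I.code x = edgeKey I a e.1 := by
  refine List.filter_congr fun x _ => ?_
  rw [decide_eq_decide, edgeKey, I.code_eq_iff (I.mod_lt_w₂ _).1 (I.mod_lt_w₂ _).2 hu hu']

/-- The key of a reported edge is the code of an actual number, since the edge has a candidate; this
bounds the key. -/
theorem abs_edgeKey_le {a : List (Fin I.graph.n) × Arrival} (ha : a ∈ I.annotated)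
    {e : ℤ × ℤ} (he : e ∈ I.reported a) :
    I.cands a.2 e = I.S.filter (fun x => I.code x = edgeKey I a.2 e.1) ∧
      0 ≤ edgeKey I a.2 e.1 ∧ edgeKey I a.2 e.1 < I.w ^ 3 := by
  rcases Inst.mem_annotated ha with ⟨h, -⟩ | h
  · rw [h] at he; simp at he
  obtain ⟨x, hx, -⟩ := (h.reported_spec he).2.1
  have hu : 0 ≤ a.2.u₂ ∧ a.2.u₂ < I.w := by
    simp only [Inst.cands, List.mem_filter, decide_eq_true_eq] at hx
    rw [← hx.2.2.2]; exact I.mod_lt_w₃ x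
  have hc := cands_eq (I := I) (a := a.2) (e := e) hu.1 hu.2
  refine ⟨hc, ?_⟩
  rw [hc] at hx
  have := (List.mem_filter.1 hx).2
  rw [decide_eq_true_eq] at this
  rw [← this]
  exact I.code_bound x

theorem ok_testEdge (hc : Ctx I n σ) (hfit : Fits I n β) (hb : Bucks I n I.S σ) {P : Prop}
    (hP : Flag σ 16 P) {key y : ℤ} (h23 : σ.var 23 = key)
    (hy : (get 15 (var 24)).eval σ = y) :
    Ok β 2 (forC 2 19 (get 5 (var 23)) <|
      .seq (asg 20 (get 6 (var 23 * var 0 + var 19))) <|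
      iteC (goodT (var 20) (get 15 (var 24))) (.seq (asg 16 (lit 1)) skipC) skipC) σ
      (50 + 200 * (I.S.filter fun x => I.code x = key).length) fun σ' =>
      (Flag σ' 16 (P ∨ ∃ x ∈ I.S.filter (fun x => I.code x = key), Good I.S x y) ∧
        σ'.ds = σ.ds) ∧ Frame [19, 20, 16] [] false σ σ' := by
  set l := I.S.filter fun x => I.code x = key with hl
  have hN : (get 5 (var 23)).eval σ = l.length := by
    rw [eval_get, eval_var, h23, hb.code.len]
  have hlS : l.length ≤ I.S.length := List.length_filter_le _ _
  refine (run_for (σ := σ) (N := l.length) (e := get 5 (var 23))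
    (fun i σ' => Flag σ' 16 (P ∨ ∃ x ∈ l.take i, Good I.S x y) ∧ σ'.ds = σ.ds)
    [19, 20, 16] [] false hN (fun _ => hlS.trans (hfit.S_le.trans hfit.n_le))
    ⟨by simpa using hP, rfl⟩ (w := 180) ?_).mono ?_ fun σ' h => ?_
  · intro i hi σ₁ ⟨h, hds⟩ hf
    have hc₁ := hc.frame hf
    have hb₁ := hb.frame hf
    have hc₂ : Ctx I n ((σ₁.setVar 19 i).setVar 20 l[i]) := (hc₁.setVar _).setVar _
    have hg := eval_goodT hc₂ (var 20) (get 15 (var 24))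
    have e1 : (get 15 (var 24)).eval ((σ₁.setVar 19 i).setVar 20 l[i]) = y := by
      rw [← hy]
      simp only [eval_get, eval_var, Store.setVar_var, Store.setVar_arr]
      rw [if_neg (by norm_num), if_neg (by norm_num), hf.var 24 rfl, hf.arr 15 rfl]
    have e2 : ((σ₁.setVar 19 i).setVar 20 l[i]).var 20 = l[i] := by simp
    have e3 : (Term.get 6 (var 23 * var 0 + var 19)).eval (σ₁.setVar 19 i) = l[i] := by
      have := hb₁.code.elem key i hi
      have e23 : σ₁.var 23 = key := by rw [hf.var 23 rfl, h23]
      simpa [e23, hc₁.n] using this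
    rw [eval_var, e1, e2] at hg
    rw [exists_mem_take_succ hi]
    refine (run_asg (fun h => h.2 _ _) (run_ite (fun h' => run_asg (fun _ => ?_) (ok_done ?_))
      fun h' => ok_done ?_)).mono (by decide) fun _ => id
    · have := β.five_le; simp; omega
    · rw [e3] at h' ⊢
      exact ⟨.of_true (by simp) (.inr (.inr (hg.1 h'))), hds⟩
    · rw [e3] at h' ⊢
      refine ⟨h.congr (by simp) ?_, hds⟩
      rw [or_iff_left (a := ∃ x ∈ l.take i, _)]
      exact fun hh => hg.2 hh h'
  · simp only [Term.size, loopCost]; omega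
  · rw [List.take_length] at h; exact h

/-- The order of the reports is not specified, so the new pairs `E` are known only up to
permutation; neither the number of tests nor their outcome depends on the order. The time per edge
is covered by the tests, because every edge causes at least one. -/
theorem ok_handle (hc : Ctx I n σ) (hfit : Fits I n β) (hb : Bucks I n I.S σ)
    (hI : Items I.arrivals σ) {i : ℕ} (hi : i < I.annotated.length) (h24 : σ.var 24 = i)
    (h16 : σ.var 16 = 0) {E : List (ℤ × ℤ)} {p : ℕ} (hE : E.Perm (I.reported I.annotated[i]))
    (h15 : σ.var 15 = p) (h2 : σ.var 2 = p + E.length) (hX : p + E.length ≤ β.X)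
    (hfst : ∀ j (h : j < E.length), σ.arr 1 (p + j : ℕ) = E[j].1) :
    Ok β 1 handleC σ (100 + 400 * I.tests I.annotated[i]) fun σ' =>
      Flag σ' 16 (I.Hit I.annotated[i]) ∧ σ'.var 15 = p + E.length ∧ σ'.ds = σ.ds ∧
        Frame [15, 16, 18, 19, 20, 21, 23] [] false σ σ' := by
  set a := I.annotated[i] with ha
  have ham : a ∈ I.annotated := List.getElem_mem _
  have hai : i < I.arrivals.length := by rwa [length_withPrev] at hi
  have ha2 : I.arrivals[i] = a.2 := by
    have h := map_snd_withPrev (fl := Arrival.fl) (vt := I.vt) [] I.arrivals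
    have : (I.annotated.map Prod.snd)[i]'(by simpa using hi) = I.arrivals[i] :=
      List.getElem_of_eq h _
    rw [← this, List.getElem_map]
  have ey : ∀ τ : Store, τ.arr 15 = σ.arr 15 → τ.var 24 = σ.var 24 →
      (get 15 (var 24)).eval τ = a.2.y := fun τ h1 h2 => by
    rw [eval_get, eval_var, h1, h2, h24, hI.y, cells_getElem _ _ (by simpa using hai)]
    simp [ha2]
  have eu1 : σ.arr 16 i = a.2.u₁ := by
    rw [hI.u₁, cells_getElem _ _ (by simpa using hai)]; simp [ha2]
  have eu2 : σ.arr 17 i = a.2.u₂ := by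
    rw [hI.u₂, cells_getElem _ _ (by simpa using hai)]; simp [ha2]
  have hsum : ((E.map fun e => (I.cands a.2 e).length).sum) = I.tests a :=
    (hE.map _).sum_eq
  have hlen : E.length ≤ I.tests a := hE.length_eq.trans_le (Inst.length_reported_le ham)
  refine Ok.mono (ok_seq (run_for' (σ := σ) (N := E.length) (e := var 2 - var 15)
    (fun j σ' => Flag σ' 16 (∃ e ∈ E.take j, ∃ x ∈ I.cands a.2 e, Good I.S x a.2.y) ∧
      σ'.ds = σ.ds)
    (fun j => 150 + 200 * if h : j < E.length then (I.cands a.2 E[j]).length else 0)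
    [16, 18, 19, 20, 21, 23] [] false (by simp [h2, h15]) (fun _ => by omega)
    ⟨.inl ⟨h16, by simp⟩, rfl⟩ ?_) fun σ' h => run_asg (fun h => h.1 2) (ok_done ?_))
    ?_ fun _ => id
  · intro j hj σ₁ ⟨h, hds⟩ hf
    have hEj : E[j] ∈ I.reported a := hE.subset (List.getElem_mem _)
    obtain ⟨k1, k2, k3⟩ := abs_edgeKey_le ham hEj
    have hc₁ : Ctx I n ((σ₁.setVar 18 j).setVar 21 E[j].1) :=
      ((hc.frame hf).setVar _).setVar _
    have e1 : (get 1 (var 15 + var 18)).eval (σ₁.setVar 18 j) = E[j].1 := by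
      have := hfst j hj
      have e15 : σ₁.var 15 = p := by rw [hf.var 15 rfl, h15]
      simp only [eval_get, eval_add, eval_var, Store.setVar_var, Store.setVar_arr]
      rw [if_neg (by norm_num), if_pos trivial, e15, hf.arr 1 rfl, ← this]
      push_cast; rfl
    have e2 : ((var 21 / var 12 * var 12 + (get 16 (var 24) - var 21 % var 12) % var 10) *
        var 12 + get 17 (var 24)).eval ((σ₁.setVar 18 j).setVar 21 E[j].1) =
        edgeKey I a.2 E[j].1 := by
      have e24 : ((σ₁.setVar 18 j).setVar 21 E[j].1).var 24 = i := by
        simp only [Store.setVar_var]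
        rw [if_neg (by norm_num), if_neg (by norm_num), hf.var 24 rfl, h24]
      have e21 : ((σ₁.setVar 18 j).setVar 21 E[j].1).var 21 = E[j].1 := by simp
      have e16 : ((σ₁.setVar 18 j).setVar 21 E[j].1).arr 16 i = a.2.u₁ := by
        rw [← eu1, ← hf.arr 16 rfl]; rfl
      have e17 : ((σ₁.setVar 18 j).setVar 21 E[j].1).arr 17 i = a.2.u₂ := by
        rw [← eu2, ← hf.arr 17 rfl]; rfl
      simp only [eval_add, eval_mul, eval_mod, eval_sub, eval_div, eval_get, eval_var, e24, e21,
        e16, e17, hc₁.w, hc₁.q₂, edgeKey]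
    rw [exists_mem_take_succ hj, dif_pos hj, k1]
    refine Ok.mono (run_asg (fun h => h.2 _ _) (run_asg (fun _ => ?_)
      (t := 50 + 200 * (I.S.filter fun x => I.code x = edgeKey I a.2 E[j].1).length) ?_)) ?_
      fun _ h => h
    · rw [e1, e2, abs_of_nonneg k2]
      exact k3.le.trans (by exact_mod_cast hfit.code_le)
    · rw [e1, e2]
      have hfl : Flag (((σ₁.setVar 18 j).setVar 21 E[j].1).setVar 23 (edgeKey I a.2 E[j].1)) 16
          (∃ e ∈ E.take j, ∃ x ∈ I.cands a.2 e, Good I.S x a.2.y) := h.congr (by simp) Iff.rfl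
      refine (ok_testEdge (β := β) (key := edgeKey I a.2 E[j].1) (y := a.2.y) (hc₁.setVar _) hfit (((hb.frame hf).setVar _ _).setVar _ _ |>.setVar _ _)
        hfl (by simp) (ey _ ?_ ?_)).mono le_rfl
        fun σ' h => ⟨?_, h.1.2.trans hds⟩
      · rw [← hf.arr 15 rfl]; rfl
      · rw [← hf.var 24 rfl]; simp
      · exact h.1.1
    · have h1 : (get 1 (var 15 + var 18)).size ≤ 20 := by decide
      have h2 : ((var 21 / var 12 * var 12 + (get 16 (var 24) - var 21 % var 12) % var 10) *
        var 12 + get 17 (var 24)).size ≤ 60 := by decide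
      omega
  · refine ⟨?_, ?_, h.1.2, ?_⟩
    · have := h.1.1
      rw [List.take_length] at this
      refine this.congr (by simp) ?_
      simp only [Inst.Hit]
      exact exists_congr fun e => and_congr_left fun _ => hE.mem_iff
    · simp [h.2.var 2 rfl, h2]
    · refine Frame.trans (σ' := σ') ⟨fun j hj => h.2.var j ?_, h.2.arr, h.2.reg, h.2.darr⟩
        ⟨fun j hj => ?_, fun _ _ => rfl, fun _ => rfl, fun _ => rfl⟩
      · simp at hj ⊢; tauto
      · simp at hj ⊢; tauto
  · have : ∑ j ∈ Finset.range E.length, (150 + 200 * (if h : j < E.length then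
        (I.cands a.2 E[j]).length else 0) + loopCost) =
        161 * E.length + 200 * I.tests a := by
      rw [← hsum, Finset.sum_add_distrib, Finset.sum_add_distrib, ← Finset.mul_sum]
      have : ∑ j ∈ Finset.range E.length, (if h : j < E.length then
          (I.cands a.2 E[j]).length else 0) = (E.map fun e => (I.cands a.2 e).length).sum := by
        rw [Finset.sum_range, ← List.sum_ofFn]
        congr 1
        refine List.ext_getElem (by simp) fun k h1 h2 => by simp
      rw [this]
      simp [loopCost]; ring
    rw [this]
    have h1 : (var 2 - var 15).size + (var 2).size ≤ 20 := by decide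
    omega

end ISGLowerBound

namespace ISGLowerBound

open Term (lit var get)

variable {β : Bds} {I : Inst} {n : ℕ} {σ : Store} {P : Prop}

/-! ### The interaction with the data structure -/

/-- What the program needs to know while it answers the queries. -/
structure Core (I : Inst) (n : ℕ) (P : Prop) (σ : Store) : Prop where
  ctx : Ctx I n σ
  bucks : Bucks I n I.S σ
  items : Items I.arrivals σ
  found : Flag σ 4 P

theorem Core.congr {σ' : Store} (h : Core I n P σ)
    (hv : ∀ j ∈ [0, 1, 3, 7, 8, 9, 10, 11, 12, 4, 14], σ'.var j = σ.var j)
    (ha : ∀ a ∈ [3, 4, 5, 6, 7, 8, 9, 10, 13, 14, 15, 16, 17], σ'.arr a = σ.arr a) :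
    Core I n P σ' where
  ctx := h.ctx.congr (fun j hj => hv j (by simp at hj ⊢; tauto))
    (fun a ha' => ha a (by simp at ha' ⊢; tauto))
  bucks := by
    have := h.bucks
    refine ⟨?_, ?_, ?_⟩
    · rw [ha 5 (by simp), ha 6 (by simp)]; exact this.code
    · rw [ha 7 (by simp), ha 8 (by simp)]; exact this.q₂
    · rw [ha 9 (by simp), ha 10 (by simp)]; exact this.q₃
  items := h.items.congr (hv 14 (by simp)) fun a ha' => ha a (by simp at ha' ⊢; tauto)
  found := h.found.congr (hv 4 (by simp)) Iff.rfl

theorem Core.simFrame {σ' : Store} (h : Core I n P σ) (hf : SimFrame σ σ') : Core I n P σ' :=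
  h.congr (fun j hj => hf.var j (by rintro rfl; simp at hj))
    fun a ha => hf.arr a (by rintro rfl; simp at ha) (by rintro rfl; simp at ha)

/-- Serve the arrival with index `x₂₄`. -/
def serveC (D : ISGStructure) : Cmd :=
  .seq (iteC (get 13 (var 24)) (simC D.start) skipC) <|
  .seq (asgD 2 (get 14 (var 24))) <|
  .seq (simC D.arrive) handleC

/-- Serve all arrivals until a solution is found. -/
def serveAllC (D : ISGStructure) : Cmd := forC 0 24 (var 14) (iteC (var 16) skipC (serveC D))

/-- The commands for an arrival. -/
abbrev Inst.cmds (I : Inst) (D : ISGStructure) : Arrival → List Cmd :=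
  D.arrivalCmds Arrival.fl I.vt

theorem arrivals_head : ∀ a ∈ I.arrivals.head?, a.fl = true := by
  intro a ha
  obtain ⟨k, hk⟩ : ∃ k, I.q₂ = k + 1 := ⟨I.q₂ - 1, by have := I.q₂_pos; omega⟩
  obtain ⟨m, hm⟩ : ∃ k, I.q₃ = k + 1 := ⟨I.q₃ - 1, by have := I.q₃_pos; omega⟩
  rw [Inst.arrivals, hk, hm, List.range_succ_eq_map, List.range_succ_eq_map] at ha
  simp [Inst.query] at ha
  rw [← ha]; rfl

theorem arrival_bound {a : Arrival} (ha : a ∈ I.arrivals) : 0 ≤ a.v ∧ a.v < I.nv := by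
  simp only [Inst.arrivals, List.mem_flatMap, Inst.query, List.mem_cons, List.mem_append,
    Inst.listA, Inst.listB, List.mem_map] at ha
  obtain ⟨i, -, j, -, rfl | ⟨x, -, rfl⟩ | ⟨x, -, rfl⟩⟩ := ha
  · exact Inst.dummy_bound
  · have hw : (0 : ℤ) ≤ I.w * I.w := by positivity
    have := I.vertA_bound i x
    exact ⟨this.1, Inst.lt_nv (this.2.trans_le (by linarith))⟩
  · have hw : (0 : ℤ) ≤ I.w * I.w := by positivity
    have := I.vertB_bound j x
    exact ⟨hw.trans this.1, Inst.lt_nv this.2⟩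

theorem prefix_head {l : List Arrival} (h : l <+: I.arrivals) : ∀ a ∈ l.head?, a.fl = true := by
  intro a ha
  refine arrivals_head (I := I) a ?_
  obtain ⟨t, ht⟩ := h
  rw [← ht]
  cases l with
  | nil => simp at ha
  | cons b l => simpa using ha

/-- What is used about the computation of the data structure. -/
structure Serves (D : ISGStructure) (I : Inst) (β : Bds) (c : ℕ) : Prop where
  spec : ∀ l, l <+: I.arrivals → RunSpec (G := I.graph) D c Arrival.fl I.vt l
  le_X : (I.graph.n + I.graph.m + I.arrivals.length + 2) ^ c ≤ β.X
  out_le : (flatAnswer Arrival.fl I.vt I.arrivals).length ≤ β.X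

variable {D : ISGStructure} {c : ℕ}

/-- A single procedure, run after the preceding ones have halted, is a segment of the full
interaction and inherits its bounds on words and output. -/
theorem Serves.reach (hs : Serves D I β c) {k : List Cmd} {b : Cmd} {k' : List Cmd} {s : State}
    (hk : k ++ b :: k' = I.arrivals.flatMap (I.cmds D))
    (h : Reachable (D.preprocess :: k, I.graph.input) ([], s)) {z : Config}
    (hz : Reachable ([b], s) z) :
    z.2.Bounded ((I.graph.n + I.graph.m + I.arrivals.length + 2) ^ c) ∧
      z.2.out.length ≤ (flatAnswer Arrival.fl I.vt I.arrivals).length := by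
  have h1 : Reachable (D.preprocess :: I.arrivals.flatMap (I.cmds D), I.graph.input)
      (z.1 ++ k', z.2) := by
    rw [← hk]
    have := (Reachable.comp h (k₃ := z.1) (s₃ := z.2) hz).append k'
    simpa using this
  exact (hs.spec _ (List.prefix_refl _)).bdd (z.1 ++ k', z.2) h1

/-- The situation before the arrival with index `i`. -/
structure Before (D : ISGStructure) (I : Inst) (i : ℕ) (σ : Store) : Prop where
  buf : BufOK σ
  ptr : σ.var 15 = σ.ds.out.length
  reach : Reachable (D.preprocess :: (I.arrivals.take i).flatMap (I.cmds D), I.graph.input)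
    ([], σ.ds)

/-- The commands `kr` stand for the arrivals that will still be served; the expected time of the
data structure on them passes through this arrival as part of the potential. -/
theorem bnd_serve (hfit : Fits I n β) (hs : Serves D I β c) {i : ℕ} (hi : i < I.annotated.length)
    (hC : Core I n P σ) (hB : Before D I i σ) (h24 : σ.var 24 = i) (h16 : σ.var 16 = 0)
    {ρ : ℕ → ℤ} {F : State → ℝ≥0∞} {A : ℝ≥0∞} {kr : List Cmd}
    (hF : ∀ σ', Core I n P σ' → Before D I (i + 1) σ' → Flag σ' 16 (I.Hit I.annotated[i]) →
      Bnd β 1 ρ F σ' (A + 5 * expectedTime (kr, σ'.ds))) :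
    Bnd β 1 ρ (wp β.B (serveC D) F) σ (A + (200 + 400 * I.tests I.annotated[i] : ℕ) +
      5 * expectedTime (I.cmds D I.annotated[i].2 ++ kr, σ.ds)) := by
  have hai : i < I.arrivals.length := by rwa [length_withPrev] at hi
  have ha2 : I.annotated[i].2 = I.arrivals[i] := by
    have h := map_snd_withPrev (fl := Arrival.fl) (vt := I.vt) [] I.arrivals
    have : (I.annotated.map Prod.snd)[i]'(by simpa using hi) = I.arrivals[i] :=
      List.getElem_of_eq h _
    rw [← this, List.getElem_map]
  set b := I.arrivals[i] with hb
  have hv : ((I.vt b : ℕ) : ℤ) = b.v := by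
    have := arrival_bound (I := I) (List.getElem_mem hai)
    exact I.toV_val this.1 this.2
  have hsplit : I.arrivals.flatMap (I.cmds D) = (I.arrivals.take i).flatMap (I.cmds D) ++
      (I.cmds D b ++ (I.arrivals.drop (i + 1)).flatMap (I.cmds D)) := by
    conv_lhs => rw [← List.take_append_drop i I.arrivals, List.drop_eq_getElem_cons hai,
      List.flatMap_append, List.flatMap_cons]
  have e13 : ∀ τ : Store, Core I n P τ → τ.var 24 = i →
      (get 13 (var 24)).eval τ = if b.fl then 1 else 0 := fun τ hτ h => by
    rw [eval_get, eval_var, h, hτ.items.fl, cells_getElem _ _ (by simpa using hai)]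
    simp [hb]
  have e14 : ∀ τ : Store, Core I n P τ → τ.var 24 = i →
      (get 14 (var 24)).eval τ = b.v := fun τ hτ h => by
    rw [eval_get, eval_var, h, hτ.items.v, cells_getElem _ _ (by simpa using hai)]
    simp [hb]
  rw [ha2]
  -- the arrival itself
  have main : ∀ τ : Store, Core I n P τ → BufOK τ → τ.var 24 = i → τ.var 16 = 0 →
      τ.var 15 = σ.ds.out.length → σ.ds.out <+: τ.ds.out →
      Reachable (D.preprocess :: ((I.arrivals.take i).flatMap (I.cmds D) ++
        if b.fl then [D.start] else []), I.graph.input) ([], τ.ds) →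
      Bnd β 1 ρ (wp β.B (.seq (asgD 2 (get 14 (var 24))) <| .seq (simC D.arrive) handleC) F) τ
        (A + (150 + 400 * I.tests I.annotated[i] : ℕ) +
        5 * expectedTime (Cmd.const 2 b.v :: D.arrive :: kr, τ.ds)) := by
    intro τ hτ hbuf h24 h16 h15 hpre hr s hsr hsl
    have hX : |(get 14 (var 24)).eval τ| ≤ β.X := by
      rw [eval_get]; exact hsr.small.2 _ _
    revert s
    change Bnd β 1 ρ _ τ _
    set τ' := τ.setDs (τ.ds.setReg 2 b.v) with hτ'
    have hC' : Core I n P τ' := hτ.congr (fun _ _ => rfl) fun _ _ => rfl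
    have hr' : Reachable (D.preprocess :: ((I.arrivals.take i).flatMap (I.cmds D) ++
        ((if b.fl then [D.start] else []) ++ [Cmd.const 2 b.v])), I.graph.input) ([], τ'.ds) := by
      have h1 : Reachable ([Cmd.const 2 b.v], τ.ds) ([], τ'.ds) :=
        Reachable.step (by simp [step, hτ'])
      have := Reachable.comp hr h1
      simpa using this
    have key : Bnd β 1 ρ (wp β.B (simC D.arrive) (wp β.B handleC F)) τ'
        (A + (100 + 400 * I.tests I.annotated[i] : ℕ) +
        5 * expectedTime (D.arrive :: kr, τ'.ds)) := by
      refine bnd_sim hs.le_X hs.out_le ⟨hbuf.one, hbuf.cnt, hbuf.fst, hbuf.snd⟩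
        (fun z hz => hs.reach (k' := (I.arrivals.drop (i + 1)).flatMap (I.cmds D)) ?_ hr' hz)
        fun σ₂ hr₂ hbuf₂ hf₂ => ?_
      · rw [hsplit]; simp [ISGStructure.arrivalCmds, hv]
      have hC₂ := hC'.simFrame hf₂
      have hreach : Reachable (D.preprocess :: (I.arrivals.take (i + 1)).flatMap (I.cmds D),
          I.graph.input) ([], σ₂.ds) := by
        have := Reachable.comp hr' hr₂
        rw [List.take_succ_eq_append_getElem hai, List.flatMap_append, List.flatMap_singleton]
        simpa [ISGStructure.arrivalCmds, hv, ← hb] using this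
      have hout : σ.ds.out <+: σ₂.ds.out := hpre.trans hr₂.out_prefix
      obtain ⟨E, hE⟩ := hout
      have hp1 := (hs.spec _ (List.take_prefix i _)).out _ hB.reach
      have hp2 := (hs.spec _ (List.take_prefix (i + 1) _)).out _ hreach
      have hfa : flatAnswer Arrival.fl I.vt (I.arrivals.take (i + 1)) =
          flatAnswer Arrival.fl I.vt (I.arrivals.take i) ++ I.reported I.annotated[i] := by
        simp only [flatAnswer, withPrev_take]
        rw [List.take_succ_eq_append_getElem hi, List.flatMap_append, List.flatMap_singleton]
        rfl
      -- The output is correct after `i` and after `i + 1` arrivals, as both are complete series of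
      -- queries. The old output is a prefix of the new one, so the difference is what this arrival
      -- has to report.
      have hperm : E.Perm (I.reported I.annotated[i]) := by
        rw [hfa, ← hE] at hp2
        exact (List.perm_append_left_iff _).1 (hp2.trans (hp1.symm.append_right _))
      have hlen : σ₂.ds.out.length = σ.ds.out.length + E.length := by rw [← hE]; simp
      have hle : σ₂.ds.out.length ≤ β.X :=
        ((hs.reach (k' := (I.arrivals.drop (i + 1)).flatMap (I.cmds D)) (by
          rw [hsplit]; simp [ISGStructure.arrivalCmds, hv]) hr' hr₂).2).trans hs.out_le
      have hv₂ : ∀ j, j ≠ 2 → σ₂.var j = τ.var j := fun j hj => hf₂.var j hj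
      refine (ok_handle (p := σ.ds.out.length) hC₂.ctx hfit hC₂.bucks hC₂.items hi (by rw [hv₂ _ (by norm_num), h24])
        (by rw [hv₂ _ (by norm_num), h16]) hperm (by rw [hv₂ _ (by norm_num), h15])
        (by rw [hbuf₂.cnt, hlen]; push_cast; rfl) (by omega) (fun j hj => ?_) ρ F
        (A + 5 * expectedTime (kr, σ₂.ds)) fun σ₃ ⟨g1, g2, g3, g4⟩ => ?_).mono (le_of_eq ?_)
      · rw [hbuf₂.fst _ (by omega)]
        simp only [← hE]
        rw [List.getElem_append_right (by omega)]
        simp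
      · rw [← g3]
        refine hF σ₃ (hC₂.congr (fun j hj => g4.var j ?_) fun a ha => g4.arr a (by simp))
          ⟨⟨?_, ?_, ?_, ?_⟩, ?_, ?_⟩ g1
        · simp at hj ⊢; omega
        · rw [g4.var _ rfl, hbuf₂.one]
        · rw [g4.var _ rfl, hbuf₂.cnt, g3]
        · rw [g4.arr _ rfl, g3]; exact hbuf₂.fst
        · rw [g4.arr _ rfl, g3]; exact hbuf₂.snd
        · rw [g2, g3, hlen]; push_cast; rfl
        · rw [g3]; exact hreach
      · ring
    have hstep : expectedTime (Cmd.const 2 b.v :: D.arrive :: kr, τ.ds) =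
        1 + expectedTime (D.arrive :: kr, τ'.ds) := expectedTime_pure rfl
    refine (bnd_seq (ok_asgD (Q := (· = τ')) (Term.plain_of_chk rfl)
      (le_trans (by decide) (Bds.deg_le _)) hX (by rw [e14 τ hτ h24]) ρ _ _ fun σ' hσ' => by
        subst hσ'; exact bnd_seq key)).mono ?_
    rw [hstep]
    have h20 : (get 14 (var 24)).size ≤ 20 := by decide
    calc _ ≤ (1 + ((40 : ℕ) + (1 + (A + (100 + 400 * I.tests I.annotated[i] : ℕ) +
        5 * expectedTime (D.arrive :: kr, τ'.ds))))) := by gcongr; omega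
      _ = A + (142 + 400 * I.tests I.annotated[i] : ℕ) +
        5 * expectedTime (D.arrive :: kr, τ'.ds) := by push_cast; ring
      _ ≤ _ := by gcongr; · omega
                  · exact le_add_self
  have hmain0 := main σ hC hB.buf h24 h16 hB.ptr (List.prefix_refl _)
  refine (bnd_seq (bnd_ite (T := A + (151 + 400 * I.tests I.annotated[i] : ℕ) +
    5 * expectedTime (I.cmds D b ++ kr, σ.ds)) (Term.plain_of_chk rfl)
    (le_trans (by decide) (Bds.deg_le _)) (fun h => ?_) fun h => ?_)).mono ?_
  · have hfl : b.fl = true := by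
      by_contra hc; rw [e13 σ hC h24] at h; simp [hc] at h
    have e : I.cmds D b ++ kr = D.start :: (Cmd.const 2 b.v :: D.arrive :: kr) := by
      simp [ISGStructure.arrivalCmds, hfl, hv]
    rw [e]
    refine (bnd_sim (A := A + (150 + 400 * I.tests I.annotated[i] : ℕ)) hs.le_X hs.out_le hB.buf
      (fun z hz => hs.reach (k' := Cmd.const 2 b.v :: D.arrive ::
        (I.arrivals.drop (i + 1)).flatMap (I.cmds D)) ?_ hB.reach hz)
      fun σ₂ hr₂ hbuf₂ hf₂ => ?_).mono (by gcongr; omega)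
    · rw [hsplit]; simp [ISGStructure.arrivalCmds, hv, hfl]
    · refine main σ₂ (hC.simFrame hf₂) hbuf₂ ?_ ?_ ?_ hr₂.out_prefix ?_
      · rw [hf₂.var _ (by norm_num), h24]
      · rw [hf₂.var _ (by norm_num), h16]
      · rw [hf₂.var _ (by norm_num), hB.ptr]
      · rw [if_pos hfl]; exact Reachable.comp hB.reach hr₂
  · have hfl : b.fl = false := by
      by_contra hc; rw [e13 σ hC h24] at h; simp [hc] at h
    have e : I.cmds D b ++ kr = Cmd.const 2 b.v :: D.arrive :: kr := by
      simp [ISGStructure.arrivalCmds, hfl, hv]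
    rw [e]
    refine (ok_skip (Q := (· = σ)) rfl ρ _ (A + (150 + 400 * I.tests I.annotated[i] : ℕ) +
        5 * expectedTime (Cmd.const 2 b.v :: D.arrive :: kr, σ.ds)) fun σ' hσ' => ?_).mono
        (le_of_eq ?_)
    · subst hσ'
      exact hmain0 (by simpa [hfl] using hB.reach)
    · push_cast; ring
  · have h20 : (get 13 (var 24)).size ≤ 20 := by decide
    calc _ ≤ 1 + ((22 : ℕ) + (A + (151 + 400 * I.tests I.annotated[i] : ℕ) +
        5 * expectedTime (I.cmds D b ++ kr, σ.ds))) := by gcongr; omega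
      _ = A + (174 + 400 * I.tests I.annotated[i] : ℕ) +
        5 * expectedTime (I.cmds D b ++ kr, σ.ds) := by push_cast; ring
      _ ≤ _ := by gcongr; omega

/-- The expected time that is left before the arrival with index `i`. -/
noncomputable def timeLeft (D : ISGStructure) (I : Inst) (i : ℕ) (s : State) : ℝ≥0∞ :=
  5 * expectedTime (((upTo I.Hit (I.annotated.drop i)).map Prod.snd).flatMap (I.cmds D), s) +
    (((upTo I.Hit (I.annotated.drop i)).map fun a => 210 + 400 * I.tests a).sum : ℕ)

/-- Until the first hit the potential is `timeLeft`; afterwards it vanishes, and the remaining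
repetitions only skip at constant cost. The data structure is abandoned in the middle of its series,
so only the arrivals up to the hit are charged. -/
theorem bnd_serveAll (hfit : Fits I n β) (hs : Serves D I β c) (hC : Core I n P σ)
    (hB : Before D I 0 σ) (h16 : σ.var 16 = 0) {ρ : ℕ → ℤ} {F : State → ℝ≥0∞} {A : ℝ≥0∞}
    (hF : ∀ σ', Core I n P σ' → Flag σ' 16 (∃ a ∈ I.annotated, I.Hit a) → Bnd β 0 ρ F σ' A) :
    Bnd β 0 ρ (wp β.B (serveAllC D) F) σ
      (A + timeLeft D I 0 σ.ds + (30 * (I.arrivals.length + 1) : ℕ)) := by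
  have hN : I.annotated.length = I.arrivals.length := length_withPrev _ _
  refine (bnd_for (N := I.arrivals.length)
    (Inv := fun i σ => Core I n P σ ∧ ((σ.var 16 = 1 ∧ ∃ a ∈ I.annotated, I.Hit a) ∨
      (σ.var 16 = 0 ∧ (¬ ∃ a ∈ I.annotated.take i, I.Hit a) ∧ Before D I i σ)))
    (Φ := fun i σ => (if σ.var 16 = 0 then timeLeft D I i σ.ds else 0) +
      (10 * (I.arrivals.length - i) : ℕ)) (A := A) (Term.plain_of_chk rfl)
      (le_trans (by decide) (Bds.deg_le _))
      (show (var 14).eval σ = _ from hC.items.len) hfit.arr_le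
      ⟨hC, .inr ⟨h16, by simp, hB⟩⟩ ?_ fun σ' h => ?_).mono ?_
  · intro i hi σ ⟨hC, h⟩ ρ F A hF
    have hC' : Core I n P (σ.setVar 24 i) :=
      hC.congr (fun j hj => by simp at hj; simp; omega) fun _ _ => rfl
    have hia : i < I.annotated.length := by omega
    have hcast : (10 * (I.arrivals.length - i) : ℕ) = 10 * (I.arrivals.length - (i + 1)) + 10 := by
      omega
    generalize I.arrivals.length - (i + 1) = K at hcast hF
    have hv16 : (σ.setVar 24 i).var 16 = σ.var 16 := by simp
    rcases h with ⟨h16, hh⟩ | ⟨h16, hh, hB⟩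
    · refine (bnd_ite (T := A + (10 * K + 1 : ℕ))
        (Term.plain_of_chk rfl) (le_trans (by decide) (Bds.deg_le _)) (fun _ => ?_)
        fun h => ?_).mono ?_
      · refine (ok_skip (Q := (· = σ.setVar 24 i)) rfl ρ _
          (A + (10 * K : ℕ)) fun σ' hσ' => ?_).mono (le_of_eq ?_)
        · subst hσ'
          refine (hF _ ⟨hC', .inl ⟨hv16.trans h16, hh⟩⟩).mono ?_
          rw [if_neg (by rw [hv16, h16]; norm_num), zero_add]
        · push_cast; ring
      · rw [eval_var, hv16, h16] at h; norm_num at h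
      · rw [h16, if_neg (by norm_num), zero_add, hcast]
        simp only [Term.size]
        push_cast
        rw [show ((5 : ℝ≥0∞) + (A + (10 * (K : ℝ≥0∞) + 1))) =
          A + (10 * (K : ℝ≥0∞) + 6) by ring]
        gcongr; norm_num
    · set a := I.annotated[i] with ha
      have hdrop : I.annotated.drop i = a :: I.annotated.drop (i + 1) :=
        List.drop_eq_getElem_cons hia
      -- The arrivals still to be served after this one. Whether it is a hit is determined by the
      -- graph and the arrivals, so this list is known in advance.
      set l := if I.Hit a then [] else upTo I.Hit (I.annotated.drop (i + 1)) with hl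
      have hup : upTo I.Hit (I.annotated.drop i) = a :: l := by
        rw [hdrop, upTo, hl]; split_ifs <;> rfl
      have htl : timeLeft D I i σ.ds = 5 * expectedTime (I.cmds D a.2 ++
          (l.map Prod.snd).flatMap (I.cmds D), σ.ds) +
          ((210 + 400 * I.tests a + (l.map fun a => 210 + 400 * I.tests a).sum : ℕ) : ℝ≥0∞) := by
        rw [timeLeft, hup]; simp
      have key := bnd_serve (β := β) (c := c) (σ := σ.setVar 24 i) (ρ := ρ) (F := F)
        (A := A + ((l.map fun a => 210 + 400 * I.tests a).sum +
          10 * K : ℕ)) (kr := (l.map Prod.snd).flatMap (I.cmds D))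
        hfit hs hia hC' ⟨⟨hB.buf.one, hB.buf.cnt, hB.buf.fst, hB.buf.snd⟩, hB.ptr, hB.reach⟩
        (by simp) (hv16.trans h16) fun σ' hC₁ hB₁ hf₁ => ?_
      · refine (bnd_ite (Term.plain_of_chk rfl) (le_trans (by decide) (Bds.deg_le _)) (fun h => ?_)
          fun _ => key).mono ?_
        · rw [eval_var, hv16, h16] at h; exact absurd rfl h
        · rw [if_pos h16, htl, hcast]
          simp only [Term.size]
          generalize (l.map fun a => 210 + 400 * I.tests a).sum = S
          rw [ha, show (σ.setVar 24 i).ds = σ.ds from rfl]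
          push_cast
          calc _ ≤ _ + (15 : ℝ≥0∞) := le_self_add
            _ = _ := ?_
          ring
      · rcases hf₁ with ⟨h1, h2⟩ | ⟨h1, h2⟩
        · refine (hF _ ⟨hC₁, .inr ⟨h1, ?_, hB₁⟩⟩).mono ?_
          · rw [exists_mem_take_succ hia]
            exact not_or.2 ⟨hh, h2⟩
          · rw [if_pos h1, timeLeft, hl, if_neg h2]
            push_cast
            apply le_of_eq; ring
        · refine (hF _ ⟨hC₁, .inl ⟨h1, a, List.getElem_mem _, h2⟩⟩).mono ?_
          rw [if_neg (by rw [h1]; norm_num), hl, if_pos h2]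
          simp [expectedTime_nil]
  · refine (hF σ' h.1 ?_).mono le_self_add
    rcases h.2 with h | ⟨h1, h2, -⟩
    · exact .inr h
    · rw [← hN, List.take_length] at h2
      exact .inl ⟨h1, h2⟩
  · rw [if_pos h16, Nat.sub_zero]
    simp only [Term.size, loopCost]
    push_cast
    rw [show A + (timeLeft D I 0 σ.ds + 10 * (I.arrivals.length : ℝ≥0∞)) +
      (13 + I.arrivals.length * 11) = A + timeLeft D I 0 σ.ds +
      (21 * (I.arrivals.length : ℝ≥0∞) + 13) by ring]
    gcongr _ + ?_
    norm_cast; omega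

end ISGLowerBound

namespace ISGLowerBound

open Term (lit var get)

/-! ## The reduction: the program -/

variable {β : Bds} {n : ℕ} {σ : Store} {D : ISGStructure}

/-- Compute the graph and the arrivals for random moduli. -/
def buildC : Cmd :=
  .seq (asg 9 (var 9 + var 6)) <| .seq (asg 10 (var 10 + var 6)) <|
  .seq (asg 11 (var 11 + var 6)) <| .seq bucketC <| .seq padC <| .seq selC <| .seq arrivalsC <|
  .seq (asgD 0 (lit 2 * (var 12 * var 12) + var 7 + var 8)) <| .seq (asgD 1 (var 13)) skipC

/-- Use the data structure. -/
def queryC (D : ISGStructure) : Cmd :=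
  .seq (simC D.preprocess) <| .seq (serveAllC D) <| .seq (asg 0 (ltT (lit 0) (var 4 + var 16))) skipC

/-- The program for 3SUM. -/
def reductionC (D : ISGStructure) (t s w : ℕ) : Cmd :=
  .seq (prepareC t s w) <| .seq (.rand (4 * 9) (4 * 6)) <| .seq (.rand (4 * 10) (4 * 6)) <|
  .seq (.rand (4 * 11) (4 * 6)) <| .seq buildC (queryC D)

/-- The instance for given random numbers. -/
def redInst (l : List ℤ) {t s w g : ℕ} (hg : 0 < g) (hw : 2 * w ≤ t + s) (i j k : ℕ) : Inst where
  R := g ^ s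
  τ := g ^ w
  M := g ^ (t + s - w)
  q₁ := i % g ^ s + g ^ s
  q₂ := j % g ^ s + g ^ s
  q₃ := k % g ^ s + g ^ s
  S := distinct l
  R_pos := pow_pos hg _
  τ_pos := pow_pos hg _
  τ_le := Nat.pow_le_pow_right hg (by omega)
  q₁_pos := Nat.add_pos_right _ (pow_pos hg s)
  q₂_pos := Nat.add_pos_right _ (pow_pos hg s)
  q₃_pos := Nat.add_pos_right _ (pow_pos hg s)
  q₁_le := by have := Nat.mod_lt i (pow_pos hg s); omega
  q₂_le := by have := Nat.mod_lt j (pow_pos hg s); omega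
  q₃_le := by have := Nat.mod_lt k (pow_pos hg s); omega
  nodup := nodup_distinct l

/-- The size of an instance. -/
def Inst.load (I : Inst) (n : ℕ) : ℕ :=
  n + I.τ * I.M + I.ins.length * I.q₁ + I.rest.length * (n + 1) + I.arrivals.length

/-- What holds when the data structure is used. -/
structure Built (I : Inst) (n : ℕ) (P : Prop) (σ : Store) : Prop where
  core : Core I n P σ
  cnt : σ.var 2 = 0
  ptr : σ.var 15 = 0
  hit : σ.var 16 = 0
  reg : σ.ds.reg = I.graph.input.reg
  arr : σ.ds.arr = I.graph.input.arr

theorem ok_build {l : List ℤ} {t s w g : ℕ} (hP : Prepared l t s w g σ) (hw : 2 * w ≤ t + s)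
    {i j k : ℕ} (hi : i < g ^ s) (hj : j < g ^ s) (hk : k < g ^ s) {I : Inst}
    (hI : I = redInst l hP.pos hw i j k) (hfit : Fits I l.length β) :
    Ok β 0 buildC (((σ.setVar 9 i).setVar 10 j).setVar 11 k) (4000 * (I.load l.length + 1))
      (Built I l.length ((∃ x ∈ l, Dup l x) ∨ ∃ z ∈ I.rest, ∃ x ∈ I.S, Good I.S x z)) := by
  have hR : (g ^ s : ℕ) ≤ I.w := by subst hI; simp only [Inst.w, redInst]; omega
  have hwX : I.w ≤ β.X := (Nat.le_self_pow (by norm_num) _).trans hfit.code_le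
  have e₁ : I.q₁ = i + g ^ s := by subst hI; simp only [redInst]; rw [Nat.mod_eq_of_lt hi]
  have e₂ : I.q₂ = j + g ^ s := by subst hI; simp only [redInst]; rw [Nat.mod_eq_of_lt hj]
  have e₃ : I.q₃ = k + g ^ s := by subst hI; simp only [redInst]; rw [Nat.mod_eq_of_lt hk]
  have b₁ := (I.q₁_le).trans hwX
  have b₂ := (I.q₂_le).trans hwX
  have b₃ := (I.q₃_le).trans hwX
  set σ₀ := (((((σ.setVar 9 i).setVar 10 j).setVar 11 k).setVar 9 I.q₁).setVar 10 I.q₂).setVar 11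
    I.q₃ with hσ₀
  have hv : ∀ m, m ≠ 9 → m ≠ 10 → m ≠ 11 → σ₀.var m = σ.var m := fun m h1 h2 h3 => by
    simp [hσ₀, h1, h2, h3]
  have hc : Ctx I l.length σ₀ := by
    constructor
    · rw [hv _ (by norm_num) (by norm_num) (by norm_num), hP.n]
    · rw [hv _ (by norm_num) (by norm_num) (by norm_num), hP.one]
    · rw [hv _ (by norm_num) (by norm_num) (by norm_num), hP.ns, hI]; rfl
    · rw [hv _ (by norm_num) (by norm_num) (by norm_num), hP.τ, hI]; rfl
    · rw [hv _ (by norm_num) (by norm_num) (by norm_num), hP.M, hI]; rfl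
    · simp [hσ₀]
    · simp [hσ₀]
    · simp [hσ₀]
    · rw [hv _ (by norm_num) (by norm_num) (by norm_num), hP.W, hI]; simp [Inst.w, redInst]
    · intro v
      change σ.arr 3 v ≠ 0 ↔ _
      rw [hP.tab, hI]
      change ((l.count v : ℕ) : ℤ) ≠ 0 ↔ v ∈ distinct l
      rw [mem_distinct, ← List.count_pos_iff]; omega
    · change σ.arr 4 = _
      rw [hP.S, hI]; rfl
  have hz : ∀ a, 5 ≤ a → σ₀.arr a = cells [] := hP.arr_zero
  have hnv := hfit.nv_le
  refine Ok.mono (run_asg (σ := ((σ.setVar 9 i).setVar 10 j).setVar 11 k) (fun _ => ?_)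
    (run_asg (fun _ => ?_) (run_asg (fun _ => ?_) (t := 1 + 500 * (l.length + 1) +
      (1 + 300 * (I.τ * I.M + 1) + (1 + (300 * (l.length + 1) + 300 * (I.ins.length * I.q₁) +
      300 * (I.rest.length * (l.length + 1))) + (1 + 1000 * (I.arrivals.length + 1) + 60)))) ?_)))
      ?_ fun _ h => h
  · have : (var 9 + var 6).eval (((σ.setVar 9 i).setVar 10 j).setVar 11 k) = I.q₁ := by
      simp [e₁, hP.R]
    rw [this, abs_of_nonneg (by positivity)]; exact_mod_cast b₁
  · have : (var 10 + var 6).eval ((((σ.setVar 9 i).setVar 10 j).setVar 11 k).setVar 9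
      ((var 9 + var 6).eval (((σ.setVar 9 i).setVar 10 j).setVar 11 k))) = I.q₂ := by
      simp [e₂, hP.R]
    rw [this, abs_of_nonneg (by positivity)]; exact_mod_cast b₂
  · have : ∀ z z', (var 11 + var 6).eval (((((σ.setVar 9 i).setVar 10 j).setVar 11 k).setVar 9
      z).setVar 10 z') = I.q₃ := by
      intro z z'; simp [e₃, hP.R]
    rw [this, abs_of_nonneg (by positivity)]; exact_mod_cast b₃
  · have hσ : ((((((σ.setVar 9 i).setVar 10 j).setVar 11 k).setVar 9
        ((var 9 + var 6).eval (((σ.setVar 9 i).setVar 10 j).setVar 11 k))).setVar 10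
        ((var 10 + var 6).eval ((((σ.setVar 9 i).setVar 10 j).setVar 11 k).setVar 9
          ((var 9 + var 6).eval (((σ.setVar 9 i).setVar 10 j).setVar 11 k))))).setVar 11
        ((var 11 + var 6).eval (((((σ.setVar 9 i).setVar 10 j).setVar 11 k).setVar 9
        ((var 9 + var 6).eval (((σ.setVar 9 i).setVar 10 j).setVar 11 k))).setVar 10
        ((var 10 + var 6).eval ((((σ.setVar 9 i).setVar 10 j).setVar 11 k).setVar 9
          ((var 9 + var 6).eval (((σ.setVar 9 i).setVar 10 j).setVar 11 k))))))) = σ₀ := by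
      simp [hσ₀, e₁, e₂, e₃, hP.R]
    rw [hσ]
    refine ok_seq (ok_bucket hc hfit hz) fun σ₁ ⟨h₁, f₁⟩ => ?_
    have hc₁ := hc.frame f₁
    refine ok_seq (ok_pad hc₁ hfit ⟨?_, ?_, ?_⟩) fun σ₂ ⟨h₂, f₂⟩ => ?_
    · rw [f₁.var 13 rfl, hv _ (by norm_num) (by norm_num) (by norm_num),
        hP.var_zero 13 (by norm_num) (by norm_num)]; rfl
    · rw [f₁.darr rfl]
      change σ.ds.arr = _
      rw [hP.darr]; funext a; simp
    · rw [f₁.reg rfl]; exact hP.reg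
    have hc₂ := hc₁.frame f₂
    have hb₂ := h₁.frame f₂
    refine ok_seq (ok_sel (P := ∃ x ∈ l, Dup l x) hc₂ hfit ⟨?_, ?_, ?_, ?_⟩) fun σ₃ ⟨h₃, f₃⟩ => ?_
    · intro κ
      rw [f₂.arr 11 rfl, f₁.arr 11 rfl, hz 11 (by norm_num)]; simp [cells]
    · intro κ
      rw [f₂.arr 12 rfl, f₁.arr 12 rfl, hz 12 (by norm_num)]; simp [cells]
    · simpa using h₂
    · refine hP.found.congr ?_ (by simp)
      rw [f₂.var 4 rfl, f₁.var 4 rfl, hv _ (by norm_num) (by norm_num) (by norm_num)]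
    have hc₃ := hc₂.frame f₃
    have hb₃ := hb₂.frame f₃
    refine ok_seq (ok_arrivals hc₃ hfit hb₃ ⟨?_, ?_, ?_, ?_, ?_, ?_⟩) fun σ₄ ⟨h₄, f₄⟩ => ?_
    · rw [f₃.var 14 rfl, f₂.var 14 rfl, f₁.var 14 rfl,
        hv _ (by norm_num) (by norm_num) (by norm_num),
        hP.var_zero 14 (by norm_num) (by norm_num)]; rfl
    · rw [f₃.arr _ rfl, f₂.arr _ rfl, f₁.arr _ rfl, hz _ (by norm_num)]; rfl
    · rw [f₃.arr _ rfl, f₂.arr _ rfl, f₁.arr _ rfl, hz _ (by norm_num)]; rfl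
    · rw [f₃.arr _ rfl, f₂.arr _ rfl, f₁.arr _ rfl, hz _ (by norm_num)]; rfl
    · rw [f₃.arr _ rfl, f₂.arr _ rfl, f₁.arr _ rfl, hz _ (by norm_num)]; rfl
    · rw [f₃.arr _ rfl, f₂.arr _ rfl, f₁.arr _ rfl, hz _ (by norm_num)]; rfl
    have hc₄ := hc₃.frame f₄
    have hb₄ := hb₃.frame f₄
    have hed : Edg I.allEdges σ₄ :=
      h₃.edg.congr (f₄.var 13 rfl) (f₄.darr rfl) (f₄.reg rfl)
    have env : (lit 2 * (var 12 * var 12) + var 7 + var 8).eval σ₄ = I.nv := by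
      simp [hc₄.w, hc₄.τ, hc₄.M, Inst.nv_eq]
    refine Ok.mono (run_asgD (fun _ => ?_) (run_asgD (fun h => h.1 13) (ok_done ?_))) ?_
      fun _ h => h
    · rw [env, abs_of_nonneg (by positivity)]; exact_mod_cast hnv
    · rw [env]
      refine ⟨⟨hc₄.congr (fun _ _ => rfl) fun _ _ => rfl, ⟨hb₄.code, hb₄.q₂, hb₄.q₃⟩,
        h₄.congr rfl fun _ _ => rfl, ?_⟩, ?_, ?_, ?_, ?_, ?_⟩
      · exact h₃.found.congr (f₄.var 4 rfl) Iff.rfl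
      · change σ₄.var 2 = 0
        rw [f₄.var 2 rfl, f₃.var 2 rfl, f₂.var 2 rfl, f₁.var 2 rfl,
          hv _ (by norm_num) (by norm_num) (by norm_num), hP.cnt]
      · change σ₄.var 15 = 0
        rw [f₄.var 15 rfl, f₃.var 15 rfl, f₂.var 15 rfl, f₁.var 15 rfl,
          hv _ (by norm_num) (by norm_num) (by norm_num), hP.var_zero _ (by norm_num) (by norm_num)]
      · change σ₄.var 16 = 0
        rw [f₄.var 16 rfl, f₃.var 16 rfl, f₂.var 16 rfl, f₁.var 16 rfl,
          hv _ (by norm_num) (by norm_num) (by norm_num), hP.var_zero _ (by norm_num) (by norm_num)]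
      · funext r
        simp only [eval_var, Store.setDs_ds, Store.setDs_var, State.setReg_reg, hed.reg, hed.len,
          DirGraph.input, I.graph_m_eq]
        by_cases h0 : r = 0
        · subst h0; simp
        · by_cases h1 : r = 1 <;> simp [h0, h1]
      · change σ₄.ds.arr = _
        rw [hed.arr]
        funext a
        simp only [DirGraph.input, I.map_fst_edges, I.map_snd_edges]
    · decide
  · have h1 : (var 9 + var 6).size + (var 10 + var 6).size + (var 11 + var 6).size ≤ 60 := by decide
    unfold Inst.load
    omega

/-! ### The expected time of the program -/

/-- The expected time for given moduli. -/
noncomputable def instTime (D : ISGStructure) (I : Inst) (n : ℕ) : ℝ≥0∞ :=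
  5 * expectedTime (D.preprocess ::
    ((upTo I.Hit I.annotated).map Prod.snd).flatMap (I.cmds D), I.graph.input) +
    (((upTo I.Hit I.annotated).map fun a => 210 + 400 * I.tests a).sum +
      5000 * (I.load n + 1) : ℕ)

open Classical in
/-- Wrong answers have infinite cost. -/
noncomputable def wrong (l : List ℤ) (s : State) : ℝ≥0∞ :=
  if (HasThreeSum l → s.reg 0 = 1) ∧ (¬ HasThreeSum l → s.reg 0 = 0) then 0 else ∞

theorem bnd_query {l : List ℤ} {I : Inst} {c : ℕ} {ρ : ℕ → ℤ} (hIS : I.S = distinct l)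
    (hfit : Fits I l.length β) (hs : Serves D I β c)
    (hB : Built I l.length ((∃ x ∈ l, Dup l x) ∨ ∃ z ∈ I.rest, ∃ x ∈ I.S, Good I.S x z) σ) :
    Bnd β 0 ρ (wp β.B (queryC D) (wrong l)) σ
      (5 * expectedTime (D.preprocess ::
        ((upTo I.Hit I.annotated).map Prod.snd).flatMap (I.cmds D), I.graph.input) +
      (((upTo I.Hit I.annotated).map fun a => 210 + 400 * I.tests a).sum +
        30 * (I.arrivals.length + 1) + 50 : ℕ)) := by
  have hfinal : ∀ σ', Core I l.length
      ((∃ x ∈ l, Dup l x) ∨ ∃ z ∈ I.rest, ∃ x ∈ I.S, Good I.S x z) σ' →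
      Flag σ' 16 (∃ a ∈ I.annotated, I.Hit a) →
      Bnd β 0 ρ (wp β.B (.seq (asg 0 (ltT (lit 0) (var 4 + var 16))) skipC) (wrong l)) σ'
        (40 : ℕ) := by
    intro σ' hC hf
    -- Variable `4` records repeated numbers and the exhaustive search, variable `16` the queries;
    -- together they cover all solutions, for every choice of the moduli.
    have hiff : HasThreeSum l ↔ ((∃ x ∈ l, Dup l x) ∨ ∃ z ∈ I.rest, ∃ x ∈ I.S, Good I.S x z) ∨
        ∃ a ∈ I.annotated, I.Hit a := by
      rw [hasThreeSum_iff, or_assoc, ← hIS, Inst.exists_good_iff]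
    have hval : ((ltT (lit 0) (var 4 + var 16)).eval σ' = 1 ∧ HasThreeSum l) ∨
        ((ltT (lit 0) (var 4 + var 16)).eval σ' = 0 ∧ ¬ HasThreeSum l) := by
      rw [hiff]
      have hev : (ltT (lit 0) (var 4 + var 16)).eval σ' =
          if 0 < σ'.var 4 + σ'.var 16 then 1 else 0 := eval_ltT _ _ _
      rw [hev]
      rcases hC.found with ⟨h1, h2⟩ | ⟨h1, h2⟩ <;> rcases hf with ⟨h3, h4⟩ | ⟨h3, h4⟩ <;>
        simp only [h1, h3]
      · right; exact ⟨by norm_num, not_or.2 ⟨h2, h4⟩⟩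
      · left; exact ⟨by norm_num, .inr h4⟩
      · left; exact ⟨by norm_num, .inl h2⟩
      · left; exact ⟨by norm_num, .inl h2⟩
    refine ((Ok.mono (run_asg (fun _ => ?_) (ok_done (Q := fun σ' => (HasThreeSum l → σ'.var 0 = 1) ∧
      (¬ HasThreeSum l → σ'.var 0 = 0)) ?_)) ?_ fun _ h => h) ρ (wrong l) 0
      fun σ'' hσ s hs _ => ?_).mono (by rw [add_zero])
    · have := β.five_le
      rcases hval with ⟨h, -⟩ | ⟨h, -⟩ <;> rw [h] <;> simp; omega
    · simp only [Store.setVar_var, if_true]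
      tauto
    · have : (ltT (lit 0) (var 4 + var 16)).size ≤ 30 := by decide
      omega
    · have := hs.var 0
      rw [mul_zero] at this
      rw [wrong, if_pos (by rw [this]; exact hσ)]
  -- The ghost output is reset, so that the simulated machine starts exactly in the input state of
  -- the graph.
  refine Bnd.setOut [] ?_
  have hds : (σ.setDs { σ.ds with out := [] }).ds = I.graph.input := by
    refine State.ext ?_ ?_ rfl
    · exact hB.reg
    · exact hB.arr
  set σ₁ := σ.setDs { σ.ds with out := [] } with hσ₁
  have hC₁ : Core I l.length _ σ₁ := hB.core.congr (fun _ _ => rfl) fun _ _ => rfl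
  have hbuf : BufOK σ₁ := ⟨hB.core.ctx.one, by simpa [hσ₁] using hB.cnt, by simp [hσ₁],
    by simp [hσ₁]⟩
  have h1 : Reachable ([], I.graph.input) ([], I.graph.input) := Reachable.refl _
  have key := bnd_sim (β := β) (d := 0) (ρ := ρ) (c := D.preprocess) (σ := σ₁)
    (kr := ((upTo I.Hit I.annotated).map Prod.snd).flatMap (I.cmds D))
    (F := wp β.B (.seq (serveAllC D) <| .seq (asg 0 (ltT (lit 0) (var 4 + var 16))) skipC) (wrong l))
    (A := (((upTo I.Hit I.annotated).map fun a => 210 + 400 * I.tests a).sum +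
        30 * (I.arrivals.length + 1) + 41 : ℕ)) hs.le_X hs.out_le hbuf (fun z hz => ?_)
    fun σ₂ hr hbuf₂ hf₂ => ?_
  · refine (bnd_seq key).mono ?_
    rw [hds]
    generalize ((upTo I.Hit I.annotated).map fun a => 210 + 400 * I.tests a).sum = S
    generalize expectedTime _ = E
    calc _ ≤ (1 : ℝ≥0∞) + ((S + 30 * (I.arrivals.length + 1) + 41 : ℕ) + 5 * E) + 8 := le_self_add
      _ = _ := by push_cast; ring
  · rw [hds] at hz
    have := hz.append (I.arrivals.flatMap (I.cmds D))
    exact (hs.spec _ (List.prefix_refl _)).bdd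
      (z.1 ++ I.arrivals.flatMap (I.cmds D), z.2) (by simpa using this)
  · have hC₂ := hC₁.simFrame hf₂
    have hout : σ₂.ds.out = [] := by
      have := (hs.spec [] (List.nil_prefix)).out σ₂.ds (by rw [hds] at hr; simpa using hr)
      simpa [flatAnswer, withPrev] using this
    have := bnd_serveAll (β := β) (D := D) (c := c) (σ := σ₂) (ρ := ρ) hfit hs hC₂ ⟨hbuf₂, ?_, ?_⟩
      ?_ hfinal
    · refine (bnd_seq this).mono (le_of_eq ?_)
      rw [timeLeft, List.drop_zero]
      generalize ((upTo I.Hit I.annotated).map fun a => 210 + 400 * I.tests a).sum = S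
      push_cast; ring
    · rw [hf₂.var _ (by norm_num), hout]
      exact hB.ptr
    · rw [hds] at hr; simpa using hr
    · rw [hf₂.var _ (by norm_num)]; exact hB.hit

/-! ### Averaging over the moduli -/

/-- Mean value. -/
noncomputable def avg (N : ℕ) (f : ℕ → ℝ≥0∞) : ℝ≥0∞ := (N : ℝ≥0∞)⁻¹ * ∑ i ∈ Finset.range N, f i

theorem avg_const_add {N : ℕ} (hN : 0 < N) (c : ℝ≥0∞) (f : ℕ → ℝ≥0∞) :
    avg N (fun i => c + f i) = c + avg N f := by
  unfold avg
  rw [Finset.sum_add_distrib, mul_add, Finset.sum_const, Finset.card_range, nsmul_eq_mul,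
    ← mul_assoc, ENNReal.inv_mul_cancel (by exact_mod_cast hN.ne') (ENNReal.natCast_ne_top _),
    one_mul]

theorem bnd_inst {l : List ℤ} {t s w g c : ℕ} (hP : Prepared l t s w g σ) (hw : 2 * w ≤ t + s)
    {i j k : ℕ} (hi : i < g ^ s) (hj : j < g ^ s) (hk : k < g ^ s)
    (hfit : Fits (redInst l hP.pos hw i j k) l.length β)
    (hs : Serves D (redInst l hP.pos hw i j k) β c) {ρ : ℕ → ℤ} :
    Bnd β 0 ρ (wp β.B (.seq buildC (queryC D)) (wrong l)) (((σ.setVar 9 i).setVar 10 j).setVar 11 k)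
      (instTime D (redInst l hP.pos hw i j k) l.length) := by
  refine (bnd_seq (ok_build hP hw hi hj hk rfl hfit ρ _ _ fun σ' hσ' =>
    bnd_query rfl hfit hs hσ')).mono ?_
  generalize redInst l hP.pos hw i j k = I
  rw [instTime]
  generalize ((upTo I.Hit I.annotated).map fun a => 210 + 400 * I.tests a).sum = S
  generalize expectedTime _ = E
  have : I.arrivals.length ≤ I.load l.length := Nat.le_add_left _ _
  generalize I.load l.length = a at *
  generalize I.arrivals.length = b at *
  calc _ = 5 * E + ((1 + 4000 * (a + 1) + (S + 30 * (b + 1) + 50) : ℕ) : ℝ≥0∞) := by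
        push_cast; ring
    _ ≤ _ := add_le_add le_rfl (Nat.cast_le.2 (by omega))

/-- Register and array `0` keep their names under the interleaving, so the input is already in
place; all other memory is zero, which is a fresh simulated machine. -/
theorem rep_initStore {l : List ℤ} (hn : l.length ≤ β.X) (hx : ∀ x ∈ l, |x| ≤ β.X) :
    Rep β (threeSumInput l) (initStore l) := by
  have hXB : (β.X : ℤ) ≤ β.B := by exact_mod_cast β.X_le_B
  have hc : ∀ i, |cells l i| ≤ β.X := fun i => by
    unfold cells
    split_ifs with h
    · rcases lt_or_ge i.toNat l.length with h' | h'
      · rw [List.getD_eq_getElem _ _ h']; exact hx _ (List.getElem_mem _)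
      · rw [List.getD_eq_default _ _ h']; simp
    · simp
  have hc0 : ∀ i, |cells [] i| ≤ β.X := fun i => by simp [cells]
  have hn' : (l.length : ℤ) ≤ β.X := by exact_mod_cast hn
  refine ⟨fun j => ?_, fun a => ?_, fun r => ?_, fun a => ?_, ⟨fun r => ?_, fun a i => ?_⟩,
    ⟨fun j => ?_, fun a i => ?_⟩⟩
  · simp [threeSumInput, initStore]
  · simp [threeSumInput, initStore]
  · simp [threeSumInput, initStore]
  · simp [threeSumInput, initStore]
  · simp only [threeSumInput]
    split_ifs
    · rw [abs_of_nonneg (by positivity)]; omega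
    · simp
  · simp only [threeSumInput]
    split_ifs
    · exact (hc i).trans hXB
    · exact (hc0 i).trans hXB
  · simp only [initStore]
    split_ifs
    · rw [abs_of_nonneg (by positivity)]; omega
    · simp
  · simp only [initStore]
    split_ifs
    · exact hc i
    · exact hc0 i

/-- The three random draws turn into three nested averages. With `wrong` as the final cost,
finiteness of the right-hand side includes correctness of the answer and the bound on all words. -/
theorem cost_reduction_le {l : List ℤ} {t s w g c : ℕ} (hl : l ≠ []) (ht : 0 < t) (hst : s ≤ t)
    (hw : 2 * w ≤ t + s) (hβ : 2 * t + 1 ≤ β.e) (hn : 2 * l.length ^ 2 ≤ β.X)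
    (hx : ∀ x ∈ l, |x| ≤ β.X) (hg : 0 < g) (hgl : g ^ t ≤ l.length) (hlg : l.length < (g + 1) ^ t)
    (hfit : ∀ i j k, Fits (redInst l hg hw i j k) l.length β)
    (hs : ∀ i j k, Serves D (redInst l hg hw i j k) β c) :
    cost β.B (wrong l) ([reductionC D t s w], threeSumInput l) ≤
      (1000 * (t + 1) * (l.length + 1) + 10 : ℕ) + avg (g ^ s) fun i => avg (g ^ s) fun j =>
        avg (g ^ s) fun k => instTime D (redInst l hg hw i j k) l.length := by
  have hpos : 0 < l.length := List.length_pos_iff.2 hl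
  have hR : 0 < g ^ s := pow_pos hg s
  have key : Bnd β 0 (fun _ => 0) (wp β.B (reductionC D t s w) (wrong l)) (initStore l)
      ((1000 * (t + 1) * (l.length + 1) + 10 : ℕ) + avg (g ^ s) fun i => avg (g ^ s) fun j =>
        avg (g ^ s) fun k => instTime D (redInst l hg hw i j k) l.length) := by
    refine (bnd_seq (ok_prepare hl ht hst (by omega) hβ hn (fun _ => 0) _
      (6 + avg (g ^ s) fun i => avg (g ^ s) fun j =>
        avg (g ^ s) fun k => instTime D (redInst l hg hw i j k) l.length)
      fun σ ⟨g', hP⟩ => ?_)).mono ?_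
    · generalize avg (g ^ s) _ = A
      calc _ ≤ 1 + (((1000 * (t + 1) * (l.length + 1) : ℕ) : ℝ≥0∞) + (6 + A)) + 3 := le_self_add
        _ = _ := by push_cast; ring
    -- The root computed by the program is the one of the statement, because both satisfy g^t ≤ n <
    -- (g+1)^t.
    · obtain rfl : g' = g := by
        have h1 : g' < g + 1 := lt_of_pow_lt_pow_left₀ t (by omega) (hP.pow_le.trans_lt hlg)
        have h2 : g < g' + 1 := lt_of_pow_lt_pow_left₀ t (by omega) (hgl.trans_lt hP.lt_pow)
        omega
      have h₃ : ∀ i < g' ^ s, ∀ j < g' ^ s, Bnd β 0 (fun _ => 0) (wp β.B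
          (.seq (.rand (4 * 11) (4 * 6)) <| .seq buildC (queryC D)) (wrong l))
          ((σ.setVar 9 i).setVar 10 j)
          (2 + avg (g' ^ s) fun k => instTime D (redInst l hg hw i j k) l.length) :=
        fun i hi j hj => (bnd_seq (bnd_rand hR (by simpa using hP.R)
          fun k hk => bnd_inst hP hw hi hj hk (hfit i j k) (hs i j k))).mono (by
            rw [← add_assoc]; norm_num [avg])
      have h₂ : ∀ i < g' ^ s, Bnd β 0 (fun _ => 0) (wp β.B
          (.seq (.rand (4 * 10) (4 * 6)) <| .seq (.rand (4 * 11) (4 * 6)) <|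
            .seq buildC (queryC D)) (wrong l)) (σ.setVar 9 i)
          (4 + avg (g' ^ s) fun j => avg (g' ^ s) fun k =>
            instTime D (redInst l hg hw i j k) l.length) :=
        fun i hi => (bnd_seq (bnd_rand hR (by simpa using hP.R) fun j hj => h₃ i hi j hj)).mono (by
            change 1 + (1 + avg _ _) ≤ _
            rw [avg_const_add hR, ← add_assoc, ← add_assoc]; norm_num)
      refine (bnd_seq (bnd_rand hR (by simpa using hP.R) h₂)).mono ?_
      change 1 + (1 + avg _ _) ≤ _
      rw [avg_const_add hR, ← add_assoc, ← add_assoc]; norm_num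
  -- At depth zero no loop counter is protected.
  refine key _ (rep_initStore ?_ hx) fun k hk => absurd hk (by omega)
  nlinarith

end ISGLowerBound

namespace ISGLowerBound

/-! ## The analysis of the reduction -/

/-! ### Sizes -/

namespace Inst
variable {I : Inst}

theorem length_flatMap_range {α : Type*} (f : ℕ → List α) (m : ℕ) :
    ((List.range m).flatMap f).length = ∑ i ∈ Finset.range m, (f i).length := by
  simpa using sum_map_flatMap_range (fun _ => 1) f m

theorem length_filter_eq (p : ℤ → Prop) [DecidablePred p] :
    (I.S.filter fun x => p x).length = ∑ _ ∈ I.S.toFinset.filter p, 1 := by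
  simpa using sum_map_filter_eq (I := I) (fun _ => 1) p

/-- Each query has a dummy; each x arrives in the q₂ queries with its residue as u₂, and each y in
q₃ queries. -/
theorem arrivals_length_le :
    I.arrivals.length ≤ I.q₂ * I.q₃ + I.q₂ * I.S.length + I.q₃ * I.S.length := by
  have hS : ∑ x ∈ I.S.toFinset, 1 = I.S.length := by
    rw [← Finset.card_eq_sum_ones, List.toFinset_card_of_nodup I.nodup]
  have hA : ∑ j ∈ Finset.range I.q₃, (I.S.filter fun x => x % I.q₃ = ((j : ℕ) : ℤ)).length ≤
      I.S.length := by
    rw [← hS]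
    simp only [length_filter_eq]
    exact sum_filter_unique _ (fun (j : ℕ) (_ : ℤ) => (j : ℤ)) _ fun y i _ j _ h h' => by omega
  have hB : ∑ i ∈ Finset.range I.q₂,
      (I.S.filter fun x => x % I.q₂ = (-((i : ℕ) : ℤ)) % I.q₂).length ≤ I.S.length := by
    rw [← hS]
    simp only [length_filter_eq]
    exact sum_filter_unique _ (fun (j : ℕ) (_ : ℤ) => (-(j : ℤ)) % I.q₂) _
      fun y i hi j hj h h' => neg_emod_inj hi hj (h.symm.trans h')
  have hq : ∀ i j : ℤ, (I.query i j).length = 1 + (I.S.filter fun x => x % I.q₃ = j).length +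
      (I.S.filter fun x => x % I.q₂ = (-i) % I.q₂).length := fun i j => by
    simp [query, listA, listB]; ring
  unfold arrivals
  simp only [length_flatMap_range, hq, Finset.sum_add_distrib, Finset.sum_const, Finset.card_range,
    smul_eq_mul, mul_one]
  rw [← Finset.mul_sum]
  have := Nat.mul_le_mul_left I.q₂ hA
  have := Nat.mul_le_mul_left I.q₃ hB
  omega

theorem flatAnswer_take (i : ℕ) : flatAnswer Arrival.fl I.vt (I.arrivals.take i) =
    (I.annotated.take i).flatMap I.reported := by
  rw [flatAnswer, withPrev_take]; rfl

/-- The arrivals until a solution is found. -/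
theorem exists_upTo_eq_take : ∃ i, upTo I.Hit I.annotated = I.annotated.take i ∧
    (upTo I.Hit I.annotated).map Prod.snd = I.arrivals.take i := by
  obtain ⟨i, hi⟩ : ∃ i, upTo I.Hit I.annotated = I.annotated.take i :=
    ⟨_, List.prefix_iff_eq_take.1 (upTo_prefix _ _)⟩
  exact ⟨i, hi, by rw [hi, List.map_take, map_snd_withPrev]⟩

theorem length_flatAnswer_upTo_le :
    (flatAnswer Arrival.fl I.vt ((upTo I.Hit I.annotated).map Prod.snd)).length ≤
      (falseTriples I.S.toFinset I.q₁ I.q₂ I.q₃).card + 4 * I.S.length := by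
  obtain ⟨i, h1, h2⟩ := exists_upTo_eq_take (I := I)
  refine le_trans ?_ I.sum_tests_le
  rw [h2, flatAnswer_take, ← h1, List.length_flatMap]
  exact List.sum_le_sum fun a ha => length_reported_le ((upTo_prefix _ _).subset ha)

theorem length_flatAnswer_le :
    (flatAnswer Arrival.fl I.vt I.arrivals).length ≤ I.arrivals.length * I.S.length := by
  have := flatAnswer_take (I := I) I.arrivals.length
  rw [List.take_length, ← length_withPrev (fl := Arrival.fl) (vt := I.vt) [],
    List.take_length] at this
  rw [this, List.length_flatMap, ← length_withPrev (fl := Arrival.fl) (vt := I.vt) [] I.arrivals,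
    ← smul_eq_mul, ← List.length_map (f := fun a => (I.reported a).length)]
  refine List.sum_le_card_nsmul _ _ fun x hx => ?_
  obtain ⟨a, ha, rfl⟩ := List.mem_map.1 hx
  exact (length_reported_le ha).trans (tests_le ha)

end Inst

variable {D : ISGStructure} {c : ℕ} {I : Inst}

/-- Needs no cost assumption, hence also holds for short lists, whose graphs may lie outside the
class. -/
theorem instTime_ne_top (h : ∀ l, l <+: I.arrivals → RunSpec (G := I.graph) D c Arrival.fl I.vt l)
    (n : ℕ) : instTime D I n ≠ ∞ := by
  obtain ⟨i, h1, h2⟩ := Inst.exists_upTo_eq_take (I := I)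
  unfold instTime
  rw [h2]
  refine ENNReal.add_ne_top.2 ⟨ENNReal.mul_ne_top (by simp) ?_, ENNReal.natCast_ne_top _⟩
  exact (h _ (List.take_prefix _ _)).time

/-- The amortized bound is applied to the series cut after the first hit. Its reported edges are at
most the tests made, that is, the false triples and 4|S| further ones. -/
theorem instTime_le (h : ∀ l, l <+: I.arrivals → RunSpec (G := I.graph) D c Arrival.fl I.vt l)
    {P q r : ℝ≥0} (hc : D.HasAmortizedCosts I.graph P q r) (n : ℕ) {p' a' r' : ℕ}
    (hP : P ≤ p') (hq : q * I.arrivals.length ≤ a') (hr : r ≤ r') :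
    instTime D I n ≤ ((5 * p' + 5 * a' + (5 * r' + 400) *
      ((falseTriples I.S.toFinset I.q₁ I.q₂ I.q₃).card + 4 * I.S.length) +
      210 * I.arrivals.length + 5000 * (I.load n + 1) : ℕ) : ℝ≥0∞) := by
  set T := (falseTriples I.S.toFinset I.q₁ I.q₂ I.q₃).card + 4 * I.S.length with hT
  have hop := Inst.length_flatAnswer_upTo_le (I := I)
  have htest := Inst.sum_tests_le (I := I)
  obtain ⟨i, h1, h2⟩ := Inst.exists_upTo_eq_take (I := I)
  rw [h2, ← hT] at hop
  rw [← hT] at htest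
  have hlen : (I.arrivals.take i).length ≤ I.arrivals.length := by simp
  have hup : (upTo I.Hit I.annotated).length ≤ I.arrivals.length := by
    rw [← List.length_map (f := Prod.snd), h2]; exact hlen
  have hS : ((upTo I.Hit I.annotated).map fun a => 210 + 400 * I.tests a).sum ≤
      210 * I.arrivals.length + 400 * T := by
    rw [List.sum_map_add, List.map_const', List.sum_replicate, smul_eq_mul, List.sum_map_mul_left]
    omega
  have hE := (h _ (List.take_prefix i _)).amortized P q r hc
  have hE' : P + q * (I.arrivals.take i).length +
      r * (flatAnswer Arrival.fl I.vt (I.arrivals.take i)).length ≤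
      ((p' + a' + r' * T : ℕ) : ℝ≥0) := by
    push_cast
    refine add_le_add (add_le_add hP (le_trans ?_ hq)) ?_
    · gcongr
    · refine mul_le_mul hr ?_ (by positivity) (by positivity)
      exact_mod_cast hop
  unfold instTime
  rw [h2]
  calc _ ≤ 5 * (((p' + a' + r' * T : ℕ) : ℝ≥0) : ℝ≥0∞) +
        ((210 * I.arrivals.length + 400 * T + 5000 * (I.load n + 1) : ℕ) : ℝ≥0∞) := by
        gcongr
        exact hE.trans (by exact_mod_cast hE')
    _ = _ := by push_cast; ring

end ISGLowerBound

/-! ### Sizes of the instances of the reduction -/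

namespace ISGLowerBound

section sizes
variable {β : Bds} {D : ISGStructure} {l : List ℤ} {t s w g : ℕ} {hg : 0 < g} {hw : 2 * w ≤ t + s}
  {i j k : ℕ}

theorem redInst_τ_mul_M : (redInst l hg hw i j k).τ * (redInst l hg hw i j k).M = g ^ (t + s) := by
  simp only [redInst]
  rw [← pow_add]; congr 1; omega

theorem redInst_arrivals_le (hn : g ^ s ≤ l.length) :
    (redInst l hg hw i j k).arrivals.length ≤ 8 * (g ^ s * l.length) := by
  have h := Inst.arrivals_length_le (I := redInst l hg hw i j k)
  have h2 := (redInst l hg hw i j k).q₂_le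
  have h3 := (redInst l hg hw i j k).q₃_le
  have hS : (redInst l hg hw i j k).S.length ≤ l.length := length_distinct_le l
  have hR : (redInst l hg hw i j k).R = g ^ s := rfl
  rw [hR] at h2 h3
  generalize (redInst l hg hw i j k).q₂ = q₂ at *
  generalize (redInst l hg hw i j k).q₃ = q₃ at *
  generalize (redInst l hg hw i j k).S.length = m at *
  have e1 := Nat.mul_le_mul h2 h3
  have e2 := Nat.mul_le_mul h2 hS
  have e3 := Nat.mul_le_mul h3 hS
  have e4 := Nat.mul_le_mul_left (g ^ s) hn
  nlinarith

theorem redInst_m_le : (redInst l hg hw i j k).graph.m ≤ g ^ (t + s) + 2 * (g ^ s * l.length) := by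
  rw [Inst.graph_m, redInst_τ_mul_M]
  have h1 := (redInst l hg hw i j k).q₁_le
  have h2 := (redInst l hg hw i j k).ins_length_le.trans (length_distinct_le l)
  have := Nat.mul_le_mul h2 h1
  have hR : (redInst l hg hw i j k).R = g ^ s := rfl
  rw [hR] at this
  nlinarith

theorem le_redInst_m : g ^ (t + s) ≤ (redInst l hg hw i j k).graph.m := by
  rw [Inst.graph_m, redInst_τ_mul_M]
  exact Nat.le_add_right _ _

theorem redInst_nv_le (hn : g ^ s ≤ l.length) (ht : g ^ t ≤ l.length) :
    (redInst l hg hw i j k).nv ≤ 10 * l.length ^ 2 := by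
  have h1 := Nat.mul_le_mul ht hn
  rw [← pow_add] at h1
  have h2 : (redInst l hg hw i j k).τ ≤ g ^ (t + s) := Nat.pow_le_pow_right hg (by omega)
  have h3 : (redInst l hg hw i j k).M ≤ g ^ (t + s) := Nat.pow_le_pow_right hg (by omega)
  have hR : (redInst l hg hw i j k).R = g ^ s := rfl
  have h4 := Nat.mul_le_mul hn hn
  unfold Inst.nv Inst.w
  rw [hR]
  nlinarith

theorem fits_redInst (hl : l ≠ []) (hst : s ≤ t) (ht : g ^ t ≤ l.length)
    (hX : 10 * l.length ^ 3 ≤ β.X) : Fits (redInst l hg hw i j k) l.length β := by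
  have hn : g ^ s ≤ l.length := (Nat.pow_le_pow_right hg hst).trans ht
  have hpos : 0 < l.length := List.length_pos_iff.2 hl
  have h23 : l.length ^ 2 ≤ l.length ^ 3 := Nat.pow_le_pow_right hpos (by norm_num)
  have h13 : l.length ≤ l.length ^ 3 := Nat.le_self_pow (by norm_num) _
  have hRn : g ^ s * l.length ≤ l.length ^ 2 := by rw [sq]; exact Nat.mul_le_mul_right _ hn
  have htn : g ^ (t + s) ≤ l.length ^ 2 := by rw [sq, pow_add]; exact Nat.mul_le_mul ht hn
  have hR : (redInst l hg hw i j k).R = g ^ s := rfl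
  refine ⟨length_distinct_le l, by omega, ?_, ?_, ?_, ?_⟩
  · have := Nat.pow_le_pow_left hn 3
    unfold Inst.w
    rw [hR, mul_pow]; omega
  · have := redInst_nv_le (l := l) (hg := hg) (hw := hw) (i := i) (j := j) (k := k) hn ht
    omega
  · rw [redInst_τ_mul_M]
    have h1 := (redInst l hg hw i j k).q₁_le
    have h2 : (redInst l hg hw i j k).S.length ≤ l.length := length_distinct_le l
    have := Nat.mul_le_mul h2 h1
    rw [hR] at this
    nlinarith
  · have := redInst_arrivals_le (l := l) (hg := hg) (hw := hw) (i := i) (j := j) (k := k) hn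
    omega

/-- The input size of the data structure is at most 23n²: at most 10n² vertices, 3n² edges, 8n²
arrivals, and 2 ≤ 2n². -/
theorem serves_redInst {c : ℕ} (hl : l ≠ []) (hst : s ≤ t) (ht : g ^ t ≤ l.length)
    (hX : 10 * l.length ^ 3 ≤ β.X) (hX' : (23 * l.length ^ 2) ^ c ≤ β.X)
    (hD : ∀ (ι : Type) (G : DirGraph) (fl : ι → Bool) (vt : ι → Fin G.n) (l : List ι),
      (∀ i ∈ l.head?, fl i = true) → RunSpec D c fl vt l) :
    Serves D (redInst l hg hw i j k) β c := by
  have hn : g ^ s ≤ l.length := (Nat.pow_le_pow_right hg hst).trans ht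
  have hpos : 0 < l.length := List.length_pos_iff.2 hl
  have hRn : g ^ s * l.length ≤ l.length ^ 2 := by rw [sq]; exact Nat.mul_le_mul_right _ hn
  have htn : g ^ (t + s) ≤ l.length ^ 2 := by rw [sq, pow_add]; exact Nat.mul_le_mul ht hn
  have harr := redInst_arrivals_le (l := l) (hg := hg) (hw := hw) (i := i) (j := j) (k := k) hn
  have hnv := redInst_nv_le (l := l) (hg := hg) (hw := hw) (i := i) (j := j) (k := k) hn ht
  have hm := redInst_m_le (l := l) (hg := hg) (hw := hw) (i := i) (j := j) (k := k)
  refine ⟨fun l hl => hD _ _ _ _ _ (prefix_head hl), le_trans ?_ hX', ?_⟩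
  · refine Nat.pow_le_pow_left ?_ c
    rw [Inst.graph_n]
    have : 1 ≤ l.length ^ 2 := Nat.one_le_pow _ _ hpos
    omega
  · refine Inst.length_flatAnswer_le.trans (le_trans ?_ hX)
    have h2 : (redInst l hg hw i j k).S.length ≤ l.length := length_distinct_le l
    calc _ ≤ 8 * l.length ^ 2 * l.length := Nat.mul_le_mul (by omega) h2
      _ ≤ 10 * l.length ^ 3 := by nlinarith [pow_pos hpos 3]

end sizes

/-! ### From cost bounds to an algorithm for 3SUM -/

/-- Bounds for the program on lists of a given length. -/
def listBds (n k c t : ℕ) (hn : 0 < n) : Bds where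
  -- The part 7c covers the words of the data structure, as 23n² ≤ (n+2)^7; k covers the given
  -- numbers; the rest covers the cubic sizes and the constant 5.
  X := (n + 2) ^ (7 * c + k + 10)
  e := 2 * t + 20
  five_le := by
    calc 5 ≤ 3 ^ 10 := by norm_num
      _ ≤ (n + 2) ^ 10 := Nat.pow_le_pow_left (by omega) _
      _ ≤ _ := Nat.pow_le_pow_right (by omega) (by omega)
  deg_le := by omega

/-- What the program does on a list, with the base of the sizes made explicit. -/
theorem cost_reduction_le_of_runSpec {D : ISGStructure} {c t s w g k₀ : ℕ} {l : List ℤ}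
    (hD : ∀ (ι : Type) (G : DirGraph) (fl : ι → Bool) (vt : ι → Fin G.n) (l : List ι),
      (∀ i ∈ l.head?, fl i = true) → RunSpec D c fl vt l)
    (hn : 0 < l.length) (hx : ∀ x ∈ l, |x| ≤ (l.length : ℤ) ^ k₀)
    (ht : 0 < t) (hst : s ≤ t) (hw : 2 * w ≤ t + s) (hg : 0 < g) (hgl : g ^ t ≤ l.length)
    (hlg : l.length < (g + 1) ^ t) :
    cost (listBds l.length k₀ c t hn).B (wrong l) ([reductionC D t s w], threeSumInput l) ≤
      (1000 * (t + 1) * (l.length + 1) + 10 : ℕ) + avg (g ^ s) fun i => avg (g ^ s) fun j =>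
        avg (g ^ s) fun k => instTime D (redInst l hg hw i j k) l.length := by
  have hl : l ≠ [] := List.length_pos_iff.1 hn
  have hX : ∀ m ≤ 7 * c + k₀ + 10, (l.length + 2) ^ m ≤ (listBds l.length k₀ c t hn).X :=
    fun m hm => Nat.pow_le_pow_right (by omega) hm
  have h6 := hX 6 (by omega)
  have h3 : 10 * l.length ^ 3 ≤ (listBds l.length k₀ c t hn).X := by
    refine le_trans ?_ h6
    calc 10 * l.length ^ 3 ≤ 3 ^ 3 * l.length ^ 3 := by gcongr; norm_num
      _ ≤ (l.length + 2) ^ 3 * (l.length + 2) ^ 3 := by gcongr <;> omega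
      _ = _ := by rw [← pow_add]
  have hc : (23 * l.length ^ 2) ^ c ≤ (listBds l.length k₀ c t hn).X := by
    refine le_trans ?_ (hX (7 * c) (by omega))
    rw [pow_mul]
    refine Nat.pow_le_pow_left ?_ c
    calc 23 * l.length ^ 2 ≤ 3 ^ 5 * l.length ^ 2 := by gcongr; norm_num
      _ ≤ (l.length + 2) ^ 5 * (l.length + 2) ^ 2 := by gcongr <;> omega
      _ = _ := by rw [← pow_add]
  refine cost_reduction_le hl ht hst hw ?_ ?_ ?_ hg hgl hlg
    (fun i j k => fits_redInst hl hst hgl h3) fun i j k => serves_redInst hl hst hgl h3 hc hD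
  · simp only [listBds]; omega
  · refine le_trans ?_ h3
    have h23 : l.length ^ 2 ≤ l.length ^ 3 := Nat.pow_le_pow_right hn (by norm_num)
    omega
  · intro x hxl
    refine (hx x hxl).trans ?_
    have : l.length ^ k₀ ≤ (listBds l.length k₀ c t hn).X :=
      (Nat.pow_le_pow_left (by omega) k₀).trans (hX k₀ (by omega))
    exact_mod_cast this

/-- Every number lies between consecutive powers. -/
theorem exists_root {t n : ℕ} (ht : 0 < t) (hn : 0 < n) :
    ∃ g, 0 < g ∧ g ^ t ≤ n ∧ n < (g + 1) ^ t := by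
  obtain ⟨g, h1, h2⟩ : ∃ g, g ^ t ≤ n ∧ n < (g + 1) ^ t := by
    have h : ∃ g, n < (g + 1) ^ t := ⟨n, (Nat.lt_succ_self n).trans_le (Nat.le_self_pow ht.ne' _)⟩
    classical
    refine ⟨Nat.find h, ?_, Nat.find_spec h⟩
    rcases Nat.eq_zero_or_pos (Nat.find h) with h0 | h0
    · rw [h0, zero_pow ht.ne']; omega
    · have := Nat.find_min h (Nat.sub_lt h0 one_pos)
      rw [Nat.sub_add_cancel (show 1 ≤ Nat.find h from h0)] at this
      omega
  refine ⟨g, ?_, h1, h2⟩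
  rcases Nat.eq_zero_or_pos g with rfl | h
  · simp at h2; omega
  · exact h

/-- From the expected time on long lists to the conclusion on all lists. -/
theorem solvesThreeSum_of_cost_le {D : ISGStructure} {c t s w g₀ : ℕ} {e : ℝ}
    (hD : ∀ (ι : Type) (G : DirGraph) (fl : ι → Bool) (vt : ι → Fin G.n) (l : List ι),
      (∀ i ∈ l.head?, fl i = true) → RunSpec D c fl vt l)
    (ht : 0 < t) (hst : s ≤ t) (hw : 2 * w ≤ t + s) (he : 0 ≤ e)
    (h : ∀ k₀ : ℕ, ∃ C : ℝ, ∀ (l : List ℤ) (g : ℕ) (hg : 0 < g), g₀ ≤ g → g ^ t ≤ l.length →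
      l.length < (g + 1) ^ t → (∀ x ∈ l, |x| ≤ (l.length : ℤ) ^ k₀) →
      (1000 * (t + 1) * (l.length + 1) + 10 : ℕ) + (avg (g ^ s) fun i => avg (g ^ s) fun j =>
        avg (g ^ s) fun k => instTime D (redInst l hg hw i j k) l.length) ≤
        ENNReal.ofReal (C * (l.length : ℝ) ^ e)) :
    SolvesThreeSumInTime (reductionC D t s w) e := by
  intro k₀
  obtain ⟨C, hC⟩ := h k₀
  have hfin : ∀ (l : List ℤ) (hn : 0 < l.length), (∀ x ∈ l, |x| ≤ (l.length : ℤ) ^ k₀) →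
      cost (listBds l.length k₀ c t hn).B (wrong l) ([reductionC D t s w], threeSumInput l) ≠ ∞ := by
    intro l hn hx
    obtain ⟨g, hg, h1, h2⟩ := exists_root ht hn
    refine ne_top_of_le_ne_top ?_ (cost_reduction_le_of_runSpec hD hn hx ht hst hw hg h1 h2)
    have havg : ∀ f : ℕ → ℝ≥0∞, (∀ i, f i ≠ ∞) → avg (g ^ s) f ≠ ∞ := fun f hf => by
      refine ENNReal.mul_ne_top (ENNReal.inv_ne_top.2 (by exact_mod_cast (pow_pos hg s).ne')) ?_
      exact ENNReal.sum_ne_top.2 fun i _ => hf i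
    refine ENNReal.add_ne_top.2 ⟨ENNReal.natCast_ne_top _, havg _ fun i => havg _ fun j =>
      havg _ fun k => instTime_ne_top (fun l hl => hD _ _ _ _ _ (prefix_head hl)) _⟩
  -- short lists
  obtain ⟨C', hC'⟩ : ∃ C' : ℝ, ∀ l : List ℤ, 0 < l.length → l.length < g₀ ^ t →
      (∀ x ∈ l, |x| ≤ (l.length : ℤ) ^ k₀) →
      expectedTime ([reductionC D t s w], threeSumInput l) ≤ ENNReal.ofReal C' := by
    -- There are finitely many short inputs, and the expected time on each is finite, so a constant
    -- bounds them all.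
    have hF : {l : List ℤ | l.length < g₀ ^ t ∧ ∀ x ∈ l, |x| ≤ ((g₀ ^ t : ℕ) : ℤ) ^ k₀}.Finite := by
      have := (List.finite_length_lt (Set.Icc (-((g₀ ^ t : ℕ) : ℤ) ^ k₀)
        (((g₀ ^ t : ℕ) : ℤ) ^ k₀)) (g₀ ^ t)).image (List.map Subtype.val)
      refine this.subset fun l hl => ?_
      refine ⟨l.attach.map fun x => ⟨x.1, abs_le.1 (hl.2 x.1 x.2)⟩, ?_, ?_⟩
      · simpa using hl.1
      · simp [List.map_map, Function.comp_def]
    obtain ⟨C', hC'⟩ := (hF.image fun l =>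
      (expectedTime ([reductionC D t s w], threeSumInput l)).toReal).bddAbove
    refine ⟨C', fun l hn hlt hx => ?_⟩
    have h1 := ne_top_of_le_ne_top (hfin l hn hx) (expectedTime_le_cost _)
    rw [← ENNReal.ofReal_toReal h1]
    refine ENNReal.ofReal_le_ofReal (hC' ⟨l, ⟨hlt, fun x hxl => (hx x hxl).trans ?_⟩, rfl⟩)
    have : l.length ^ k₀ ≤ (g₀ ^ t) ^ k₀ := Nat.pow_le_pow_left hlt.le k₀
    exact_mod_cast this
  refine ⟨(7 * c + k₀ + 10) * (2 * t + 20), max C (max C' 0), fun l hl hx => ?_⟩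
  have hn : 0 < l.length := List.length_pos_iff.2 hl
  have hne := hfin l hn hx
  have hB : (listBds l.length k₀ c t hn).B =
      (l.length + 2) ^ ((7 * c + k₀ + 10) * (2 * t + 20)) := by rw [pow_mul]; rfl
  have hn1 : (1 : ℝ) ≤ l.length := by exact_mod_cast hn
  refine ⟨fun z hz => ?_, fun s hs => ?_, ?_⟩
  · have := bounded_of_cost_ne_top (cost_ne_top_of_reachable hz hne)
    rw [hB] at this
    exact_mod_cast this
  · have := final_ne_top_of_cost_ne_top (cost_ne_top_of_reachable hs hne)
    rw [wrong] at this
    by_contra hcon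
    rw [if_neg hcon] at this
    exact this rfl
  · rcases lt_or_ge l.length (g₀ ^ t) with hlt | hge
    · refine (hC' l hn hlt hx).trans (ENNReal.ofReal_le_ofReal ?_)
      have h1 : (1 : ℝ) ≤ (l.length : ℝ) ^ e := Real.one_le_rpow hn1 he
      have h0 : C' ≤ max C (max C' 0) := (le_max_left _ _).trans (le_max_right _ _)
      have h2 : 0 ≤ max C (max C' 0) := (le_max_right _ _).trans (le_max_right _ _)
      nlinarith
    · obtain ⟨g, hg, h1, h2⟩ := exists_root ht hn
      have hgg : g₀ ≤ g := by
        have : g₀ < g + 1 := lt_of_pow_lt_pow_left₀ t (by omega) (hge.trans_lt h2)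
        omega
      refine (expectedTime_le_cost _).trans ((cost_reduction_le_of_runSpec hD hn hx ht hst hw hg h1
        h2).trans ((hC l g hg hgg h1 h2 hx).trans (ENNReal.ofReal_le_ofReal ?_)))
      gcongr
      exact le_max_left _ _

end ISGLowerBound

namespace ISGLowerBound

/-! ### Asymptotics -/

/-- For a rational u/v between a and b take w/(t+s) slightly above u/v; a large multiplier N makes w
as large as the savings w·ε and w·ε' require. The gap between `a * (t + s)` and w pays for constant
factors in the number of edges. -/
theorem exists_exponents {a b ε ε' : ℝ} (ha : 0 < a) (hab : a < b) (hb : b ≤ 1 / 2) (hε : 0 < ε)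
    (hε' : 0 < ε') : ∃ t s w : ℕ, 2 ≤ t ∧ s < t ∧ s + w = t + 2 ∧ 2 * w ≤ t + s ∧
      3 ≤ w ∧ a * (t + s : ℕ) + 1 ≤ w ∧ (w : ℝ) ≤ b * (t + s : ℕ) ∧ 3 ≤ w * ε ∧ 3 ≤ w * ε' := by
  obtain ⟨x, hx1, hx2⟩ := exists_rat_btwn hab
  have hx0 : 0 < x := by exact_mod_cast ha.trans hx1
  obtain ⟨u, hu⟩ : ∃ u : ℕ, x.num = u := Int.eq_ofNat_of_zero_le (Rat.num_pos.2 hx0).le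
  have hu0 : 0 < u := by have := Rat.num_pos.2 hx0; omega
  set v := x.den with hv
  have hv0 : (0 : ℝ) < v := by exact_mod_cast x.den_pos
  have hxv : (x : ℝ) = u / v := by
    rw [Rat.cast_def, hu]; simp [hv]
  rw [hxv] at hx1 hx2
  rw [lt_div_iff₀ hv0] at hx1
  rw [div_lt_iff₀ hv0] at hx2
  -- Here b ≤ 1/2 enters; it yields 2w ≤ t+s, which means τ ≤ M for the padding.
  have huv : 2 * u < v := by
    have : (2 * u : ℝ) < v := by nlinarith
    exact_mod_cast this
  have hu1 : (1 : ℝ) ≤ u := by exact_mod_cast hu0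
  obtain ⟨N, hN⟩ := exists_nat_ge (2 + 3 / ε + 3 / ε' + 1 / (b * v - u))
  have p1 : 0 < 3 / ε := by positivity
  have p2 : 0 < 3 / ε' := by positivity
  have p3 : 0 < 1 / (b * v - u) := one_div_pos.2 (by linarith)
  have hN2 : 2 ≤ N := by
    have : (2 : ℝ) ≤ N := by linarith
    exact_mod_cast this
  have hNr : (2 : ℝ) ≤ N := by exact_mod_cast hN2
  have e1 : 3 ≤ N * ε := by rw [← div_le_iff₀ hε]; linarith
  have e2 : 3 ≤ N * ε' := by rw [← div_le_iff₀ hε']; linarith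
  have e3 : 1 ≤ N * (b * v - u) := by rw [← div_le_iff₀ (by linarith)]; linarith
  have hNu : 1 * 2 ≤ u * N := Nat.mul_le_mul hu0 hN2
  have hNv : (2 * u + 1) * N ≤ v * N := Nat.mul_le_mul_right N huv
  have hNuw : (N : ℝ) ≤ 2 * N * u + 2 := by nlinarith
  -- With these values t+s = 2Nv, so w/(t+s) = u/v + 1/(Nv), and s+w = t+2.
  refine ⟨N * (v + u), N * (v - u), 2 * N * u + 2, ?_⟩
  obtain ⟨d, hd⟩ : ∃ d, v = u + d := ⟨v - u, by omega⟩
  have hts : N * (v + u) + N * (v - u) = 2 * N * v := by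
    rw [hd, Nat.add_sub_cancel_left]; ring
  rw [hts]
  have hd' : v - u = d := by omega
  have hs : N * (v - u) + N * u = N * v := by rw [hd', hd]; ring
  have hvu : N * (v + u) = N * v + N * u := by ring
  have c1 : u * N = N * u := mul_comm _ _
  have c2 : v * N = N * v := mul_comm _ _
  have c3 : (2 * u + 1) * N = 2 * (N * u) + N := by ring
  have c4 : 2 * N * u = 2 * (N * u) := by ring
  have c5 : 2 * N * v = 2 * (N * v) := by ring
  rw [c4, c5]
  refine ⟨by omega, by omega, by omega, by omega, by omega, ?_, ?_, ?_, ?_⟩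
  · push_cast; nlinarith
  · push_cast; nlinarith
  · push_cast; nlinarith
  · push_cast; nlinarith

/-- Averaging a bound in which two terms are small on average. -/
theorem avg_avg_avg_le {R A B E U V : ℕ} (hR : 0 < R) {f : ℕ → ℕ → ℕ → ℝ≥0∞} {u : ℕ → ℕ → ℕ → ℕ}
    {v : ℕ → ℕ} (hf : ∀ i < R, ∀ j < R, ∀ k < R,
      f i j k ≤ ((A + B * u i j k + E * v j : ℕ) : ℝ≥0∞))
    (hu : B * ∑ i ∈ Finset.range R, ∑ j ∈ Finset.range R, ∑ k ∈ Finset.range R, u i j k ≤ U * R ^ 3)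
    (hv : E * ∑ j ∈ Finset.range R, v j ≤ V * R) :
    (avg R fun i => avg R fun j => avg R fun k => f i j k) ≤ ((A + U + V : ℕ) : ℝ≥0∞) := by
  have h0 : (R : ℝ≥0∞) ≠ 0 := by exact_mod_cast hR.ne'
  have h1 : ∑ i ∈ Finset.range R, ∑ j ∈ Finset.range R, ∑ k ∈ Finset.range R, f i j k ≤
      (((A + U + V) * R ^ 3 : ℕ) : ℝ≥0∞) := by
    calc _ ≤ ∑ i ∈ Finset.range R, ∑ j ∈ Finset.range R, ∑ k ∈ Finset.range R,
          ((A + B * u i j k + E * v j : ℕ) : ℝ≥0∞) :=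
          Finset.sum_le_sum fun i hi => Finset.sum_le_sum fun j hj => Finset.sum_le_sum fun k hk =>
            hf i (Finset.mem_range.1 hi) j (Finset.mem_range.1 hj) k (Finset.mem_range.1 hk)
      _ = ((∑ i ∈ Finset.range R, ∑ j ∈ Finset.range R, ∑ k ∈ Finset.range R,
          (A + B * u i j k + E * v j) : ℕ) : ℝ≥0∞) := by simp only [Nat.cast_sum]
      _ ≤ _ := by
        refine Nat.cast_le.2 ?_
        simp only [Finset.sum_add_distrib, Finset.sum_const, Finset.card_range, smul_eq_mul,
          ← Finset.mul_sum]
        have := Nat.mul_le_mul_left (R * R) hv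
        calc _ = A * R ^ 3 + B * (∑ i ∈ Finset.range R, ∑ j ∈ Finset.range R,
              ∑ k ∈ Finset.range R, u i j k) + R * R * (E * ∑ j ∈ Finset.range R, v j) := by ring
          _ ≤ A * R ^ 3 + U * R ^ 3 + R * R * (V * R) := by gcongr
          _ = _ := by ring
  unfold avg
  simp only [← Finset.mul_sum]
  calc _ ≤ (R : ℝ≥0∞)⁻¹ * ((R : ℝ≥0∞)⁻¹ * ((R : ℝ≥0∞)⁻¹ * (((A + U + V) * R ^ 3 : ℕ) : ℝ≥0∞))) := by
        gcongr
    _ = ((R : ℝ≥0∞)⁻¹ * R) ^ 3 * ((A + U + V : ℕ) : ℝ≥0∞) := by push_cast; ring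
    _ = _ := by rw [ENNReal.inv_mul_cancel h0 (ENNReal.natCast_ne_top R)]; simp

/-- Few moduli divide a number of polynomial size. -/
theorem exists_modCount_le (t k₀ L : ℕ) : ∃ K : ℕ, ∀ g n : ℕ, 0 < g → n ≤ L * g ^ t →
    ∃ d : ℕ, d ^ 3 ≤ K * g ∧ ∀ (R : ℕ) (v : ℤ), v ≠ 0 → |v| ≤ 3 * (n : ℤ) ^ k₀ →
      modCount R v ≤ d := by
  set m := t * k₀ + 1 with hm
  have hm0 : (0 : ℝ) < m := by positivity
  -- The number in question is at most (Zg)^m, so this exponent bounds its divisors by C(Zg)^(1/3);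
  -- the cube, which counts the bad choices of three moduli, is then linear in g.
  obtain ⟨C, hC1, hC⟩ := exists_card_divisors_le (η := 1 / (3 * m)) (by positivity)
  set Z := 3 * (L + 1) ^ k₀ with hZ
  have hZ1 : 1 ≤ Z := by have := Nat.one_le_pow k₀ (L + 1) (by omega); omega
  obtain ⟨K, hK⟩ := exists_nat_ge (C ^ 3 * Z)
  refine ⟨K, fun g n hg hn => ⟨⌊C * ((Z * g : ℕ) : ℝ) ^ (1 / 3 : ℝ)⌋₊, ?_, fun R v hv hvn => ?_⟩⟩
  · have h1 : (⌊C * ((Z * g : ℕ) : ℝ) ^ (1 / 3 : ℝ)⌋₊ : ℝ) ≤ C * ((Z * g : ℕ) : ℝ) ^ (1 / 3 : ℝ) :=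
      Nat.floor_le (by positivity)
    have h2 := pow_le_pow_left₀ (by positivity) h1 3
    rw [mul_pow, ← Real.rpow_natCast (_ ^ (1 / 3 : ℝ)), ← Real.rpow_mul (by positivity)] at h2
    norm_num at h2
    have h3 : C ^ 3 * (Z * g) ≤ (K * g : ℝ) := by
      rw [← mul_assoc]; gcongr
    exact_mod_cast h2.trans h3
  · refine Nat.le_floor (le_trans (Nat.cast_le.2 (modCount_le R hv)) ((hC _ (by simpa)).trans ?_))
    have h1 : v.natAbs ≤ (Z * g) ^ m := by
      have : v.natAbs ≤ 3 * n ^ k₀ := by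
        zify; exact hvn
      calc v.natAbs ≤ 3 * n ^ k₀ := this
        _ ≤ 3 * ((L + 1) * g ^ t) ^ k₀ := by gcongr; exact hn.trans (by gcongr; omega)
        _ = Z * g ^ (t * k₀) := by rw [mul_pow, ← pow_mul, ← mul_assoc]
        _ ≤ Z ^ m * g ^ m := Nat.mul_le_mul (Nat.le_self_pow (by omega) _)
          (Nat.pow_le_pow_right hg (by omega))
        _ = _ := (mul_pow _ _ _).symm
    have h2 : (v.natAbs : ℝ) ≤ (((Z * g : ℕ) : ℝ)) ^ m := by exact_mod_cast h1
    have h3 := Real.rpow_le_rpow (by positivity) h2 (show 0 ≤ 1 / (3 * (m : ℝ)) by positivity)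
    rw [← Real.rpow_natCast, ← Real.rpow_mul (by positivity)] at h3
    have : (m : ℝ) * (1 / (3 * m)) = 1 / 3 := by field_simp
    rw [this] at h3
    gcongr

/-! ### Membership in the class, and the time for single and for random moduli -/

section
variable {l : List ℤ} {t s w g L : ℕ} {hg : 0 < g} {hw : 2 * w ≤ t + s} {i j k : ℕ}

theorem redInst_m_le' (hn : l.length ≤ L * g ^ t) :
    (redInst l hg hw i j k).graph.m ≤ (1 + 2 * L) * g ^ (t + s) := by
  refine redInst_m_le.trans ?_
  have := Nat.mul_le_mul_left (2 * g ^ s) hn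
  calc _ ≤ g ^ (t + s) + 2 * g ^ s * (L * g ^ t) := by linarith
    _ = _ := by rw [pow_add]; ring

/-- The number of edges is g^(t+s) up to the constant 1+2L, while the degeneracy is exactly g^w. As
s < t, the vertices number at most 10·g^(t+s-1), which is below g^(t+s) for g ≥ 10. -/
theorem redInst_inRange {a b : ℝ} (ha : 0 < a) (hab : a < b) (hb : b ≤ 1 / 2) (hst : s < t)
    (hw3 : 3 ≤ w) (haw : a * (t + s : ℕ) + 1 ≤ w) (hbw : (w : ℝ) ≤ b * (t + s : ℕ))
    (hgL : 10 + (1 + 2 * L) ≤ g) (hn : l.length ≤ L * g ^ t) :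
    (redInst l hg hw i j k).graph.InRange a b := by
  have hm1 := le_redInst_m (l := l) (hg := hg) (hw := hw) (i := i) (j := j) (k := k)
  have hm2 := redInst_m_le' (hg := hg) (hw := hw) (i := i) (j := j) (k := k) hn
  have hδ : (redInst l hg hw i j k).graph.δ = g ^ w := Inst.delta_eq _
  have hg0 : (0 : ℝ) < g := by exact_mod_cast hg
  have hg1 : (1 : ℝ) ≤ g := by exact_mod_cast hg
  refine ⟨(Nat.one_le_pow _ _ hg).trans hm1, ?_, ?_, ?_⟩
  · rw [Inst.graph_n]
    refine le_trans ?_ hm1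
    have h1 : (g ^ s * g ^ s : ℕ) ≤ g ^ (t + s - 1) := by
      rw [← pow_add]; exact Nat.pow_le_pow_right hg (by omega)
    have h2 : (redInst l hg hw i j k).τ ≤ g ^ (t + s - 1) := Nat.pow_le_pow_right hg (by omega)
    have h3 : (redInst l hg hw i j k).M ≤ g ^ (t + s - 1) := Nat.pow_le_pow_right hg (by omega)
    have hR : (redInst l hg hw i j k).R = g ^ s := rfl
    have h4 : g ^ (t + s) = g ^ (t + s - 1) * g := by rw [← pow_succ]; congr 1; omega
    unfold Inst.nv Inst.w
    rw [hR, h4]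
    have : g ^ (t + s - 1) * 10 ≤ g ^ (t + s - 1) * g := Nat.mul_le_mul_left _ (by omega)
    nlinarith
  · rw [hδ]
    generalize (redInst l hg hw i j k).graph.m = m at *
    have h1 : (m : ℝ) ≤ (1 + 2 * L : ℕ) * (g : ℝ) ^ (t + s) := by exact_mod_cast hm2
    -- The constant costs at most one factor g, which the summand 1 in `haw` pays for.
    have hL : ((1 + 2 * L : ℕ) : ℝ) ^ a ≤ g := by
      calc ((1 + 2 * L : ℕ) : ℝ) ^ a ≤ ((1 + 2 * L : ℕ) : ℝ) ^ (1 : ℝ) :=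
            Real.rpow_le_rpow_of_exponent_le (by push_cast; linarith [L.cast_nonneg (α := ℝ)])
              (by linarith)
        _ ≤ g := by rw [Real.rpow_one]; exact Nat.cast_le.2 (by omega)
    calc (m : ℝ) ^ a ≤ ((1 + 2 * L : ℕ) * (g : ℝ) ^ (t + s)) ^ a :=
          Real.rpow_le_rpow (by positivity) h1 ha.le
      _ = ((1 + 2 * L : ℕ) : ℝ) ^ a * (g : ℝ) ^ (a * (t + s : ℕ)) := by
          rw [Real.mul_rpow (by positivity) (by positivity), ← Real.rpow_natCast (g : ℝ),
            ← Real.rpow_mul hg0.le, mul_comm a]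
      _ ≤ (g : ℝ) ^ (1 : ℝ) * (g : ℝ) ^ (a * (t + s : ℕ)) := by rw [Real.rpow_one]; gcongr
      _ = (g : ℝ) ^ (a * (t + s : ℕ) + 1) := by rw [← Real.rpow_add hg0, add_comm]
      _ ≤ (g : ℝ) ^ (w : ℝ) := Real.rpow_le_rpow_of_exponent_le hg1 haw
      _ = _ := by rw [Real.rpow_natCast]; push_cast; rfl
  · rw [hδ]
    generalize (redInst l hg hw i j k).graph.m = m at *
    have h1 : (g : ℝ) ^ (t + s) ≤ m := by exact_mod_cast hm1
    calc ((g ^ w : ℕ) : ℝ) = (g : ℝ) ^ (w : ℝ) := by rw [Real.rpow_natCast]; push_cast; rfl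
      _ ≤ (g : ℝ) ^ (((t + s : ℕ) : ℝ) * b) :=
          Real.rpow_le_rpow_of_exponent_le hg1 (by linarith)
      _ = ((g : ℝ) ^ (t + s)) ^ b := by rw [Real.rpow_mul hg0.le, Real.rpow_natCast]
      _ ≤ (m : ℝ) ^ b := Real.rpow_le_rpow (by positivity) h1 (by linarith)

/-- Three factors g are saved. As s + w = t + 2, this lowers g^(t+s+w) = g^(2t+2) to g^(2t-1), just
below n². -/
theorem rpow_one_sub_le {ε : ℝ} (hg : 0 < g) (hw : 3 ≤ w) (h : 3 ≤ w * ε) :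
    (((g ^ w : ℕ) : ℝ)) ^ (1 - ε) ≤ ((g ^ (w - 3) : ℕ) : ℝ) := by
  have hg1 : (1 : ℝ) ≤ g := by exact_mod_cast hg
  push_cast
  rw [← Real.rpow_natCast, ← Real.rpow_mul (by positivity), ← Real.rpow_natCast]
  refine Real.rpow_le_rpow_of_exponent_le hg1 ?_
  rw [Nat.cast_sub hw]; push_cast; linarith

/-- The bound on the time for one choice of the moduli. -/
theorem instTime_redInst_le {D : ISGStructure} {c K₁ K₂ K₃ : ℕ}
    (h : ∀ l', l' <+: (redInst l hg hw i j k).arrivals →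
      RunSpec (G := (redInst l hg hw i j k).graph) D c Arrival.fl (redInst l hg hw i j k).vt l')
    {P q r : ℝ≥0} (hc : D.HasAmortizedCosts (redInst l hg hw i j k).graph P q r)
    (ht : 2 ≤ t) (hst : s < t) (hgn : g ^ t ≤ l.length)
    (hn : l.length ≤ L * g ^ t)
    (hP : P ≤ (K₁ * g ^ (2 * t - 1) : ℕ)) (hr : r ≤ (K₃ * g : ℕ))
    (hq : q * (redInst l hg hw i j k).arrivals.length ≤ (K₂ * g ^ (2 * t - 1) : ℕ))
    (hi : i < g ^ s) (hj : j < g ^ s) (hk : k < g ^ s) :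
    instTime D (redInst l hg hw i j k) l.length ≤
      (((5 * K₁ + 5 * K₂ + 4 * (5 * K₃ + 400) * L + 1680 * L + 5000 * (11 * L + 2)) *
        g ^ (2 * t - 1) + (5 * K₃ + 400) * g *
        (falseTriples (distinct l).toFinset (g ^ s + i) (g ^ s + j) (g ^ s + k)).card +
        5000 * (l.length + 1) * (heavy (distinct l).toFinset (g ^ w) (g ^ s + j)).card : ℕ) :
          ℝ≥0∞) := by
  refine (instTime_le h hc l.length hP hq hr).trans (Nat.cast_le.2 ?_)
  have hgs : g ^ s ≤ l.length := (Nat.pow_le_pow_right hg hst.le).trans hgn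
  have harr := redInst_arrivals_le (hg := hg) (hw := hw) (i := i) (j := j) (k := k) hgs
  have hS : (redInst l hg hw i j k).S.length ≤ l.length := length_distinct_le l
  have hrest := (redInst l hg hw i j k).rest_length_le
  have hins := (redInst l hg hw i j k).ins_length_le
  have hq₁ := (redInst l hg hw i j k).q₁_le
  have hτM := redInst_τ_mul_M (l := l) (hg := hg) (hw := hw) (i := i) (j := j) (k := k)
  have e₁ : (redInst l hg hw i j k).q₁ = g ^ s + i := by
    simp only [redInst]; rw [Nat.mod_eq_of_lt hi, add_comm]
  have e₂ : (redInst l hg hw i j k).q₂ = g ^ s + j := by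
    simp only [redInst]; rw [Nat.mod_eq_of_lt hj, add_comm]
  have e₃ : (redInst l hg hw i j k).q₃ = g ^ s + k := by
    simp only [redInst]; rw [Nat.mod_eq_of_lt hk, add_comm]
  have e₄ : (redInst l hg hw i j k).S = distinct l := rfl
  have e₅ : (redInst l hg hw i j k).R = g ^ s := rfl
  have e₆ : (redInst l hg hw i j k).τ = g ^ w := rfl
  rw [e₅] at hq₁
  rw [e₂, e₆, e₄] at hrest
  rw [e₁, e₂, e₃, e₄, Inst.load, hτM]
  rw [e₄] at hins hS
  generalize (redInst l hg hw i j k).q₁ = q₁ at *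
  generalize (redInst l hg hw i j k).arrivals.length = A at *
  generalize (redInst l hg hw i j k).rest.length = r₀ at *
  generalize (redInst l hg hw i j k).ins.length = s₀ at *
  generalize (falseTriples (distinct l).toFinset (g ^ s + i) (g ^ s + j) (g ^ s + k)).card = F
  generalize (heavy (distinct l).toFinset (g ^ w) (g ^ s + j)).card = H at *
  generalize (distinct l).length = S at *
  generalize l.length = n at *
  have pw : ∀ x, x ≤ 2 * t - 1 → g ^ x ≤ g ^ (2 * t - 1) := fun x hx => Nat.pow_le_pow_right hg hx
  have b1 : g ^ s * n ≤ L * g ^ (2 * t - 1) := by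
    calc _ ≤ g ^ s * (L * g ^ t) := Nat.mul_le_mul_left _ hn
      _ = L * g ^ (t + s) := by rw [pow_add]; ring
      _ ≤ _ := Nat.mul_le_mul_left _ (pw _ (by omega))
  have b2 : n * g ≤ L * g ^ (2 * t - 1) := by
    calc _ ≤ L * g ^ t * g := Nat.mul_le_mul_right _ hn
      _ = L * g ^ (t + 1) := by rw [pow_succ]; ring
      _ ≤ _ := Nat.mul_le_mul_left _ (pw _ (by omega))
  have b3 : n ≤ L * g ^ (2 * t - 1) := hn.trans (Nat.mul_le_mul_left _ (pw _ (by omega)))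
  have b4 : g ^ (t + s) ≤ g ^ (2 * t - 1) := pw _ (by omega)
  have b5 : 1 ≤ g ^ (2 * t - 1) := Nat.one_le_pow _ _ hg
  have b6 : s₀ * q₁ ≤ n * (2 * g ^ s) := Nat.mul_le_mul (hins.trans hS) hq₁
  have b7 : r₀ * (n + 1) ≤ H * (n + 1) := Nat.mul_le_mul_right _ hrest
  have b8 : 5 * (K₃ * g) + 400 ≤ (5 * K₃ + 400) * g := by nlinarith
  have b9 : (5 * (K₃ * g) + 400) * (F + 4 * S) ≤ (5 * K₃ + 400) * g * (F + 4 * n) :=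
    Nat.mul_le_mul b8 (by omega)
  have b10 : (5 * K₃ + 400) * g * (F + 4 * n) ≤
      (5 * K₃ + 400) * g * F + 4 * (5 * K₃ + 400) * (L * g ^ (2 * t - 1)) := by
    calc _ = (5 * K₃ + 400) * g * F + 4 * (5 * K₃ + 400) * (n * g) := by ring
      _ ≤ _ := Nat.add_le_add_left (Nat.mul_le_mul_left _ b2) _
  generalize g ^ (2 * t - 1) = G at *
  calc _ ≤ 5 * (K₁ * G) + 5 * (K₂ * G) +
        ((5 * K₃ + 400) * g * F + 4 * (5 * K₃ + 400) * (L * G)) + 210 * (8 * (L * G)) +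
        5000 * (L * G + G + 2 * (L * G) + H * (n + 1) + 8 * (L * G) + G) := by
        have : n * (2 * g ^ s) = 2 * (g ^ s * n) := by ring
        linarith
    _ = _ := by ring

/-- The bound on the average over the moduli. -/
theorem avg_instTime_le {D : ISGStructure} {A B K : ℕ} {d : ℕ}
    (ht : 2 ≤ t) (hsw : s + w = t + 2) (hst : s < t)
    (hn : l.length ≤ L * g ^ t) (hL : 1 ≤ L)
    (hd : d ^ 3 ≤ K * g)
    (hdT : ∀ x ∈ (distinct l).toFinset, ∀ y ∈ (distinct l).toFinset, ∀ z ∈ (distinct l).toFinset,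
      x + y + z ≠ 0 → modCount (g ^ s) (x + y + z) ≤ d)
    (hdH : ∀ z ∈ (distinct l).toFinset, ∀ x ∈ (distinct l).toFinset,
      x - z ≠ 0 → modCount (g ^ s) (x - z) ≤ d)
    (h : ∀ i < g ^ s, ∀ j < g ^ s, ∀ k < g ^ s, instTime D (redInst l hg hw i j k) l.length ≤
      ((A * g ^ (2 * t - 1) + B * g *
        (falseTriples (distinct l).toFinset (g ^ s + i) (g ^ s + j) (g ^ s + k)).card +
        5000 * (l.length + 1) * (heavy (distinct l).toFinset (g ^ w) (g ^ s + j)).card : ℕ) :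
          ℝ≥0∞)) :
    (avg (g ^ s) fun i => avg (g ^ s) fun j => avg (g ^ s) fun k =>
      instTime D (redInst l hg hw i j k) l.length) ≤
      ((A * g ^ (2 * t - 1) + B * L ^ 3 * K * g ^ (2 * t - 1) +
        10000 * (L ^ 2 + L ^ 3 * K) * g ^ (2 * t - 1) : ℕ) : ℝ≥0∞) := by
  have hcard : (distinct l).toFinset.card ≤ L * g ^ t :=
    (List.toFinset_card_le _).trans ((length_distinct_le l).trans hn)
  have hgt : 1 ≤ g ^ t := Nat.one_le_pow _ _ hg
  have hn1 : l.length + 1 ≤ 2 * L * g ^ t := by nlinarith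
  have hdK : d ≤ K * g := (Nat.le_self_pow (by norm_num) d).trans hd
  refine avg_avg_avg_le (pow_pos hg s) h ?_ ?_
  · calc _ ≤ B * g * ((distinct l).toFinset.card ^ 3 * d ^ 3) :=
          Nat.mul_le_mul_left _ (sum_falseTriples_le hdT)
      _ ≤ B * g * ((L * g ^ t) ^ 3 * (K * g)) := by gcongr
      _ = B * L ^ 3 * K * g ^ (3 * t + 2) := by rw [pow_add, pow_mul']; ring
      -- This needs t + 3 ≤ 3s, which follows from 2w ≤ t+s and s+w = t+2.
      _ ≤ B * L ^ 3 * K * g ^ (2 * t - 1 + s * 3) :=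
          Nat.mul_le_mul_left _ (Nat.pow_le_pow_right hg (by omega))
      _ = _ := by rw [pow_add, pow_mul]; ring
  · have hH := sum_heavy_le (τ := g ^ w) hdH
    -- Multiplication by the threshold τ avoids the division in Markov's inequality.
    refine Nat.le_of_mul_le_mul_left ?_ (pow_pos hg w)
    calc _ = 5000 * (l.length + 1) * (g ^ w * ∑ j ∈ Finset.range (g ^ s),
            (heavy (distinct l).toFinset (g ^ w) (g ^ s + j)).card) := by ring
      _ ≤ 5000 * (2 * L * g ^ t) * (L * g ^ t * g ^ s + (L * g ^ t) ^ 2 * (K * g)) := by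
          refine Nat.mul_le_mul (Nat.mul_le_mul_left _ hn1) (hH.trans ?_)
          gcongr
      _ = 10000 * (L ^ 2 * g ^ (2 * t + s) + L ^ 3 * K * g ^ (3 * t + 1)) := by
          rw [pow_add, pow_add, pow_mul', pow_mul']; ring
      _ ≤ 10000 * (L ^ 2 * g ^ (3 * t + 1) + L ^ 3 * K * g ^ (3 * t + 1)) := by
          gcongr 10000 * (L ^ 2 * ?_ + _)
          exact Nat.pow_le_pow_right hg (by omega)
      -- The dominant term is n·n²·d/(τR) with d ≤ Kg, that is g^(3t+1-w-s) up to constants; s+w =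
      -- t+2 makes the exponent 2t-1.
      _ = 10000 * (L ^ 2 + L ^ 3 * K) * g ^ (w + (2 * t - 1) + s) := by
          rw [show w + (2 * t - 1) + s = 3 * t + 1 by omega]; ring
      _ = _ := by rw [pow_add, pow_add]; ring

end

theorem nnreal_le_natCast {x : ℝ≥0} {n : ℕ} (h : (x : ℝ) ≤ n) : x ≤ n := by exact_mod_cast h

/-- A data structure that is fast on the graphs of the reduction gives a fast algorithm. -/
theorem exists_solvesThreeSum {a b ε ε' C₁ C₂ : ℝ} (ha : 0 < a) (hab : a < b) (hb : b ≤ 1 / 2)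
    {D : ISGStructure} (hD : D.SolvesISG) {P q r : DirGraph → ℝ≥0}
    (hcosts : ∀ G : DirGraph, G.InRange a b → D.HasAmortizedCosts G (P G) (q G) (r G))
    (hε : 0 < ε) (hε' : 0 < ε')
    (hP : ∀ G : DirGraph, G.InRange a b → (P G : ℝ) ≤ C₁ * ((G.m : ℝ) * (G.δ : ℝ) ^ (1 - ε)))
    (hq : ∀ G : DirGraph, G.InRange a b → (q G : ℝ) ≤ C₂ * (G.δ : ℝ) ^ (1 - ε'))
    (hr : ∀ η : ℝ, 0 < η → ∃ C : ℝ, ∀ G : DirGraph, G.InRange a b →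
      (r G : ℝ) ≤ C * (G.m : ℝ) ^ η) :
    ∃ ε₀ : ℝ, 0 < ε₀ ∧ ∃ p : Cmd, SolvesThreeSumInTime p (2 - ε₀) := by
  obtain ⟨t, s, w, ht, hst, hsw, hw, hw3, haw, hbw, hwε, hwε'⟩ :=
    exists_exponents ha hab hb hε hε'
  obtain ⟨c, hRun⟩ := hD.runSpec
  have hts0 : (0 : ℝ) < ((t + s : ℕ) : ℝ) := by exact_mod_cast (by omega : 0 < t + s)
  -- With this exponent m^η is at most a constant times g, a loss the bound on false triples can
  -- afford.
  obtain ⟨C₃, hr⟩ := hr (1 / (t + s : ℕ)) (by positivity)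
  have ht0 : (0 : ℝ) < t := by exact_mod_cast (by omega : 0 < t)
  have ht1 : 1 / (t : ℝ) ≤ 1 := by
    rw [div_le_one ht0]; exact_mod_cast (by omega : 1 ≤ t)
  -- From n < (g+1)^t ≤ (2g)^t the length is at most L·g^t.
  set L := 2 ^ t with hL
  have hL1 : 1 ≤ L := Nat.one_le_pow _ _ (by norm_num)
  obtain ⟨K₁, hK₁⟩ := exists_nat_ge (max C₁ 0 * (1 + 2 * L : ℕ))
  obtain ⟨K₂, hK₂⟩ := exists_nat_ge (max C₂ 0 * (8 * L : ℕ))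
  obtain ⟨K₃, hK₃⟩ := exists_nat_ge (max C₃ 0 * (1 + 2 * L : ℕ))
  -- The target g^(2t-1) is at most n^(2-1/t). Below the threshold `g₀` the graphs need not lie in
  -- the class, and those finitely many list lengths are treated as short.
  refine ⟨1 / t, by positivity, reductionC D t s w, solvesThreeSum_of_cost_le
    (g₀ := 10 + (1 + 2 * L)) hRun (by omega) hst.le hw (by linarith) fun k₀ => ?_⟩
  obtain ⟨K, hK⟩ := exists_modCount_le t k₀ L
  set A := 5 * K₁ + 5 * K₂ + 4 * (5 * K₃ + 400) * L + 1680 * L + 5000 * (11 * L + 2) with hA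
  set B := 5 * K₃ + 400 with hB
  refine ⟨((1000 * (t + 1) * (2 * L) + 10 + A + B * L ^ 3 * K + 10000 * (L ^ 2 + L ^ 3 * K) : ℕ) :
    ℝ), fun l g hg hgg hgn hng hx => ?_⟩
  have hn : l.length ≤ L * g ^ t := by
    rw [hL, ← mul_pow]
    exact hng.le.trans (Nat.pow_le_pow_left (by omega) t)
  have hgG : 1 ≤ g ^ (2 * t - 1) := Nat.one_le_pow _ _ hg
  have hgt : 1 ≤ g ^ t := Nat.one_le_pow _ _ hg
  have hnG : l.length + 1 ≤ 2 * L * g ^ (2 * t - 1) := by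
    have : g ^ t ≤ g ^ (2 * t - 1) := Nat.pow_le_pow_right hg (by omega)
    have h1 := hn.trans (Nat.mul_le_mul_left L this)
    have h2 := Nat.mul_le_mul hL1 hgG
    linarith
  have hgs : g ^ s ≤ l.length := (Nat.pow_le_pow_right hg hst.le).trans hgn
  obtain ⟨d, hd, hmod⟩ := hK g l.length hg hn
  have hx' : ∀ x ∈ (distinct l).toFinset, |x| ≤ (l.length : ℤ) ^ k₀ := fun x hxl =>
    hx x (mem_distinct.1 (List.mem_toFinset.1 hxl))
  have havg := avg_instTime_le (D := D) (A := A) (B := B) (hg := hg) (hw := hw) ht hsw hst hn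
    hL1 hd
    (fun x hx y hy z hz h0 => hmod _ _ h0 (by
      have := abs_add_three x y z
      have := hx' x hx; have := hx' y hy; have := hx' z hz; linarith))
    (fun z hz x hx h0 => hmod _ _ h0 (by
      have := abs_sub x z
      have := hx' x hx; have := hx' z hz
      have := abs_nonneg x; linarith)) ?_
  · have hreal : ((g ^ (2 * t - 1) : ℕ) : ℝ) ≤ (l.length : ℝ) ^ (2 - 1 / (t : ℝ)) := by
      have h1 : ((g : ℝ) ^ t) ≤ l.length := by exact_mod_cast hgn
      calc ((g ^ (2 * t - 1) : ℕ) : ℝ) = ((g : ℝ) ^ t) ^ (2 - 1 / (t : ℝ)) := by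
            rw [← Real.rpow_natCast (g : ℝ) t, ← Real.rpow_mul (by positivity), Nat.cast_pow,
              ← Real.rpow_natCast]
            congr 1
            rw [Nat.cast_sub (by omega)]; push_cast; field_simp
        _ ≤ _ := Real.rpow_le_rpow (by positivity) h1 (by linarith)
    calc _ ≤ ((1000 * (t + 1) * (l.length + 1) + 10 : ℕ) : ℝ≥0∞) + _ := add_le_add le_rfl havg
      _ ≤ (((1000 * (t + 1) * (2 * L) + 10 + A + B * L ^ 3 * K + 10000 * (L ^ 2 + L ^ 3 * K)) *
          g ^ (2 * t - 1) : ℕ) : ℝ≥0∞) := by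
          rw [← Nat.cast_add]
          refine Nat.cast_le.2 ?_
          generalize g ^ (2 * t - 1) = G at *
          have := Nat.mul_le_mul_left (1000 * (t + 1)) hnG
          calc _ ≤ 1000 * (t + 1) * (2 * L * G) + 10 * G + (A * G + B * L ^ 3 * K * G +
              10000 * (L ^ 2 + L ^ 3 * K) * G) := by omega
            _ = _ := by ring
      _ ≤ _ := by
          rw [← ENNReal.ofReal_natCast, Nat.cast_mul]
          exact ENNReal.ofReal_le_ofReal (mul_le_mul_of_nonneg_left hreal (by positivity))
  · intro i hi j hj k hk
    have hG : (redInst l hg hw i j k).graph.InRange a b :=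
      redInst_inRange ha hab hb hst hw3 haw hbw hgg hn
    have hδ : (redInst l hg hw i j k).graph.δ = g ^ w := Inst.delta_eq _
    have hm : ((redInst l hg hw i j k).graph.m : ℝ) ≤ (((1 + 2 * L) * g ^ (t + s) : ℕ) : ℝ) :=
      Nat.cast_le.2 (redInst_m_le' hn)
    have harr := redInst_arrivals_le (hg := hg) (hw := hw) (i := i) (j := j) (k := k) hgs
    -- Edges, and likewise arrivals, are O(g^(t+s)), each at cost O(g^(w-3)); this common product
    -- bounds both preprocessing and queries.
    have hpow : g ^ (t + s) * g ^ (w - 3) = g ^ (2 * t - 1) := by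
      rw [← pow_add]; congr 1; omega
    refine instTime_redInst_le (fun l _ => hRun _ _ _ _ _ (prefix_head ‹_›)) (hcosts _ hG) ht hst
      hgn hn (nnreal_le_natCast ?_) (nnreal_le_natCast ?_) (nnreal_le_natCast ?_) hi hj hk
    · refine (hP _ hG).trans ?_
      rw [hδ]
      have h1 := rpow_one_sub_le hg hw3 hwε
      calc _ ≤ max C₁ 0 * ((((1 + 2 * L) * g ^ (t + s) : ℕ) : ℝ) * ((g ^ (w - 3) : ℕ) : ℝ)) := by
            gcongr; exact le_max_left _ _
        _ = max C₁ 0 * (1 + 2 * L : ℕ) * ((g ^ (2 * t - 1) : ℕ) : ℝ) := by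
            rw [← hpow]; push_cast; ring
        _ ≤ K₁ * ((g ^ (2 * t - 1) : ℕ) : ℝ) := by gcongr
        _ = _ := by push_cast; rfl
    · refine (hr _ hG).trans ?_
      have h1 : ((redInst l hg hw i j k).graph.m : ℝ) ≤
          (((1 + 2 * L) * g : ℕ) : ℝ) ^ ((t + s : ℕ) : ℝ) := by
        refine hm.trans ?_
        rw [Real.rpow_natCast]
        have : (1 + 2 * L) * g ^ (t + s) ≤ ((1 + 2 * L) * g) ^ (t + s) := by
          rw [mul_pow]
          exact Nat.mul_le_mul_right _ (Nat.le_self_pow (by omega) _)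
        exact_mod_cast this
      have h2 := Real.rpow_le_rpow (by positivity) h1 (show 0 ≤ 1 / ((t + s : ℕ) : ℝ) by positivity)
      rw [← Real.rpow_mul (by positivity), mul_one_div_cancel hts0.ne', Real.rpow_one] at h2
      calc _ ≤ max C₃ 0 * (((1 + 2 * L) * g : ℕ) : ℝ) := by
            gcongr; exact le_max_left _ _
        _ = max C₃ 0 * (1 + 2 * L : ℕ) * g := by push_cast; ring
        _ ≤ K₃ * g := by gcongr
        _ = _ := by push_cast; rfl
    · have h1 := rpow_one_sub_le hg hw3 hwε'
      have h2 := hq _ hG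
      rw [hδ] at h2
      have h3 : (redInst l hg hw i j k).arrivals.length ≤ 8 * L * g ^ (t + s) := by
        refine harr.trans ?_
        calc _ ≤ 8 * (g ^ s * (L * g ^ t)) := by gcongr
          _ = _ := by rw [pow_add]; ring
      push_cast
      calc _ ≤ (max C₂ 0 * ((g ^ (w - 3) : ℕ) : ℝ)) * ((8 * L * g ^ (t + s) : ℕ) : ℝ) := by
            refine mul_le_mul (h2.trans ?_) (Nat.cast_le.2 h3) (by positivity) (by positivity)
            gcongr; exact le_max_left _ _
        _ = max C₂ 0 * (8 * L : ℕ) * ((g ^ (2 * t - 1) : ℕ) : ℝ) := by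
            rw [← hpow]; push_cast; ring
        _ ≤ K₂ * ((g ^ (2 * t - 1) : ℕ) : ℝ) := by gcongr
        _ = _ := by push_cast; rfl

end ISGLowerBound

open ISGLowerBound in
/-- Conditional lower bound for the Induced Subgraph problem. Both `1 - Ω(1)` and `1 - o(1)` are
spelled out with a constant in the exponent: the query cost is not `O(δ ^ (1 - ε'))` for any
`ε' > 0`. -/
theorem theorem2
    (h3SUM : ThreeSumConjecture)
    (a b : ℝ) (ha : 0 < a) (hab : a < b) (hb : b ≤ 1 / 2)
    (D : ISGStructure) (hD : D.SolvesISG)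
    (P q r : DirGraph → ℝ≥0)
    (hcosts : ∀ G : DirGraph, G.InRange a b → D.HasAmortizedCosts G (P G) (q G) (r G))
    (hP : ∃ ε : ℝ, 0 < ε ∧ ∃ C : ℝ, ∀ G : DirGraph, G.InRange a b →
      (P G : ℝ) ≤ C * ((G.m : ℝ) * (G.δ : ℝ) ^ (1 - ε)))
    (hr : ∀ η : ℝ, 0 < η → ∃ C : ℝ, ∀ G : DirGraph, G.InRange a b →
      (r G : ℝ) ≤ C * (G.m : ℝ) ^ η) :
    ∀ ε' : ℝ, 0 < ε' → ∀ C : ℝ, ∃ G : DirGraph, G.InRange a b ∧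
      C * (G.δ : ℝ) ^ (1 - ε') < (q G : ℝ) := by
  intro ε' hε' C₂
  by_contra hcon
  push Not at hcon
  obtain ⟨ε, hε, C₁, hP⟩ := hP
  obtain ⟨ε₀, hε₀, hp⟩ := exists_solvesThreeSum ha hab hb hD hcosts hε hε' hP hcon hr
  exact h3SUM ε₀ hε₀ hp
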